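/- Let $N\ge 2$, let $h$ be a formal parameter, and let $G$ be a nonsingular complex $N\times N$ matrix with $G^t=G$ (then $\mathfrak g_N=\mathfrak o_N$) or $G^t=-G$ (then $\mathfrak g_N=\mathfrak{sp}_N$). Let $P$ be the permutation operator on $\mathbb C^N\otimes\mathbb C^N$, let $R(u)=1-\frac hu P$, let $g(u)\in 1+u^{-1}\mathbb C[[u^{-1}]]$ be the unique series with $g(u+N)=g(u)(1-u^{-2})$, put $\overline R(u)=g(u/h)R(u)$, and let $\overline R^{\,t}(u)$ be $\overline R(u)$ transposed in one of the two tensor factors. Negative powers of sums of variables are expanded in negative powers of the variable on the left. For $c\in\mathbb C$ let ${\rm DY}_c(\mathfrak{gl}_N)$ be the double Yangian at the level $c$: the associative $\mathbb C[[h]]$-algebra with generators $t_{ij}^{(\pm r)}$, $1\le i,j\le N$, $r\ge 1$, and the relations $$R(u-v)T_1(u)T_2(v)=T_2(v)T_1(u)R(u-v),\qquad R(u-v)T^+_1(u)T^+_2(v)=T^+_2(v)T^+_1(u)R(u-v),$$ $$\overline R(u-v+hc/2)\,T_1(u)T^+_2(v)=T^+_2(v)T_1(u)\,\overline R(u-v-hc/2),$$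 imposed after cancelling powers of $h$ (so that the algebra has no $h$-torsion), where $T(u)=1+h\sum_{r\ge1}t^{(r)}u^{-r}$, $T^+(u)=1-h\sum_{r\ge1}t^{(-r)}u^{r-1}$, $t^{(\pm r)}=(t_{ij}^{(\pm r)})_{i,j}$. Put $$S^+(u)=T^+(u)\,G\,T^{+t}(-u)=G-h\sum_{r\ge1}s^{(-r)}u^{r-1},\qquad S(u)=T(u+hc)\,G\,T^{t}(-u)=G+h\sum_{r\ge1}s^{(r)}u^{-r},$$ and let ${\rm A}_c(\mathfrak g_N)\subset{\rm DY}_c(\mathfrak{gl}_N)$ be the subalgebra generated by all matrix entries $s_{ij}^{(\pm r)}$. Let $I_p$ be the left ideal of ${\rm DY}_c(\mathfrak{gl}_N)$ generated by all $t_{ij}^{(r)}$ with $r\ge p$, and let $\widetilde{\rm A}_c(\mathfrak g_N)$ be the $h$-adic completion of $\varprojlim_p {\rm A}_c(\mathfrak g_N)/({\rm A}_c(\mathfrak g_N)\cap I_p)$; equivalently, $\widetilde{\rm A}_c(\mathfrak g_N)$ is the closure of ${\rm A}_c(\mathfrak g_N)$ in the completed double Yangian $\varprojlim_{p,m}{\rm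 DY}_c(\mathfrak{gl}_N)/(I_p+h^m{\rm DY}_c(\mathfrak{gl}_N))$. For variables $v_1,\dots,v_n$ put $$S^+_{[n]}(v_1,\dots,v_n)=\prod_{i=1}^{n}\Big(S^+_i(v_i)\,\overline R^{\,t}_{i,i+1}(-v_i-v_{i+1})\cdots\overline R^{\,t}_{i,n}(-v_i-v_n)\Big),$$ $$S_{[n]}(v_1,\dots,v_n)=\prod_{i=1}^{n}\Big(S_i(v_i)\,\overline R^{\,t}_{i,i+1}(-v_i-v_{i+1}-hc)\cdots\overline R^{\,t}_{i,n}(-v_i-v_n-hc)\Big),$$ the factors being ordered from left to right. Let $\nu$ be a Young diagram with $n$ boxes and at most $N$ rows, let $\mathcal U$ be a standard tableau of shape $\nu$, let $c_p=j-i$ be the content of the box $(i,j)$ of $\mathcal U$ occupied by $p$, and let $\mathcal E_{\mathcal U}$ be the image, under the action of the symmetric group $\mathfrak S_n$ on $(\mathbb C^N)^{\otimes n}$ by permutations of the tensor factors, of the primitive idempotent of $\mathbb C[\mathfrak S_n]$ which projects onto the line of the vector of Young's orthonormal basis labelled by $\mathcal U$. Put $u_\nu=(u+hc_1,\dots,u+hc_n)$,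 and let $c=-N/2$. Then the series $$\mathbb A_\nu(u)={\rm tr}_{1,\dots,n}\,\mathcal E_{\mathcal U}\,S^+_{[n]}(u_\nu)\,S_{[n]}(u_\nu-hN/4)^{-1}$$ is a well-defined series in $u^{\pm1}$ with coefficients in $\widetilde{\rm A}_{-N/2}(\mathfrak g_N)$, and each of its coefficients belongs to the center of the algebra $\widetilde{\rm A}_{-N/2}(\mathfrak g_N)$. -/

import Mathlib

open scoped Matrix Kronecker

namespace TwistedYangian

noncomputable section

/-! ### Scalars, formal series and the normalized Yang R-matrix -/

/-- The ground ring `ℂ[[h]]`. -/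
abbrev Kh : Type := PowerSeries ℂ

/-- The formal parameter `h`. -/
abbrev hbar : Kh := PowerSeries.X

/-- The element `h * z` of `ℂ[[h]]` for a complex number `z`. -/
abbrev hmul (z : ℂ) : Kh := hbar * PowerSeries.C z

/-- A power series `f` is read as the series `∑ f_k x^{-k}` in `x⁻¹`. Then `atInf α β f` is
`f (α u + β)` expanded in negative powers of `u`, that is
`∑_k f_k α^{-k} ∑_l binom(-k, l) (β/α)^l u^{-k-l}`, as a power series in `u⁻¹`. -/
def atInf {B M : Type*} [CommRing B] [Algebra ℂ B] [Ring M] [Algebra B M]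
    (α : ℂ) (β : B) (f : PowerSeries M) : PowerSeries M :=
  PowerSeries.mk fun m => ∑ k ∈ Finset.range (m + 1),
    (algebraMap ℂ B (α⁻¹ ^ k * ((Ring.choose (-(k : ℤ)) (m - k) : ℤ) : ℂ)) *
      (algebraMap ℂ B α⁻¹ * β) ^ (m - k)) • PowerSeries.coeff k f

/-- The coefficients of the series `g(u) = 1 + g_1 u⁻¹ + ...` with
`g(u + N) = g(u) (1 - u⁻²)`; see `gSeries_spec` and `gSeries_unique`. -/
def gCoeff (N : ℕ) : ℕ → ℂ
  | 0 => 1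
  | m + 1 => (((m : ℂ) + 1) * N)⁻¹ * (gCoeff N m + ∑ k : Fin m,
      gCoeff N (k + 1) * ((Ring.choose (-((k : ℕ) + 1 : ℤ)) (m + 1 - k) : ℤ) : ℂ) *
        (N : ℂ) ^ (m + 1 - (k : ℕ)))

/-- The series `g(u)`, as a power series in `u⁻¹`. -/
def gSeries (N : ℕ) : PowerSeries ℂ := PowerSeries.mk (gCoeff N)

theorem coeff_atInf_natCast (N : ℕ) (g : PowerSeries ℂ) (m : ℕ) :
    PowerSeries.coeff (m + 2) (atInf 1 (N : ℂ) g) = PowerSeries.coeff (m + 2) g -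
      ((m : ℂ) + 1) * N * PowerSeries.coeff (m + 1) g + ∑ k : Fin m,
        PowerSeries.coeff (k + 1) g * ((Ring.choose (-((k : ℕ) + 1 : ℤ)) (m + 1 - k) : ℤ) : ℂ) *
          (N : ℂ) ^ (m + 1 - (k : ℕ)) := by
  have h0 : Ring.choose (-((0 : ℕ) : ℤ)) (m + 2 - 0) = 0 := by
    rw [Nat.cast_zero, neg_zero, Ring.choose_zero_pos _ (by omega)]
  simp only [atInf, PowerSeries.coeff_mk, Algebra.algebraMap_self, RingHom.id_apply, inv_one,
    one_pow, one_mul, smul_eq_mul]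
  rw [Finset.sum_range_succ, Finset.sum_range_succ, Finset.sum_range_succ', h0,
    Fin.sum_univ_eq_sum_range fun k => PowerSeries.coeff (k + 1) g *
      ((Ring.choose (-((k : ℕ) + 1 : ℤ)) (m + 1 - k) : ℤ) : ℂ) * (N : ℂ) ^ (m + 1 - (k : ℕ))]
  have h1 : m + 2 - (m + 1) = 1 := by omega
  rw [h1, Nat.sub_self, Ring.choose_one_right, Ring.choose_zero_right]
  have h2 : ∑ k ∈ Finset.range m,
      ((Ring.choose (-((k + 1 : ℕ) : ℤ)) (m + 2 - (k + 1)) : ℤ) : ℂ) *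
        (N : ℂ) ^ (m + 2 - (k + 1)) * PowerSeries.coeff (k + 1) g =
      ∑ k ∈ Finset.range m, PowerSeries.coeff (k + 1) g *
      ((Ring.choose (-((k : ℕ) + 1 : ℤ)) (m + 1 - k) : ℤ) : ℂ) * (N : ℂ) ^ (m + 1 - (k : ℕ)) := by
    refine Finset.sum_congr rfl fun k _ => ?_
    have : m + 2 - (k + 1) = m + 1 - k := by omega
    rw [this]
    push_cast
    ring
  rw [h2]
  push_cast
  ring

theorem coeff_atInf_small (N : ℕ) (g : PowerSeries ℂ) :
    PowerSeries.coeff 0 (atInf 1 (N : ℂ) g) = PowerSeries.coeff 0 g ∧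
      PowerSeries.coeff 1 (atInf 1 (N : ℂ) g) = PowerSeries.coeff 1 g := by
  have h0 : Ring.choose (0 : ℤ) 1 = 0 := Ring.choose_zero_pos _ (by omega)
  constructor <;> simp [atInf, Finset.sum_range_succ, h0]

theorem coeff_mul_one_sub_sq (g : PowerSeries ℂ) :
    PowerSeries.coeff 0 (g * (1 - PowerSeries.X ^ 2)) = PowerSeries.coeff 0 g ∧
    PowerSeries.coeff 1 (g * (1 - PowerSeries.X ^ 2)) = PowerSeries.coeff 1 g ∧
    ∀ m, PowerSeries.coeff (m + 2) (g * (1 - PowerSeries.X ^ 2)) =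
      PowerSeries.coeff (m + 2) g - PowerSeries.coeff m g := by
  refine ⟨?_, ?_, fun m => ?_⟩ <;>
    rw [mul_sub, mul_one, map_sub, PowerSeries.coeff_mul_X_pow'] <;> simp

theorem gSeries_spec (N : ℕ) (hN : N ≠ 0) :
    PowerSeries.constantCoeff (gSeries N) = 1 ∧
      atInf 1 (N : ℂ) (gSeries N) = gSeries N * (1 - PowerSeries.X ^ 2) := by
  have hN' : (N : ℂ) ≠ 0 := Nat.cast_ne_zero.2 hN
  refine ⟨by simp [gSeries, gCoeff], ?_⟩
  obtain ⟨a0, a1⟩ := coeff_atInf_small N (gSeries N)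
  obtain ⟨b0, b1, b2⟩ := coeff_mul_one_sub_sq (gSeries N)
  ext m
  match m with
  | 0 => rw [a0, b0]
  | 1 => rw [a1, b1]
  | m + 2 =>
    rw [coeff_atInf_natCast, b2]
    have hm : (m : ℂ) + 1 ≠ 0 := by exact_mod_cast Nat.succ_ne_zero m
    have := gCoeff.eq_2 N m
    simp only [gSeries, PowerSeries.coeff_mk]
    rw [this]
    field_simp
    ring

theorem gSeries_unique (N : ℕ) (hN : N ≠ 0) (g : PowerSeries ℂ)
    (h0 : PowerSeries.constantCoeff g = 1)
    (h1 : atInf 1 (N : ℂ) g = g * (1 - PowerSeries.X ^ 2)) : g = gSeries N := by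
  have hN' : (N : ℂ) ≠ 0 := Nat.cast_ne_zero.2 hN
  obtain ⟨b0, b1, b2⟩ := coeff_mul_one_sub_sq g
  ext m
  induction m using Nat.strong_induction_on with
  | _ m ih =>
    match m with
    | 0 => simpa [gSeries, gCoeff] using h0
    | m + 1 =>
      have hm : (m : ℂ) + 1 ≠ 0 := by exact_mod_cast Nat.succ_ne_zero m
      have h2 := congrArg (PowerSeries.coeff (m + 2)) h1
      rw [coeff_atInf_natCast, b2, ih m (by omega)] at h2
      have h3 : ∀ k : Fin m, PowerSeries.coeff ((k : ℕ) + 1) g = gCoeff N (k + 1) := fun k => by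
        rw [ih (k + 1) (by omega), gSeries, PowerSeries.coeff_mk]
      simp only [h3] at h2
      simp only [gSeries, PowerSeries.coeff_mk] at h2 ⊢
      rw [gCoeff.eq_2 N m, eq_inv_mul_iff_mul_eq₀ (mul_ne_zero hm hN')]
      linear_combination -h2

/-- `g(x/h)` as a power series in `x⁻¹` over `ℂ[[h]]`. -/
def gh (N : ℕ) : PowerSeries Kh :=
  PowerSeries.mk fun k => hbar ^ k * PowerSeries.C (gCoeff N k)

/-- `- (h/x) g(x/h)`. Hence the normalized R-matrix is `R̄(x) = gh(x) 1 + ghP(x) P`. -/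
def ghP (N : ℕ) : PowerSeries Kh := -(PowerSeries.C hbar * PowerSeries.X) * gh N

/-! ### The double Yangian at the level `c` -/

/-- Generators: `pos i j r` is `t_ij^{(r+1)}` and `neg i j r` is `t_ij^{(-r-1)}`. -/
inductive Gen (N : ℕ) : Type
  | pos (i j : Fin N) (r : ℕ) : Gen N
  | neg (i j : Fin N) (r : ℕ) : Gen N

section Series

variable {N : ℕ} {D : Type*} [Ring D] [Algebra Kh D]

/-- The coefficient of `u^{-r}` in `T(u) = 1 + h ∑_{r ≥ 1} t^{(r)} u^{-r}`. -/
def Tcoeff (x : Gen N → D) : ℕ → Matrix (Fin N) (Fin N) D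
  | 0 => 1
  | r + 1 => hbar • Matrix.of fun i j => x (.pos i j r)

/-- The coefficient of `u^r` in `T⁺(u) = 1 - h ∑_{r ≥ 1} t^{(-r)} u^{r-1}`. -/
def Tpcoeff (x : Gen N → D) (r : ℕ) : Matrix (Fin N) (Fin N) D :=
  (if r = 0 then 1 else 0) - hbar • Matrix.of fun i j => x (.neg i j r)

/-- The permutation operator `P` on `ℂ^N ⊗ ℂ^N`. -/
def flip (N : ℕ) (D : Type*) [Ring D] : Matrix (Fin N × Fin N) (Fin N × Fin N) D :=
  Matrix.of fun a b => if a.1 = b.2 ∧ a.2 = b.1 then 1 else 0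

/-- `R̄(u - v + h α)` expanded in `u⁻¹` (outer variable) and `v` (inner variable). -/
def Rbar (N : ℕ) (D : Type*) [Ring D] [Algebra Kh D] (α : ℂ) :
    PowerSeries (PowerSeries (Matrix (Fin N × Fin N) (Fin N × Fin N) D)) :=
  let ev (f : PowerSeries Kh) :
      PowerSeries (PowerSeries (Matrix (Fin N × Fin N) (Fin N × Fin N) D)) :=
    PowerSeries.map (PowerSeries.map (algebraMap Kh _))
      (atInf 1 (-PowerSeries.X + PowerSeries.C (hmul α) : PowerSeries Kh)
        (PowerSeries.map PowerSeries.C f))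
  ev (gh N) + ev (ghP N) * PowerSeries.C (PowerSeries.C (flip N D))

/-- `X_1(u)`: the first tensor copy, in the outer variable. -/
def copy1 (X : ℕ → Matrix (Fin N) (Fin N) D) :
    PowerSeries (PowerSeries (Matrix (Fin N × Fin N) (Fin N × Fin N) D)) :=
  PowerSeries.mk fun r => PowerSeries.C (X r ⊗ₖ (1 : Matrix (Fin N) (Fin N) D))

/-- `X_2(v)`: the second tensor copy, in the inner variable. -/
def copy2 (X : ℕ → Matrix (Fin N) (Fin N) D) :
    PowerSeries (PowerSeries (Matrix (Fin N × Fin N) (Fin N × Fin N) D)) :=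
  PowerSeries.C (PowerSeries.mk fun r => (1 : Matrix (Fin N) (Fin N) D) ⊗ₖ X r)

/-- `(u - v) R(u - v) = u - v - h P`, as a polynomial in `u` (outer) and `v` (inner). -/
def Rplus (N : ℕ) (D : Type*) [Ring D] [Algebra Kh D] :
    PowerSeries (PowerSeries (Matrix (Fin N × Fin N) (Fin N × Fin N) D)) :=
  PowerSeries.X - PowerSeries.C PowerSeries.X - PowerSeries.C (PowerSeries.C (hbar • flip N D))

/-- `u⁻¹ v⁻¹ (u - v) R(u - v) = v⁻¹ - u⁻¹ - h u⁻¹ v⁻¹ P`, as a polynomial in `u⁻¹` (outer) and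
`v⁻¹` (inner). -/
def Rminus (N : ℕ) (D : Type*) [Ring D] [Algebra Kh D] :
    PowerSeries (PowerSeries (Matrix (Fin N × Fin N) (Fin N × Fin N) D)) :=
  PowerSeries.C PowerSeries.X - PowerSeries.X -
    PowerSeries.X * PowerSeries.C PowerSeries.X * PowerSeries.C (PowerSeries.C (hbar • flip N D))

/-- The `(I, J)` matrix entry of the coefficient of (outer variable)^a (inner variable)^b. -/
def entry (a b : ℕ) (I J : Fin N × Fin N)
    (F : PowerSeries (PowerSeries (Matrix (Fin N × Fin N) (Fin N × Fin N) D))) : D :=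
  (PowerSeries.coeff b (PowerSeries.coeff a F)) I J

end Series

/-- The RTT relations at the level `c`, for all matrix entries and all coefficients of the
series in `u` and `v`. In the first two relations the denominator `u - v` of the
Yang R-matrix `R(u - v) = 1 - h P / (u - v)` is cleared. -/
inductive Rel (N : ℕ) (c : ℂ) : FreeAlgebra Kh (Gen N) → FreeAlgebra Kh (Gen N) → Prop
  | rtt (a b : ℕ) (I J : Fin N × Fin N) : Rel N c
      (entry a b I J (Rminus N _ * copy1 (Tcoeff (FreeAlgebra.ι Kh)) *
        copy2 (Tcoeff (FreeAlgebra.ι Kh))))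
      (entry a b I J (copy2 (Tcoeff (FreeAlgebra.ι Kh)) * copy1 (Tcoeff (FreeAlgebra.ι Kh)) *
        Rminus N _))
  | rttPlus (a b : ℕ) (I J : Fin N × Fin N) : Rel N c
      (entry a b I J (Rplus N _ * copy1 (Tpcoeff (FreeAlgebra.ι Kh)) *
        copy2 (Tpcoeff (FreeAlgebra.ι Kh))))
      (entry a b I J (copy2 (Tpcoeff (FreeAlgebra.ι Kh)) * copy1 (Tpcoeff (FreeAlgebra.ι Kh)) *
        Rplus N _))
  | rttMixed (a b : ℕ) (I J : Fin N × Fin N) : Rel N c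
      (entry a b I J (Rbar N _ (c / 2) * copy1 (Tcoeff (FreeAlgebra.ι Kh)) *
        copy2 (Tpcoeff (FreeAlgebra.ι Kh))))
      (entry a b I J (copy2 (Tpcoeff (FreeAlgebra.ι Kh)) * copy1 (Tcoeff (FreeAlgebra.ι Kh)) *
        Rbar N _ (-(c / 2))))

/-- Equality up to `h`-torsion in a `ℂ[[h]]`-algebra. -/
def torsionCon (D : Type*) [Ring D] [Algebra Kh D] : RingCon D where
  r x y := ∃ k : ℕ, hbar ^ k • x = hbar ^ k • y
  iseqv := ⟨fun _ => ⟨0, rfl⟩, fun ⟨k, hk⟩ => ⟨k, hk.symm⟩, fun ⟨k, hk⟩ ⟨l, hl⟩ => ⟨l + k, by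
    rw [pow_add, mul_smul, hk, smul_comm, hl, smul_comm, ← mul_smul]⟩⟩
  add' := fun {a b c d} ⟨k, hk⟩ ⟨l, hl⟩ => ⟨l + k, by
    have h1 : hbar ^ (l + k) • a = hbar ^ (l + k) • b := by
      rw [pow_add, mul_smul, hk, ← mul_smul]
    have h2 : hbar ^ (l + k) • c = hbar ^ (l + k) • d := by
      rw [pow_add, mul_comm, mul_smul, hl, ← mul_smul]
    rw [smul_add, smul_add, h1, h2]⟩
  mul' := fun {a b c d} ⟨k, hk⟩ ⟨l, hl⟩ => ⟨l + k, by
    have h1 : ∀ x y : D, hbar ^ (l + k) • (x * y) = (hbar ^ k • x) * (hbar ^ l • y) := by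
      intro x y
      rw [smul_mul_smul_comm, ← pow_add, add_comm k l]
    rw [h1, h1, hk, hl]⟩

/-- The double Yangian at the level `c`. Its RTT relations, written in the generators
`t_ij^{(±r)}`, are all divisible by `h²`, and they are imposed after cancelling the powers of `h`:
the quotient by the relations as they stand is further divided by its `h`-torsion. -/
def DY (N : ℕ) (c : ℂ) : Type := (torsionCon (RingQuot (Rel N c))).Quotient

instance (N : ℕ) (c : ℂ) : Ring (DY N c) :=
  inferInstanceAs (Ring (torsionCon (RingQuot (Rel N c))).Quotient)

instance (N : ℕ) (c : ℂ) : Algebra Kh (DY N c) :=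
  inferInstanceAs (Algebra Kh (torsionCon (RingQuot (Rel N c))).Quotient)

/-- The quotient map from the free algebra. -/
def DY.mk (N : ℕ) (c : ℂ) : FreeAlgebra Kh (Gen N) →ₐ[Kh] DY N c :=
  ((torsionCon (RingQuot (Rel N c))).mkₐ Kh).comp (RingQuot.mkAlgHom Kh (Rel N c))

/-- The generators `t_ij^{(±r)}` of the double Yangian. -/
def DY.gen (N : ℕ) (c : ℂ) (x : Gen N) : DY N c := DY.mk N c (FreeAlgebra.ι Kh x)

/-- The left ideal `I_p` generated by all `t_ij^{(r)}` with `r ≥ p`. -/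
def Ip (N : ℕ) (c : ℂ) (p : ℕ) : Ideal (DY N c) :=
  Ideal.span {x | ∃ i j r, p ≤ r + 1 ∧ x = DY.gen N c (.pos i j r)}

/-- `I_p + h^n DY`. -/
def nbhd (N : ℕ) (c : ℂ) (p n : ℕ) : Ideal (DY N c) :=
  Ip N c p ⊔ Ideal.span {algebraMap Kh (DY N c) (hbar ^ n)}

/-! ### `I_p + h^n DY` is a basis of neighbourhoods of zero for a ring topology -/

section Topology

variable {N : ℕ} {c : ℂ}

theorem DY.mk_surjective : Function.Surjective (DY.mk N c) := by
  intro x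
  obtain ⟨y, rfl⟩ := Quotient.mk_surjective x
  obtain ⟨z, rfl⟩ := RingQuot.mkAlgHom_surjective Kh (Rel N c) y
  exact ⟨z, rfl⟩

theorem DY.smul_cancel {x y : DY N c} (k : ℕ) (h : hbar ^ k • x = hbar ^ k • y) : x = y := by
  obtain ⟨x, rfl⟩ := Quotient.mk_surjective x
  obtain ⟨y, rfl⟩ := Quotient.mk_surjective y
  have h' : (torsionCon (RingQuot (Rel N c))) (hbar ^ k • x) (hbar ^ k • y) :=
    Quotient.exact h
  obtain ⟨l, hl⟩ := h'
  apply Quotient.sound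
  refine ⟨l + k, ?_⟩
  rw [pow_add, mul_smul, mul_smul, hl]

theorem DY.mk_rel {x y : FreeAlgebra Kh (Gen N)} (h : Rel N c x y) :
    DY.mk N c x = DY.mk N c y :=
  congrArg ((torsionCon (RingQuot (Rel N c))).mkₐ Kh) (RingQuot.mkAlgHom_rel Kh h)

section Map

variable {D D' : Type*} [Ring D] [Algebra Kh D] [Ring D'] [Algebra Kh D'] (φ : D →ₐ[Kh] D')

/-- An algebra homomorphism applied to all matrix entries of a double series. -/
def mapSeries : PowerSeries (PowerSeries (Matrix (Fin N × Fin N) (Fin N × Fin N) D)) →+*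
    PowerSeries (PowerSeries (Matrix (Fin N × Fin N) (Fin N × Fin N) D')) :=
  PowerSeries.map (PowerSeries.map (φ : D →+* D').mapMatrix)

theorem entry_mapSeries (a b : ℕ) (I J : Fin N × Fin N)
    (F : PowerSeries (PowerSeries (Matrix (Fin N × Fin N) (Fin N × Fin N) D))) :
    entry a b I J (mapSeries φ F) = φ (entry a b I J F) := by
  simp [entry, mapSeries]

theorem map_flip : (φ : D →+* D').mapMatrix (flip N D) = flip N D' := by
  ext I J
  simp only [flip, RingHom.mapMatrix_apply, Matrix.map_apply, Matrix.of_apply]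
  split_ifs <;> simp

theorem map_algebraMap_matrix (x : Kh) : (φ : D →+* D').mapMatrix
    (algebraMap Kh (Matrix (Fin N × Fin N) (Fin N × Fin N) D) x) = algebraMap Kh _ x := by
  ext I J
  simp only [RingHom.mapMatrix_apply, Matrix.map_apply, Matrix.algebraMap_matrix_apply]
  split_ifs <;> simp

theorem map_hbar_flip : (φ : D →+* D').mapMatrix (hbar • flip N D) = hbar • flip N D' := by
  rw [Algebra.smul_def, map_mul, map_algebraMap_matrix, map_flip, ← Algebra.smul_def]

theorem mapSeries_Rbar (α : ℂ) : mapSeries φ (Rbar N D α) = Rbar N D' α := by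
  ext1 a
  ext1 b
  simp only [mapSeries, Rbar, map_add, map_mul, PowerSeries.map_C, map_flip]
  have : ∀ f : PowerSeries (PowerSeries Kh),
      PowerSeries.map (PowerSeries.map (φ : D →+* D').mapMatrix)
        (PowerSeries.map (PowerSeries.map
          (algebraMap Kh (Matrix (Fin N × Fin N) (Fin N × Fin N) D))) f) =
      PowerSeries.map (PowerSeries.map
          (algebraMap Kh (Matrix (Fin N × Fin N) (Fin N × Fin N) D'))) f := by
    intro f
    ext1 a
    ext1 b
    simp only [PowerSeries.coeff_map, map_algebraMap_matrix]
  rw [this, this]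

theorem map_kronecker (A B : Matrix (Fin N) (Fin N) D) :
    (φ : D →+* D').mapMatrix (A ⊗ₖ B) =
      (φ : D →+* D').mapMatrix A ⊗ₖ (φ : D →+* D').mapMatrix B := by
  ext I J
  simp [Matrix.kroneckerMap_apply]

theorem mapSeries_copy1 (X : ℕ → Matrix (Fin N) (Fin N) D) :
    mapSeries φ (copy1 X) = copy1 fun r => (φ : D →+* D').mapMatrix (X r) := by
  ext1 a
  simp only [mapSeries, copy1, PowerSeries.coeff_map, PowerSeries.coeff_mk, PowerSeries.map_C,
    map_kronecker, map_one]

theorem mapSeries_copy2 (X : ℕ → Matrix (Fin N) (Fin N) D) :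
    mapSeries φ (copy2 X) = copy2 fun r => (φ : D →+* D').mapMatrix (X r) := by
  simp only [mapSeries, copy2, PowerSeries.map_C]
  congr 1
  ext1 b
  simp only [PowerSeries.coeff_map, PowerSeries.coeff_mk, map_kronecker, map_one]

theorem mapSeries_Rminus : mapSeries φ (Rminus N D) = Rminus N D' := by
  simp only [mapSeries, Rminus, map_sub, map_mul, PowerSeries.map_C, PowerSeries.map_X,
    map_hbar_flip]

theorem map_Tcoeff (x : Gen N → D) (r : ℕ) :
    (φ : D →+* D').mapMatrix (Tcoeff x r) = Tcoeff (fun g => φ (x g)) r := by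
  cases r with
  | zero => simp [Tcoeff]
  | succ r => ext i j; simp [Tcoeff]

theorem map_Tpcoeff (x : Gen N → D) (r : ℕ) :
    (φ : D →+* D').mapMatrix (Tpcoeff x r) = Tpcoeff (fun g => φ (x g)) r := by
  unfold Tpcoeff
  rw [map_sub]
  congr 1
  · split_ifs <;> simp
  · ext i j; simp

end Map

theorem DY.rtt : Rminus N (DY N c) * copy1 (Tcoeff (DY.gen N c)) * copy2 (Tcoeff (DY.gen N c)) =
    copy2 (Tcoeff (DY.gen N c)) * copy1 (Tcoeff (DY.gen N c)) * Rminus N (DY N c) := by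
  ext a b I J
  have := DY.mk_rel (Rel.rtt (N := N) (c := c) a b I J)
  rw [← entry_mapSeries, ← entry_mapSeries] at this
  simp only [map_mul, mapSeries_Rminus, mapSeries_copy1, mapSeries_copy2, map_Tcoeff] at this
  exact this

theorem DY.rttMixed :
    Rbar N (DY N c) (c / 2) * copy1 (Tcoeff (DY.gen N c)) * copy2 (Tpcoeff (DY.gen N c)) =
    copy2 (Tpcoeff (DY.gen N c)) * copy1 (Tcoeff (DY.gen N c)) * Rbar N (DY N c) (-(c / 2)) := by
  ext a b I J
  have := DY.mk_rel (Rel.rttMixed (N := N) (c := c) a b I J)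
  rw [← entry_mapSeries, ← entry_mapSeries] at this
  simp only [map_mul, mapSeries_Rbar, mapSeries_copy1, mapSeries_copy2, map_Tcoeff,
    map_Tpcoeff] at this
  exact this

section Entries

variable {D : Type*} [Ring D]

theorem coeff_copy12 (X Y : ℕ → Matrix (Fin N) (Fin N) D) (a b : ℕ) :
    PowerSeries.coeff b (PowerSeries.coeff a (copy1 X * copy2 Y)) =
      (X a ⊗ₖ (1 : Matrix (Fin N) (Fin N) D)) * ((1 : Matrix (Fin N) (Fin N) D) ⊗ₖ Y b) := by
  simp [copy1, copy2]

theorem coeff_copy21 (X Y : ℕ → Matrix (Fin N) (Fin N) D) (a b : ℕ) :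
    PowerSeries.coeff b (PowerSeries.coeff a (copy2 Y * copy1 X)) =
      ((1 : Matrix (Fin N) (Fin N) D) ⊗ₖ Y b) * (X a ⊗ₖ (1 : Matrix (Fin N) (Fin N) D)) := by
  simp [copy1, copy2]

theorem kron12 (X Y : Matrix (Fin N) (Fin N) D) (i k j l : Fin N) :
    ((X ⊗ₖ (1 : Matrix (Fin N) (Fin N) D)) * ((1 : Matrix (Fin N) (Fin N) D) ⊗ₖ Y))
      (i, k) (j, l) = X i j * Y k l := by
  simp only [Matrix.mul_apply, Matrix.kroneckerMap_apply, Fintype.sum_prod_type,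
    Matrix.one_apply, mul_ite, mul_one, mul_zero, ite_mul, one_mul, zero_mul]
  simp

theorem kron21 (X Y : Matrix (Fin N) (Fin N) D) (i k j l : Fin N) :
    (((1 : Matrix (Fin N) (Fin N) D) ⊗ₖ Y) * (X ⊗ₖ (1 : Matrix (Fin N) (Fin N) D)))
      (i, k) (j, l) = Y k l * X i j := by
  simp only [Matrix.mul_apply, Matrix.kroneckerMap_apply, Fintype.sum_prod_type,
    Matrix.one_apply, mul_ite, mul_one, mul_zero, ite_mul, one_mul, zero_mul]
  simp

theorem flip_mul_apply (M : Matrix (Fin N × Fin N) (Fin N × Fin N) D) (i k : Fin N)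
    (J : Fin N × Fin N) : (flip N D * M) (i, k) J = M (k, i) J := by
  rw [Matrix.mul_apply, Finset.sum_eq_single (k, i)]
  · simp [flip]
  · rintro ⟨a, b⟩ - hab
    have : ¬ (i = b ∧ k = a) := by rintro ⟨rfl, rfl⟩; exact hab rfl
    simp [flip, this]
  · simp

theorem mul_flip_apply (M : Matrix (Fin N × Fin N) (Fin N × Fin N) D) (j l : Fin N)
    (I : Fin N × Fin N) : (M * flip N D) I (j, l) = M I (l, j) := by
  rw [Matrix.mul_apply, Finset.sum_eq_single (l, j)]
  · simp [flip]
  · rintro ⟨a, b⟩ - hab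
    have : ¬ (a = l ∧ b = j) := by rintro ⟨rfl, rfl⟩; exact hab rfl
    simp [flip, this]
  · simp

theorem coeff_Rminus_mul [Algebra Kh D] (a b : ℕ)
    (F : PowerSeries (PowerSeries (Matrix (Fin N × Fin N) (Fin N × Fin N) D))) :
    PowerSeries.coeff (b + 1) (PowerSeries.coeff (a + 1) (Rminus N D * F)) =
      PowerSeries.coeff b (PowerSeries.coeff (a + 1) F) -
      PowerSeries.coeff (b + 1) (PowerSeries.coeff a F) -
      (hbar • flip N D) * PowerSeries.coeff b (PowerSeries.coeff a F) := by
  simp only [Rminus, sub_mul, map_sub, mul_assoc, PowerSeries.coeff_succ_X_mul,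
    PowerSeries.coeff_C_mul]

theorem coeff_mul_Rminus [Algebra Kh D] (a b : ℕ)
    (F : PowerSeries (PowerSeries (Matrix (Fin N × Fin N) (Fin N × Fin N) D))) :
    PowerSeries.coeff (b + 1) (PowerSeries.coeff (a + 1) (F * Rminus N D)) =
      PowerSeries.coeff b (PowerSeries.coeff (a + 1) F) -
      PowerSeries.coeff (b + 1) (PowerSeries.coeff a F) -
      PowerSeries.coeff b (PowerSeries.coeff a F) * (hbar • flip N D) := by
  simp only [Rminus, mul_sub, map_sub, ← mul_assoc, PowerSeries.coeff_succ_mul_X,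
    PowerSeries.coeff_mul_C]

end Entries

theorem DY.rtt_entry (a b : ℕ) (i j k l : Fin N) :
    Tcoeff (DY.gen N c) (a + 1) i j * Tcoeff (DY.gen N c) b k l -
      Tcoeff (DY.gen N c) a i j * Tcoeff (DY.gen N c) (b + 1) k l -
      hbar • (Tcoeff (DY.gen N c) a k j * Tcoeff (DY.gen N c) b i l) =
    Tcoeff (DY.gen N c) b k l * Tcoeff (DY.gen N c) (a + 1) i j -
      Tcoeff (DY.gen N c) (b + 1) k l * Tcoeff (DY.gen N c) a i j -
      hbar • (Tcoeff (DY.gen N c) b k j * Tcoeff (DY.gen N c) a i l) := by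
  have h := congrArg (fun F : PowerSeries (PowerSeries
    (Matrix (Fin N × Fin N) (Fin N × Fin N) (DY N c))) =>
    PowerSeries.coeff (b + 1) (PowerSeries.coeff (a + 1) F) (i, k) (j, l))
    (DY.rtt (N := N) (c := c))
  simp only [mul_assoc (Rminus N (DY N c)), coeff_Rminus_mul, coeff_mul_Rminus, coeff_copy12,
    coeff_copy21, Matrix.sub_apply, kron12, kron21, Matrix.smul_mul, Matrix.mul_smul,
    Matrix.smul_apply, flip_mul_apply, mul_flip_apply] at h
  exact h

theorem Ip_gen {p : ℕ} (i j : Fin N) {r : ℕ} (h : p ≤ r + 1) :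
    DY.gen N c (.pos i j r) ∈ Ip N c p :=
  Ideal.subset_span ⟨i, j, r, h, rfl⟩

theorem smul_mem_ideal (I : Ideal (DY N c)) (z : Kh) {x : DY N c} (h : x ∈ I) : z • x ∈ I := by
  rw [Algebra.smul_def]
  exact I.mul_mem_left _ h

theorem sub_rearrange {A : Type*} [AddCommGroup A] {x y z u v w : A}
    (h : x - y - z = u - v - w) : y = x - z - u + v + w := by
  have : y = x - z - (x - y - z) := by abel
  rw [this, h]
  abel

theorem Ip_mul_pos (p s : ℕ) : ∀ (r : ℕ) (_ : p ≤ r + 1) (i j k l : Fin N),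
    DY.gen N c (.pos i j r) * DY.gen N c (.pos k l s) ∈ Ip N c p := by
  induction s with
  | zero =>
    intro r hr i j k l
    have h := DY.rtt_entry (N := N) (c := c) (r + 1) 0 i j k l
    simp only [Tcoeff, Matrix.smul_apply, Matrix.of_apply, smul_mul_smul_comm] at h
    have key : DY.gen N c (.pos i j r) * DY.gen N c (.pos k l 0) =
        DY.gen N c (.pos k l 0) * DY.gen N c (.pos i j r) +
        (1 : Matrix (Fin N) (Fin N) (DY N c)) k j * DY.gen N c (.pos i l r) -
        DY.gen N c (.pos k j r) * (1 : Matrix (Fin N) (Fin N) (DY N c)) i l := by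
      apply DY.smul_cancel 2
      have e1 : ∀ x : DY N c, hbar • x * (1 : Matrix (Fin N) (Fin N) (DY N c)) k l =
          (1 : Matrix (Fin N) (Fin N) (DY N c)) k l * hbar • x := by
        intro x; rw [Matrix.one_apply]; split_ifs <;> simp
      rw [e1] at h
      simp only [smul_mul_assoc, mul_smul_comm, smul_smul, ← pow_two] at h
      rw [sub_rearrange h]
      simp only [smul_sub, smul_add]
      abel
    rw [key]
    refine Ideal.sub_mem _ (Ideal.add_mem _ (Ideal.mul_mem_left _ _ (Ip_gen _ _ hr))
      (Ideal.mul_mem_left _ _ (Ip_gen _ _ hr))) ?_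
    rw [Matrix.one_apply]
    split_ifs
    · rw [mul_one]; exact Ip_gen _ _ hr
    · simp
  | succ s ih =>
    intro r hr i j k l
    have h := DY.rtt_entry (N := N) (c := c) (r + 1) (s + 1) i j k l
    simp only [Tcoeff, Matrix.smul_apply, Matrix.of_apply, smul_mul_smul_comm, ← pow_two] at h
    have key : DY.gen N c (.pos i j r) * DY.gen N c (.pos k l (s + 1)) =
        DY.gen N c (.pos i j (r + 1)) * DY.gen N c (.pos k l s) -
        hbar • (DY.gen N c (.pos k j r) * DY.gen N c (.pos i l s)) -
        DY.gen N c (.pos k l s) * DY.gen N c (.pos i j (r + 1)) +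
        DY.gen N c (.pos k l (s + 1)) * DY.gen N c (.pos i j r) +
        hbar • (DY.gen N c (.pos k j s) * DY.gen N c (.pos i l r)) := by
      apply DY.smul_cancel 2
      simp only [smul_sub, smul_add, smul_comm (hbar ^ 2) hbar]
      exact sub_rearrange h
    rw [key]
    exact Ideal.add_mem _ (Ideal.add_mem _ (Ideal.sub_mem _ (Ideal.sub_mem _
      (ih (r + 1) (by omega) _ _ _ _) (smul_mem_ideal _ _ (ih r hr _ _ _ _)))
      (Ideal.mul_mem_left _ _ (Ip_gen _ _ (by omega)))) (Ideal.mul_mem_left _ _ (Ip_gen _ _ hr)))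
      (smul_mem_ideal _ _ (Ideal.mul_mem_left _ _ (Ip_gen _ _ hr)))

theorem coeff_coeff_mul {M : Type*} [Ring M] (a b : ℕ) (F H : PowerSeries (PowerSeries M)) :
    PowerSeries.coeff b (PowerSeries.coeff a (F * H)) =
      ∑ x ∈ Finset.HasAntidiagonal.antidiagonal a, ∑ y ∈ Finset.HasAntidiagonal.antidiagonal b,
        PowerSeries.coeff y.1 (PowerSeries.coeff x.1 F) *
          PowerSeries.coeff y.2 (PowerSeries.coeff x.2 H) := by
  rw [PowerSeries.coeff_mul, map_sum]
  exact Finset.sum_congr rfl fun x _ => PowerSeries.coeff_mul _ _ _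

theorem hbar_pow_dvd_coeff_pow (z : ℂ) (m : ℕ) : ∀ b : ℕ, hbar ^ (m - b) ∣
    PowerSeries.coeff b ((-PowerSeries.X + PowerSeries.C (hmul z) : PowerSeries Kh) ^ m) := by
  induction m with
  | zero => intro b; simp
  | succ m ih =>
    intro b
    rw [pow_succ', add_mul, map_add, PowerSeries.coeff_C_mul, neg_mul, map_neg]
    refine dvd_add ?_ ?_
    · rw [dvd_neg]
      cases b with
      | zero => simp
      | succ b => rw [PowerSeries.coeff_succ_X_mul, Nat.add_sub_add_right]; exact ih b
    · have h1 : hbar ^ (m + 1 - b) ∣ hbar ^ (1 + (m - b)) := pow_dvd_pow _ (by omega)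
      refine h1.trans ?_
      rw [pow_add, pow_one]
      exact mul_dvd_mul (Dvd.intro _ rfl) (ih b)

/-- The coefficient of `u^{-a} v^b` in `f(u - v + h z)`. -/
def shiftCoeff (f : PowerSeries Kh) (z : ℂ) (a b : ℕ) : Kh :=
  PowerSeries.coeff b (PowerSeries.coeff a
    (atInf 1 (-PowerSeries.X + PowerSeries.C (hmul z) : PowerSeries Kh)
        (PowerSeries.map PowerSeries.C f)))

theorem shiftCoeff_dvd (f : PowerSeries Kh) (hf : ∀ k, hbar ^ k ∣ PowerSeries.coeff k f) (z : ℂ)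
    (a b e : ℕ) (ha : 1 ≤ a) (he : e ≤ max 1 (a - b)) : hbar ^ e ∣ shiftCoeff f z a b := by
  simp only [shiftCoeff, atInf, PowerSeries.coeff_mk, map_sum]
  refine Finset.dvd_sum fun k hk => ?_
  rw [Finset.mem_range] at hk
  rcases Nat.eq_zero_or_pos k with rfl | hk0
  · have : Ring.choose (-((0 : ℕ) : ℤ)) (a - 0) = 0 := by
      rw [Nat.cast_zero, neg_zero, Ring.choose_zero_pos _ (by omega)]
    rw [this, Int.cast_zero, mul_zero, map_zero, zero_mul, zero_smul, map_zero]
    exact dvd_zero _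
  · have e1 : (algebraMap ℂ (PowerSeries Kh)) (1 : ℂ)⁻¹ = 1 := by simp
    rw [e1, one_mul, smul_eq_mul, PowerSeries.coeff_map, PowerSeries.coeff_mul_C, mul_comm]
    have e2 : hbar ^ e ∣ hbar ^ (k + (a - k - b)) := pow_dvd_pow _ (by omega)
    refine e2.trans ?_
    rw [pow_add]
    refine mul_dvd_mul (hf k) ?_
    rw [PowerSeries.algebraMap_apply, PowerSeries.coeff_C_mul]
    exact Dvd.dvd.mul_left (hbar_pow_dvd_coeff_pow z _ b) _

theorem shiftCoeff_zero (f : PowerSeries Kh) (z : ℂ) (b : ℕ) :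
    shiftCoeff f z 0 b = if b = 0 then PowerSeries.coeff 0 f else 0 := by
  simp only [shiftCoeff, atInf, PowerSeries.coeff_mk]
  simp [PowerSeries.coeff_C]

theorem gh_dvd (k : ℕ) : hbar ^ k ∣ PowerSeries.coeff k (gh N) := by
  rw [gh, PowerSeries.coeff_mk]
  exact Dvd.intro _ rfl

theorem ghP_dvd (k : ℕ) : hbar ^ k ∣ PowerSeries.coeff k (ghP N) := by
  rw [ghP, neg_mul, map_neg, dvd_neg, mul_assoc, PowerSeries.coeff_C_mul]
  cases k with
  | zero => simp
  | succ k =>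
    rw [PowerSeries.coeff_succ_X_mul, pow_succ']
    exact mul_dvd_mul_left _ (gh_dvd k)

theorem coeff_Rbar (D : Type*) [Ring D] [Algebra Kh D] (z : ℂ) (a b : ℕ) :
    PowerSeries.coeff b (PowerSeries.coeff a (Rbar N D z)) =
      algebraMap Kh _ (shiftCoeff (gh N) z a b) +
        algebraMap Kh _ (shiftCoeff (ghP N) z a b) * flip N D := by
  simp only [Rbar, map_add, PowerSeries.coeff_map, PowerSeries.coeff_mul_C, shiftCoeff]

theorem coeff_Rbar_zero (D : Type*) [Ring D] [Algebra Kh D] (z : ℂ) (b : ℕ) :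
    PowerSeries.coeff b (PowerSeries.coeff 0 (Rbar N D z)) = if b = 0 then 1 else 0 := by
  have h1 : PowerSeries.coeff 0 (ghP N) = 0 := by
    rw [ghP, neg_mul, map_neg, mul_assoc, PowerSeries.coeff_C_mul]; simp
  have h2 : PowerSeries.coeff 0 (gh N) = 1 := by
    rw [gh, PowerSeries.coeff_mk]; simp [gCoeff]
  rw [coeff_Rbar, shiftCoeff_zero, shiftCoeff_zero, h1, h2]
  split_ifs <;> simp

theorem coeff_Rbar_succ (D : Type*) [Ring D] [Algebra Kh D] (z : ℂ) (a b e : ℕ)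
    (he : e ≤ max 1 (a + 1 - b)) : ∃ z₁ z₂ : Kh,
      PowerSeries.coeff b (PowerSeries.coeff (a + 1) (Rbar N D z)) =
        hbar ^ e • (z₁ • (1 : Matrix (Fin N × Fin N) (Fin N × Fin N) D) + z₂ • flip N D) := by
  obtain ⟨z₁, h₁⟩ := shiftCoeff_dvd (gh N) gh_dvd z (a + 1) b e (by omega) he
  obtain ⟨z₂, h₂⟩ := shiftCoeff_dvd (ghP N) ghP_dvd z (a + 1) b e (by omega) he
  refine ⟨z₁, z₂, ?_⟩
  rw [coeff_Rbar, h₁, h₂, ← Algebra.smul_def, Algebra.algebraMap_eq_smul_one, smul_add, mul_smul,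
    mul_smul]

/-- Matrices with all entries in a left ideal. -/
def matIdeal (I : Ideal (DY N c)) :
    AddSubgroup (Matrix (Fin N × Fin N) (Fin N × Fin N) (DY N c)) where
  carrier := {M | ∀ a b, M a b ∈ I}
  zero_mem' := fun _ _ => I.zero_mem
  add_mem' := fun h h' a b => I.add_mem (h a b) (h' a b)
  neg_mem' := fun h a b => I.neg_mem (h a b)

theorem matIdeal_mul {I : Ideal (DY N c)} (A : Matrix (Fin N × Fin N) (Fin N × Fin N) (DY N c))
    {M : Matrix (Fin N × Fin N) (Fin N × Fin N) (DY N c)} (h : M ∈ matIdeal I) :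
    A * M ∈ matIdeal I := fun a b => by
  rw [Matrix.mul_apply]
  exact I.sum_mem fun j _ => I.mul_mem_left _ (h j b)

theorem matIdeal_smul {I : Ideal (DY N c)} (z : Kh)
    {M : Matrix (Fin N × Fin N) (Fin N × Fin N) (DY N c)} (h : M ∈ matIdeal I) :
    z • M ∈ matIdeal I := fun a b => smul_mem_ideal I z (h a b)

theorem matIdeal_mul_R {I : Ideal (DY N c)} (z₁ z₂ : Kh)
    {M : Matrix (Fin N × Fin N) (Fin N × Fin N) (DY N c)} (h : M ∈ matIdeal I) :
    M * (z₁ • (1 : Matrix (Fin N × Fin N) (Fin N × Fin N) (DY N c)) + z₂ • flip N (DY N c)) ∈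
      matIdeal I := by
  rw [mul_add, Matrix.mul_smul, Matrix.mul_smul, mul_one]
  refine AddSubgroup.add_mem _ (matIdeal_smul _ h) (matIdeal_smul _ ?_)
  rintro a ⟨j, l⟩
  rw [mul_flip_apply]
  exact h _ _

theorem hbar_pow_smul_mem (p n : ℕ) (x : DY N c) : hbar ^ n • x ∈ nbhd N c p n := by
  rw [Algebra.smul_def, Algebra.commutes]
  exact Ideal.mul_mem_left _ _ (Ideal.mem_sup_right (Ideal.subset_span rfl))

theorem hbar_smul_mem {p n : ℕ} {x : DY N c} (h : x ∈ nbhd N c p n) :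
    hbar • x ∈ nbhd N c p (n + 1) := by
  obtain ⟨y, hy, z, hz, rfl⟩ := Submodule.mem_sup.1 h
  obtain ⟨w, rfl⟩ := Ideal.mem_span_singleton'.1 hz
  rw [smul_add]
  refine Ideal.add_mem _ (smul_mem_ideal _ _ (Ideal.mem_sup_left hy)) ?_
  rw [← Algebra.commutes, ← Algebra.smul_def, smul_smul, ← pow_succ']
  exact hbar_pow_smul_mem _ _ _

theorem Ip_anti {p q : ℕ} (h : p ≤ q) : Ip N c q ≤ Ip N c p := by
  refine Ideal.span_mono ?_
  rintro x ⟨i, j, r, hr, rfl⟩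
  exact ⟨i, j, r, h.trans hr, rfl⟩

/-- `t^{(r+1)}` in the first tensor copy. -/
def tau (N : ℕ) (c : ℂ) (r : ℕ) : Matrix (Fin N × Fin N) (Fin N × Fin N) (DY N c) :=
  (Matrix.of fun i j => DY.gen N c (.pos i j r)) ⊗ₖ (1 : Matrix (Fin N) (Fin N) (DY N c))

/-- `t^{(-r-1)}` in the second tensor copy. -/
def sig (N : ℕ) (c : ℂ) (r : ℕ) : Matrix (Fin N × Fin N) (Fin N × Fin N) (DY N c) :=
  (1 : Matrix (Fin N) (Fin N) (DY N c)) ⊗ₖ (Matrix.of fun i j => DY.gen N c (.neg i j r))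

/-- The coefficients of `T⁺` in the second tensor copy. -/
def Tp2 (N : ℕ) (c : ℂ) (r : ℕ) : Matrix (Fin N × Fin N) (Fin N × Fin N) (DY N c) :=
  (1 : Matrix (Fin N) (Fin N) (DY N c)) ⊗ₖ Tpcoeff (DY.gen N c) r

/-- The coefficients of `T` in the first tensor copy. -/
def T1 (N : ℕ) (c : ℂ) (r : ℕ) : Matrix (Fin N × Fin N) (Fin N × Fin N) (DY N c) :=
  Tcoeff (DY.gen N c) r ⊗ₖ (1 : Matrix (Fin N) (Fin N) (DY N c))

theorem T1_succ (r : ℕ) : T1 N c (r + 1) = hbar • tau N c r := by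
  ext ⟨i, k⟩ ⟨j, l⟩
  simp [T1, tau, Tcoeff, Matrix.kroneckerMap_apply]

theorem Tp2_eq (r : ℕ) : Tp2 N c r = (if r = 0 then 1 else 0) - hbar • sig N c r := by
  ext ⟨i, k⟩ ⟨j, l⟩
  simp only [Tp2, sig, Tpcoeff, Matrix.kroneckerMap_apply, Matrix.sub_apply, Matrix.smul_apply,
    Matrix.of_apply, mul_sub, mul_smul_comm]
  congr 1
  split_ifs with h
  · simp only [Matrix.one_apply, Prod.mk.injEq]
    split_ifs <;> simp_all
  · simp

theorem tau_mem {p r : ℕ} (n : ℕ) (h : p ≤ r + 1) : tau N c r ∈ matIdeal (nbhd N c p n) := by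
  rintro ⟨i, k⟩ ⟨j, l⟩
  simp only [tau, Matrix.kroneckerMap_apply, Matrix.of_apply, Matrix.one_apply]
  split_ifs
  · rw [mul_one]; exact Ideal.mem_sup_left (Ip_gen _ _ h)
  · rw [mul_zero]; exact Ideal.zero_mem _

/-- Multiples by `h²` of the matrices with entries in a left ideal. -/
def matIdeal2 (I : Ideal (DY N c)) :
    AddSubgroup (Matrix (Fin N × Fin N) (Fin N × Fin N) (DY N c)) :=
  (matIdeal I).map (DistribSMul.toAddMonoidHom _ (hbar ^ 2))

theorem mem_matIdeal2 {I : Ideal (DY N c)} {M M' : Matrix (Fin N × Fin N) (Fin N × Fin N) (DY N c)}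
    (h : M' ∈ matIdeal I) (e : M = hbar ^ 2 • M') : M ∈ matIdeal2 I :=
  ⟨M', h, e.symm⟩

theorem sum_ite_left {M : Type*} [Ring M] (b : ℕ) (f : ℕ × ℕ → M) :
    ∑ y ∈ Finset.HasAntidiagonal.antidiagonal b, (if y.1 = 0 then 1 else 0) * f y = f (0, b) := by
  rw [Finset.sum_eq_single (0, b)]
  · simp
  · rintro ⟨y1, y2⟩ hy hne
    have : y1 ≠ 0 := by rintro rfl; apply hne; simp_all
    simp [this]
  · simp

theorem sum_ite_right {M : Type*} [Ring M] (b : ℕ) (f : ℕ × ℕ → M) :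
    ∑ y ∈ Finset.HasAntidiagonal.antidiagonal b, f y * (if y.2 = 0 then 1 else 0) = f (b, 0) := by
  rw [Finset.sum_eq_single (b, 0)]
  · simp
  · rintro ⟨y1, y2⟩ hy hne
    have : y2 ≠ 0 := by rintro rfl; apply hne; simp_all
    simp [this]
  · simp

theorem DY.mixed_coeff (r b : ℕ) :
    hbar ^ 2 • (tau N c r * sig N c b) = hbar ^ 2 • (sig N c b * tau N c r) +
      (∑ x ∈ Finset.HasAntidiagonal.antidiagonal r, ∑ y ∈ Finset.HasAntidiagonal.antidiagonal b,
        PowerSeries.coeff y.1 (PowerSeries.coeff (x.1 + 1) (Rbar N (DY N c) (c / 2))) *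
          (T1 N c x.2 * Tp2 N c y.2)) -
      (∑ x ∈ Finset.HasAntidiagonal.antidiagonal r, ∑ y ∈ Finset.HasAntidiagonal.antidiagonal b,
        (Tp2 N c y.1 * T1 N c x.1) *
        PowerSeries.coeff y.2 (PowerSeries.coeff (x.2 + 1) (Rbar N (DY N c) (-(c / 2))))) := by
  have h := congrArg (fun F : PowerSeries (PowerSeries
    (Matrix (Fin N × Fin N) (Fin N × Fin N) (DY N c))) =>
    PowerSeries.coeff b (PowerSeries.coeff (r + 1) F)) (DY.rttMixed (N := N) (c := c))
  simp only [mul_assoc (Rbar N (DY N c) (c / 2))] at h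
  simp only [coeff_coeff_mul _ _ (Rbar N (DY N c) (c / 2)),
    coeff_coeff_mul _ _ _ (Rbar N (DY N c) (-(c / 2))), coeff_copy12, coeff_copy21] at h
  rw [Finset.Nat.sum_antidiagonal_succ, Finset.Nat.sum_antidiagonal_succ'] at h
  simp only [coeff_Rbar_zero] at h
  rw [sum_ite_left, sum_ite_right] at h
  change T1 N c (r + 1) * Tp2 N c b + _ = Tp2 N c b * T1 N c (r + 1) + _ at h
  have e1 : T1 N c (r + 1) * Tp2 N c b = hbar • (if b = 0 then tau N c r else 0) -
      hbar ^ 2 • (tau N c r * sig N c b) := by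
    rw [T1_succ, Tp2_eq, mul_sub, smul_mul_smul_comm, ← pow_two]
    split_ifs <;> simp
  have e2 : Tp2 N c b * T1 N c (r + 1) = hbar • (if b = 0 then tau N c r else 0) -
      hbar ^ 2 • (sig N c b * tau N c r) := by
    rw [T1_succ, Tp2_eq, sub_mul, smul_mul_smul_comm, ← pow_two]
    split_ifs <;> simp
  rw [e1, e2] at h
  have aux : ∀ {A : Type _} [AddCommGroup A] {x y u v w : A}, w - x + u = w - y + v →
      x = y + u - v := by
    intro A _ x y u v w h
    have : x = (w + u) - (w - x + u) := by abel
    rw [this, h]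
    abel
  exact aux h

theorem tau_sig_mem (p b n : ℕ) : ∃ q, ∀ r, q ≤ r → ∀ b' ≤ b,
    tau N c r * sig N c b' ∈ matIdeal (nbhd N c p n) := by
  induction n with
  | zero =>
    refine ⟨0, fun r _ b' _ i j => ?_⟩
    have := hbar_pow_smul_mem (N := N) (c := c) p 0 ((tau N c r * sig N c b') i j)
    rwa [pow_zero, one_smul] at this
  | succ n ih =>
    obtain ⟨q, hq⟩ := ih
    refine ⟨max p q + b + n + 3, fun r hr b' hb' => ?_⟩
    have hL : (∑ x ∈ Finset.HasAntidiagonal.antidiagonal r, ∑ y ∈ Finset.HasAntidiagonal.antidiagonal b',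
        PowerSeries.coeff y.1 (PowerSeries.coeff (x.1 + 1) (Rbar N (DY N c) (c / 2))) *
          (T1 N c x.2 * Tp2 N c y.2)) ∈ matIdeal2 (nbhd N c p (n + 1)) := by
      refine sum_mem fun x hx => sum_mem fun y hy => ?_
      obtain ⟨x1, x2⟩ := x
      obtain ⟨y1, y2⟩ := y
      rw [Finset.HasAntidiagonal.mem_antidiagonal] at hx hy
      simp only at hx hy ⊢
      by_cases hs : x2 ≤ max p q
      · obtain ⟨z₁, z₂, hz⟩ := coeff_Rbar_succ (N := N) (DY N c) (c / 2) x1 y1 (2 + (n + 1))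
          (by omega)
        rw [hz, pow_add, mul_smul, Matrix.smul_mul, Matrix.smul_mul]
        exact mem_matIdeal2 (fun i j => hbar_pow_smul_mem _ _ _) rfl
      · obtain ⟨x', rfl⟩ : ∃ x', x2 = x' + 1 := ⟨x2 - 1, by omega⟩
        obtain ⟨z₁, z₂, hz⟩ := coeff_Rbar_succ (N := N) (DY N c) (c / 2) x1 y1 1 (by omega)
        have e : T1 N c (x' + 1) * Tp2 N c y2 = hbar • ((if y2 = 0 then tau N c x' else 0) -
            hbar • (tau N c x' * sig N c y2)) := by
          rw [T1_succ, Tp2_eq, mul_sub, smul_mul_smul_comm, smul_sub, smul_smul]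
          split_ifs <;> simp
        rw [hz, e, pow_one, smul_mul_smul_comm, ← pow_two]
        refine mem_matIdeal2 (matIdeal_mul _ (AddSubgroup.sub_mem _ ?_ ?_)) rfl
        · split_ifs
          · exact tau_mem _ (by omega)
          · exact AddSubgroup.zero_mem _
        · exact fun i j => hbar_smul_mem (hq x' (by omega) y2 (by omega) i j)
    have hR : (∑ x ∈ Finset.HasAntidiagonal.antidiagonal r, ∑ y ∈ Finset.HasAntidiagonal.antidiagonal b',
        (Tp2 N c y.1 * T1 N c x.1) *
        PowerSeries.coeff y.2 (PowerSeries.coeff (x.2 + 1) (Rbar N (DY N c) (-(c / 2))))) ∈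
          matIdeal2 (nbhd N c p (n + 1)) := by
      refine sum_mem fun x hx => sum_mem fun y hy => ?_
      obtain ⟨x1, x2⟩ := x
      obtain ⟨y1, y2⟩ := y
      rw [Finset.HasAntidiagonal.mem_antidiagonal] at hx hy
      simp only at hx hy ⊢
      by_cases hs : x1 ≤ max p q
      · obtain ⟨z₁, z₂, hz⟩ := coeff_Rbar_succ (N := N) (DY N c) (-(c / 2)) x2 y2 (2 + (n + 1))
          (by omega)
        rw [hz, pow_add, mul_smul, Matrix.mul_smul, Matrix.mul_smul]
        exact mem_matIdeal2 (fun i j => hbar_pow_smul_mem _ _ _) rfl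
      · obtain ⟨x', rfl⟩ : ∃ x', x1 = x' + 1 := ⟨x1 - 1, by omega⟩
        obtain ⟨z₁, z₂, hz⟩ := coeff_Rbar_succ (N := N) (DY N c) (-(c / 2)) x2 y2 1 (by omega)
        rw [hz, T1_succ, Matrix.mul_smul (Tp2 N c y1), pow_one, smul_mul_smul_comm, ← pow_two]
        exact mem_matIdeal2 (matIdeal_mul_R _ _ (matIdeal_mul _ (tau_mem _ (by omega)))) rfl
    obtain ⟨L, hLm, hLe⟩ := hL
    obtain ⟨R, hRm, hRe⟩ := hR
    have key := DY.mixed_coeff (N := N) (c := c) r b'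
    rw [← hLe, ← hRe] at key
    have key' : tau N c r * sig N c b' = sig N c b' * tau N c r + L - R := by
      ext i j
      apply DY.smul_cancel 2
      have := congrFun (congrFun key i) j
      simpa [smul_sub, smul_add] using this
    rw [key']
    exact AddSubgroup.sub_mem _ (AddSubgroup.add_mem _ (matIdeal_mul _ (tau_mem _ (by omega))) hLm)
      hRm

theorem nbhd_mul_right (x : DY N c) : ∀ p n : ℕ, ∃ q, ∀ y ∈ nbhd N c q n,
    y * x ∈ nbhd N c p n := by
  have red : ∀ (x : DY N c) (p n q : ℕ), (∀ i j r, q ≤ r + 1 →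
      DY.gen N c (.pos i j r) * x ∈ nbhd N c p n) →
      ∀ y ∈ nbhd N c q n, y * x ∈ nbhd N c p n := by
    intro x p n q h y hy
    obtain ⟨y, hy', z, hz, rfl⟩ := Submodule.mem_sup.1 hy
    rw [add_mul]
    refine Ideal.add_mem _ ?_ ?_
    · refine Submodule.span_induction (p := fun y _ => y * x ∈ nbhd N c p n) ?_ ?_ ?_ ?_ hy'
      · rintro _ ⟨i, j, r, hr, rfl⟩
        exact h i j r hr
      · rw [zero_mul]; exact Ideal.zero_mem _
      · intro a b _ _ ha hb
        rw [add_mul]; exact Ideal.add_mem _ ha hb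
      · intro a b _ hb
        rw [smul_eq_mul, mul_assoc]; exact Ideal.mul_mem_left _ _ hb
    · obtain ⟨w, rfl⟩ := Ideal.mem_span_singleton'.1 hz
      rw [← Algebra.commutes, ← Algebra.smul_def, smul_mul_assoc]
      exact hbar_pow_smul_mem _ _ _
  obtain ⟨x, rfl⟩ := DY.mk_surjective x
  induction x using FreeAlgebra.induction with
  | grade0 z =>
    intro p n
    refine ⟨p, fun y hy => ?_⟩
    rw [AlgHom.commutes, ← Algebra.commutes]
    exact Ideal.mul_mem_left _ _ hy
  | grade1 g =>
    intro p n
    change ∃ q, ∀ y ∈ nbhd N c q n, y * DY.gen N c g ∈ nbhd N c p n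
    cases g with
    | pos k l s =>
      exact ⟨p, red _ _ _ _ fun i j r hr => Ideal.mem_sup_left (Ip_mul_pos p s r hr i j k l)⟩
    | neg k l s =>
      obtain ⟨q, hq⟩ := tau_sig_mem (N := N) (c := c) p s n
      refine ⟨q + 1, red _ _ _ _ fun i j r hr => ?_⟩
      have := hq r (by omega) s le_rfl (i, k) (j, l)
      rwa [tau, sig, kron12] at this
  | mul a b ha hb =>
    intro p n
    obtain ⟨q, hq⟩ := hb p n
    obtain ⟨q', hq'⟩ := ha q n
    refine ⟨q', fun y hy => ?_⟩
    rw [map_mul, ← mul_assoc]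
    exact hq _ (hq' y hy)
  | add a b ha hb =>
    intro p n
    obtain ⟨q, hq⟩ := ha p n
    obtain ⟨q', hq'⟩ := hb p n
    have hle : ∀ m, m ≤ max q q' → nbhd N c (max q q') n ≤ nbhd N c m n :=
      fun m hm => sup_le_sup_right (Ip_anti hm) _
    refine ⟨max q q', fun y hy => ?_⟩
    rw [map_add, mul_add]
    exact Ideal.add_mem _ (hq _ (hle q (le_max_left _ _) hy)) (hq' _ (hle q' (le_max_right _ _) hy))

theorem nbhd_anti {p q n m : ℕ} (h : p ≤ q) (h' : n ≤ m) : nbhd N c q m ≤ nbhd N c p n := by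
  refine sup_le_sup (Ip_anti h) ?_
  rw [Ideal.span_singleton_le_iff_mem, Ideal.mem_span_singleton']
  refine ⟨algebraMap Kh _ (hbar ^ (m - n)), ?_⟩
  rw [← map_mul, ← pow_add, Nat.sub_add_cancel h']

theorem nbhd_basis (N : ℕ) (c : ℂ) :
    RingSubgroupsBasis fun i : ℕ × ℕ => (nbhd N c i.1 i.2).toAddSubgroup where
  inter i j := ⟨(max i.1 j.1, max i.2 j.2), le_inf
    (nbhd_anti (le_max_left _ _) (le_max_left _ _))
    (nbhd_anti (le_max_right _ _) (le_max_right _ _))⟩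
  mul i := ⟨i, by
    rintro _ ⟨x, _, y, hy, rfl⟩
    exact Ideal.mul_mem_left _ _ hy⟩
  leftMul x i := ⟨i, fun _ hy => Ideal.mul_mem_left _ _ hy⟩
  rightMul x i := by
    obtain ⟨q, hq⟩ := nbhd_mul_right x i.1 i.2
    exact ⟨(q, i.2), fun y hy => hq y hy⟩

end Topology

/-- The uniform structure on the double Yangian for which the `I_p + h^n DY` form a basis of
neighbourhoods of zero. -/
instance (N : ℕ) (c : ℂ) : UniformSpace (DY N c) :=
  @IsTopologicalAddGroup.rightUniformSpace (DY N c) _ (nbhd_basis N c).topology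
    (nbhd_basis N c).toRingFilterBasis.toAddGroupFilterBasis.isTopologicalAddGroup

instance (N : ℕ) (c : ℂ) : IsTopologicalRing (DY N c) :=
  (nbhd_basis N c).toRingFilterBasis.isTopologicalRing

instance (N : ℕ) (c : ℂ) : IsUniformAddGroup (DY N c) :=
  @isUniformAddGroup_of_addCommGroup (DY N c) _ (nbhd_basis N c).topology
    (nbhd_basis N c).toRingFilterBasis.toAddGroupFilterBasis.isTopologicalAddGroup

/-- The completed double Yangian: the `h`-adic completion of the inverse limit of the `DY / I_p`,
that is, the inverse limit of all the quotients `DY / (I_p + h^n DY)`, with its ring structure. -/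
abbrev DYtilde (N : ℕ) (c : ℂ) : Type := UniformSpace.Completion (DY N c)

/-! ### The subalgebra `A_c(g_N)` and its completion -/

section Twisted

variable (N : ℕ) (c : ℂ) (G : Matrix (Fin N) (Fin N) ℂ)

/-- A complex matrix regarded as a matrix over the double Yangian. -/
def scalarMat {ι : Type*} (E : Matrix ι ι ℂ) : Matrix ι ι (DY N c) :=
  E.map fun z => algebraMap Kh (DY N c) (PowerSeries.C z)

/-- `S⁺(u) = T⁺(u) G T⁺ᵗ(-u)`, a power series in `u`. -/
def Splus : PowerSeries (Matrix (Fin N) (Fin N) (DY N c)) :=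
  PowerSeries.mk (Tpcoeff (DY.gen N c)) * PowerSeries.C (scalarMat N c G) *
    PowerSeries.mk fun r => (-1 : Kh) ^ r • (Tpcoeff (DY.gen N c) r)ᵀ

/-- `S(u) = T(u + h c) G Tᵗ(-u)`, a power series in `u⁻¹`. -/
def Sminus : PowerSeries (Matrix (Fin N) (Fin N) (DY N c)) :=
  atInf 1 (hmul c) (PowerSeries.mk (Tcoeff (DY.gen N c))) * PowerSeries.C (scalarMat N c G) *
    atInf (-1) (0 : Kh) (PowerSeries.mk fun r => (Tcoeff (DY.gen N c) r)ᵀ)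

/-- The subalgebra `A_c(g_N)` generated by the elements `s_ij^{(±r)}`, `r ≥ 1`, determined by
`S⁺(u) = G - h ∑ s^{(-r)} u^{r-1}` and `S(u) = G + h ∑ s^{(r)} u^{-r}`
(the double Yangian has no `h`-torsion). -/
def Alg : Subalgebra Kh (DY N c) :=
  Algebra.adjoin Kh
    ({x | ∃ i j r, PowerSeries.coeff r (Splus N c G - PowerSeries.C (scalarMat N c G)) i j =
        -(hbar • x)} ∪
      {x | ∃ i j r, PowerSeries.coeff (r + 1) (Sminus N c G) i j = hbar • x})

/-- The completed algebra `Ã_c(g_N)`, realized in the completed double Yangian as the closure of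
`A_c(g_N)`. -/
def AlgTilde : Subring (DYtilde N c) :=
  ((Alg N c G).toSubring.map
    (UniformSpace.Completion.coeRingHom : DY N c →+* DYtilde N c)).topologicalClosure

end Twisted

/-! ### The products `S⁺_{[n]}` and `S_{[n]}` -/

section Products

variable (N : ℕ) (c : ℂ) (G : Matrix (Fin N) (Fin N) ℂ) {n : ℕ}

/-- Matrices over the double Yangian with `n` tensor copies of `End ℂ^N`. -/
abbrev TMat (n : ℕ) : Type := Matrix (Fin n → Fin N) (Fin n → Fin N) (DY N c)

variable {N c} in
/-- `X_i`: the matrix `X` in the `i`-th tensor copy. -/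
def site (i : Fin n) (X : Matrix (Fin N) (Fin N) (DY N c)) : TMat N c n :=
  Matrix.of fun I J => if ∀ k, k ≠ i → I k = J k then X (I i) (J i) else 0

/-- `P_ijᵗ`: the partially transposed permutation operator of the tensor copies `i` and `j`. -/
def flipT (i j : Fin n) : TMat N c n :=
  Matrix.of fun I J =>
    if I i = I j ∧ J i = J j ∧ ∀ k, k ≠ i → k ≠ j → I k = J k then 1 else 0

/-- `R̄_ijᵗ(-2 u + β)` expanded in `u⁻¹`. -/
def RbarT (i j : Fin n) (β : Kh) : PowerSeries (TMat N c n) :=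
  PowerSeries.map (algebraMap Kh (TMat N c n)) (atInf (-2) β (gh N)) +
    PowerSeries.map (algebraMap Kh (TMat N c n)) (atInf (-2) β (ghP N)) *
      PowerSeries.C (flipT N c i j)

/-- `R̄ᵗ_{i,i+1}(-u_i-u_{i+1}-hγ) ⋯ R̄ᵗ_{i,n}(-u_i-u_n-hγ)` with `u_k = u + h a_k`. -/
def RbarTprod (γ : ℂ) (a : Fin n → ℂ) (i : Fin n) : PowerSeries (TMat N c n) :=
  (((List.finRange n).filter fun j => i < j).map fun j =>
    RbarT N c i j (hmul (-a i - a j - γ))).prod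

/-- `S_{[n]}(u_1,…,u_n) = ∏_i S_i(u_i) R̄ᵗ_{i,i+1}(-u_i-u_{i+1}-hc) ⋯ R̄ᵗ_{i,n}(-u_i-u_n-hc)` with
`u_k = u + h a_k`, a power series in `u⁻¹`. -/
def Sbracket (a : Fin n → ℂ) : PowerSeries (TMat N c n) :=
  (List.ofFn fun i : Fin n =>
    (PowerSeries.mk fun m => site i (PowerSeries.coeff m (atInf 1 (hmul (a i)) (Sminus N c G)))) *
      RbarTprod N c c a i).prod

/-- The variable `u` in the ring of Laurent series in `u⁻¹`. -/
def uvar (n : ℕ) : LaurentSeries (TMat N c n) := HahnSeries.single (-1) 1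

/-- The term of
`S⁺_{[n]}(u_1,…,u_n) = ∏_i S⁺_i(u_i) R̄ᵗ_{i,i+1}(-u_i-u_{i+1}) ⋯ R̄ᵗ_{i,n}(-u_i-u_n)`, with
`u_k = u + h a_k`, which arises by taking from each of the power series `S⁺_i(u_i)` its term of
degree `r_i` in `u_i`. It is a Laurent series in `u⁻¹`. -/
def SplusBracketTerm (a : Fin n → ℂ) (r : Fin n → ℕ) : LaurentSeries (TMat N c n) :=
  (List.ofFn fun i : Fin n =>
    HahnSeries.C (site i (PowerSeries.coeff (r i) (Splus N c G))) *
      (uvar N c n + HahnSeries.C (algebraMap Kh (TMat N c n) (hmul (a i)))) ^ r i *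
      HahnSeries.ofPowerSeries ℤ (TMat N c n) (RbarTprod N c 0 a i)).prod

variable {N c G}

theorem site_one (i : Fin n) : site i (1 : Matrix (Fin N) (Fin N) (DY N c)) = 1 := by
  ext I J
  simp only [site, Matrix.of_apply, Matrix.one_apply]
  by_cases h : I = J
  · subst h; simp
  · rw [if_neg h]
    split_ifs with h1 h2
    · exact absurd (funext fun k => if hk : k = i then hk ▸ h2 else h1 k hk) h
    · rfl
    · rfl

theorem site_mul (i : Fin n) (X Y : Matrix (Fin N) (Fin N) (DY N c)) :
    site i (X * Y) = site i X * site i Y := by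
  ext I J
  simp only [site, Matrix.of_apply, Matrix.mul_apply]
  by_cases h : ∀ k, k ≠ i → I k = J k
  · rw [if_pos h]
    refine Finset.sum_of_injOn (fun a => Function.update I i a) ?_ ?_ ?_ ?_
    · intro a _ b _ hab
      simpa using congrFun hab i
    · intro a _; simp
    · intro K _ hK
      have : ¬ ∀ k, k ≠ i → I k = K k := by
        intro hIK
        apply hK
        refine ⟨K i, by simp, ?_⟩
        funext k
        by_cases hk : k = i
        · subst hk; simp
        · simp [hk, hIK k hk]
      rw [if_neg this, zero_mul]
    · intro a _
      rw [if_pos (fun k hk => by simp [hk]), if_pos (fun k hk => by simp [hk, h k hk])]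
      simp
  · rw [if_neg h]
    refine (Finset.sum_eq_zero fun K _ => ?_).symm
    by_cases h1 : ∀ k, k ≠ i → I k = K k
    · have h2 : ¬ ∀ k, k ≠ i → K k = J k := fun h2 => h fun k hk => (h1 k hk).trans (h2 k hk)
      rw [if_neg h2, mul_zero]
    · rw [if_neg h1, zero_mul]

theorem constantCoeff_atInf {B M : Type*} [CommRing B] [Algebra ℂ B] [Ring M] [Algebra B M]
    (α : ℂ) (β : B) (f : PowerSeries M) :
    PowerSeries.coeff 0 (atInf α β f) = PowerSeries.coeff 0 f := by
  simp [atInf]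

theorem constantCoeff_RbarT (i j : Fin n) (β : Kh) :
    PowerSeries.coeff 0 (RbarT N c i j β) = 1 := by
  have h1 : PowerSeries.coeff 0 (ghP N) = 0 := by
    rw [ghP, neg_mul, map_neg, mul_assoc, PowerSeries.coeff_C_mul]; simp
  have h2 : PowerSeries.coeff 0 (gh N) = 1 := by
    rw [gh, PowerSeries.coeff_mk]; simp [gCoeff]
  simp only [RbarT, map_add, PowerSeries.coeff_mul_C, PowerSeries.coeff_map, constantCoeff_atInf,
    h1, h2, map_zero, map_one, zero_mul, add_zero]

/-- `S_{[n]}` is invertible as a power series in `u⁻¹`. -/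
theorem isUnit_Sbracket (hG : IsUnit G.det) (a : Fin n → ℂ) : IsUnit (Sbracket N c G a) := by
  rw [PowerSeries.isUnit_iff_constantCoeff, Sbracket, map_list_prod]
  refine List.prod_isUnit fun m hm => ?_
  simp only [List.map_ofFn, List.mem_ofFn, Function.comp_apply] at hm
  obtain ⟨i, rfl⟩ := hm
  rw [map_mul]
  have e1 : PowerSeries.constantCoeff (RbarTprod N c c a i) = 1 := by
    rw [RbarTprod, map_list_prod]
    refine List.prod_eq_one fun x hx => ?_
    simp only [List.map_map, List.mem_map, Function.comp_apply] at hx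
    obtain ⟨j, -, rfl⟩ := hx
    rw [← PowerSeries.coeff_zero_eq_constantCoeff_apply, constantCoeff_RbarT]
  have e2 : PowerSeries.coeff 0 (Sminus N c G) = scalarMat N c G := by
    rw [Sminus, PowerSeries.coeff_zero_eq_constantCoeff_apply, map_mul, map_mul]
    simp only [← PowerSeries.coeff_zero_eq_constantCoeff_apply, constantCoeff_atInf,
      PowerSeries.coeff_mk]
    simp [Tcoeff]
  rw [e1, mul_one, ← PowerSeries.coeff_zero_eq_constantCoeff_apply, PowerSeries.coeff_mk,
    constantCoeff_atInf, e2]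
  have e3 : ∀ X Y : Matrix (Fin N) (Fin N) ℂ, X * Y = 1 →
      site i (scalarMat N c X) * site (n := n) i (scalarMat N c Y) = 1 := by
    intro X Y hXY
    have : scalarMat N c X * scalarMat N c Y = scalarMat N c (X * Y) := by
      ext k l
      simp [scalarMat, Matrix.mul_apply]
    rw [← site_mul, this, hXY, ← site_one i]
    congr 1
    ext k l
    simp only [scalarMat, Matrix.map_apply, Matrix.one_apply]
    split_ifs <;> simp
  exact ⟨⟨_, _, e3 G G⁻¹ (Matrix.mul_nonsing_inv _ hG), e3 G⁻¹ G (Matrix.nonsing_inv_mul _ hG)⟩, rfl⟩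

end Products

/-! ### Standard tableaux and the primitive idempotents of the symmetric group -/

/-- A standard tableau of shape `ν`: the entries `0, …, n-1` fill the boxes bijectively and
increase along the rows and down the columns; `box p` is the box occupied by the entry `p`. -/
structure StandardTableau (ν : YoungDiagram) where
  /-- The box occupied by an entry. -/
  box : Fin ν.card ≃ ν.cells
  /-- Entries increase along rows and columns. -/
  mono : ∀ p q, (box p : ℕ × ℕ) ≤ (box q : ℕ × ℕ) → p ≤ q

/-- The content `j - i` of the entry `p`, which occupies the box `(i, j)`. -/
def StandardTableau.content {ν : YoungDiagram} (U : StandardTableau ν) (p : Fin ν.card) : ℤ :=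
  ((U.box p : ℕ × ℕ).2 : ℤ) - ((U.box p : ℕ × ℕ).1 : ℤ)

/-- The Jucys–Murphy element `(0 k) + (1 k) + ⋯ + (k-1 k)`. -/
def jucysMurphy (n : ℕ) (k : Fin n) : MonoidAlgebra ℂ (Equiv.Perm (Fin n)) :=
  ∑ i ∈ Finset.univ.filter fun i : Fin n => i < k, MonoidAlgebra.of ℂ _ (Equiv.swap i k)

/-- The primitive idempotent `e_U`, which is the projection onto the line of the vector `v_U` of
the orthonormal Young basis. The Jucys–Murphy element `x_k` acts on a Young basis vector `v_T`
as the scalar `c_k(T)`, one of `-k, …, k` for the `0`-based `k`, and a tableau is determined by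
its contents; so `e_U = ∏_k ∏_{a ≠ c_k(U)} (x_k - a) / (c_k(U) - a)`, with `a` from `-k` to `k`
(all factors commute). -/
def StandardTableau.idempotent {ν : YoungDiagram} (U : StandardTableau ν) :
    MonoidAlgebra ℂ (Equiv.Perm (Fin ν.card)) :=
  (List.ofFn fun k : Fin ν.card =>
    ((((List.range (2 * (k : ℕ) + 1)).map fun m => (m : ℤ) - ((k : ℕ) : ℤ)).filter
        fun a => a ≠ U.content k).map fun a =>
      ((U.content k : ℂ) - (a : ℂ))⁻¹ •
        (jucysMurphy ν.card k - algebraMap ℂ _ (a : ℂ))).prod).prod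

/-- The action of an element of the group algebra of the symmetric group on `(ℂ^N)^{⊗ n}` by
permutations of the tensor factors: `σ` moves the `k`-th factor to the place `σ k`. -/
def permAction (N : ℕ) {n : ℕ} (e : MonoidAlgebra ℂ (Equiv.Perm (Fin n))) :
    Matrix (Fin n → Fin N) (Fin n → Fin N) ℂ :=
  ∑ σ : Equiv.Perm (Fin n), e.coeff σ •
    Matrix.of fun I J => if I = J ∘ (σ⁻¹ : Equiv.Perm (Fin n)) then 1 else 0

/-! ### The series `𝔸_ν(u)` at the critical level `c = -N/2` -/

/-- The critical level. -/
abbrev crit (N : ℕ) : ℂ := -(N : ℂ) / 2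

/-- The contribution of the multidegree `r` (see `SplusBracketTerm`) to the coefficient of `u^k` in
`𝔸_ν(u) = tr E_U S⁺_{[n]}(u_ν) S_{[n]}(u_ν - hN/4)⁻¹`, where `u_ν = (u + h c_1, …, u + h c_n)`.
This coefficient is the sum of the contributions over all `r`. -/
def AnuTerm {N : ℕ} (G : Matrix (Fin N) (Fin N) ℂ) {ν : YoungDiagram} (U : StandardTableau ν)
    (k : ℤ) (r : Fin ν.card → ℕ) : DY N (crit N) :=
  Matrix.trace (scalarMat N (crit N) (permAction N U.idempotent) *
    (SplusBracketTerm N (crit N) G (fun p => (U.content p : ℂ)) r *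
      HahnSeries.ofPowerSeries ℤ (TMat N (crit N) ν.card)
        (Ring.inverse (Sbracket N (crit N) G fun p => (U.content p : ℂ) - (N : ℂ) / 4))).coeff (-k))

end

end TwistedYangian

open scoped LaurentPolynomial

namespace TwistedYangian

set_option linter.unusedSectionVars false

noncomputable section

/-! ### Tensor copies over an arbitrary coefficient ring -/

section Sites

variable {ι : Type*} [DecidableEq ι] [Fintype ι] {N : ℕ} {D : Type*} [Ring D]

/-- The matrix `X` in the tensor copy `i`. -/
def siteM (i : ι) (X : Matrix (Fin N) (Fin N) D) : Matrix (ι → Fin N) (ι → Fin N) D :=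
  Matrix.of fun I J => if ∀ k, k ≠ i → I k = J k then X (I i) (J i) else 0

/-- The matrix `M` in the tensor copies `i` and `j`. -/
def pairM (i j : ι) (M : Matrix (Fin N × Fin N) (Fin N × Fin N) D) :
    Matrix (ι → Fin N) (ι → Fin N) D :=
  Matrix.of fun I J => if ∀ k, k ≠ i → k ≠ j → I k = J k then M (I i, I j) (J i, J j) else 0

/-- The action of a permutation of the tensor copies. -/
def permM (N : ℕ) (D : Type*) [Ring D] (σ : Equiv.Perm ι) : Matrix (ι → Fin N) (ι → Fin N) D :=
  Matrix.of fun I J => if I = J ∘ (σ⁻¹ : Equiv.Perm ι) then 1 else 0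

/-- The permutation operator of the tensor copies `i` and `j`. -/
def Pm (N : ℕ) (D : Type*) [Ring D] (i j : ι) : Matrix (ι → Fin N) (ι → Fin N) D :=
  permM N D (Equiv.swap i j)

/-- The partially transposed permutation operator of the tensor copies `i` and `j`. -/
def Qm (N : ℕ) (D : Type*) [Ring D] (i j : ι) : Matrix (ι → Fin N) (ι → Fin N) D :=
  Matrix.of fun I J =>
    if I i = I j ∧ J i = J j ∧ ∀ k, k ≠ i → k ≠ j → I k = J k then 1 else 0

/-- The partially transposed permutation operator on two tensor copies. -/
def flipQ (N : ℕ) (D : Type*) [Ring D] : Matrix (Fin N × Fin N) (Fin N × Fin N) D :=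
  Matrix.of fun a b => if a.1 = a.2 ∧ b.1 = b.2 then 1 else 0

theorem permM_mul_apply (σ : Equiv.Perm ι) (M : Matrix (ι → Fin N) (ι → Fin N) D)
    (I J : ι → Fin N) : (permM N D σ * M) I J = M (I ∘ σ) J := by
  rw [Matrix.mul_apply, Finset.sum_eq_single (I ∘ σ)]
  · have : I = (I ∘ σ) ∘ (σ⁻¹ : Equiv.Perm ι) := by ext k; simp
    simp only [permM, Matrix.of_apply]
    rw [if_pos this, one_mul]
  · intro K _ hK
    have : ¬ I = K ∘ (σ⁻¹ : Equiv.Perm ι) := by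
      rintro rfl; apply hK; ext k; simp
    simp only [permM, Matrix.of_apply]
    rw [if_neg this, zero_mul]
  · simp

theorem mul_permM_apply (σ : Equiv.Perm ι) (M : Matrix (ι → Fin N) (ι → Fin N) D)
    (I J : ι → Fin N) : (M * permM N D σ) I J = M I (J ∘ (σ⁻¹ : Equiv.Perm ι)) := by
  rw [Matrix.mul_apply, Finset.sum_eq_single (J ∘ (σ⁻¹ : Equiv.Perm ι))]
  · simp only [permM, Matrix.of_apply]
    simp
  · intro K _ hK
    simp only [permM, Matrix.of_apply]
    rw [if_neg hK, mul_zero]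
  · simp

theorem permM_one : permM N D (1 : Equiv.Perm ι) = 1 := by
  ext I J
  simp [permM, Matrix.one_apply]

theorem permM_mul (σ τ : Equiv.Perm ι) : permM N D (σ * τ) = permM N D σ * permM N D τ := by
  ext I J
  rw [permM_mul_apply]
  simp only [permM, Matrix.of_apply]
  congr 1
  apply propext
  constructor
  · rintro rfl; ext k; simp
  · intro h; ext k
    have := congrFun h (σ⁻¹ k)
    simp at this
    simp [this]

theorem permM_mul_siteM (σ : Equiv.Perm ι) (i : ι) (X : Matrix (Fin N) (Fin N) D) :
    permM N D σ * siteM i X = siteM (σ i) X * permM N D σ := by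
  ext I J
  rw [permM_mul_apply, mul_permM_apply]
  simp only [siteM, Matrix.of_apply, Function.comp_apply, Equiv.Perm.inv_def, Equiv.symm_apply_apply]
  congr 1
  apply propext
  constructor
  · intro h k hk
    have := h (σ⁻¹ k) (by rintro rfl; simp at hk)
    simpa using this
  · intro h k hk
    have := h (σ k) (by simpa using hk)
    simpa using this

theorem permM_mul_Qm (σ : Equiv.Perm ι) (i j : ι) :
    permM N D σ * Qm N D i j = Qm N D (σ i) (σ j) * permM N D σ := by
  ext I J
  rw [permM_mul_apply, mul_permM_apply]
  simp only [Qm, Matrix.of_apply, Function.comp_apply, Equiv.Perm.inv_def, Equiv.symm_apply_apply]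
  congr 1
  apply propext
  refine and_congr Iff.rfl (and_congr Iff.rfl ⟨fun h k hk hk' => ?_, fun h k hk hk' => ?_⟩)
  · have := h (σ⁻¹ k) (by rintro rfl; simp at hk) (by rintro rfl; simp at hk')
    simpa using this
  · have := h (σ k) (by simpa using hk) (by simpa using hk')
    simpa using this

theorem Pm_comm (i j : ι) : Pm N D i j = Pm N D j i := by rw [Pm, Equiv.swap_comm, Pm]

theorem Qm_comm (i j : ι) : Qm N D i j = Qm N D j i := by
  ext I J
  simp only [Qm, Matrix.of_apply]
  congr 1
  apply propext
  constructor <;> rintro ⟨h, h', h''⟩ <;> exact ⟨h.symm, h'.symm, fun k a b => h'' k b a⟩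

theorem Pm_mul_self (i j : ι) : Pm N D i j * Pm N D i j = 1 := by
  rw [Pm, ← permM_mul, Equiv.swap_mul_self, permM_one]

theorem permM_mul_Pm (σ : Equiv.Perm ι) (i j : ι) :
    permM N D σ * Pm N D i j = Pm N D (σ i) (σ j) * permM N D σ := by
  rw [Pm, Pm, ← permM_mul, ← permM_mul]
  congr 1
  rw [Equiv.swap_apply_apply, inv_mul_cancel_right]

theorem pairM_mul {i j : ι} (hij : i ≠ j) (M M' : Matrix (Fin N × Fin N) (Fin N × Fin N) D) :
    pairM i j (M * M') = pairM i j M * pairM i j M' := by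
  ext I J
  simp only [pairM, Matrix.of_apply, Matrix.mul_apply]
  by_cases h : ∀ k, k ≠ i → k ≠ j → I k = J k
  · rw [if_pos h]
    refine Finset.sum_of_injOn
      (fun a => Function.update (Function.update I i a.1) j a.2) ?_ ?_ ?_ ?_
    · rintro ⟨a, a'⟩ _ ⟨b, b'⟩ _ hab
      have h1 := congrFun hab i
      have h2 := congrFun hab j
      simp [hij] at h1 h2
      simp [h1, h2]
    · intro a _; simp
    · intro K _ hK
      have : ¬ ∀ k, k ≠ i → k ≠ j → I k = K k := by
        intro hIK
        apply hK
        refine ⟨(K i, K j), by simp, ?_⟩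
        funext k
        by_cases hk' : k = j
        · subst hk'; simp
        · by_cases hk : k = i
          · subst hk; simp [hk']
          · simp [hk, hk', hIK k hk hk']
      rw [if_neg this, zero_mul]
    · rintro ⟨a, a'⟩ _
      rw [if_pos (fun k hk hk' => by simp [hk, hk']),
        if_pos (fun k hk hk' => by simp [hk, hk', h k hk hk'])]
      simp [hij]
  · rw [if_neg h]
    refine (Finset.sum_eq_zero fun K _ => ?_).symm
    by_cases h1 : ∀ k, k ≠ i → k ≠ j → I k = K k
    · have h2 : ¬ ∀ k, k ≠ i → k ≠ j → K k = J k :=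
        fun h2 => h fun k hk hk' => (h1 k hk hk').trans (h2 k hk hk')
      rw [if_neg h2, mul_zero]
    · rw [if_neg h1, zero_mul]

theorem pairM_add (i j : ι) (M M' : Matrix (Fin N × Fin N) (Fin N × Fin N) D) :
    pairM i j (M + M') = pairM i j M + pairM i j M' := by
  ext I J
  simp only [pairM, Matrix.of_apply, Matrix.add_apply]
  split_ifs <;> simp

theorem pairM_smul {S : Type*} [SMulZeroClass S D] (i j : ι) (z : S)
    (M : Matrix (Fin N × Fin N) (Fin N × Fin N) D) :
    pairM i j (z • M) = z • pairM i j M := by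
  ext I J
  simp only [pairM, Matrix.of_apply, Matrix.smul_apply]
  split_ifs <;> simp

theorem pairM_one (i j : ι) :
    pairM i j (1 : Matrix (Fin N × Fin N) (Fin N × Fin N) D) = 1 := by
  ext I J
  simp only [pairM, Matrix.of_apply, Matrix.one_apply, Prod.mk.injEq]
  by_cases h : I = J
  · subst h; simp
  · rw [if_neg h]
    split_ifs with h1 h2
    · refine absurd (funext fun k => ?_) h
      by_cases hk : k = i
      · exact hk ▸ h2.1
      · by_cases hk' : k = j
        · exact hk' ▸ h2.2
        · exact h1 k hk hk'
    · rfl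
    · rfl

theorem pairM_left {i j : ι} (hij : i ≠ j) (X : Matrix (Fin N) (Fin N) D) :
    pairM i j (X ⊗ₖ (1 : Matrix (Fin N) (Fin N) D)) = siteM i X := by
  ext I J
  simp only [pairM, siteM, Matrix.of_apply, Matrix.kroneckerMap_apply, Matrix.one_apply]
  by_cases h : I j = J j
  · rw [if_pos h, mul_one]
    congr 1
    apply propext
    refine ⟨fun H k hk => ?_, fun H k hk _ => H k hk⟩
    by_cases hk' : k = j
    · exact hk' ▸ h
    · exact H k hk hk'
  · rw [if_neg h, mul_zero, ite_self, if_neg]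
    exact fun H => h (H j hij.symm)

theorem pairM_right {i j : ι} (hij : i ≠ j) (X : Matrix (Fin N) (Fin N) D) :
    pairM i j ((1 : Matrix (Fin N) (Fin N) D) ⊗ₖ X) = siteM j X := by
  ext I J
  simp only [pairM, siteM, Matrix.of_apply, Matrix.kroneckerMap_apply, Matrix.one_apply]
  by_cases h : I i = J i
  · rw [if_pos h, one_mul]
    congr 1
    apply propext
    refine ⟨fun H k hk => ?_, fun H k _ hk => H k hk⟩
    by_cases hk' : k = i
    · exact hk' ▸ h
    · exact H k hk' hk
  · rw [if_neg h, zero_mul, ite_self, if_neg]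
    exact fun H => h (H i hij)

theorem pairM_flip {i j : ι} : pairM i j (flip N D) = Pm N D i j := by
  ext I J
  simp only [pairM, flip, Pm, permM, Matrix.of_apply]
  rw [← ite_and]
  congr 1
  apply propext
  rw [Equiv.swap_inv]
  constructor
  · rintro ⟨h, h1, h2⟩
    ext k
    simp only [Function.comp_apply]
    by_cases hk : k = i
    · subst hk; simp [h1]
    · by_cases hk' : k = j
      · subst hk'; simp [h2]
      · rw [Equiv.swap_apply_of_ne_of_ne hk hk', h k hk hk']
  · rintro rfl
    refine ⟨fun k hk hk' => ?_, ?_, ?_⟩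
    · simp [Equiv.swap_apply_of_ne_of_ne hk hk']
    · simp
    · simp

theorem pairM_flipQ {i j : ι} : pairM i j (flipQ N D) = Qm N D i j := by
  ext I J
  simp only [pairM, flipQ, Qm, Matrix.of_apply]
  rw [← ite_and]
  congr 1
  apply propext
  tauto

theorem siteM_mul (i : ι) (X Y : Matrix (Fin N) (Fin N) D) :
    siteM i (X * Y) = siteM i X * siteM i Y := by
  ext I J
  simp only [siteM, Matrix.of_apply, Matrix.mul_apply]
  by_cases h : ∀ k, k ≠ i → I k = J k
  · rw [if_pos h]
    refine Finset.sum_of_injOn (fun a => Function.update I i a) ?_ ?_ ?_ ?_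
    · intro a _ b _ hab
      simpa using congrFun hab i
    · intro a _; simp
    · intro K _ hK
      have : ¬ ∀ k, k ≠ i → I k = K k := by
        intro hIK
        apply hK
        refine ⟨K i, by simp, ?_⟩
        funext k
        by_cases hk : k = i
        · subst hk; simp
        · simp [hk, hIK k hk]
      rw [if_neg this, zero_mul]
    · intro a _
      rw [if_pos (fun k hk => by simp [hk]), if_pos (fun k hk => by simp [hk, h k hk])]
      simp
  · rw [if_neg h]
    refine (Finset.sum_eq_zero fun K _ => ?_).symm
    by_cases h1 : ∀ k, k ≠ i → I k = K k
    · have h2 : ¬ ∀ k, k ≠ i → K k = J k := fun h2 => h fun k hk => (h1 k hk).trans (h2 k hk)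
      rw [if_neg h2, mul_zero]
    · rw [if_neg h1, zero_mul]

theorem siteM_one (i : ι) : siteM i (1 : Matrix (Fin N) (Fin N) D) = 1 := by
  ext I J
  simp only [siteM, Matrix.of_apply, Matrix.one_apply]
  by_cases h : I = J
  · subst h; simp
  · rw [if_neg h]
    split_ifs with h1 h2
    · exact absurd (funext fun k => if hk : k = i then hk ▸ h2 else h1 k hk) h
    · rfl
    · rfl

theorem Qm_mul_apply {i j : ι} (hij : i ≠ j) (M : Matrix (ι → Fin N) (ι → Fin N) D)
    (I J : ι → Fin N) : (Qm N D i j * M) I J =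
      if I i = I j then ∑ a, M (Function.update (Function.update I i a) j a) J else 0 := by
  rw [Matrix.mul_apply]
  split_ifs with h
  · symm
    refine Finset.sum_of_injOn
      (fun a => Function.update (Function.update I i a) j a) ?_ ?_ ?_ ?_
    · intro a _ b _ hab
      simpa using congrFun hab j
    · intro a _; simp
    · intro K _ hK
      simp only [Qm, Matrix.of_apply]
      rw [if_neg, zero_mul]
      rintro ⟨-, h1, h2⟩
      apply hK
      refine ⟨K j, by simp, ?_⟩
      funext k
      by_cases hk' : k = j
      · subst hk'; simp
      · by_cases hk : k = i
        · subst hk; simp [hk', h1]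
        · simp [hk, hk', h2 k hk hk']
    · intro a _
      simp only [Qm, Matrix.of_apply]
      rw [if_pos, one_mul]
      exact ⟨h, by simp [hij], fun k hk hk' => by simp [hk, hk']⟩
  · refine Finset.sum_eq_zero fun K _ => ?_
    simp only [Qm, Matrix.of_apply]
    rw [if_neg (fun H => h H.1), zero_mul]

theorem mul_Qm_apply {i j : ι} (hij : i ≠ j) (M : Matrix (ι → Fin N) (ι → Fin N) D)
    (I J : ι → Fin N) : (M * Qm N D i j) I J =
      if J i = J j then ∑ a, M I (Function.update (Function.update J i a) j a) else 0 := by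
  rw [Matrix.mul_apply]
  split_ifs with h
  · symm
    refine Finset.sum_of_injOn
      (fun a => Function.update (Function.update J i a) j a) ?_ ?_ ?_ ?_
    · intro a _ b _ hab
      simpa using congrFun hab j
    · intro a _; simp
    · intro K _ hK
      simp only [Qm, Matrix.of_apply]
      rw [if_neg, mul_zero]
      rintro ⟨h1, -, h2⟩
      apply hK
      refine ⟨K j, by simp, ?_⟩
      funext k
      by_cases hk' : k = j
      · subst hk'; simp
      · by_cases hk : k = i
        · subst hk; simp [hk', h1]
        · simp [hk, hk', h2 k hk hk']
    · intro a _
      simp only [Qm, Matrix.of_apply]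
      rw [if_pos, mul_one]
      exact ⟨by simp [hij], h, fun k hk hk' => by simp [hk, hk']⟩
  · refine Finset.sum_eq_zero fun K _ => ?_
    simp only [Qm, Matrix.of_apply]
    rw [if_neg (fun H => h H.2.1), mul_zero]

theorem Qm_mul_Qm {i j k : ι} (hij : i ≠ j) (hik : i ≠ k) (hjk : j ≠ k) :
    Qm N D i j * Qm N D j k = Pm N D i k * Qm N D j k := by
  ext I J
  rw [Qm_mul_apply hij, Pm, permM_mul_apply]
  simp only [Qm, Matrix.of_apply, Function.comp_apply, Equiv.swap_apply_right,
    Equiv.swap_apply_of_ne_of_ne hij.symm hjk]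
  by_cases h : I i = I j
  · rw [if_pos h, Finset.sum_eq_single (I k)]
    · congr 1
      apply propext
      simp only [Function.update_self, Function.update_of_ne hjk.symm, Function.update_of_ne hik.symm,
        h, true_and]
      refine and_congr Iff.rfl (forall_congr' fun l => ?_)
      refine imp_congr_right fun hl => imp_congr_right fun hl' => ?_
      by_cases hli : l = i
      · subst hli; simp [hl]
      · rw [Equiv.swap_apply_of_ne_of_ne hli hl']; simp [hl, hli]
    · intro a _ ha
      rw [if_neg]
      simp only [Function.update_self, Function.update_of_ne hjk.symm, Function.update_of_ne hik.symm]
      exact fun H => ha H.1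
    · simp
  · rw [if_neg h, if_neg]
    exact fun H => h H.1.symm

theorem Qm_mul_siteM_comm {i j k : ι} (hij : i ≠ j) (hki : k ≠ i) (hkj : k ≠ j)
    (X : Matrix (Fin N) (Fin N) D) : Commute (Qm N D i j) (siteM k X) := by
  rw [Commute, SemiconjBy]
  ext I J
  rw [Qm_mul_apply hij, mul_Qm_apply hij]
  simp only [siteM, Matrix.of_apply]
  have e1 : ∀ (a : Fin N) (H : ι → Fin N),
      Function.update (Function.update H i a) j a k = H k := by
    intro a H; simp [hki, hkj]
  simp only [e1]
  have key : ∀ (H L : ι → Fin N) (a : Fin N),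
      (∀ l, l ≠ k → Function.update (Function.update H i a) j a l = L l) ↔
        (a = L j ∧ L i = L j ∧ ∀ l, l ≠ k → l ≠ i → l ≠ j → H l = L l) := by
    intro H L a
    constructor
    · intro h
      have hj := h j hkj.symm
      have hi := h i hki.symm
      simp [hij] at hj hi
      refine ⟨hj, hi.symm.trans hj, fun l hl hl1 hl2 => ?_⟩
      have := h l hl
      simpa [hl1, hl2] using this
    · rintro ⟨h1, h2, h3⟩ l hl
      by_cases hlj : l = j
      · subst hlj; simpa using h1
      · by_cases hli : l = i
        · subst hli; simp [hlj, h1, h2]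
        · simpa [hlj, hli] using h3 l hl hli hlj
  have key' : ∀ (a : Fin N), (∀ l, l ≠ k → I l = Function.update (Function.update J i a) j a l) ↔
        (a = I j ∧ I i = I j ∧ ∀ l, l ≠ k → l ≠ i → l ≠ j → J l = I l) := by
    intro a; rw [← key]; exact forall_congr' fun l => imp_congr_right fun _ => eq_comm
  simp only [key, key']
  by_cases hI : I i = I j <;> by_cases hJ : J i = J j
  · simp only [hI, hJ, true_and, if_true, ite_and]
    simp only [Finset.sum_ite_eq', Finset.mem_univ, if_true]
    congr 1
    apply propext
    exact forall_congr' fun l => imp_congr_right fun _ => imp_congr_right fun _ =>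
      imp_congr_right fun _ => eq_comm
  · simp [hI, hJ]
  · simp [hI, hJ]
  · simp [hI, hJ]

theorem Qm_mul_Qm_comm {i j k l : ι} (hij : i ≠ j) (hkl : k ≠ l) (hik : i ≠ k) (hil : i ≠ l)
    (hjk : j ≠ k) (hjl : j ≠ l) : Commute (Qm N D i j) (Qm N D k l) := by
  have e : Qm N D k l = ∑ a : Fin N, ∑ b : Fin N,
      siteM k (Matrix.single a b 1) * siteM l (Matrix.single a b (1 : D)) := by
    rw [← pairM_flipQ]
    have : flipQ N D = ∑ a : Fin N, ∑ b : Fin N,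
        (Matrix.single a b (1 : D) ⊗ₖ (1 : Matrix (Fin N) (Fin N) D)) *
          ((1 : Matrix (Fin N) (Fin N) D) ⊗ₖ Matrix.single a b (1 : D)) := by
      ext ⟨a1, a2⟩ ⟨b1, b2⟩
      rw [Matrix.sum_apply, Finset.sum_eq_single a1, Matrix.sum_apply, Finset.sum_eq_single b1]
      · rw [kron12]
        simp only [flipQ, Matrix.of_apply, Matrix.single_apply]
        by_cases h1 : a1 = a2 <;> by_cases h2 : b1 = b2 <;> simp [h1, h2]
      · intro b _ hb; rw [kron12]; simp [Matrix.single_apply, hb]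
      · simp
      · intro a _ ha
        rw [Matrix.sum_apply]
        refine Finset.sum_eq_zero fun b _ => ?_
        rw [kron12]; simp [Matrix.single_apply, ha]
      · simp
    have hs : ∀ (s : Finset (Fin N)) (f : Fin N → Matrix (Fin N × Fin N) (Fin N × Fin N) D),
        pairM k l (∑ x ∈ s, f x) = ∑ x ∈ s, pairM k l (f x) := by
      intro s f
      exact map_sum (AddMonoidHom.mk' (pairM k l) (pairM_add k l)) f s
    rw [this, hs]
    refine Finset.sum_congr rfl fun a _ => ?_
    rw [hs]
    refine Finset.sum_congr rfl fun b _ => ?_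
    rw [pairM_mul hkl, pairM_left hkl, pairM_right hkl]
  rw [e]
  refine Commute.sum_right _ _ _ fun a _ => Commute.sum_right _ _ _ fun b _ => ?_
  exact (Qm_mul_siteM_comm hij hik.symm hjk.symm _).mul_right
    (Qm_mul_siteM_comm hij hil.symm hjl.symm _)

theorem Pm_siteM_comm {i j k : ι} (hki : k ≠ i) (hkj : k ≠ j)
    (X : Matrix (Fin N) (Fin N) D) : Commute (Pm N D i j) (siteM k X) := by
  rw [Commute, SemiconjBy, Pm, permM_mul_siteM, Equiv.swap_apply_of_ne_of_ne hki hkj]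

theorem Pm_Qm_comm {i j k l : ι} (hki : k ≠ i) (hkj : k ≠ j) (hli : l ≠ i) (hlj : l ≠ j) :
    Commute (Pm N D i j) (Qm N D k l) := by
  rw [Commute, SemiconjBy, Pm, permM_mul_Qm, Equiv.swap_apply_of_ne_of_ne hki hkj,
    Equiv.swap_apply_of_ne_of_ne hli hlj]

theorem Qm_mul_self {i j : ι} (hij : i ≠ j) : Qm N D i j * Qm N D i j = (N : D) • Qm N D i j := by
  ext I J
  rw [Qm_mul_apply hij, Matrix.smul_apply]
  simp only [Qm, Matrix.of_apply, smul_eq_mul]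
  by_cases h : I i = I j
  · rw [if_pos h]
    have : ∀ a : Fin N, (Function.update (Function.update I i a) j a i =
        Function.update (Function.update I i a) j a j ∧ J i = J j ∧ ∀ k, k ≠ i → k ≠ j →
        Function.update (Function.update I i a) j a k = J k) ↔
        (I i = I j ∧ J i = J j ∧ ∀ k, k ≠ i → k ≠ j → I k = J k) := by
      intro a
      simp only [h, Function.update_self, Function.update_of_ne hij, true_and]
      refine and_congr Iff.rfl (forall_congr' fun k => imp_congr_right fun hk =>
        imp_congr_right fun hk' => ?_)
      simp [hk, hk']
    simp only [this, Finset.sum_const, Finset.card_univ, Fintype.card_fin, nsmul_eq_mul]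
  · rw [if_neg h, if_neg (fun H => h H.1), mul_zero]

end Sites

/-! ### Substitution into power series with noncommutative coefficients -/

section Substitution

open PowerSeries Finset

variable {K B B' : Type*} [CommRing K] [Ring B] [Algebra K B] [Ring B'] [Algebra K B']

theorem coeff_pow_eq_zero {q : PowerSeries K} {M : ℕ} (hq : constantCoeff q ^ M = 0) {m k : ℕ}
    (h : m + M ≤ k) : coeff m (q ^ k) = 0 := by
  rw [eq_X_mul_shift_add_const q, add_pow, map_sum]
  refine sum_eq_zero fun j _ => ?_
  by_cases hj : j ≤ m
  · have : (C (constantCoeff q) : PowerSeries K) ^ (k - j) = 0 := by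
      rw [← map_pow, pow_eq_zero_of_le (by omega) hq, map_zero]
    rw [this, mul_zero, zero_mul, map_zero]
  · rw [mul_pow, mul_assoc, mul_assoc, coeff_X_pow_mul', if_neg hj]

/-- `f(q)` for a power series `q` whose constant coefficient has vanishing `M`-th power. -/
def subsFun (M : ℕ) (q : PowerSeries K) (f : PowerSeries B) : PowerSeries B :=
  PowerSeries.mk fun m => ∑ k ∈ range (m + M), coeff m (q ^ k) • coeff k f

theorem coeff_subsFun {M : ℕ} {q : PowerSeries K} (hq : constantCoeff q ^ M = 0)
    (f : PowerSeries B) {m n : ℕ} (h : m + M ≤ n) :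
    coeff m (subsFun M q f) = ∑ k ∈ range n, coeff m (q ^ k) • coeff k f := by
  rw [subsFun, coeff_mk]
  refine sum_subset (range_subset_range.2 h) fun k _ hk => ?_
  rw [coeff_pow_eq_zero hq (by simpa using hk), zero_smul]

theorem sum_range_antidiagonal {X : Type*} [AddCommMonoid X] (n : ℕ) (F : ℕ → ℕ → X)
    (hF : ∀ k l, n ≤ k + l → F k l = 0) :
    ∑ t ∈ range n, ∑ x ∈ antidiagonal t, F x.1 x.2 = ∑ k ∈ range n, ∑ l ∈ range n, F k l := by
  rw [← sum_product', sum_sigma']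
  refine sum_of_injOn (fun x => x.2) ?_ ?_ ?_ ?_
  · rintro ⟨a, a1, a2⟩ ha ⟨b, b1, b2⟩ hb hab
    simp only [coe_sigma, Set.mem_sigma_iff, mem_coe, mem_range, HasAntidiagonal.mem_antidiagonal] at ha hb
    simp only [Prod.mk.injEq] at hab
    obtain ⟨rfl, rfl⟩ := hab
    obtain rfl : a = b := by rw [← ha.2, ← hb.2]
    rfl
  · rintro ⟨a, a1, a2⟩ ha
    simp only [coe_sigma, Set.mem_sigma_iff, mem_coe, mem_range, HasAntidiagonal.mem_antidiagonal] at ha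
    simp only [coe_product, Set.mem_prod, mem_coe, mem_range]
    omega
  · rintro ⟨k, l⟩ _ h
    refine hF k l (not_lt.1 fun hlt => h ⟨⟨k + l, k, l⟩, ?_, rfl⟩)
    simp [hlt]
  · intro x _; rfl

theorem subsFun_mul {M : ℕ} {q : PowerSeries K} (hq : constantCoeff q ^ M = 0)
    (f g : PowerSeries B) : subsFun M q (f * g) = subsFun M q f * subsFun M q g := by
  ext m
  rw [coeff_subsFun hq _ le_rfl, coeff_mul]
  have h1 : ∀ x ∈ antidiagonal m, coeff x.1 (subsFun M q f) * coeff x.2 (subsFun M q g) =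
      ∑ k ∈ range (m + M), ∑ l ∈ range (m + M),
        (coeff x.1 (q ^ k) * coeff x.2 (q ^ l)) • (coeff k f * coeff l g) := by
    intro x hx
    rw [HasAntidiagonal.mem_antidiagonal] at hx
    rw [coeff_subsFun hq f (n := m + M) (by omega), coeff_subsFun hq g (n := m + M) (by omega),
      sum_mul_sum]
    refine sum_congr rfl fun k _ => sum_congr rfl fun l _ => ?_
    rw [smul_mul_smul_comm]
  rw [sum_congr rfl h1, sum_comm]
  have h2 : ∀ k ∈ range (m + M), ∑ x ∈ antidiagonal m, ∑ l ∈ range (m + M),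
        (coeff x.1 (q ^ k) * coeff x.2 (q ^ l)) • (coeff k f * coeff l g) =
      ∑ l ∈ range (m + M), coeff m (q ^ (k + l)) • (coeff k f * coeff l g) := by
    intro k _
    rw [sum_comm]
    refine sum_congr rfl fun l _ => ?_
    rw [← sum_smul, pow_add, coeff_mul]
  rw [sum_congr rfl h2, ← sum_range_antidiagonal (m + M)
    (fun k l => coeff m (q ^ (k + l)) • (coeff k f * coeff l g))]
  · refine sum_congr rfl fun t _ => ?_
    rw [coeff_mul, smul_sum]
    refine sum_congr rfl fun x hx => ?_
    rw [HasAntidiagonal.mem_antidiagonal.1 hx]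
  · intro k l h
    rw [coeff_pow_eq_zero hq h, zero_smul]

variable (B) in
/-- Substitution as a ring homomorphism. -/
def subsHom (M : ℕ) (q : PowerSeries K) (hq : constantCoeff q ^ M = 0) :
    PowerSeries B →+* PowerSeries B where
  toFun := subsFun M q
  map_mul' := subsFun_mul hq
  map_zero' := by ext m; simp [subsFun]
  map_add' f g := by ext m; simp [subsFun, smul_add, sum_add_distrib]
  map_one' := by
    ext m
    rw [coeff_subsFun hq _ (n := m + M + 1) (by omega), sum_range_succ', sum_eq_zero]
    · simp [coeff_one]
    · intro k _; simp [coeff_one]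

theorem coeff_subsHom {M : ℕ} {q : PowerSeries K} (hq : constantCoeff q ^ M = 0)
    (f : PowerSeries B) {m n : ℕ} (h : m + M ≤ n) :
    coeff m (subsHom B M q hq f) = ∑ k ∈ range n, coeff m (q ^ k) • coeff k f :=
  coeff_subsFun hq f h

theorem subsHom_C {M : ℕ} {q : PowerSeries K} (hq : constantCoeff q ^ M = 0) (b : B) :
    subsHom B M q hq (C b) = C b := by
  ext m
  rw [coeff_subsHom hq _ (n := m + M + 1) (by omega), sum_range_succ', sum_eq_zero]
  · simp only [pow_zero, coeff_one, coeff_C, if_true]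
    split_ifs <;> simp
  · intro k _; simp

theorem subsHom_X {M : ℕ} {q : PowerSeries K} (hq : constantCoeff q ^ M = 0) :
    subsHom B M q hq X = PowerSeries.map (algebraMap K B) q := by
  ext m
  rw [coeff_subsHom hq _ (n := m + M + 2) (by omega), sum_eq_single 1]
  · simp [coeff_X, Algebra.algebraMap_eq_smul_one]
  · intro k _ hk; simp [coeff_X, hk]
  · simp

theorem map_subsHom (φ : B →ₐ[K] B') {M : ℕ} {q : PowerSeries K} (hq : constantCoeff q ^ M = 0)
    (f : PowerSeries B) : PowerSeries.map (φ : B →+* B') (subsHom B M q hq f) =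
      subsHom B' M q hq (PowerSeries.map (φ : B →+* B') f) := by
  ext m
  rw [coeff_subsHom hq _ le_rfl, coeff_map, coeff_subsHom hq _ le_rfl, map_sum]
  refine sum_congr rfl fun k _ => ?_
  simp

theorem subsHom_subsHom {q q' : PowerSeries K} (hq : constantCoeff q ^ 1 = 0)
    (hq' : constantCoeff q' ^ 1 = 0) (hq'' : constantCoeff (subsHom K 1 q hq q') ^ 1 = 0)
    (f : PowerSeries B) :
    subsHom B 1 q hq (subsHom B 1 q' hq' f) = subsHom B 1 (subsHom K 1 q hq q') hq'' f := by
  ext m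
  rw [coeff_subsHom hq _ le_rfl, coeff_subsHom hq'' _ le_rfl]
  have h1 : ∀ k ∈ range (m + 1), coeff m (q ^ k) • coeff k (subsHom B 1 q' hq' f) =
      ∑ j ∈ range (m + 1), (coeff m (q ^ k) * coeff k (q' ^ j)) • coeff j f := by
    intro k hk
    rw [coeff_subsHom hq' f (n := m + 1) (by simp at hk; omega), smul_sum]
    exact sum_congr rfl fun j _ => by rw [mul_smul]
  rw [sum_congr rfl h1, sum_comm]
  refine sum_congr rfl fun j _ => ?_
  rw [← sum_smul, ← map_pow, coeff_subsHom hq _ le_rfl]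
  simp

/-- Evaluation of a power series at an element with vanishing `M`-th power. -/
def evalNil (M : ℕ) (p : K) (hp : p ^ M = 0) : PowerSeries K →+* K :=
  constantCoeff.comp (subsHom K M (C p) (by simpa using hp))

theorem evalNil_apply {M : ℕ} {p : K} (hp : p ^ M = 0) (f : PowerSeries K) :
    evalNil M p hp f = ∑ k ∈ range M, p ^ k * coeff k f := by
  simp only [evalNil, RingHom.comp_apply, ← coeff_zero_eq_constantCoeff_apply]
  rw [coeff_subsHom _ _ (n := M) (by omega)]
  refine sum_congr rfl fun k _ => ?_
  rw [← map_pow]; simp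

theorem evalNil_X {M : ℕ} {p : K} (hp : p ^ M = 0) : evalNil M p hp X = p := by
  simp [evalNil, subsHom_X]

theorem evalNil_subsHom {M : ℕ} {p : K} (hp : p ^ M = 0) {q : PowerSeries K}
    (hq : constantCoeff q ^ 1 = 0) (hp' : evalNil M p hp q ^ M = 0) (f : PowerSeries K) :
    evalNil M p hp (subsHom K 1 q hq f) = evalNil M (evalNil M p hp q) hp' f := by
  rw [evalNil_apply, evalNil_apply]
  have h1 : ∀ m ∈ range M, p ^ m * coeff m (subsHom K 1 q hq f) =
      ∑ k ∈ range M, (p ^ m * coeff m (q ^ k)) * coeff k f := by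
    intro m hm
    rw [coeff_subsHom hq f (n := M) (by simp at hm; omega), mul_sum]
    exact sum_congr rfl fun j _ => by rw [smul_eq_mul, mul_assoc]
  rw [sum_congr rfl h1, sum_comm]
  refine sum_congr rfl fun k _ => ?_
  rw [← sum_mul, ← map_pow, evalNil_apply]

end Substitution

/-! ### The substitution `atInf` -/

section AtInf

open PowerSeries Finset

variable {B M : Type*} [CommRing B] [Algebra ℂ B] [Ring M] [Algebra B M]

/-- The coefficients of `(α x + β)^{-k}` as a power series in `x⁻¹`. -/
def atInfPow (α : ℂ) (β : B) (k : ℕ) : PowerSeries B :=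
  PowerSeries.mk fun m => if k ≤ m then
    algebraMap ℂ B (α⁻¹ ^ k * ((Ring.choose (-(k : ℤ)) (m - k) : ℤ) : ℂ)) *
      (algebraMap ℂ B α⁻¹ * β) ^ (m - k) else 0

theorem atInfPow_zero (α : ℂ) (β : B) : atInfPow α β 0 = 1 := by
  ext m
  rw [atInfPow, coeff_mk, coeff_one, if_pos (Nat.zero_le _)]
  split_ifs with h
  · subst h; simp
  · rw [Nat.cast_zero, neg_zero, Ring.choose_zero_pos _ (by omega)]; simp

theorem atInfPow_succ (α : ℂ) (β : B) (k : ℕ) :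
    atInfPow α β (k + 1) * (1 + C (algebraMap ℂ B α⁻¹ * β) * X) =
      C (algebraMap ℂ B α⁻¹) * X * atInfPow α β k := by
  set b := algebraMap ℂ B α⁻¹ * β
  have e : ∀ m, coeff m (atInfPow α β k) = if k ≤ m then
    algebraMap ℂ B (α⁻¹ ^ k * ((Ring.choose (-(k : ℤ)) (m - k) : ℤ) : ℂ)) * b ^ (m - k) else 0 :=
    fun m => by rw [atInfPow, coeff_mk]
  have e' : ∀ m, coeff m (atInfPow α β (k + 1)) = if k + 1 ≤ m then
    algebraMap ℂ B (α⁻¹ ^ (k + 1) * ((Ring.choose (-((k + 1 : ℕ) : ℤ)) (m - (k + 1)) : ℤ) : ℂ)) *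
      b ^ (m - (k + 1)) else 0 :=
    fun m => by rw [atInfPow, coeff_mk]
  have hc : ∀ l : ℕ, Ring.choose (-((k + 1 : ℕ) : ℤ)) (l + 1) + Ring.choose (-((k + 1 : ℕ) : ℤ)) l =
      Ring.choose (-(k : ℤ)) (l + 1) := by
    intro l
    have := Ring.choose_succ_succ (-((k + 1 : ℕ) : ℤ)) l
    rw [add_comm, ← this]
    congr 1
    push_cast; ring
  ext m
  rw [mul_add, mul_one, map_add, ← mul_assoc, mul_assoc (C _)]
  cases m with
  | zero =>
    rw [coeff_zero_mul_X, coeff_C_mul, coeff_zero_X_mul, e']; simp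
  | succ m =>
    rw [coeff_succ_mul_X, coeff_mul_C, coeff_C_mul, coeff_succ_X_mul, e, e', e']
    rcases lt_trichotomy k m with h | h | h
    · rw [if_pos (by omega), if_pos (by omega), if_pos (by omega)]
      obtain ⟨l, rfl⟩ : ∃ l, m = k + 1 + l := ⟨m - (k + 1), by omega⟩
      have h1 : k + 1 + l + 1 - (k + 1) = l + 1 := by omega
      have h2 : k + 1 + l - (k + 1) = l := by omega
      have h3 : k + 1 + l - k = l + 1 := by omega
      rw [h1, h2, h3, ← hc l, mul_assoc, ← pow_succ, ← add_mul, ← map_add, ← mul_assoc, ← map_mul]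
      congr 2
      push_cast; ring
    · subst h
      rw [if_pos le_rfl, if_neg (by omega), if_pos le_rfl]
      simp [pow_succ']
    · rw [if_neg (by omega), if_neg (by omega), if_neg (by omega)]; simp

/-- The series `(α x + β)⁻¹` in `x⁻¹`. -/
def atInfQ (α : ℂ) (β : B) : PowerSeries B := atInfPow α β 1

theorem atInfQ_mul (α : ℂ) (β : B) :
    atInfQ α β * (1 + C (algebraMap ℂ B α⁻¹ * β) * X) = C (algebraMap ℂ B α⁻¹) * X := by
  rw [atInfQ, atInfPow_succ, atInfPow_zero, mul_one]

theorem isUnit_one_add_mul_X (b : M) : IsUnit (1 + C b * X : PowerSeries M) := by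
  rw [isUnit_iff_constantCoeff]; simp

theorem atInfQ_pow (α : ℂ) (β : B) (k : ℕ) : atInfQ α β ^ k = atInfPow α β k := by
  induction k with
  | zero => rw [atInfPow_zero, pow_zero]
  | succ k ih =>
    apply (isUnit_one_add_mul_X (algebraMap ℂ B α⁻¹ * β)).mul_right_cancel
    rw [atInfPow_succ, pow_succ, mul_assoc, atInfQ_mul, ih, mul_comm]

theorem constantCoeff_atInfQ (α : ℂ) (β : B) : constantCoeff (atInfQ α β) ^ 1 = 0 := by
  rw [← coeff_zero_eq_constantCoeff_apply, atInfQ, atInfPow, coeff_mk]; simp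

theorem atInf_eq (α : ℂ) (β : B) (f : PowerSeries M) :
    atInf α β f = subsHom M 1 (atInfQ α β) (constantCoeff_atInfQ α β) f := by
  ext m
  rw [coeff_subsHom _ _ le_rfl, atInf, coeff_mk]
  refine sum_congr rfl fun k hk => ?_
  rw [atInfQ_pow, atInfPow, coeff_mk, if_pos (by simp at hk; omega)]

end AtInf

/-! ### The functional equations of `g` -/

section G

open PowerSeries

variable {N : ℕ}

theorem gSeries_unitarity (hN : N ≠ 0) :
    gSeries N * subsHom ℂ 1 (-X : PowerSeries ℂ) (by simp) (gSeries N) * (1 - X ^ 2) = 1 := by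
  obtain ⟨g0, g1⟩ := gSeries_spec N hN
  set q : PowerSeries ℂ := atInfQ 1 (N : ℂ) with hqdef
  have hq := constantCoeff_atInfQ (1 : ℂ) (N : ℂ)
  have hn : constantCoeff (-X : PowerSeries ℂ) ^ 1 = 0 := by simp
  set τ := subsHom ℂ 1 q hq with hτ
  set ν := subsHom ℂ 1 (-X : PowerSeries ℂ) hn with hν
  have hg : τ (gSeries N) = gSeries N * (1 - X ^ 2) := by rw [← g1, atInf_eq]
  have hτX : τ X = q := by rw [hτ, subsHom_X]; ext; simp
  have hνX : ν X = -X := by rw [hν, subsHom_X]; ext; simp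
  have hCN : ∀ φ : PowerSeries ℂ →+* PowerSeries ℂ, φ (C (N : ℂ)) = C (N : ℂ) := by
    intro φ; rw [map_natCast, map_natCast]
  have hqm : q * (1 + C (N : ℂ) * X) = X := by
    have := atInfQ_mul (1 : ℂ) (N : ℂ)
    simpa using this
  have hτντX : τ (ν q) = -X := by
    have h1 : ν q * (1 - C (N : ℂ) * X) = -X := by
      have := congrArg ν hqm
      rw [map_mul, map_add, map_mul, map_one, hCN, hνX] at this
      linear_combination this
    have h2 : τ (ν q) * (1 - C (N : ℂ) * q) = -q := by
      have := congrArg τ h1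
      rwa [map_mul, map_sub, map_mul, map_one, hCN, map_neg, hτX] at this
    have h3 : (1 - C (N : ℂ) * q) * (1 + C (N : ℂ) * X) = 1 := by
      linear_combination (-C (N : ℂ)) * hqm
    calc τ (ν q) = τ (ν q) * ((1 - C (N : ℂ) * q) * (1 + C (N : ℂ) * X)) := by rw [h3, mul_one]
      _ = -q * (1 + C (N : ℂ) * X) := by rw [← mul_assoc, h2]
      _ = -X := by rw [neg_mul, hqm]
  have hτντ : ∀ f, τ (ν (τ f)) = ν f := by
    intro f
    have a1 : constantCoeff (subsHom ℂ 1 (-X : PowerSeries ℂ) hn q) ^ 1 = 0 := by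
      rw [← coeff_zero_eq_constantCoeff_apply, coeff_subsHom hn _ le_rfl]
      simpa using hq
    have e1 : ν (τ f) = subsHom ℂ 1 (ν q) a1 f := subsHom_subsHom hn hq a1 f
    have a2 : constantCoeff (subsHom ℂ 1 q hq (ν q)) ^ 1 = 0 := by
      change constantCoeff (τ (ν q)) ^ 1 = 0
      rw [hτντX]; simp
    rw [e1, hτ, subsHom_subsHom hq a1 a2]
    change subsHom ℂ 1 (τ (ν q)) a2 f = _
    simp only [hτντX]
    rfl
  have c0 : constantCoeff (ν (gSeries N)) = 1 := by
    rw [← coeff_zero_eq_constantCoeff_apply, hν, coeff_subsHom hn _ le_rfl]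
    simpa using g0
  have hu : IsUnit (ν (gSeries N) * (1 - X ^ 2)) := by
    rw [isUnit_iff_constantCoeff, map_mul, c0]; simp
  obtain ⟨k, hk⟩ := hu.exists_left_inv
  have hkey : ν (gSeries N) = τ (ν (gSeries N)) * τ (1 - X ^ 2) := by
    have h1 : ν (1 - X ^ 2) = 1 - X ^ 2 := by rw [map_sub, map_one, map_pow, hνX]; ring
    have h2 := hτντ (gSeries N)
    rw [hg, map_mul, h1, map_mul] at h2
    exact h2.symm
  have hk2 : τ k * ν (gSeries N) = 1 := by
    rw [hkey, ← map_mul, ← map_mul, hk, map_one]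
  have hkg : k = gSeries N := by
    refine gSeries_unique N hN k ?_ ?_
    · have := congrArg constantCoeff hk
      rw [map_mul, map_mul, c0] at this
      simpa using this
    · rw [atInf_eq]
      change τ k = _
      have : k * (1 - X ^ 2) * ν (gSeries N) = 1 := by rw [mul_assoc, mul_comm (1 - X ^ 2), hk]
      calc τ k = τ k * (ν (gSeries N) * (k * (1 - X ^ 2))) := by
            rw [mul_comm (ν _), this, mul_one]
        _ = k * (1 - X ^ 2) := by rw [← mul_assoc, hk2, one_mul]
  rw [← hkg, mul_assoc]
  rw [hkg] at hk ⊢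
  exact hk

variable {S : Type*} [CommRing S] [Algebra Kh S]

/-- `g(1/p)` for an element `p` with vanishing `M`-th power. -/
def gval (N M : ℕ) (p : S) : S :=
  ∑ k ∈ Finset.range M, algebraMap Kh S (C (gCoeff N k)) * p ^ k

theorem gval_eq {M : ℕ} {p : S} (hp : p ^ M = 0) : gval N M p =
    evalNil M p hp (PowerSeries.map ((algebraMap Kh S).comp C) (gSeries N)) := by
  rw [evalNil_apply, gval]
  exact Finset.sum_congr rfl fun k _ => by simp [gSeries, mul_comm]

theorem gval_unitarity (hN : N ≠ 0) {M : ℕ} {p : S} (hp : p ^ M = 0) :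
    gval N M p * gval N M (-p) * (1 - p ^ 2) = 1 := by
  have hp' : (-p) ^ M = 0 := by rw [neg_pow, hp, mul_zero]
  have h := congrArg (fun f => evalNil M p hp (PowerSeries.map ((algebraMap Kh S).comp C) f))
    (gSeries_unitarity hN)
  simp only [map_mul, map_sub, map_one, map_pow, PowerSeries.map_X, evalNil_X] at h
  rw [gval_eq hp, gval_eq hp', ← h]
  congr 2
  rw [evalNil_apply, evalNil_apply]
  refine Finset.sum_congr rfl fun k _ => ?_
  rw [coeff_map, coeff_map, coeff_subsHom _ _ le_rfl, Finset.sum_eq_single k]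
  · rw [neg_pow X k, ← map_one C, ← map_neg C, ← map_pow, coeff_C_mul, coeff_X_pow_self,
      neg_pow p]
    simp only [mul_one, smul_eq_mul, map_mul, map_pow, map_neg, map_one]
    ring
  · intro j _ hj
    rw [neg_pow X j, ← map_one C, ← map_neg C, ← map_pow, coeff_C_mul, coeff_X_pow, if_neg hj.symm]
    simp
  · simp

theorem gval_crossing (hN : N ≠ 0) {M : ℕ} {p p' : S} (hp : p ^ M = 0)
    (h : p' * (1 + N * p) = p) : gval N M p' = gval N M p * (1 - p ^ 2) := by
  obtain ⟨g0, g1⟩ := gSeries_spec N hN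
  set η : ℂ →+* S := (algebraMap Kh S).comp C with hη
  let : Algebra ℂ S := η.toAlgebra
  set q : PowerSeries S := PowerSeries.map η (atInfQ 1 (N : ℂ)) with hq
  have hqm : atInfQ 1 (N : ℂ) * (1 + C (N : ℂ) * X) = X := by
    have := atInfQ_mul (1 : ℂ) (N : ℂ)
    simpa using this
  have hu : IsUnit (1 + N * p) := by
    refine IsNilpotent.isUnit_one_add ⟨M, ?_⟩
    rw [mul_pow, hp, mul_zero]
  have hpn : evalNil M p hp q = p' := by
    apply hu.mul_right_cancel
    rw [h]
    have := congrArg (fun f => evalNil M p hp (PowerSeries.map η f)) hqm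
    simpa [map_mul, map_add, evalNil_X] using this
  have hp' : p' ^ M = 0 := by
    have : p' ^ M * (1 + N * p) ^ M = 0 := by rw [← mul_pow, h, hp]
    exact (hu.pow M).mul_left_eq_zero.1 this
  have hp'' : evalNil M p hp q ^ M = 0 := by rw [hpn, hp']
  have hq0 : constantCoeff q ^ 1 = 0 := by
    have := constantCoeff_atInfQ (1 : ℂ) (N : ℂ)
    rw [pow_one] at this ⊢
    rw [hq, ← coeff_zero_eq_constantCoeff_apply, coeff_map, coeff_zero_eq_constantCoeff_apply,
      this, map_zero]
  have h1 := congrArg (fun f => evalNil M p hp (PowerSeries.map η f)) g1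
  simp only [map_mul, map_sub, map_one, map_pow, PowerSeries.map_X, evalNil_X] at h1
  rw [← gval_eq hp] at h1
  rw [← h1, gval_eq hp']
  have e : PowerSeries.map η (atInf 1 (N : ℂ) (gSeries N)) =
      subsHom S 1 q hq0 (PowerSeries.map η (gSeries N)) := by
    ext m
    rw [atInf_eq, coeff_map, coeff_subsHom _ _ le_rfl, coeff_subsHom _ _ le_rfl, map_sum]
    refine Finset.sum_congr rfl fun k _ => ?_
    rw [hq, ← map_pow, coeff_map, coeff_map, smul_eq_mul, smul_eq_mul, map_mul]
  rw [e, evalNil_subsHom hp hq0 hp'']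
  congr 1
  simp only [hpn]

end G

/-! ### From RTT relations to reflection equations -/

section TwoSites

variable {N : ℕ} {S D : Type*} [CommRing S] [Ring D] [Algebra S D]

/-- `X ⊗ 1`. -/
abbrev kl (X : Matrix (Fin N) (Fin N) D) : Matrix (Fin N × Fin N) (Fin N × Fin N) D :=
  X ⊗ₖ (1 : Matrix (Fin N) (Fin N) D)

/-- `1 ⊗ X`. -/
abbrev kr (X : Matrix (Fin N) (Fin N) D) : Matrix (Fin N × Fin N) (Fin N × Fin N) D :=
  (1 : Matrix (Fin N) (Fin N) D) ⊗ₖ X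

/-- `α + β P`. -/
abbrev lin (N : ℕ) (D : Type*) [Ring D] [Algebra S D] (r : S × S) :
    Matrix (Fin N × Fin N) (Fin N × Fin N) D :=
  r.1 • 1 + r.2 • flip N D

/-- `α + β Pᵗ`. -/
abbrev linQ (N : ℕ) (D : Type*) [Ring D] [Algebra S D] (r : S × S) :
    Matrix (Fin N × Fin N) (Fin N × Fin N) D :=
  r.1 • 1 + r.2 • flipQ N D

/-- The relation `(α + β P) X₁ Y₂ = Y₂ X₁ (α' + β' P)`. -/
def RTT (X Y : Matrix (Fin N) (Fin N) D) (r r' : S × S) : Prop :=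
  lin N D r * kl X * kr Y = kr Y * kl X * lin N D r'

/-- The relation `X₁ Y₂ (α' + β' P) = (α + β P) Y₂ X₁`. -/
def RTTr (X Y : Matrix (Fin N) (Fin N) D) (r' r : S × S) : Prop :=
  kl X * kr Y * lin N D r' = lin N D r * kr Y * kl X

theorem kl_flipQ_kr (X Y : Matrix (Fin N) (Fin N) D) (a b c d : Fin N) :
    (kl X * flipQ N D * kr Y) (a, b) (c, d) = X a b * Y c d := by
  simp only [Matrix.mul_apply, Matrix.kroneckerMap_apply, Fintype.sum_prod_type, flipQ,
    Matrix.one_apply, Matrix.of_apply, mul_ite, mul_one, mul_zero, ite_mul, one_mul, zero_mul,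
    ite_and]
  simp

theorem kr_flipQ_kl (X Y : Matrix (Fin N) (Fin N) D) (a b c d : Fin N) :
    (kr Y * flipQ N D * kl X) (a, b) (c, d) = Y b a * X d c := by
  simp only [Matrix.mul_apply, Matrix.kroneckerMap_apply, Fintype.sum_prod_type, flipQ,
    Matrix.one_apply, Matrix.of_apply, mul_ite, mul_one, mul_zero, ite_mul, one_mul, zero_mul,
    ite_and]
  simp

theorem flip_kl_kr_apply (X Y : Matrix (Fin N) (Fin N) D) (i j k l : Fin N) :
    (flip N D * kl X * kr Y) (i, k) (j, l) = X k j * Y i l := by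
  rw [mul_assoc, flip_mul_apply, kron12]

theorem flip_kr_kl_apply (X Y : Matrix (Fin N) (Fin N) D) (i j k l : Fin N) :
    (flip N D * kr Y * kl X) (i, k) (j, l) = Y i l * X k j := by
  rw [mul_assoc, flip_mul_apply, kron21]

theorem RTT_iff (X Y : Matrix (Fin N) (Fin N) D) (r r' : S × S) : RTT X Y r r' ↔
    ∀ i j k l, r.1 • (X i j * Y k l) + r.2 • (X k j * Y i l) =
      r'.1 • (Y k l * X i j) + r'.2 • (Y k j * X i l) := by
  rw [RTT, ← Matrix.ext_iff]
  constructor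
  · intro h i j k l
    have := h (i, k) (j, l)
    simpa only [lin, add_mul, mul_add, Matrix.smul_mul, Matrix.mul_smul, one_mul,
      mul_one, Matrix.add_apply, Matrix.smul_apply, flip_kl_kr_apply, flip_kr_kl_apply, kron12,
      kron21, mul_flip_apply] using this
  · rintro h ⟨i, k⟩ ⟨j, l⟩
    simpa only [lin, add_mul, mul_add, Matrix.smul_mul, Matrix.mul_smul, one_mul,
      mul_one, Matrix.add_apply, Matrix.smul_apply, flip_kl_kr_apply, flip_kr_kl_apply, kron12,
      kron21, mul_flip_apply] using h i j k l

theorem RTTr_iff (X Y : Matrix (Fin N) (Fin N) D) (r r' : S × S) : RTTr X Y r' r ↔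
    ∀ i j k l, r'.1 • (X i j * Y k l) + r'.2 • (X i l * Y k j) =
      r.1 • (Y k l * X i j) + r.2 • (Y i l * X k j) := by
  rw [RTTr, ← Matrix.ext_iff]
  constructor
  · intro h i j k l
    have := h (i, k) (j, l)
    simpa only [lin, add_mul, mul_add, Matrix.smul_mul, Matrix.mul_smul, one_mul,
      mul_one, Matrix.add_apply, Matrix.smul_apply, flip_kl_kr_apply, flip_kr_kl_apply, kron12,
      kron21, mul_flip_apply] using this
  · rintro h ⟨i, k⟩ ⟨j, l⟩
    simpa only [lin, add_mul, mul_add, Matrix.smul_mul, Matrix.mul_smul, one_mul,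
      mul_one, Matrix.add_apply, Matrix.smul_apply, flip_kl_kr_apply, flip_kr_kl_apply, kron12,
      kron21, mul_flip_apply] using h i j k l

theorem RTT.transpose_left {X Y : Matrix (Fin N) (Fin N) D} {r r' : S × S} (h : RTT X Y r r') :
    kl Xᵀ * linQ N D r * kr Y = kr Y * linQ N D r' * kl Xᵀ := by
  rw [RTT_iff] at h
  ext ⟨i, k⟩ ⟨j, l⟩
  have := h j i k l
  simpa only [linQ, add_mul, mul_add, Matrix.smul_mul, Matrix.mul_smul, one_mul,
      mul_one, Matrix.add_apply, Matrix.smul_apply, kron12, kron21,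
      kl_flipQ_kr, kr_flipQ_kl, Matrix.transpose_apply] using this

theorem RTTr.transpose_right {X Y : Matrix (Fin N) (Fin N) D} {r r' : S × S} (h : RTTr X Y r' r) :
    kl X * linQ N D r' * kr Yᵀ = kr Yᵀ * linQ N D r * kl X := by
  rw [RTTr_iff] at h
  ext ⟨i, k⟩ ⟨j, l⟩
  have := h i j l k
  simpa only [linQ, add_mul, mul_add, Matrix.smul_mul, Matrix.mul_smul, one_mul,
      mul_one, Matrix.add_apply, Matrix.smul_apply, kron12, kron21,
      kl_flipQ_kr, kr_flipQ_kl, Matrix.transpose_apply] using this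

theorem RTTr.transpose_both {X Y : Matrix (Fin N) (Fin N) D} {r r' : S × S} (h : RTTr X Y r' r) :
    lin N D r' * kl Xᵀ * kr Yᵀ = kr Yᵀ * kl Xᵀ * lin N D r := by
  rw [RTTr_iff] at h
  change RTT Xᵀ Yᵀ r' r
  rw [RTT_iff]
  intro i j k l
  simpa only [Matrix.transpose_apply] using h j i l k

theorem flip_mul_kl (X : Matrix (Fin N) (Fin N) D) : flip N D * kl X = kr X * flip N D := by
  ext ⟨i, k⟩ ⟨j, l⟩
  rw [flip_mul_apply, mul_flip_apply]
  simp [Matrix.kroneckerMap_apply, Matrix.one_apply]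

theorem flip_mul_kr (X : Matrix (Fin N) (Fin N) D) : flip N D * kr X = kl X * flip N D := by
  ext ⟨i, k⟩ ⟨j, l⟩
  rw [flip_mul_apply, mul_flip_apply]
  simp [Matrix.kroneckerMap_apply, Matrix.one_apply]

theorem flip_mul_flipQ : flip N D * flipQ N D = flipQ N D := by
  ext ⟨i, k⟩ ⟨j, l⟩
  rw [flip_mul_apply]
  simp [flipQ, eq_comm]

theorem flipQ_mul_flip : flipQ N D * flip N D = flipQ N D := by
  ext ⟨i, k⟩ ⟨j, l⟩
  rw [mul_flip_apply]
  simp [flipQ, eq_comm]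

theorem kl_flipQ (X : Matrix (Fin N) (Fin N) D) : kl X * flipQ N D = kr Xᵀ * flipQ N D := by
  have h1 := fun a b c d => kl_flipQ_kr X (1 : Matrix (Fin N) (Fin N) D) a b c d
  have h2 := fun a b c d => kr_flipQ_kl (1 : Matrix (Fin N) (Fin N) D) Xᵀ a b c d
  ext ⟨i, k⟩ ⟨j, l⟩
  have e : kl (1 : Matrix (Fin N) (Fin N) D) = 1 := Matrix.one_kronecker_one
  have e' : kr (1 : Matrix (Fin N) (Fin N) D) = 1 := Matrix.one_kronecker_one
  rw [← mul_one (kl X * flipQ N D), ← mul_one (kr Xᵀ * flipQ N D)]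
  nth_rewrite 1 [← e']
  rw [← e, h1, h2, Matrix.transpose_apply]
  simp [Matrix.one_apply, eq_comm]

theorem flipQ_kr (X : Matrix (Fin N) (Fin N) D) : flipQ N D * kr X = flipQ N D * kl Xᵀ := by
  have h1 := fun a b c d => kl_flipQ_kr (1 : Matrix (Fin N) (Fin N) D) X a b c d
  have h2 := fun a b c d => kr_flipQ_kl Xᵀ (1 : Matrix (Fin N) (Fin N) D) a b c d
  ext ⟨i, k⟩ ⟨j, l⟩
  have e : kl (1 : Matrix (Fin N) (Fin N) D) = 1 := Matrix.one_kronecker_one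
  have e' : kr (1 : Matrix (Fin N) (Fin N) D) = 1 := Matrix.one_kronecker_one
  rw [← one_mul (flipQ N D)]
  nth_rewrite 1 [← e]
  rw [← e', h1, h2, Matrix.transpose_apply]
  simp [Matrix.one_apply, eq_comm]

theorem kl_kr_commute {X Y : Matrix (Fin N) (Fin N) D} (h : ∀ i j k l, Commute (X i j) (Y k l)) :
    Commute (kl X) (kr Y) := by
  rw [Commute, SemiconjBy]
  ext ⟨i, k⟩ ⟨j, l⟩
  rw [kron12, kron21]
  exact h _ _ _ _

theorem linQ_reflection {G : Matrix (Fin N) (Fin N) D} (hc : ∀ i j (d : D), Commute (G i j) d)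
    (hG : Gᵀ = G ∨ Gᵀ = -G) (r s : S × S) :
    lin N D r * kl G * linQ N D s * kr G = kr G * linQ N D s * kl G * lin N D r := by
  have h12 : kl G * kr G = kr G * kl G := kl_kr_commute fun _ _ _ _ => hc _ _ _
  have hQ : kl G * flipQ N D * kr G = kr G * flipQ N D * kl G := by
    rw [kl_flipQ, mul_assoc, flipQ_kr, ← mul_assoc]
    rcases hG with hG | hG <;> rw [hG]
    have e1 : kr (-G) = -kr G := by ext ⟨i, k⟩ ⟨j, l⟩; simp [Matrix.kroneckerMap_apply]
    have e2 : kl (-G) = -kl G := by ext ⟨i, k⟩ ⟨j, l⟩; simp [Matrix.kroneckerMap_apply]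
    rw [e1, e2, neg_mul, neg_mul_neg]
  have hP : flip N D * kl G * kr G = kr G * kl G * flip N D := by
    rw [flip_mul_kl, mul_assoc, flip_mul_kr, ← mul_assoc]
  have hPQ : flip N D * kl G * flipQ N D * kr G = kr G * flipQ N D * kl G * flip N D := by
    calc flip N D * kl G * flipQ N D * kr G
        = kr G * (flip N D * flipQ N D) * kr G := by rw [flip_mul_kl, mul_assoc (kr G)]
      _ = kr G * (flipQ N D * flip N D) * kr G := by rw [flip_mul_flipQ, flipQ_mul_flip]
      _ = kr G * flipQ N D * (flip N D * kr G) := by simp only [mul_assoc]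
      _ = kr G * flipQ N D * kl G * flip N D := by rw [flip_mul_kr, ← mul_assoc]
  simp only [lin, linQ, add_mul, mul_add, Matrix.smul_mul, Matrix.mul_smul, one_mul, mul_one,
    h12, hQ, hP, hPQ, smul_smul, mul_comm]
  abel

theorem reflection_of_rtt {A : Type*} [Monoid A] {x x' y y' g₁ g₂ ρ ρ' ρ₄ κ κ' κ₂ : A}
    (h1 : ρ * x * y = y * x * ρ') (h3 : x' * κ * y = y * κ' * x')
    (h2 : x * κ' * y' = y' * κ₂ * x) (h4 : ρ' * x' * y' = y' * x' * ρ₄)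
    (hg : ρ' * g₁ * κ' * g₂ = g₂ * κ' * g₁ * ρ')
    (c1 : Commute g₁ y) (c2 : Commute x' g₂) (c3 : Commute x g₂) (c4 : Commute g₁ y') :
    ρ * (x * g₁ * x') * κ * (y * g₂ * y') = y * g₂ * y' * κ₂ * (x * g₁ * x') * ρ₄ := by
  simp only [Commute, SemiconjBy] at c1 c2 c3 c4
  calc ρ * (x * g₁ * x') * κ * (y * g₂ * y')
      = ρ * x * g₁ * (x' * κ * y) * g₂ * y' := by simp only [mul_assoc]
    _ = ρ * x * (g₁ * y) * κ' * (x' * g₂) * y' := by rw [h3]; simp only [mul_assoc]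
    _ = (ρ * x * y) * g₁ * κ' * g₂ * x' * y' := by rw [c1, c2]; simp only [mul_assoc]
    _ = y * x * (ρ' * g₁ * κ' * g₂) * x' * y' := by rw [h1]; simp only [mul_assoc]
    _ = y * (x * g₂) * κ' * g₁ * (ρ' * x' * y') := by rw [hg]; simp only [mul_assoc]
    _ = y * g₂ * x * κ' * (g₁ * y') * x' * ρ₄ := by rw [h4, c3]; simp only [mul_assoc]
    _ = y * g₂ * (x * κ' * y') * g₁ * x' * ρ₄ := by rw [c4]; simp only [mul_assoc]
    _ = y * g₂ * y' * κ₂ * (x * g₁ * x') * ρ₄ := by rw [h2]; simp only [mul_assoc]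

theorem kl_mul (X Y : Matrix (Fin N) (Fin N) D) : kl (X * Y) = kl X * kl Y := by
  ext ⟨i, k⟩ ⟨j, l⟩
  simp [Matrix.mul_apply, Matrix.kroneckerMap_apply, Fintype.sum_prod_type, Matrix.one_apply]

theorem kr_mul (X Y : Matrix (Fin N) (Fin N) D) : kr (X * Y) = kr X * kr Y := by
  ext ⟨i, k⟩ ⟨j, l⟩
  simp [Matrix.mul_apply, Matrix.kroneckerMap_apply, Fintype.sum_prod_type, Matrix.one_apply]

theorem reflection₂ {G X X' Y Y' : Matrix (Fin N) (Fin N) D}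
    (hc : ∀ i j (d : D), Commute (G i j) d) (hG : Gᵀ = G ∨ Gᵀ = -G)
    {r₁ r₁' r₂ r₃ r₃' r₄ : S × S} (h1 : RTT X Y r₁ r₁') (h3 : RTT X' Y r₃ r₃')
    (h2 : RTTr X Y' r₃' r₂) (h4 : RTTr X' Y' r₁' r₄) :
    lin N D r₁ * kl (X * G * X'ᵀ) * linQ N D r₃ * kr (Y * G * Y'ᵀ) =
      kr (Y * G * Y'ᵀ) * linQ N D r₂ * kl (X * G * X'ᵀ) * lin N D r₄ := by
  simp only [kl_mul, kr_mul]
  exact reflection_of_rtt h1 h3.transpose_left h2.transpose_right h4.transpose_both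
    (linQ_reflection hc hG _ _) (kl_kr_commute fun _ _ _ _ => hc _ _ _)
    (kl_kr_commute fun _ _ _ _ => (hc _ _ _).symm) (kl_kr_commute fun _ _ _ _ => (hc _ _ _).symm)
    (kl_kr_commute fun _ _ _ _ => hc _ _ _)

variable {ι : Type*} [DecidableEq ι] [Fintype ι]

theorem pairM_lin (i j : ι) (r : S × S) :
    pairM i j (lin N D r) = r.1 • 1 + r.2 • Pm N D i j := by
  rw [lin, pairM_add, pairM_smul, pairM_smul, pairM_one, pairM_flip]

theorem pairM_linQ (i j : ι) (r : S × S) :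
    pairM i j (linQ N D r) = r.1 • 1 + r.2 • Qm N D i j := by
  rw [linQ, pairM_add, pairM_smul, pairM_smul, pairM_one, pairM_flipQ]

theorem reflection {G X X' Y Y' : Matrix (Fin N) (Fin N) D}
    (hc : ∀ i j (d : D), Commute (G i j) d) (hG : Gᵀ = G ∨ Gᵀ = -G)
    {r₁ r₁' r₂ r₃ r₃' r₄ : S × S} (h1 : RTT X Y r₁ r₁') (h3 : RTT X' Y r₃ r₃')
    (h2 : RTTr X Y' r₃' r₂) (h4 : RTTr X' Y' r₁' r₄) {i j : ι} (hij : i ≠ j) :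
    (r₁.1 • 1 + r₁.2 • Pm N D i j) * siteM i (X * G * X'ᵀ) * (r₃.1 • 1 + r₃.2 • Qm N D i j) *
      siteM j (Y * G * Y'ᵀ) =
    siteM j (Y * G * Y'ᵀ) * (r₂.1 • 1 + r₂.2 • Qm N D i j) * siteM i (X * G * X'ᵀ) *
      (r₄.1 • 1 + r₄.2 • Pm N D i j) := by
  have := congrArg (pairM i j) (reflection₂ hc hG h1 h3 h2 h4)
  simpa only [pairM_mul hij, pairM_lin, pairM_linQ, pairM_left hij, pairM_right hij] using this

end TwoSites

/-! ### The normalized R-matrices -/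

section RMatrix

variable {N M : ℕ} {S D : Type*} [CommRing S] [Algebra Kh S] [Ring D] [Algebra S D]
  {ι : Type*} [DecidableEq ι] [Fintype ι]

/-- The coefficients of `R̄(x) = g(x/h) (1 - (h/x) P)`, where `p = h/x`. -/
def rr (N M : ℕ) (p : S) : S × S := (gval N M p, -(gval N M p * p))

variable (N M D) in
/-- `R̄_ij(h/p)`. -/
def Rb (i j : ι) (p : S) : Matrix (ι → Fin N) (ι → Fin N) D :=
  (rr N M p).1 • 1 + (rr N M p).2 • Pm N D i j

variable (N M D) in
/-- `R̄ᵗ_ij(h/p)`. -/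
def Rbt (i j : ι) (p : S) : Matrix (ι → Fin N) (ι → Fin N) D :=
  (rr N M p).1 • 1 + (rr N M p).2 • Qm N D i j

theorem isUnit_gval (hN : N ≠ 0) {p : S} (hp : p ^ M = 0) : IsUnit (gval N M p) :=
  IsUnit.of_mul_eq_one (gval N M (-p) * (1 - p ^ 2)) (by rw [← mul_assoc, gval_unitarity hN hp])

theorem Rb_eq (i j : ι) (p : S) : Rb N M D i j p = gval N M p • (1 - p • Pm N D i j) := by
  rw [Rb, rr, smul_sub, neg_smul, smul_smul, sub_eq_add_neg]

theorem Rbt_eq (i j : ι) (p : S) : Rbt N M D i j p = gval N M p • (1 - p • Qm N D i j) := by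
  rw [Rbt, rr, smul_sub, neg_smul, smul_smul, sub_eq_add_neg]

theorem Rb_comm (i j : ι) (p : S) : Rb N M D i j p = Rb N M D j i p := by
  rw [Rb, Pm_comm, Rb]

theorem Rbt_comm (i j : ι) (p : S) : Rbt N M D i j p = Rbt N M D j i p := by
  rw [Rbt, Qm_comm, Rbt]

theorem Rb_mul_neg (hN : N ≠ 0) {p : S} (hp : p ^ M = 0) (i j : ι) :
    Rb N M D i j p * Rb N M D i j (-p) = 1 := by
  rw [Rb_eq, Rb_eq, smul_mul_smul_comm]
  have : (1 - p • Pm N D i j) * (1 - (-p) • Pm N D i j) = (1 - p ^ 2) • 1 := by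
    simp only [sub_mul, mul_sub, one_mul, mul_one, smul_mul_assoc, mul_smul_comm, Pm_mul_self]
    module
  rw [this, smul_smul, gval_unitarity hN hp, one_smul]

theorem neg_pow_eq_zero {p : S} (hp : p ^ M = 0) : (-p) ^ M = 0 := by
  rw [neg_pow, hp, mul_zero]

theorem Rb_neg_mul (hN : N ≠ 0) {p : S} (hp : p ^ M = 0) (i j : ι) :
    Rb N M D i j (-p) * Rb N M D i j p = 1 := by
  have := Rb_mul_neg (D := D) hN (neg_pow_eq_zero hp) i j
  rwa [neg_neg] at this

theorem RTT.toRTTr (hN : N ≠ 0) {X Y : Matrix (Fin N) (Fin N) D} {p p' : S} (hp : p ^ M = 0)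
    (hp' : p' ^ M = 0) (h : RTT X Y (rr N M p) (rr N M p')) :
    RTTr X Y (rr N M (-p')) (rr N M (-p)) := by
  have key : ∀ {q : S}, q ^ M = 0 → lin N D (rr N M q) * lin N D (rr N M (-q)) = 1 := by
    intro q hq
    have hf : flip N D * flip N D = 1 := by
      ext ⟨i, k⟩ ⟨j, l⟩
      rw [flip_mul_apply]
      simp only [flip, Matrix.of_apply, Matrix.one_apply, Prod.mk.injEq]
      congr 1
      rw [and_comm]
    have h1 := gval_unitarity hN hq
    simp only [lin, rr, add_mul, mul_add, one_mul, mul_one, smul_mul_assoc, mul_smul_comm, hf]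
    linear_combination (norm := module) congrArg
      (fun z : S => z • (1 : Matrix (Fin N × Fin N) (Fin N × Fin N) D)) h1
  have e1 := key (neg_pow_eq_zero hp)
  rw [neg_neg] at e1
  rw [RTT] at h
  rw [RTTr]
  calc kl X * kr Y * lin N D (rr N M (-p'))
      = lin N D (rr N M (-p)) * (lin N D (rr N M p) * kl X * kr Y) * lin N D (rr N M (-p')) := by
        rw [← mul_assoc, ← mul_assoc, e1, one_mul]
    _ = lin N D (rr N M (-p)) * kr Y * kl X *
        (lin N D (rr N M p') * lin N D (rr N M (-p'))) := by rw [h]; simp only [mul_assoc]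
    _ = _ := by rw [key hp', mul_one]

theorem RTT.smul {X Y : Matrix (Fin N) (Fin N) D} {r r' : S × S} (h : RTT X Y r r') (s : S) :
    RTT X Y (s • r) (s • r') := by
  rw [RTT_iff] at h ⊢
  intro i j k l
  simp only [Prod.smul_fst, Prod.smul_snd, smul_assoc, ← smul_add, h]

theorem Rbt_crossing (hN : N ≠ 0) {p p' : S} (hp : p ^ M = 0) (h : p' * (1 + N * p) = p)
    {i j : ι} (hij : i ≠ j) : Rbt N M D i j (-p) * Rbt N M D i j p' = 1 ∧
      Rbt N M D i j p' * Rbt N M D i j (-p) = 1 := by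
  have h1 : gval N M (-p) * gval N M p' = 1 := by
    rw [gval_crossing hN hp h]
    linear_combination gval_unitarity hN hp
  have hQ : Qm N D i j * Qm N D i j = (N : S) • Qm N D i j := by
    rw [Qm_mul_self hij]
    ext I J
    simp [Algebra.smul_def]
  have h3 : (-p + p' + N * (p * p')) • Qm N D i j = 0 := by
    rw [show -p + p' + N * (p * p') = 0 by linear_combination h, zero_smul]
  constructor
  · rw [Rbt_eq, Rbt_eq, smul_mul_smul_comm, h1, one_smul]
    simp only [sub_mul, mul_sub, one_mul, mul_one, smul_mul_assoc, mul_smul_comm, hQ]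
    linear_combination (norm := module) (-1 : S) • h3
  · rw [Rbt_eq, Rbt_eq, smul_mul_smul_comm, mul_comm, h1, one_smul]
    simp only [sub_mul, mul_sub, one_mul, mul_one, smul_mul_assoc, mul_smul_comm, hQ]
    linear_combination (norm := module) (-1 : S) • h3

theorem ybe_aux {p q r : S} (h : p * q = p * r + q * r) {i j k : ι} (hij : i ≠ j) (hik : i ≠ k)
    (hjk : j ≠ k) :
    (1 - p • Pm N D i j) * (1 - q • Qm N D i k) * (1 - r • Qm N D j k) =
      (1 - r • Qm N D j k) * (1 - q • Qm N D i k) * (1 - p • Pm N D i j) := by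
  have e1 : Pm N D i j * Qm N D i k = Qm N D j k * Pm N D i j := by
    rw [Pm, permM_mul_Qm, Equiv.swap_apply_left, Equiv.swap_apply_of_ne_of_ne hik.symm hjk.symm]
  have e2 : Pm N D i j * Qm N D j k = Qm N D i k * Pm N D i j := by
    rw [Pm, permM_mul_Qm, Equiv.swap_apply_right, Equiv.swap_apply_of_ne_of_ne hik.symm hjk.symm]
  have e3 : Qm N D i k * Qm N D j k = Qm N D i k * Pm N D i j := by
    rw [Qm_comm j k, Qm_mul_Qm hik hij hjk.symm, Qm_comm k j, e2]
  have e4 : Qm N D j k * Qm N D i k = Qm N D j k * Pm N D i j := by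
    rw [Qm_comm i k, Qm_mul_Qm hjk hij.symm hik.symm, Qm_comm k i, Pm_comm j i, e1]
  have e6 : Qm N D j k * (Qm N D i k * Pm N D i j) = Qm N D j k := by
    rw [← mul_assoc, e4, mul_assoc, Pm_mul_self, mul_one]
  simp only [sub_mul, mul_sub, one_mul, mul_one, smul_mul_assoc, mul_smul_comm, mul_assoc, e6,
    Pm_mul_self, e1, e2, e3, e4, smul_sub, smul_smul]
  have h3 : (p * q) • (Qm N D j k * Pm N D i j - Qm N D i k * Pm N D i j) =
    (p * r + q * r) • (Qm N D j k * Pm N D i j - Qm N D i k * Pm N D i j) := by rw [h]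
  linear_combination (norm := module) h3

theorem Rb_Rbt_Rbt {p q r : S} (h : p * q = p * r + q * r)
    {i j k : ι} (hij : i ≠ j) (hik : i ≠ k) (hjk : j ≠ k) :
    Rb N M D i j p * Rbt N M D i k q * Rbt N M D j k r =
      Rbt N M D j k r * Rbt N M D i k q * Rb N M D i j p := by
  rw [Rb_eq, Rbt_eq, Rbt_eq]
  simp only [smul_mul_assoc, mul_smul_comm]
  rw [ybe_aux h hij hik hjk]
  module

theorem commute_smul_one_add {A : Type*} [Ring A] [Algebra S A] {x y : A} (h : Commute x y)
    (a b : S) : Commute (a • 1 + b • x) y :=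
  ((Commute.one_left y).smul_left a).add_left (h.smul_left b)

theorem Rb_siteM_comm {i j k : ι} (hki : k ≠ i) (hkj : k ≠ j) (p : S)
    (X : Matrix (Fin N) (Fin N) D) : Commute (Rb N M D i j p) (siteM k X) :=
  commute_smul_one_add (Pm_siteM_comm hki hkj X) _ _

theorem Rbt_siteM_comm {i j k : ι} (hij : i ≠ j) (hki : k ≠ i) (hkj : k ≠ j) (p : S)
    (X : Matrix (Fin N) (Fin N) D) : Commute (Rbt N M D i j p) (siteM k X) :=
  commute_smul_one_add (Qm_mul_siteM_comm hij hki hkj X) _ _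

theorem Rb_Rbt_comm {i j k l : ι} (hki : k ≠ i) (hkj : k ≠ j) (hli : l ≠ i) (hlj : l ≠ j)
    (p q : S) : Commute (Rb N M D i j p) (Rbt N M D k l q) :=
  commute_smul_one_add (commute_smul_one_add (Pm_Qm_comm hki hkj hli hlj).symm _ _).symm _ _

theorem Rbt_Rbt_comm {i j k l : ι} (hij : i ≠ j) (hkl : k ≠ l) (hik : i ≠ k) (hil : i ≠ l)
    (hjk : j ≠ k) (hjl : j ≠ l) (p q : S) : Commute (Rbt N M D i j p) (Rbt N M D k l q) :=
  commute_smul_one_add (commute_smul_one_add (Qm_mul_Qm_comm hij hkl hik hil hjk hjl).symm _ _).symm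
    _ _

end RMatrix

/-! ### Exchange relations for multiple products -/

section Multisite

variable {A ι : Type*} [Monoid A]

/-- The product `∏_i (s_i ∏_{j > i} r_ij)`, in the order of the list. -/
def prodS (r : ι → ι → A) (s : ι → A) : List ι → A
  | [] => 1
  | i :: l => s i * (l.map (r i)).prod * prodS r s l

theorem commute_map_prod {x : A} {f : ι → A} {l : List ι} (h : ∀ j ∈ l, Commute x (f j)) :
    Commute x (l.map f).prod := by
  refine Commute.list_prod_right _ _ fun y hy => ?_
  obtain ⟨j, hj, rfl⟩ := List.mem_map.1 hy
  exact h j hj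

theorem commute_prodS {x : A} {r : ι → ι → A} {s : ι → A} : ∀ {l : List ι}, l.Nodup →
    (∀ j ∈ l, Commute x (s j)) → (∀ j ∈ l, ∀ k ∈ l, j ≠ k → Commute x (r j k)) →
    Commute x (prodS r s l)
  | [], _, _, _ => Commute.one_right x
  | i :: l, hl, h1, h2 => by
    rw [List.nodup_cons] at hl
    refine ((h1 i (by simp)).mul_right (commute_map_prod fun j hj => h2 i (by simp) j (by simp [hj])
      (fun h => hl.1 (h ▸ hj)))).mul_right (commute_prodS hl.2 (fun j hj => h1 j (by simp [hj]))
        fun j hj k hk => h2 j (by simp [hj]) k (by simp [hk]))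

theorem map_prodS {B F : Type*} [Monoid B] [FunLike F A B] [MonoidHomClass F A B] (φ : F)
    (r : ι → ι → A) (s : ι → A) : ∀ l : List ι,
    φ (prodS r s l) = prodS (fun i j => φ (r i j)) (fun i => φ (s i)) l
  | [] => map_one φ
  | i :: l => by
    rw [prodS, prodS, map_mul, map_mul, map_list_prod, List.map_map, map_prodS φ r s l]
    rfl

theorem prodS_snoc {r : ι → ι → A} {s : ι → A} {m : ι} : ∀ {l : List ι}, (l ++ [m]).Nodup →
    (∀ i ∈ l, ∀ j ∈ l, i ≠ j → Commute (r i m) (s j)) →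
    (∀ i ∈ l, ∀ j ∈ l, ∀ k ∈ l, i ≠ j → i ≠ k → j ≠ k → Commute (r i m) (r j k)) →
    prodS r s (l ++ [m]) = prodS r s l * (l.map (r · m)).prod * s m
  | [], _, _, _ => by simp [prodS]
  | i :: l, hl, h1, h2 => by
    rw [List.cons_append, List.nodup_cons] at hl
    have hi : ∀ j ∈ l, i ≠ j := fun j hj h => hl.1 (by simp [h, hj])
    have c : Commute (r i m) (prodS r s l) :=
      commute_prodS (List.nodup_append.1 hl.2).1 (fun j hj => h1 i (by simp) j (by simp [hj]) (hi j hj))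
        fun j hj k hk hjk => h2 i (by simp) j (by simp [hj]) k (by simp [hk]) (hi j hj) (hi k hk) hjk
    have ih := prodS_snoc (r := r) (s := s) (m := m) hl.2
      (fun i hi j hj => h1 i (by simp [hi]) j (by simp [hj]))
      (fun i hi j hj k hk => h2 i (by simp [hi]) j (by simp [hj]) k (by simp [hk]))
    rw [List.cons_append, prodS, ih, prodS]
    simp only [List.map_append, List.map_cons, List.map_nil, List.prod_append, List.prod_cons,
      List.prod_nil, mul_one, mul_assoc]
    rw [← mul_assoc (r i m), c.eq, mul_assoc]

theorem exchange_prod {w : A} {y r : ι → A} : ∀ {l : List ι}, l.Nodup →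
    (∀ j ∈ l, w * y j * r j = r j * y j * w) →
    (∀ j ∈ l, ∀ k ∈ l, j ≠ k → Commute (r j) (y k)) →
    w * (l.map y).prod * (l.map r).prod = (l.map r).prod * (l.map y).prod * w
  | [], _, _, _ => by simp
  | i :: l, hl, h1, h2 => by
    rw [List.nodup_cons] at hl
    have hi : ∀ j ∈ l, i ≠ j := fun j hj h => hl.1 (h ▸ hj)
    have c1 : Commute (r i) (l.map y).prod :=
      commute_map_prod fun j hj => h2 i (by simp) j (by simp [hj]) (hi j hj)
    have c2 : Commute (y i) (l.map r).prod :=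
      commute_map_prod fun j hj => (h2 j (by simp [hj]) i (by simp) (hi j hj).symm).symm
    have ih := exchange_prod hl.2 (fun j hj => h1 j (by simp [hj]))
      (fun j hj k hk => h2 j (by simp [hj]) k (by simp [hk]))
    simp only [List.map_cons, List.prod_cons]
    generalize (l.map y).prod = Y at *
    generalize (l.map r).prod = R at *
    calc w * (y i * Y) * (r i * R) = w * y i * (Y * r i) * R := by simp only [mul_assoc]
      _ = (w * y i * r i) * Y * R := by rw [← c1.eq]; simp only [mul_assoc]
      _ = r i * y i * (w * Y * R) := by rw [h1 i (by simp)]; simp only [mul_assoc]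
      _ = r i * (y i * R) * Y * w := by rw [ih]; simp only [mul_assoc]
      _ = r i * R * (y i * Y) * w := by rw [c2.eq]; simp only [mul_assoc]

theorem exchange_reverse_prod {z : A} {x r : ι → A} : ∀ {l : List ι}, l.Nodup →
    (∀ j ∈ l, x j * z * r j = r j * z * x j) →
    (∀ j ∈ l, ∀ k ∈ l, j ≠ k → Commute (r j) (x k)) →
    (l.map x).reverse.prod * z * (l.map r).prod = (l.map r).prod * z * (l.map x).reverse.prod
  | [], _, _, _ => by simp
  | i :: l, hl, h1, h2 => by
    rw [List.nodup_cons] at hl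
    have hi : ∀ j ∈ l, i ≠ j := fun j hj h => hl.1 (h ▸ hj)
    have c1 : Commute (r i) (l.map x).reverse.prod := by
      rw [← List.map_reverse]
      refine commute_map_prod fun j hj => ?_
      rw [List.mem_reverse] at hj
      exact h2 i (by simp) j (by simp [hj]) (hi j hj)
    have c2 : Commute (x i) (l.map r).prod :=
      commute_map_prod fun j hj => (h2 j (by simp [hj]) i (by simp) (hi j hj).symm).symm
    have ih := exchange_reverse_prod hl.2 (fun j hj => h1 j (by simp [hj]))
      (fun j hj k hk => h2 j (by simp [hj]) k (by simp [hk]))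
    simp only [List.map_cons, List.prod_cons, List.reverse_cons, List.prod_append, List.prod_nil,
      mul_one]
    generalize (l.map x).reverse.prod = X at *
    generalize (l.map r).prod = R at *
    calc X * x i * z * (r i * R) = X * (x i * z * r i) * R := by simp only [mul_assoc]
      _ = (X * r i) * z * (x i * R) := by rw [h1 i (by simp)]; simp only [mul_assoc]
      _ = r i * (X * z * R) * x i := by rw [c1.symm.eq, c2.eq]; simp only [mul_assoc]
      _ = r i * R * z * (X * x i) := by rw [ih]; simp only [mul_assoc]

theorem multisite {S₀ : A} {X Y Z W s : ι → A} {r : ι → ι → A} : ∀ {l : List ι}, l.Nodup →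
    (∀ i ∈ l, X i * S₀ * Y i * s i = s i * Z i * S₀ * W i) →
    (∀ i ∈ l, ∀ j ∈ l, i ≠ j → W i * Y j * r i j = r i j * Y j * W i) →
    (∀ i ∈ l, ∀ j ∈ l, i ≠ j → X j * Z i * r i j = r i j * Z i * X j) →
    (∀ i ∈ l, ∀ j ∈ l, i ≠ j → Commute (X i) (s j) ∧ Commute (Y i) (s j) ∧ Commute (Z i) (s j) ∧
      Commute (W i) (s j) ∧ Commute S₀ (r i j)) →
    (∀ i ∈ l, ∀ j ∈ l, ∀ k ∈ l, i ≠ j → i ≠ k → j ≠ k → Commute (X i) (r j k) ∧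
      Commute (Y i) (r j k) ∧ Commute (Z i) (r j k) ∧ Commute (W i) (r j k)) →
    (l.map X).reverse.prod * S₀ * (l.map Y).prod * prodS r s l =
      prodS r s l * (l.map Z).prod * S₀ * (l.map W).reverse.prod
  | [], _, _, _, _, _, _ => by simp [prodS]
  | i :: l, hl, h1, h2, h3, c, cr => by
    rw [List.nodup_cons] at hl
    have hi : ∀ j ∈ l, i ≠ j := fun j hj h => hl.1 (h ▸ hj)
    have mi : i ∈ i :: l := by simp
    have ml : ∀ {j}, j ∈ l → j ∈ i :: l := fun hj => by simp [hj]
    have ih := multisite (S₀ := S₀) (X := X) (Y := Y) (Z := Z) (W := W) (s := s) (r := r) hl.2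
      (fun i hi => h1 i (ml hi)) (fun i hi j hj => h2 i (ml hi) j (ml hj))
      (fun i hi j hj => h3 i (ml hi) j (ml hj)) (fun i hi j hj => c i (ml hi) j (ml hj))
      (fun i hi j hj k hk => cr i (ml hi) j (ml hj) k (ml hk))
    have e1 := exchange_prod (w := W i) (y := Y) (r := r i) hl.2
      (fun j hj => h2 i mi j (ml hj) (hi j hj))
      (fun j hj k hk hjk => ((cr k (ml hk) i mi j (ml hj) (hi k hk).symm hjk.symm (hi j hj)).2.1).symm)
    have e2 := exchange_reverse_prod (z := Z i) (x := X) (r := r i) hl.2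
      (fun j hj => h3 i mi j (ml hj) (hi j hj))
      (fun j hj k hk hjk => ((cr k (ml hk) i mi j (ml hj) (hi k hk).symm hjk.symm (hi j hj)).1).symm)
    have c1 : Commute (l.map Y).prod (s i) := (commute_map_prod fun j hj =>
      ((c j (ml hj) i mi (hi j hj).symm).2.1).symm).symm
    have c2 : Commute (l.map X).reverse.prod (s i) := by
      rw [← List.map_reverse]
      refine (commute_map_prod fun j hj => ?_).symm
      rw [List.mem_reverse] at hj
      exact ((c j (ml hj) i mi (hi j hj).symm).1).symm
    have c3 : Commute S₀ (l.map (r i)).prod :=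
      commute_map_prod fun j hj => (c i mi j (ml hj) (hi j hj)).2.2.2.2
    have c4 : Commute (W i) (prodS r s l) := commute_prodS hl.2
      (fun j hj => (c i mi j (ml hj) (hi j hj)).2.2.2.1)
      (fun j hj k hk hjk => (cr i mi j (ml hj) k (ml hk) (hi j hj) (hi k hk) hjk).2.2.2)
    have c5 : Commute (Z i) (prodS r s l) := commute_prodS hl.2
      (fun j hj => (c i mi j (ml hj) (hi j hj)).2.2.1)
      (fun j hj k hk hjk => (cr i mi j (ml hj) k (ml hk) (hi j hj) (hi k hk) hjk).2.2.1)
    have h1i := h1 i mi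
    simp only [prodS, List.map_cons, List.prod_cons, List.reverse_cons, List.prod_append,
      List.prod_nil, mul_one]
    generalize (l.map Y).prod = PY at *
    generalize (l.map Z).prod = PZ at *
    generalize (l.map X).reverse.prod = PX at *
    generalize (l.map W).reverse.prod = PW at *
    generalize (l.map (r i)).prod = R at *
    generalize prodS r s l = T at *
    calc PX * X i * S₀ * (Y i * PY) * (s i * R * T)
        = PX * X i * S₀ * Y i * (PY * s i) * R * T := by simp only [mul_assoc]
      _ = PX * (X i * S₀ * Y i * s i) * PY * R * T := by rw [c1.eq]; simp only [mul_assoc]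
      _ = (PX * s i) * Z i * S₀ * (W i * PY * R) * T := by rw [h1i]; simp only [mul_assoc]
      _ = s i * PX * Z i * (S₀ * R) * PY * (W i * T) := by rw [c2.eq, e1]; simp only [mul_assoc]
      _ = s i * (PX * Z i * R) * S₀ * PY * T * W i := by rw [c3.eq, c4.eq]; simp only [mul_assoc]
      _ = s i * R * Z i * (PX * S₀ * PY * T) * W i := by rw [e2]; simp only [mul_assoc]
      _ = s i * R * (Z i * T) * PZ * S₀ * PW * W i := by rw [ih]; simp only [mul_assoc]
      _ = s i * R * T * (Z i * PZ) * S₀ * (PW * W i) := by rw [c5.eq]; simp only [mul_assoc]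

end Multisite

/-! ### Fusion -/

section Fusion

variable {N : ℕ} {S D : Type*} [CommRing S] [Ring D] [Algebra S D]
  {ι : Type*} [DecidableEq ι] [Fintype ι]

/-- `F x_m = c_m F` for the Jucys–Murphy elements `x_m = ∑_{i < m} P_im`, where `m` is in the list
and `i < m` means that `i` precedes `m` in the list. -/
def JMEigen (F : Matrix (ι → Fin N) (ι → Fin N) D) (c : ι → S) (l : List ι) : Prop :=
  ∀ l' m, l' ++ [m] <+: l → F * (l'.map fun i => Pm N D i m).sum = c m • F

theorem JMEigen.initial {F : Matrix (ι → Fin N) (ι → Fin N) D} {c : ι → S} {l l₁ : List ι}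
    (h : JMEigen F c l) (h₁ : l₁ <+: l) : JMEigen F c l₁ :=
  fun l' m hl => h l' m (hl.trans h₁)

theorem JMEigen.last {F : Matrix (ι → Fin N) (ι → Fin N) D} {c : ι → S} {l : List ι} {m : ι}
    (h : JMEigen F c (l ++ [m])) : F * (l.map fun i => Pm N D i m).sum = c m • F :=
  h l m (List.prefix_refl _)

theorem JMEigen.snoc {F : Matrix (ι → Fin N) (ι → Fin N) D} {c : ι → S} {l : List ι} {m : ι}
    (h : JMEigen F c l) (hm : F * (l.map fun i => Pm N D i m).sum = c m • F) :
    JMEigen F c (l ++ [m]) := by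
  intro l' k hl
  rcases List.prefix_concat_iff.1 hl with h1 | h1
  · obtain ⟨h2, h3⟩ := List.append_inj' h1 rfl
    obtain rfl : k = m := by simpa using h3
    rw [h2]; exact hm
  · exact h l' k h1

theorem fusion_P {F : Matrix (ι → Fin N) (ι → Fin N) D} {c p : ι → S} {p₀ : S} {l : List ι}
    (hF : JMEigen F c l) (hl : l.Nodup) (hp : ∀ i ∈ l, p i * (1 - c i * p₀) = p₀) :
    ∀ m ∉ l, F * (l.map fun i => 1 - p i • Pm N D i m).reverse.prod =
      F * (1 - p₀ • (l.map fun i => Pm N D i m).sum) := by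
  induction l using List.reverseRecOn with
  | nil => intro m _; simp
  | append_singleton l k ih =>
    intro m hm
    rw [List.nodup_append] at hl
    have hkl : k ∉ l := fun h => hl.2.2 k h k (by simp) rfl
    have hml : m ∉ l := fun h => hm (by simp [h])
    have hmk : m ≠ k := fun h => hm (by simp [h])
    have ih' := ih (hF.initial (List.prefix_append _ _)) hl.1 fun i hi => hp i (by simp [hi])
    have hk := hF.last
    have pk := hp k (by simp)
    have sw : ∀ i ∈ l, Pm N D k m * Pm N D i m = Pm N D i k * Pm N D k m := by
      intro i hi
      have h1 : i ≠ k := fun h => hkl (h ▸ hi)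
      have h2 : i ≠ m := fun h => hml (h ▸ hi)
      rw [Pm, permM_mul_Pm, Equiv.swap_apply_right, Equiv.swap_apply_of_ne_of_ne h1 h2]
    have e1 : Pm N D k m * (l.map fun i => 1 - p i • Pm N D i m).reverse.prod =
        (l.map fun i => 1 - p i • Pm N D i k).reverse.prod * Pm N D k m := by
      clear ih ih' hF hk hp hl hkl hml hm
      induction l with
      | nil => simp
      | cons i l ih =>
        have hi := sw i (by simp)
        simp only [List.map_cons, List.reverse_cons, List.prod_append, List.prod_cons,
          List.prod_nil, mul_one]
        rw [← mul_assoc, ih fun j hj => sw j (by simp [hj]), mul_assoc, mul_assoc]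
        congr 1
        rw [mul_sub, sub_mul, mul_smul_comm, hi, smul_mul_assoc, mul_one, one_mul]
    rw [List.map_append, List.reverse_append, List.map_append, List.sum_append]
    simp only [List.map_cons, List.map_nil, List.reverse_cons, List.reverse_nil, List.nil_append,
      List.prod_append, List.prod_cons, List.prod_nil, mul_one, List.sum_cons, List.sum_nil,
      add_zero]
    rw [sub_mul, one_mul, smul_mul_assoc, e1, mul_sub, ih' m hml, mul_smul_comm, ← mul_assoc,
      ih' k hkl]
    simp only [mul_sub, sub_mul, mul_one, smul_mul_assoc, mul_smul_comm, mul_add, hk]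
    have := congrArg (fun z : S => z • (F * Pm N D k m)) pk
    linear_combination (norm := module) -this

theorem fusion_Q {F : Matrix (ι → Fin N) (ι → Fin N) D} {c q : ι → S} {q₀ : S} {l : List ι}
    (hF : JMEigen F c l) (hl : l.Nodup) (hq : ∀ i ∈ l, q i * (1 - c i * q₀) = q₀) :
    ∀ m ∉ l, F * (l.map fun i => 1 - q i • Qm N D i m).prod =
      F * (1 - q₀ • (l.map fun i => Qm N D i m).sum) := by
  induction l using List.reverseRecOn with
  | nil => intro m _; simp
  | append_singleton l k ih =>
    intro m hm
    rw [List.nodup_append] at hl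
    have hkl : k ∉ l := fun h => hl.2.2 k h k (by simp) rfl
    have hml : m ∉ l := fun h => hm (by simp [h])
    have hmk : m ≠ k := fun h => hm (by simp [h])
    have ih' := ih (hF.initial (List.prefix_append _ _)) hl.1 (fun i hi => hq i (by simp [hi])) m hml
    have hk := hF.last
    have qk := hq k (by simp)
    have sw : (l.map fun i => Qm N D i m).sum * Qm N D k m =
        (l.map fun i => Pm N D i k).sum * Qm N D k m := by
      clear ih ih' hF hk hq hl
      induction l with
      | nil => simp
      | cons i l ih =>
        have h1 : i ≠ k := fun h => hkl (by simp [h])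
        have h2 : i ≠ m := fun h => hml (by simp [h])
        simp only [List.map_cons, List.sum_cons, add_mul]
        rw [ih (fun h => hm (by simp at h ⊢; tauto)) (fun h => hkl (by simp [h]))
          (fun h => hml (by simp [h])), Qm_comm k m, Qm_mul_Qm h2 h1 hmk]
    rw [List.map_append, List.prod_append, List.map_append, List.sum_append]
    simp only [List.map_cons, List.map_nil, List.prod_cons, List.prod_nil, mul_one, List.sum_cons,
      List.sum_nil, add_zero]
    rw [← mul_assoc, ih', mul_assoc]
    simp only [mul_sub, sub_mul, mul_one, one_mul, smul_mul_assoc, mul_smul_comm, mul_add, sw]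
    rw [← mul_assoc F, hk]
    simp only [smul_mul_assoc]
    have := congrArg (fun z : S => z • (F * Qm N D k m)) qk
    linear_combination (norm := module) -this

end Fusion

/-! ### Polynomial functions of a complex parameter -/

section PolyFun

variable (S : Type*) [CommRing S] [Algebra Kh S] (R : Type*) [Ring R] [Algebra S R]

/-- Complex numbers as scalars. -/
def cst : ℂ →+* S := (algebraMap Kh S).comp PowerSeries.C

/-- The ring of polynomial functions `ℂ → R`. -/
def polyFun : Subring (ℂ → R) :=
  (Polynomial.eval₂RingHom' (RingHom.pi fun _ : ℂ => RingHom.id R)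
    (fun a => algebraMap S R (cst S a)) fun r => funext fun a =>
      ((Algebra.commutes (cst S a) r).symm : _ * _ = _ * _)).range

variable {S R}

theorem mem_polyFun_iff {f : ℂ → R} : f ∈ polyFun S R ↔
    ∃ p : Polynomial R, ∀ a, f a = p.sum fun k b => cst S a ^ k • b := by
  have key : ∀ (p : Polynomial R) (a : ℂ),
      Polynomial.eval₂ (RingHom.pi fun _ : ℂ => RingHom.id R)
        (fun a => algebraMap S R (cst S a)) p a = p.sum fun k b => cst S a ^ k • b := by
    intro p a
    rw [Polynomial.eval₂_eq_sum, Polynomial.sum, Finset.sum_apply, Polynomial.sum]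
    refine Finset.sum_congr rfl fun k _ => ?_
    rw [Algebra.smul_def, map_pow]
    exact ((Algebra.commute_algebraMap_left (cst S a) (p.coeff k)).pow_left k).symm.eq
  constructor
  · rintro ⟨p, rfl⟩
    exact ⟨p, fun a => key p a⟩
  · rintro ⟨p, hp⟩
    exact ⟨p, funext fun a => (key p a).trans (hp a).symm⟩

theorem const_mem_polyFun (r : R) : (fun _ => r) ∈ polyFun S R :=
  ⟨Polynomial.C r, by
    change Polynomial.eval₂ _ _ _ = _
    rw [Polynomial.eval₂_C]; rfl⟩

theorem cst_mem_polyFun : (fun a => algebraMap S R (cst S a)) ∈ polyFun S R :=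
  ⟨Polynomial.X, by
    change Polynomial.eval₂ _ _ _ = _
    rw [Polynomial.eval₂_X]⟩

theorem smul_mem_polyFun {f : ℂ → S} (hf : f ∈ polyFun S S) (r : R) :
    (fun a => f a • r) ∈ polyFun S R := by
  obtain ⟨p, hp⟩ := mem_polyFun_iff.1 hf
  have : (fun a => f a • r) = ∑ k ∈ p.support,
      (fun a => algebraMap S R (cst S a)) ^ k * fun _ => p.coeff k • r := by
    funext a
    rw [hp, Polynomial.sum, Finset.sum_smul, Finset.sum_apply]
    refine Finset.sum_congr rfl fun k _ => ?_
    rw [Pi.mul_apply, Pi.pow_apply, ← map_pow (algebraMap S R), ← Algebra.smul_def, smul_smul,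
      smul_eq_mul]
  rw [this]
  exact Subring.sum_mem _ fun k _ => Subring.mul_mem _ (Subring.pow_mem _ cst_mem_polyFun k)
    (const_mem_polyFun _)

theorem polyFun_map {R' : Type*} [Ring R'] [Algebra S R'] (φ : R →ₗ[S] R') {f : ℂ → R}
    (hf : f ∈ polyFun S R) : (fun a => φ (f a)) ∈ polyFun S R' := by
  obtain ⟨p, hp⟩ := mem_polyFun_iff.1 hf
  have : (fun a => φ (f a)) = ∑ k ∈ p.support,
      (fun a => algebraMap S R' (cst S a)) ^ k * fun _ => φ (p.coeff k) := by
    funext a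
    rw [hp, Polynomial.sum, map_sum, Finset.sum_apply]
    refine Finset.sum_congr rfl fun k _ => ?_
    rw [Pi.mul_apply, Pi.pow_apply, ← map_pow (algebraMap S R'), ← Algebra.smul_def, map_smul]
  rw [this]
  exact Subring.sum_mem _ fun k _ => Subring.mul_mem _ (Subring.pow_mem _ cst_mem_polyFun k)
    (const_mem_polyFun _)

theorem list_prod_mem_polyFun {ι : Type*} {l : List ι} {f : ι → ℂ → R}
    (h : ∀ i ∈ l, f i ∈ polyFun S R) : (fun a => (l.map fun i => f i a).prod) ∈ polyFun S R := by
  induction l with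
  | nil => exact Subring.one_mem _
  | cons i l ih =>
    simp only [List.map_cons, List.prod_cons]
    exact Subring.mul_mem _ (h i (by simp)) (ih fun j hj => h j (by simp [hj]))

theorem polyFun_eq_zero {f : ℂ → R} (hf : f ∈ polyFun S R) {s : Set ℂ} (hs : s.Finite)
    (h : ∀ a ∉ s, f a = 0) : f = 0 := by
  obtain ⟨p, hp⟩ := mem_polyFun_iff.1 hf
  let _ : Module ℂ R := Module.compHom R (cst S)
  have hsm : ∀ (a : ℂ) (r : R), a • r = cst S a • r := fun _ _ => rfl
  have key : ∀ k, p.coeff k = 0 := by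
    intro k
    rw [← Module.forall_dual_apply_eq_zero_iff ℂ]
    intro φ
    let P : Polynomial ℂ := ∑ k ∈ p.support, Polynomial.monomial k (φ (p.coeff k))
    have hP : P = 0 := by
      refine Polynomial.eq_zero_of_infinite_isRoot P (Set.Infinite.mono ?_ hs.infinite_compl)
      intro a ha
      change P.eval a = 0
      have h0 := congrArg φ ((hp a).symm.trans (h a ha))
      rw [map_zero, Polynomial.sum, map_sum] at h0
      rw [Polynomial.eval_finsetSum, ← h0]
      refine Finset.sum_congr rfl fun k _ => ?_
      rw [Polynomial.eval_monomial, ← map_pow, ← hsm, map_smul, smul_eq_mul, mul_comm]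
    have h1 : P.coeff k = φ (p.coeff k) := by
      simp only [P, Polynomial.finsetSum_coeff, Polynomial.coeff_monomial, Finset.sum_ite_eq']
      split_ifs with h2
      · rfl
      · rw [Polynomial.notMem_support_iff.1 h2, map_zero]
    rw [← h1, hP, Polynomial.coeff_zero]
  funext a
  rw [hp, Polynomial.sum]
  exact Finset.sum_eq_zero fun k _ => by rw [key, smul_zero]

end PolyFun

/-! ### Absorption of the Young idempotents -/

section Absorb

theorem list_prod_smul {S A κ : Type*} [CommRing S] [Ring A] [Algebra S A] (g : κ → S) (f : κ → A)
    (l : List κ) : (l.map fun i => g i • f i).prod = (l.map g).prod • (l.map f).prod := by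
  induction l with
  | nil => simp
  | cons i l ih => simp only [List.map_cons, List.prod_cons, ih, smul_mul_smul_comm]

variable {N M : ℕ} {S D : Type*} [CommRing S] [Algebra Kh S] [Ring D] [Algebra S D]
  {ι : Type*} [DecidableEq ι] [Fintype ι]

theorem JMEigen.mul {F Y : Matrix (ι → Fin N) (ι → Fin N) D} {c : ι → S} {l : List ι}
    (h : JMEigen F c l) (hY : ∀ i ∈ l, ∀ j ∈ l, i ≠ j → Commute (Pm N D i j) Y) (hl : l.Nodup) :
    JMEigen (F * Y) c l := by
  intro l' m hm
  have : Commute Y (l'.map fun i => Pm N D i m).sum := by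
    refine Commute.list_sum_right _ _ fun x hx => ?_
    obtain ⟨i, hi, rfl⟩ := List.mem_map.1 hx
    have h1 := (hm.sublist.nodup hl)
    rw [List.nodup_append] at h1
    exact (hY i (hm.subset (by simp [hi])) m (hm.subset (by simp)) (h1.2.2 i hi m (by simp))).symm
  rw [mul_assoc, this.eq, ← mul_assoc, h l' m hm, smul_mul_assoc]

theorem commute_Pm_sum {f : ι → Matrix (ι → Fin N) (ι → Fin N) D}
    {i j : ι} (hf : ∀ k, Pm N D i j * f k = f (Equiv.swap i j k) * Pm N D i j) {l : List ι}
    (hl : l.Nodup) (hi : i ∈ l) (hj : j ∈ l) : Commute (Pm N D i j) (l.map f).sum := by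
  rw [← List.sum_toFinset _ hl, Commute, SemiconjBy, Finset.mul_sum, Finset.sum_mul]
  refine Finset.sum_bij' (fun k _ => Equiv.swap i j k) (fun k _ => Equiv.swap i j k) ?_ ?_
    (fun _ _ => by simp) (fun _ _ => by simp) fun k _ => hf k
  all_goals
    intro k hk
    rw [List.mem_toFinset] at hk ⊢
    rw [Equiv.swap_apply_def]; split_ifs <;> assumption

theorem commute_Pm_sum_Qm {i j m : ι} (him : m ≠ i) (hjm : m ≠ j) (l : List ι) (hl : l.Nodup)
    (hi : i ∈ l) (hj : j ∈ l) : Commute (Pm N D i j) (l.map fun k => Qm N D k m).sum :=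
  commute_Pm_sum (fun k => by
    rw [Pm, permM_mul_Qm, Equiv.swap_apply_of_ne_of_ne him hjm]) hl hi hj

variable (q : ℂ → S) (s : ℂ → Matrix (Fin N) (Fin N) D)

theorem polyFun_of_add (hq : ∀ a b, q (a + b) * (1 - cst S b * q a) = q a) {a : ℂ}
    (hqM : q a ^ M = 0) : (fun b => q (a + b)) ∈ polyFun S S := by
  have : (fun b => q (a + b)) = (fun _ => q a) *
      ∑ k ∈ Finset.range M, ((fun b => algebraMap S S (cst S b)) * fun _ => q a) ^ k := by
    funext b
    have h1 : (1 - cst S b * q a) * ∑ k ∈ Finset.range M, (cst S b * q a) ^ k = 1 := by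
      rw [mul_neg_geom_sum, mul_pow, hqM, mul_zero, sub_zero]
    simp only [Pi.mul_apply, Finset.sum_apply, Pi.pow_apply, Algebra.algebraMap_self,
      RingHom.id_apply]
    calc q (a + b) = q (a + b) * (1 - cst S b * q a) * ∑ k ∈ Finset.range M, (cst S b * q a) ^ k := by
          rw [mul_assoc, h1, mul_one]
      _ = _ := by rw [hq]
  rw [this]
  exact Subring.mul_mem _ (const_mem_polyFun _) (Subring.sum_mem _ fun k _ => Subring.pow_mem _
    (Subring.mul_mem _ cst_mem_polyFun (const_mem_polyFun _)) _)

theorem gval_mem_polyFun {f : ℂ → S} (hf : f ∈ polyFun S S) :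
    (fun a => gval N M (f a)) ∈ polyFun S S := by
  have : (fun a => gval N M (f a)) = ∑ k ∈ Finset.range M,
      (fun _ => algebraMap Kh S (PowerSeries.C (gCoeff N k))) * f ^ k := by
    funext a
    rw [gval, Finset.sum_apply]
    rfl
  rw [this]
  exact Subring.sum_mem _ fun k _ => Subring.mul_mem _ (const_mem_polyFun _) (Subring.pow_mem _ hf _)

theorem Rbt_mem_polyFun {f : ℂ → S} (hf : f ∈ polyFun S S) (i j : ι) :
    (fun a => Rbt N M D i j (f a)) ∈ polyFun S (Matrix (ι → Fin N) (ι → Fin N) D) := by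
  have h1 := gval_mem_polyFun (N := N) (M := M) hf
  exact Subring.add_mem _ (smul_mem_polyFun h1 _)
    (smul_mem_polyFun (Subring.neg_mem _ (Subring.mul_mem _ h1 hf)) _)

theorem jmEigen_prodS (hq : ∀ a b, q (a + b) * (1 - cst S b * q a) = q a)
    (hqM : ∀ a, q a ^ M = 0)
    (hs : ∀ m : ι, (fun a => siteM m (s a)) ∈ polyFun S (Matrix (ι → Fin N) (ι → Fin N) D))
    (hrefl : ∀ (i j : ι) (a b : ℂ), i ≠ j → a ≠ b →
      (1 - cst S (a - b)⁻¹ • Pm N D i j) * siteM i (s a) * Rbt N M D i j (q (a + b)) *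
        siteM j (s b) =
      siteM j (s b) * Rbt N M D i j (q (a + b)) * siteM i (s a) *
        (1 - cst S (a - b)⁻¹ • Pm N D i j))
    {E : Matrix (ι → Fin N) (ι → Fin N) D} {c : ι → ℂ} {l : List ι} (hl : l.Nodup)
    (hE : JMEigen E (fun i => cst S (c i)) l) :
    JMEigen (E * prodS (fun i j => Rbt N M D i j (q (c i + c j))) (fun i => siteM i (s (c i))) l)
      (fun i => cst S (c i)) l := by
  induction l using List.reverseRecOn with
  | nil => intro l' m h; simp at h
  | append_singleton l m ih =>
    have hl' := List.nodup_append.1 hl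
    have hml : m ∉ l := fun h => hl'.2.2 m h m (by simp) rfl
    have hne : ∀ i ∈ l, i ≠ m := fun i hi h => hml (h ▸ hi)
    have ih' := ih hl'.1 (hE.initial (List.prefix_append _ _))
    set T := prodS (fun i j => Rbt N M D i j (q (c i + c j))) (fun i => siteM i (s (c i))) l with hT
    have hsnoc : prodS (fun i j => Rbt N M D i j (q (c i + c j))) (fun i => siteM i (s (c i)))
        (l ++ [m]) = T * (l.map fun i => Rbt N M D i m (q (c i + c m))).prod * siteM m (s (c m)) := by
      refine prodS_snoc hl ?_ ?_
      · intro i hi j hj hij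
        exact Rbt_siteM_comm (hne i hi) hij.symm (hne j hj) _ _
      · intro i hi j hj k hk hij hik hjk
        exact Rbt_Rbt_comm (hne i hi) hjk hij hik (hne j hj).symm (hne k hk).symm _ _
    let Y : ℂ → Matrix (ι → Fin N) (ι → Fin N) D := fun a =>
      (l.map fun i => Rbt N M D i m (q (c i + a))).prod
    have hYeig : ∀ a, JMEigen (E * T * Y a * siteM m (s a)) (fun i => cst S (c i)) l := by
      intro a
      have e : E * T * Y a = (l.map fun i => gval N M (q (c i + a))).prod •
          (E * T * (1 - q a • (l.map fun k => Qm N D k m).sum)) := by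
        have h1 := fusion_Q ih' hl'.1 (q := fun i => q (c i + a)) (q₀ := q a)
          (fun i _ => by rw [add_comm (c i)]; exact hq a (c i)) m hml
        simp only [Y, Rbt_eq, list_prod_smul, mul_smul_comm, h1]
      rw [e, ← mul_smul_comm, mul_assoc]
      refine ih'.mul (fun i hi j hj hij => ?_) hl'.1
      refine Commute.mul_right (Commute.smul_right ?_ _)
        (Pm_siteM_comm (hne i hi).symm (hne j hj).symm _)
      exact (Commute.one_right _).sub_right ((commute_Pm_sum_Qm (hne i hi).symm (hne j hj).symm l
        hl'.1 hi hj).smul_right _)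
    have hmain : ∀ a ∉ ({0} ∪ {x | ∃ i ∈ l, c i = x} : Set ℂ),
        E * T * Y a * siteM m (s a) *
            (cst S a • 1 - (l.map fun i => Pm N D i m).sum) -
          (cst S a - cst S (c m)) • (E * siteM m (s a) * Y a * T) = 0 := by
      intro a ha
      simp only [Set.mem_union, Set.mem_singleton_iff, Set.mem_ofPred_eq, not_or, not_exists,
        not_and] at ha
      have ha0 : cst S a * cst S a⁻¹ = 1 := by rw [← map_mul, mul_inv_cancel₀ ha.1, map_one]
      have hpi : ∀ i ∈ l, cst S (a - c i)⁻¹ * (1 - cst S (c i) * cst S a⁻¹) = cst S a⁻¹ := by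
        intro i hi
        rw [← map_mul, ← map_one (cst S), ← map_sub, ← map_mul]
        congr 1
        have : a - c i ≠ 0 := sub_ne_zero.2 fun h => ha.2 i hi h.symm
        field_simp [ha.1]
      have hms := multisite (S₀ := siteM m (s a))
        (X := fun i => 1 - cst S (a - c i)⁻¹ • Pm N D i m)
        (Y := fun i => Rbt N M D i m (q (c i + a))) (Z := fun i => Rbt N M D i m (q (c i + a)))
        (W := fun i => 1 - cst S (a - c i)⁻¹ • Pm N D i m) (s := fun i => siteM i (s (c i)))
        (r := fun i j => Rbt N M D i j (q (c i + c j))) hl'.1 ?_ ?_ ?_ ?_ ?_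
      · have f1 := fusion_P (hE.initial (List.prefix_append _ _)) hl'.1 hpi m hml
        have f2 := fusion_P (hYeig a) hl'.1 hpi m hml
        rw [← hT] at hms
        change _ * _ * Y a * T = T * Y a * _ * _ at hms
        have h3 := congrArg (E * ·) hms
        simp only [← mul_assoc] at h3
        rw [f1, f2, mul_sub, mul_smul_comm, hE.last, mul_one] at h3
        have h4 := congrArg (cst S a • ·) h3
        simp only [mul_sub, sub_mul, smul_sub, mul_smul_comm, smul_mul_assoc, smul_smul, mul_one,
          ← mul_assoc, ha0, one_smul, one_mul] at h4
        simp only [mul_sub, mul_smul_comm, mul_one, sub_smul]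
        rw [← h4, sub_self]
      · intro i hi
        have := hrefl m i a (c i) (hne i hi).symm fun h => ha.2 i hi h.symm
        simpa only [Pm_comm m i, Rbt_comm m i, add_comm a (c i)] using this
      · intro i hi j hj hij
        have h1 : Rbt N M D i j (q (c i + c j)) = gval N M (q (c i + c j)) •
          (1 - q (c i + c j) • Qm N D i j) := Rbt_eq _ _ _
        have h2 : Rbt N M D j m (q (c j + a)) = gval N M (q (c j + a)) •
          (1 - q (c j + a) • Qm N D m j) := by rw [Rbt_eq, Qm_comm]
        have hy := ybe_aux (N := N) (D := D) (p := cst S (a - c i)⁻¹) (q := q (c j + a))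
          (r := q (c i + c j)) ?_ (hne i hi).symm (hne j hj).symm hij
        · simp only [h1, h2, Pm_comm i m, smul_mul_assoc, mul_smul_comm, hy]
          rw [smul_comm]
        · have h3 := hq (c i + c j) (a - c i)
          rw [show c i + c j + (a - c i) = c j + a by ring] at h3
          have h4 : cst S (a - c i)⁻¹ * cst S (a - c i) = 1 := by
            rw [← map_mul, inv_mul_cancel₀ (sub_ne_zero.2 fun h => ha.2 i hi h.symm), map_one]
          linear_combination cst S (a - c i)⁻¹ * h3 + q (c j + a) * q (c i + c j) * h4
      · intro i hi j hj hij
        have h1 : Rbt N M D i j (q (c i + c j)) = gval N M (q (c i + c j)) •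
          (1 - q (c i + c j) • Qm N D j i) := by rw [Rbt_eq, Qm_comm]
        have h2 : Rbt N M D i m (q (c i + a)) = gval N M (q (c i + a)) •
          (1 - q (c i + a) • Qm N D m i) := by rw [Rbt_eq, Qm_comm]
        have hy := ybe_aux (N := N) (D := D) (p := cst S (a - c j)⁻¹) (q := q (c i + a))
          (r := q (c i + c j)) ?_ (hne j hj).symm (hne i hi).symm hij.symm
        · simp only [h1, h2, Pm_comm j m, smul_mul_assoc, mul_smul_comm, hy]
          rw [smul_comm]
        · have h3 := hq (c i + c j) (a - c j)
          rw [show c i + c j + (a - c j) = c i + a by ring] at h3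
          have h4 : cst S (a - c j)⁻¹ * cst S (a - c j) = 1 := by
            rw [← map_mul, inv_mul_cancel₀ (sub_ne_zero.2 fun h => ha.2 j hj h.symm), map_one]
          linear_combination cst S (a - c j)⁻¹ * h3 + q (c i + a) * q (c i + c j) * h4
      · intro i hi j hj hij
        have e1 : Commute (1 - cst S (a - c i)⁻¹ • Pm N D i m) (siteM j (s (c j))) :=
          (Commute.one_left _).sub_left ((Pm_siteM_comm hij.symm (hne j hj) _).smul_left _)
        have e2 := Rbt_siteM_comm (M := M) (hne i hi) hij.symm (hne j hj) (q (c i + a)) (s (c j))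
        exact ⟨e1, e2, e2, e1, (Rbt_siteM_comm hij (hne i hi).symm (hne j hj).symm _ _).symm⟩
      · intro i hi j hj k hk hij hik hjk
        have e1 : Commute (1 - cst S (a - c i)⁻¹ • Pm N D i m) (Rbt N M D j k (q (c j + c k))) := by
          refine (Commute.one_left _).sub_left (Commute.smul_left ?_ _)
          exact (commute_smul_one_add
            (Pm_Qm_comm hij.symm (hne j hj) hik.symm (hne k hk)).symm _ _).symm
        have e2 := Rbt_Rbt_comm (N := N) (M := M) (D := D) (hne i hi) hjk hij hik (hne j hj).symm
          (hne k hk).symm (q (c i + a)) (q (c j + c k))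
        exact ⟨e1, e2, e2, e1⟩
    have hYpoly : Y ∈ polyFun S (Matrix (ι → Fin N) (ι → Fin N) D) :=
      list_prod_mem_polyFun fun i _ => Rbt_mem_polyFun (polyFun_of_add q hq (hqM (c i))) i m
    have hzero := polyFun_eq_zero (S := S) (f := fun a => E * T * Y a * siteM m (s a) *
            (cst S a • 1 - (l.map fun i => Pm N D i m).sum) -
          (cst S a - cst S (c m)) • (E * siteM m (s a) * Y a * T)) ?_
      ((Set.finite_singleton 0).union ((List.finite_toSet l).image c |>.subset ?_)) hmain
    · have h0 := congrFun hzero (c m)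
      simp only [Pi.zero_apply, sub_self, zero_smul, sub_zero, mul_sub, mul_smul_comm, mul_one,
        sub_eq_zero] at h0
      rw [hsnoc, ← mul_assoc, ← mul_assoc]
      exact (hYeig (c m)).snoc h0.symm
    · have hc : (fun a => cst S a • (1 : Matrix (ι → Fin N) (ι → Fin N) D)) ∈
          polyFun S (Matrix (ι → Fin N) (ι → Fin N) D) :=
        smul_mem_polyFun (R := Matrix (ι → Fin N) (ι → Fin N) D) cst_mem_polyFun 1
      have e : (fun a => (cst S a - cst S (c m)) • (E * siteM m (s a) * Y a * T)) =
        (fun a => cst S a • (1 : Matrix (ι → Fin N) (ι → Fin N) D) - cst S (c m) • 1) *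
        fun a => E * siteM m (s a) * Y a * T := by
        funext a
        rw [Pi.mul_apply, sub_mul, smul_mul_assoc, smul_mul_assoc, one_mul, sub_smul]
      refine Subring.sub_mem _ ?_ (e ▸ ?_)
      · exact Subring.mul_mem _ (Subring.mul_mem _ (Subring.mul_mem _ (const_mem_polyFun _) hYpoly)
          (hs m)) (Subring.sub_mem _ hc (const_mem_polyFun _))
      · exact Subring.mul_mem _ (Subring.sub_mem _ hc (const_mem_polyFun _))
          (Subring.mul_mem _ (Subring.mul_mem _ (Subring.mul_mem _ (const_mem_polyFun _) (hs m))
            hYpoly) (const_mem_polyFun _))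
    · rintro _ ⟨i, hi, rfl⟩
      exact ⟨i, hi, rfl⟩

end Absorb

/-! ### Spectrum of the Jucys–Murphy elements -/

section JucysMurphy

variable {N n : ℕ}

/-- The Jucys–Murphy element as a matrix. -/
def jmM (N : ℕ) {n : ℕ} (D : Type*) [Ring D] (k : Fin n) :
    Matrix (Fin n → Fin N) (Fin n → Fin N) D :=
  ∑ i ∈ Finset.univ.filter fun i : Fin n => i < k, Pm N D i k

theorem Pm_jmM_comm {D : Type*} [Ring D] {i j k : Fin n} (hi : i < k) (hj : j < k) :
    Commute (Pm N D i j) (jmM N D k) := by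
  rw [jmM, Commute, SemiconjBy, Finset.mul_sum, Finset.sum_mul]
  refine Finset.sum_bij' (fun l _ => Equiv.swap i j l) (fun l _ => Equiv.swap i j l) ?_ ?_
    (fun _ _ => by simp) (fun _ _ => by simp) ?_
  · intro l hl
    simp only [Finset.mem_filter, Finset.mem_univ, true_and] at hl ⊢
    rw [Equiv.swap_apply_def]; split_ifs <;> assumption
  · intro l hl
    simp only [Finset.mem_filter, Finset.mem_univ, true_and] at hl ⊢
    rw [Equiv.swap_apply_def]; split_ifs <;> assumption
  · intro l _
    rw [Pm, permM_mul_Pm, Equiv.swap_apply_of_ne_of_ne hi.ne' hj.ne']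

theorem jmM_comm {D : Type*} [Ring D] (j k : Fin n) : Commute (jmM N D j) (jmM N D k) := by
  have key : ∀ {j k : Fin n}, j < k → Commute (jmM N D j) (jmM N D k) := by
    intro j k hjk
    refine Commute.sum_left _ _ _ fun i hi => Pm_jmM_comm ?_ hjk
    simp only [Finset.mem_filter, Finset.mem_univ, true_and] at hi
    exact hi.trans hjk
  rcases lt_trichotomy j k with h | rfl | h
  · exact key h
  · exact Commute.refl _
  · exact (key h).symm

theorem jmM_succ {D : Type*} [Ring D] {k : ℕ} (hk : k + 1 < n) :
    Pm N D ⟨k, by omega⟩ ⟨k + 1, hk⟩ * jmM N D ⟨k + 1, hk⟩ =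
      jmM N D (⟨k, by omega⟩ : Fin n) * Pm N D ⟨k, by omega⟩ ⟨k + 1, hk⟩ + 1 := by
  have h1 : (Finset.univ.filter fun i : Fin n => i < ⟨k + 1, hk⟩) =
      insert ⟨k, by omega⟩ (Finset.univ.filter fun i : Fin n => i < ⟨k, by omega⟩) := by
    ext i
    simp only [Finset.mem_filter, Finset.mem_univ, true_and, Finset.mem_insert, Fin.lt_def,
      Fin.ext_iff]
    omega
  rw [jmM, jmM, h1, Finset.sum_insert (by simp), mul_add, Pm_mul_self, add_comm, Finset.mul_sum,
    Finset.sum_mul]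
  congr 1
  refine Finset.sum_congr rfl fun i hi => ?_
  simp only [Finset.mem_filter, Finset.mem_univ, true_and, Fin.lt_def] at hi
  rw [Pm, permM_mul_Pm, Equiv.swap_apply_right, Equiv.swap_apply_of_ne_of_ne]
  · simp only [ne_eq, Fin.ext_iff]; omega
  · simp only [ne_eq, Fin.ext_iff]; omega

theorem exists_joint_eigenvector {m : Type*} [Fintype m] [DecidableEq m] {x y : Matrix m m ℂ}
    (hxy : Commute x y) {μ : ℂ} {v : m → ℂ} (hv : v ≠ 0) (hyv : y *ᵥ v = μ • v) :
    ∃ (w : m → ℂ) (l : ℂ), w ≠ 0 ∧ y *ᵥ w = μ • w ∧ x *ᵥ w = l • w := by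
  let W := Module.End.eigenspace (Matrix.toLin' y) μ
  have hmem : ∀ w, w ∈ W ↔ y *ᵥ w = μ • w := fun w => by
    rw [Module.End.mem_eigenspace_iff, Matrix.toLin'_apply]
  have hW : ∀ w ∈ W, Matrix.toLin' x w ∈ W := by
    intro w hw
    rw [hmem] at hw ⊢
    rw [Matrix.toLin'_apply, Matrix.mulVec_mulVec, ← hxy.eq, ← Matrix.mulVec_mulVec, hw,
      Matrix.mulVec_smul]
  have : Nontrivial W := ⟨⟨⟨v, (hmem v).2 hyv⟩, 0, fun h => hv (congrArg Subtype.val h)⟩⟩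
  obtain ⟨l, hl⟩ := Module.End.exists_eigenvalue ((Matrix.toLin' x).restrict hW)
  obtain ⟨w, hw⟩ := hl.exists_hasEigenvector
  refine ⟨w, l, fun h => hw.2 (Subtype.ext h), (hmem _).1 w.2, ?_⟩
  have := congrArg Subtype.val (Module.End.mem_eigenspace_iff.1 hw.1)
  rw [LinearMap.restrict_apply] at this
  exact this

theorem jmM_eigenvalue : ∀ (k : ℕ) (hk : k < n) (μ : ℂ) (v : (Fin n → Fin N) → ℂ), v ≠ 0 →
    jmM N ℂ (⟨k, hk⟩ : Fin n) *ᵥ v = μ • v → ∃ a : ℤ, -(k : ℤ) ≤ a ∧ a ≤ k ∧ μ = a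
  | 0, hk, μ, v, hv, h => by
    refine ⟨0, by simp, by simp, ?_⟩
    have : jmM N ℂ (⟨0, hk⟩ : Fin n) = 0 := by
      rw [jmM]
      exact Finset.sum_eq_zero fun i hi => by simp [Fin.lt_def] at hi
    rw [this, Matrix.zero_mulVec] at h
    simpa [hv] using h.symm
  | k + 1, hk, μ, v, hv, h => by
    obtain ⟨w, l, hw, hy, hx⟩ := exists_joint_eigenvector (jmM_comm ⟨k, by omega⟩ ⟨k + 1, hk⟩) hv h
    obtain ⟨a, ha1, ha2, rfl⟩ := jmM_eigenvalue k (by omega) l w hw hx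
    have hs := congrArg (· *ᵥ w) (jmM_succ (N := N) (D := ℂ) hk)
    have hss := congrArg (· *ᵥ w) (Pm_mul_self (N := N) (D := ℂ) (⟨k, by omega⟩ : Fin n) ⟨k + 1, hk⟩)
    simp only [← Matrix.mulVec_mulVec, Matrix.add_mulVec, Matrix.one_mulVec, hy,
      Matrix.mulVec_smul] at hs hss
    set x := jmM N ℂ (⟨k, by omega⟩ : Fin n) with hxdef
    set s := Pm N ℂ (⟨k, by omega⟩ : Fin n) ⟨k + 1, hk⟩ with hsdef
    by_cases hμ : μ = a
    · exact ⟨a, by push_cast; omega, by push_cast; omega, hμ⟩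
    have hd : μ - a ≠ 0 := sub_ne_zero.2 hμ
    by_cases hz : s *ᵥ w - (μ - a)⁻¹ • w = 0
    · rw [sub_eq_zero] at hz
      rw [hz, Matrix.mulVec_smul, hz, smul_smul] at hss
      have h1 : (μ - a)⁻¹ * (μ - a)⁻¹ = 1 := by
        have : ((μ - a)⁻¹ * (μ - a)⁻¹ - 1) • w = 0 := by rw [sub_smul, hss, one_smul, sub_self]
        rcases smul_eq_zero.1 this with h | h
        · exact sub_eq_zero.1 h
        · exact absurd h hw
      have h2 : (μ - a - 1) * (μ - a + 1) = 0 := by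
        field_simp at h1
        linear_combination -h1
      rcases mul_eq_zero.1 h2 with h3 | h3
      · exact ⟨a + 1, by push_cast; omega, by push_cast; omega, by push_cast; linear_combination h3⟩
      · exact ⟨a - 1, by push_cast; omega, by push_cast; omega, by push_cast; linear_combination h3⟩
    · have h3 : x *ᵥ (s *ᵥ w - (μ - a)⁻¹ • w) = μ • (s *ᵥ w - (μ - a)⁻¹ • w) := by
        rw [Matrix.mulVec_sub, Matrix.mulVec_smul, hx, ← sub_eq_iff_eq_add.2 hs]
        have h4 : (μ - a)⁻¹ * (μ - a) = 1 := inv_mul_cancel₀ hd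
        have h5 := congrArg (fun z : ℂ => z • w) h4
        simp only [mul_smul, sub_smul, one_smul] at h5
        linear_combination (norm := module) h5
      obtain ⟨b, hb1, hb2, hb⟩ := jmM_eigenvalue k (by omega) μ _ hz h3
      exact ⟨b, by push_cast; omega, by push_cast; omega, hb⟩

theorem list_prod_sub_mulVec {m : Type*} [Fintype m] [DecidableEq m] {x : Matrix m m ℂ} {v : m → ℂ}
    {μ : ℂ} (h : x *ᵥ v = μ • v) (l : List ℤ) :
    (l.map fun a : ℤ => x - algebraMap ℂ _ (a : ℂ)).prod *ᵥ v =
      (l.map fun a : ℤ => μ - (a : ℂ)).prod • v := by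
  induction l with
  | nil => simp
  | cons a l ih =>
    simp only [List.map_cons, List.prod_cons]
    rw [← Matrix.mulVec_mulVec, ih, Matrix.mulVec_smul, Matrix.sub_mulVec, h,
      Algebra.algebraMap_eq_smul_one, Matrix.smul_mulVec, Matrix.one_mulVec]
    module

theorem jmM_isHermitian (k : Fin n) : (jmM N ℂ k).IsHermitian := by
  rw [Matrix.IsHermitian, jmM, Matrix.conjTranspose_sum]
  refine Finset.sum_congr rfl fun i _ => ?_
  ext I J
  rw [Matrix.conjTranspose_apply]
  simp only [Pm, permM, Matrix.of_apply]
  have : J = I ∘ ⇑((Equiv.swap i k)⁻¹ : Equiv.Perm (Fin n)) ↔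
      I = J ∘ ⇑((Equiv.swap i k)⁻¹ : Equiv.Perm (Fin n)) := by
    rw [Equiv.swap_inv]
    constructor <;> rintro rfl <;> funext x <;> simp
  by_cases h : I = J ∘ ⇑((Equiv.swap i k)⁻¹ : Equiv.Perm (Fin n))
  · rw [if_pos h, if_pos (this.2 h)]; simp
  · rw [if_neg h, if_neg (mt this.1 h)]; simp

theorem list_prod_jmM (k : Fin n) {l : List ℤ} (hl : ∀ a : ℤ, -(k : ℤ) ≤ a → a ≤ k → a ∈ l) :
    (l.map fun a : ℤ => jmM N ℂ k - algebraMap ℂ _ (a : ℂ)).prod = 0 := by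
  have hA := jmM_isHermitian (N := N) k
  set B := (l.map fun a : ℤ => jmM N ℂ k - algebraMap ℂ _ (a : ℂ)).prod with hB
  have hBU : B * (hA.eigenvectorUnitary : Matrix _ _ ℂ) = 0 := by
    ext I j
    have h1 : jmM N ℂ k *ᵥ (hA.eigenvectorBasis j).ofLp =
        ((hA.eigenvalues j : ℝ) : ℂ) • (hA.eigenvectorBasis j).ofLp := by
      rw [hA.mulVec_eigenvectorBasis]; rfl
    have hne : (hA.eigenvectorBasis j).ofLp ≠ 0 := by
      intro h
      have h2 := hA.eigenvectorBasis.orthonormal.ne_zero j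
      apply h2
      ext i
      exact congrFun h i
    obtain ⟨a, ha1, ha2, ha⟩ := jmM_eigenvalue k.1 k.2 _ _ hne h1
    have h3 := list_prod_sub_mulVec h1 l
    have h4 : (l.map fun a : ℤ => ((hA.eigenvalues j : ℝ) : ℂ) - (a : ℂ)).prod = 0 :=
      List.prod_eq_zero (List.mem_map.2 ⟨a, hl a ha1 ha2, by rw [ha, sub_self]⟩)
    rw [h4, zero_smul, ← hB] at h3
    have h5 := congrFun h3 I
    rw [Matrix.mul_apply]
    simpa [Matrix.mulVec, dotProduct, Matrix.IsHermitian.eigenvectorUnitary_apply] using h5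
  have h6 := Unitary.mul_star_self_of_mem hA.eigenvectorUnitary.2
  rw [← mul_one B, ← h6, ← mul_assoc, hBU, zero_mul]

end JucysMurphy

/-! ### The Young idempotents -/

section Young

variable {N : ℕ} {S D : Type*} [CommRing S] [Algebra Kh S] [Ring D] [Algebra S D]

/-- The action of the group algebra, as a homomorphism. -/
def permActionHom (N n : ℕ) : MonoidAlgebra ℂ (Equiv.Perm (Fin n)) →ₐ[ℂ]
    Matrix (Fin n → Fin N) (Fin n → Fin N) ℂ :=
  MonoidAlgebra.lift ℂ _ _ ⟨⟨permM N ℂ, permM_one⟩, permM_mul⟩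

theorem permAction_eq {n : ℕ} (e : MonoidAlgebra ℂ (Equiv.Perm (Fin n))) :
    permAction N e = permActionHom N n e := by
  rw [permActionHom, MonoidAlgebra.lift_apply, Finsupp.sum_fintype]
  · rfl
  · exact fun _ => zero_smul _ _

theorem permAction_jucysMurphy {n : ℕ} (k : Fin n) :
    permActionHom N n (jucysMurphy n k) = jmM N ℂ k := by
  rw [jucysMurphy, map_sum, jmM]
  exact Finset.sum_congr rfl fun i _ => MonoidAlgebra.lift_of _ _

variable {ν : YoungDiagram} (U : StandardTableau ν)

/-- The contents which occur in the `k`-th factor of the idempotent. -/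
def jmRange (k : Fin ν.card) : List ℤ :=
  ((List.range (2 * (k : ℕ) + 1)).map fun m : ℕ => (m : ℤ) - ((k : ℕ) : ℤ)).filter
    fun a => a ≠ U.content k

theorem permAction_idempotent : permAction N U.idempotent =
    (List.ofFn fun k : Fin ν.card => ((jmRange U k).map fun a : ℤ =>
      ((U.content k : ℂ) - (a : ℂ))⁻¹ • (jmM N ℂ k - algebraMap ℂ _ (a : ℂ))).prod).prod := by
  rw [permAction_eq, StandardTableau.idempotent, map_list_prod, List.map_ofFn]
  congr 1
  refine congrArg List.ofFn (funext fun k => ?_)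
  rw [Function.comp_apply, map_list_prod, List.map_map, jmRange]
  simp only [List.bind_eq_flatMap, List.pure_def, ← List.map_eq_flatMap, List.map_map]
  congr 1
  refine List.map_congr_left fun a _ => ?_
  rw [Function.comp_apply, Function.comp_apply, map_smul, map_sub, permAction_jucysMurphy,
    AlgHom.commutes]

theorem permAction_mul_jmM (k : Fin ν.card) :
    permAction N U.idempotent * jmM N ℂ k = (U.content k : ℂ) • permAction N U.idempotent := by
  have hfac : ((jmRange U k).map fun a : ℤ =>
      ((U.content k : ℂ) - (a : ℂ))⁻¹ • (jmM N ℂ k - algebraMap ℂ _ (a : ℂ))).prod *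
      (jmM N ℂ k - algebraMap ℂ _ ((U.content k : ℤ) : ℂ)) = 0 := by
    rw [list_prod_smul, smul_mul_assoc]
    have h1 := list_prod_jmM (N := N) k (l := jmRange U k ++ [U.content k]) (by
      intro a h1 h2
      by_cases ha : a = U.content k
      · simp [ha]
      · refine List.mem_append_left _ (List.mem_filter.2 ⟨List.mem_map.2 ⟨(a + k).toNat, ?_, ?_⟩, ?_⟩)
        · rw [List.mem_range]; omega
        · omega
        · simpa using ha)
    rw [List.map_append, List.prod_append, List.map_cons, List.map_nil, List.prod_singleton] at h1
    rw [h1, smul_zero]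
  have hz : permAction N U.idempotent * (jmM N ℂ k - algebraMap ℂ _ ((U.content k : ℤ) : ℂ)) = 0 := by
    rw [permAction_idempotent]
    have : ∀ l : List (Fin ν.card), k ∈ l → (l.map fun k : Fin ν.card =>
        ((jmRange U k).map fun a : ℤ =>
        ((U.content k : ℂ) - (a : ℂ))⁻¹ • (jmM N ℂ k - algebraMap ℂ _ (a : ℂ))).prod).prod *
        (jmM N ℂ k - algebraMap ℂ _ ((U.content k : ℤ) : ℂ)) = 0 := by
      intro l hl
      obtain ⟨l₁, l₂, rfl⟩ := List.append_of_mem hl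
      rw [List.map_append, List.prod_append, List.map_cons, List.prod_cons, mul_assoc, mul_assoc]
      have hc : Commute (jmM N ℂ k - algebraMap ℂ _ ((U.content k : ℤ) : ℂ))
          (l₂.map fun k : Fin ν.card => ((jmRange U k).map fun a : ℤ =>
            ((U.content k : ℂ) - (a : ℂ))⁻¹ • (jmM N ℂ k - algebraMap ℂ _ (a : ℂ))).prod).prod := by
        refine commute_map_prod fun j _ => commute_map_prod fun a _ => Commute.smul_right ?_ _
        exact ((jmM_comm k j).sub_right (Algebra.commute_algebraMap_right _ _)).sub_left
          (Algebra.commute_algebraMap_left _ _)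
      rw [← hc.eq, ← mul_assoc _ (jmM N ℂ k - _), hfac, zero_mul, mul_zero]
    simpa only [List.ofFn_eq_map] using this (List.finRange _) (List.mem_finRange k)
  rw [mul_sub, sub_eq_zero] at hz
  rw [hz, ← Algebra.commutes, ← Algebra.smul_def]

variable (N S D) in
/-- The idempotent `E_U` over the ring `D`. -/
def youngE : Matrix (Fin ν.card → Fin N) (Fin ν.card → Fin N) D :=
  ((algebraMap S D).comp (cst S)).mapMatrix (permAction N U.idempotent)

theorem mapMatrix_Pm {D' : Type*} [Ring D'] {ι : Type*} [DecidableEq ι] [Fintype ι]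
    (φ : D' →+* D) (i j : ι) : φ.mapMatrix (Pm N D' i j) = Pm N D i j := by
  ext I J
  simp only [Pm, permM, RingHom.mapMatrix_apply, Matrix.map_apply, Matrix.of_apply]
  split_ifs <;> simp

theorem mapMatrix_jmM {D' : Type*} [Ring D'] {n : ℕ} (φ : D' →+* D) (k : Fin n) :
    φ.mapMatrix (jmM N D' k) = jmM N D k := by
  rw [jmM, map_sum, jmM]
  exact Finset.sum_congr rfl fun i _ => mapMatrix_Pm φ i k

theorem mapMatrix_smul' {m : Type*} [Fintype m] [DecidableEq m] (z : ℂ) (X : Matrix m m ℂ) :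
    ((algebraMap S D).comp (cst S)).mapMatrix (z • X) =
      cst S z • ((algebraMap S D).comp (cst S)).mapMatrix X := by
  ext I J
  simp only [RingHom.mapMatrix_apply, Matrix.map_apply, Matrix.smul_apply, smul_eq_mul, map_mul,
    RingHom.comp_apply, Algebra.smul_def (cst S z)]

theorem mapMatrix_algebraMap' {m : Type*} [Fintype m] [DecidableEq m] (z : ℂ) :
    ((algebraMap S D).comp (cst S)).mapMatrix (algebraMap ℂ (Matrix m m ℂ) z) =
      cst S z • 1 := by
  rw [Algebra.algebraMap_eq_smul_one, mapMatrix_smul', map_one]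

theorem youngE_eq : youngE N S D U =
    ((List.finRange ν.card).map fun k : Fin ν.card => ((jmRange U k).map fun a : ℤ =>
      cst S ((U.content k : ℂ) - (a : ℂ))⁻¹ • (jmM N D k - cst S (a : ℂ) • 1)).prod).prod := by
  rw [youngE, permAction_idempotent, List.ofFn_eq_map, map_list_prod, List.map_map]
  congr 1
  refine List.map_congr_left fun k _ => ?_
  rw [Function.comp_apply, map_list_prod, List.map_map]
  congr 1
  refine List.map_congr_left fun a _ => ?_
  rw [Function.comp_apply, mapMatrix_smul', map_sub, mapMatrix_jmM, mapMatrix_algebraMap']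

theorem finRange_prefix {n : ℕ} {l' : List (Fin n)} {m : Fin n} (h : l' ++ [m] <+: List.finRange n) :
    ∀ A : Type _, ∀ [AddCommMonoid A] (f : Fin n → A), (l'.map f).sum =
      ∑ i ∈ Finset.univ.filter fun i : Fin n => i < m, f i := by
  intro A _ f
  obtain ⟨t, ht⟩ := h
  have hnd : (l' ++ [m] ++ t).Nodup := ht ▸ List.nodup_finRange n
  have hs : (l' ++ [m] ++ t).Pairwise (· < ·) := ht ▸ List.pairwise_lt_finRange n
  have hl' : l'.Nodup := (List.nodup_append.1 (List.nodup_append.1 hnd).1).1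
  rw [← List.sum_toFinset _ hl']
  refine Finset.sum_congr ?_ fun _ _ => rfl
  ext i
  simp only [List.mem_toFinset, Finset.mem_filter, Finset.mem_univ, true_and]
  rw [List.pairwise_append, List.pairwise_append] at hs
  constructor
  · intro hi
    exact hs.1.2.2 i hi m (by simp)
  · intro hi
    have hmem : i ∈ l' ++ [m] ++ t := ht ▸ List.mem_finRange i
    simp only [List.mem_append, List.mem_singleton] at hmem
    rcases hmem with (h | h) | h
    · exact h
    · exact absurd h hi.ne
    · exact absurd (hs.2.2 m (by simp) i h) hi.not_gt

theorem youngE_jmEigen :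
    JMEigen (youngE N S D U) (fun k => cst S (U.content k : ℂ)) (List.finRange ν.card) := by
  intro l' m h
  rw [finRange_prefix h _ fun i => Pm N D i m]
  change _ * jmM N D m = _
  rw [youngE, ← mapMatrix_jmM ((algebraMap S D).comp (cst S)), ← map_mul, permAction_mul_jmM,
    mapMatrix_smul']

theorem JMEigen.mul_youngE {F : Matrix (Fin ν.card → Fin N) (Fin ν.card → Fin N) D}
    (hF : JMEigen F (fun k => cst S (U.content k : ℂ)) (List.finRange ν.card)) :
    F * youngE N S D U = F := by
  have h1 : ∀ k, F * jmM N D k = cst S (U.content k : ℂ) • F := by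
    intro k
    obtain ⟨l₁, l₂, hl⟩ := List.append_of_mem (List.mem_finRange k)
    have hp : l₁ ++ [k] <+: List.finRange ν.card := ⟨l₂, by rw [hl]; simp⟩
    have := hF l₁ k hp
    rwa [finRange_prefix hp _ fun i => Pm N D i k] at this
  have h2 : ∀ (k) (l : List ℤ), (∀ a ∈ l, a ≠ U.content k) → F * (l.map fun a : ℤ =>
      cst S ((U.content k : ℂ) - (a : ℂ))⁻¹ • (jmM N D k - cst S (a : ℂ) • 1)).prod = F := by
    intro k l hl
    induction l with
    | nil => simp
    | cons a l ih =>
      have ha : (U.content k : ℂ) - (a : ℂ) ≠ 0 :=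
        sub_ne_zero.2 fun h => hl a (by simp) (by exact_mod_cast h.symm)
      rw [List.map_cons, List.prod_cons, ← mul_assoc, mul_smul_comm, mul_sub, h1, mul_smul_comm,
        mul_one, ← sub_smul, smul_smul, ← map_sub, ← map_mul, inv_mul_cancel₀ ha, map_one, one_smul,
        ih fun b hb => hl b (by simp [hb])]
  rw [youngE_eq]
  induction List.finRange ν.card with
  | nil => simp
  | cons k l ih =>
    rw [List.map_cons, List.prod_cons, ← mul_assoc, h2, ih]
    intro a ha
    simpa using (List.mem_filter.1 ha).2

theorem youngE_mul_self : youngE N S D U * youngE N S D U = youngE N S D U :=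
  (youngE_jmEigen U).mul_youngE

theorem youngE_commute {Z : Matrix (Fin ν.card → Fin N) (Fin ν.card → Fin N) D}
    (h : ∀ i j, Commute Z (Pm N D i j)) : Commute Z (youngE N S D U) := by
  rw [youngE_eq]
  refine commute_map_prod fun k _ => commute_map_prod fun a _ => Commute.smul_right ?_ _
  exact (Commute.sum_right _ _ _ fun i _ => h i k).sub_right ((Commute.one_right Z).smul_right _)

end Young

/-! ### Adding an auxiliary tensor factor -/

section Aux

variable {N : ℕ} {κ : Type*} [DecidableEq κ] [Fintype κ] {D : Type*} [Ring D]

/-- A multi-index with the auxiliary index `a`. -/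
def cons (a : Fin N) (K : κ → Fin N) : Option κ → Fin N := fun o => o.elim a K

@[simp] theorem cons_none (a : Fin N) (K : κ → Fin N) : cons a K none = a := rfl

@[simp] theorem cons_some (a : Fin N) (K : κ → Fin N) (i : κ) : cons a K (some i) = K i := rfl

theorem cons_eta (I : Option κ → Fin N) : cons (I none) (fun i => I (some i)) = I := by
  funext o; cases o <;> rfl

theorem cons_inj {a b : Fin N} {K L : κ → Fin N} : cons a K = cons b L ↔ a = b ∧ K = L := by
  constructor
  · intro h
    exact ⟨congrFun h none, funext fun i => congrFun h (some i)⟩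
  · rintro ⟨rfl, rfl⟩; rfl

theorem update_cons_some (a : Fin N) (K : κ → Fin N) (i : κ) (b : Fin N) :
    Function.update (cons a K) (some i) b = cons a (Function.update K i b) := by
  funext o
  cases o with
  | none => simp
  | some j => by_cases h : j = i <;> simp [h]

theorem update_cons_none (a : Fin N) (K : κ → Fin N) (b : Fin N) :
    Function.update (cons a K) none b = cons b K := by
  funext o
  cases o <;> simp

theorem sum_option {A : Type*} [AddCommMonoid A] (f : (Option κ → Fin N) → A) :
    ∑ I, f I = ∑ a, ∑ K, f (cons a K) := by
  rw [← Fintype.sum_prod_type' fun a K => f (cons a K)]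
  let e : (Option κ → Fin N) ≃ Fin N × (κ → Fin N) :=
    { toFun := fun I => (I none, fun i => I (some i))
      invFun := fun x => cons x.1 x.2
      left_inv := fun I => cons_eta I
      right_inv := fun _ => rfl }
  refine Fintype.sum_equiv e _ _ fun I => ?_
  exact congrArg f (cons_eta I).symm

/-- `1 ⊗ X`, with the auxiliary factor `none`. -/
def emb : Matrix (κ → Fin N) (κ → Fin N) D →+*
    Matrix (Option κ → Fin N) (Option κ → Fin N) D where
  toFun X := Matrix.of fun I J =>
    if I none = J none then X (fun i => I (some i)) (fun i => J (some i)) else 0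
  map_one' := by
    ext I J
    obtain ⟨a, I, rfl⟩ : ∃ a K, I = cons a K := ⟨_, _, (cons_eta I).symm⟩
    obtain ⟨b, J, rfl⟩ : ∃ a K, J = cons a K := ⟨_, _, (cons_eta J).symm⟩
    change (if a = b then (1 : Matrix (κ → Fin N) (κ → Fin N) D) I J else 0) = _
    simp only [Matrix.one_apply, cons_inj]
    split_ifs <;> simp_all
  map_mul' X Y := by
    ext I J
    simp only [Matrix.of_apply, Matrix.mul_apply, sum_option, cons_none, cons_some]
    by_cases h : I none = J none
    · rw [if_pos h, Finset.sum_eq_single (I none)]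
      · simp [h]
      · intro b _ hb
        simp [hb.symm]
      · simp
    · rw [if_neg h]
      refine (Finset.sum_eq_zero fun a _ => Finset.sum_eq_zero fun K _ => ?_).symm
      by_cases ha : I none = a
      · exact mul_eq_zero_of_right _ (if_neg (ha ▸ h))
      · exact mul_eq_zero_of_left (if_neg ha) _
  map_zero' := by ext I J; simp
  map_add' X Y := by
    ext I J
    simp only [Matrix.of_apply, Matrix.add_apply]
    split_ifs <;> simp

theorem emb_cons (X : Matrix (κ → Fin N) (κ → Fin N) D) (a b : Fin N) (K L : κ → Fin N) :
    emb X (cons a K) (cons b L) = if a = b then X K L else 0 := rfl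

theorem emb_smul {S : Type*} [CommRing S] [Algebra S D] (z : S)
    (X : Matrix (κ → Fin N) (κ → Fin N) D) : emb (z • X) = z • emb X := by
  ext I J
  simp only [emb, RingHom.coe_mk, MonoidHom.coe_mk, OneHom.coe_mk, Matrix.of_apply,
    Matrix.smul_apply]
  split_ifs <;> simp

theorem matrix_ext_cons {X Y : Matrix (Option κ → Fin N) (Option κ → Fin N) D}
    (h : ∀ a b K L, X (cons a K) (cons b L) = Y (cons a K) (cons b L)) : X = Y := by
  ext I J
  rw [← cons_eta I, ← cons_eta J]
  exact h _ _ _ _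

theorem emb_siteM (i : κ) (X : Matrix (Fin N) (Fin N) D) : emb (siteM i X) = siteM (some i) X := by
  refine matrix_ext_cons fun a b K L => ?_
  rw [emb_cons]
  simp only [siteM, Matrix.of_apply, cons_some]
  by_cases h : a = b
  · subst h
    rw [if_pos rfl]
    congr 1
    refine propext ⟨fun h k hk => ?_, fun h k hk => h (some k) (by simpa using hk)⟩
    cases k with
    | none => rfl
    | some k => exact h k (by simpa using hk)
  · rw [if_neg h, if_neg fun h' => h (h' none (by simp))]

theorem emb_permM_swap (i j : κ) : emb (Pm N D i j) = Pm N D (some i) (some j) := by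
  have hsw : ∀ L : κ → Fin N, ∀ b, cons b L ∘ Equiv.swap (some i) (some j) =
      cons b (L ∘ Equiv.swap i j) := by
    intro L b
    funext o
    cases o with
    | none => simp [Equiv.swap_apply_of_ne_of_ne]
    | some k =>
      simp only [Function.comp_apply, cons_some, Equiv.swap_apply_def, Option.some.injEq]
      split_ifs <;> rfl
  refine matrix_ext_cons fun a b K L => ?_
  rw [emb_cons]
  simp only [Pm, permM, Matrix.of_apply]
  have e : (cons a K = cons b L ∘ ⇑((Equiv.swap (some i) (some j))⁻¹ : Equiv.Perm (Option κ))) ↔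
      a = b ∧ K = L ∘ ⇑((Equiv.swap i j)⁻¹ : Equiv.Perm κ) := by
    rw [Equiv.swap_inv, Equiv.swap_inv, hsw, cons_inj]
  by_cases h : a = b
  · rw [if_pos h]
    by_cases h' : K = L ∘ ⇑((Equiv.swap i j)⁻¹ : Equiv.Perm κ)
    · rw [if_pos h', if_pos (e.2 ⟨h, h'⟩)]
    · rw [if_neg h', if_neg (fun h'' => h' (e.1 h'').2)]
  · rw [if_neg h, if_neg (fun h'' => h (e.1 h'').1)]

theorem emb_Qm (i j : κ) : emb (Qm N D i j) = Qm N D (some i) (some j) := by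
  refine matrix_ext_cons fun a b K L => ?_
  rw [emb_cons]
  simp only [Qm, Matrix.of_apply, cons_some]
  by_cases h : a = b
  · subst h
    rw [if_pos rfl]
    congr 1
    refine propext (and_congr_right fun _ => and_congr_right fun _ =>
      ⟨fun h k hk hk' => ?_, fun h k hk hk' => h (some k) (by simpa using hk) (by simpa using hk')⟩)
    cases k with
    | none => rfl
    | some k => exact h k (by simpa using hk) (by simpa using hk')
  · rw [if_neg h]
    refine (if_neg ?_).symm
    exact fun h' => h (h'.2.2 none (by simp) (by simp))

/-- The trace over all factors except the auxiliary one. -/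
def ptr (Z : Matrix (Option κ → Fin N) (Option κ → Fin N) D) : Matrix (Fin N) (Fin N) D :=
  Matrix.of fun a b => ∑ K, Z (cons a K) (cons b K)

/-- The transposition in all factors except the auxiliary one. -/
def pT (Z : Matrix (Option κ → Fin N) (Option κ → Fin N) D) :
    Matrix (Option κ → Fin N) (Option κ → Fin N) D :=
  Matrix.of fun I J => Z (cons (I none) fun i => J (some i)) (cons (J none) fun i => I (some i))

theorem pT_cons (Z : Matrix (Option κ → Fin N) (Option κ → Fin N) D) (a b : Fin N)
    (K L : κ → Fin N) : pT Z (cons a K) (cons b L) = Z (cons a L) (cons b K) := rfl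

theorem ptr_sub (Z Z' : Matrix (Option κ → Fin N) (Option κ → Fin N) D) :
    ptr (Z - Z') = ptr Z - ptr Z' := by
  ext a b
  simp [ptr]

theorem siteM_none_cons (s : Matrix (Fin N) (Fin N) D) (a b : Fin N) (K L : κ → Fin N) :
    siteM none s (cons a K) (cons b L) = if K = L then s a b else 0 := by
  simp only [siteM, Matrix.of_apply, cons_none]
  congr 1
  refine propext ⟨fun h => funext fun i => h (some i) (by simp), ?_⟩
  rintro rfl k hk
  cases k with
  | none => exact absurd rfl hk
  | some k => rfl

theorem ptr_siteM_mul (s : Matrix (Fin N) (Fin N) D)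
    (Z : Matrix (Option κ → Fin N) (Option κ → Fin N) D) :
    ptr (siteM none s * Z) = s * ptr Z := by
  ext a b
  simp only [ptr, Matrix.of_apply, Matrix.mul_apply, sum_option, siteM_none_cons, ite_mul, zero_mul,
    Finset.sum_ite_eq, Finset.mem_univ, if_true, Finset.mul_sum]
  exact Finset.sum_comm

theorem ptr_mul_siteM (s : Matrix (Fin N) (Fin N) D)
    (Z : Matrix (Option κ → Fin N) (Option κ → Fin N) D) :
    ptr (Z * siteM none s) = ptr Z * s := by
  ext a b
  simp only [ptr, Matrix.of_apply, Matrix.mul_apply, sum_option, siteM_none_cons, mul_ite, mul_zero,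
    Finset.sum_ite_eq', Finset.mem_univ, if_true, Finset.sum_mul]
  exact Finset.sum_comm

/-- Matrices with central entries. -/
def centralM (m D : Type*) [Fintype m] [DecidableEq m] [Ring D] : Subring (Matrix m m D) :=
  (Subring.center D).matrix

theorem mem_centralM {m : Type*} [Fintype m] [DecidableEq m] {Z : Matrix m m D} :
    Z ∈ centralM m D ↔ ∀ i j d, Commute (Z i j) d := by
  constructor
  · intro h i j d
    exact (Subring.mem_center_iff.1 (h i j) d).symm
  · intro h i j
    exact Subring.mem_center_iff.2 fun d => (h i j d).eq.symm

theorem ptr_emb_mul {E : Matrix (κ → Fin N) (κ → Fin N) D} (hE : E ∈ centralM _ D)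
    (Z : Matrix (Option κ → Fin N) (Option κ → Fin N) D) : ptr (emb E * Z) = ptr (Z * emb E) := by
  rw [mem_centralM] at hE
  ext a b
  simp only [ptr, Matrix.of_apply, Matrix.mul_apply, sum_option, emb_cons, ite_mul, mul_ite,
    zero_mul, mul_zero]
  have e1 : ∀ K : κ → Fin N, ∑ x, ∑ L, (if a = x then E K L * Z (cons x L) (cons b K) else 0) =
      ∑ L, E K L * Z (cons a L) (cons b K) := by
    intro K
    rw [Finset.sum_comm]
    exact Finset.sum_congr rfl fun L _ => by simp
  have e2 : ∀ K : κ → Fin N, ∑ x, ∑ L, (if x = b then Z (cons a K) (cons x L) * E L K else 0) =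
      ∑ L, Z (cons a K) (cons b L) * E L K := by
    intro K
    rw [Finset.sum_comm]
    exact Finset.sum_congr rfl fun L _ => by simp
  simp only [e1, e2]
  rw [Finset.sum_comm]
  exact Finset.sum_congr rfl fun L _ => Finset.sum_congr rfl fun K _ => (hE K L _).eq

theorem ptr_mul_emb_mul {L R : Matrix (Option κ → Fin N) (Option κ → Fin N) D}
    (hL : L ∈ centralM _ D) (hLR : pT L * pT R = 1)
    (Q : Matrix (κ → Fin N) (κ → Fin N) D) :
    ptr (L * emb Q * R) = Matrix.trace Q • 1 := by
  rw [mem_centralM] at hL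
  ext a b
  have h : ∀ I J, ∑ c, ∑ K, L (cons a K) (cons c I) * R (cons c J) (cons b K) =
      if a = b ∧ I = J then 1 else 0 := by
    intro I J
    have := congrFun (congrFun hLR (cons a I)) (cons b J)
    simpa only [Matrix.mul_apply, sum_option, pT_cons, Matrix.one_apply, cons_inj] using this
  have e : ∀ K : κ → Fin N, (L * emb Q * R) (cons a K) (cons b K) =
      ∑ I, ∑ J, ∑ c, Q I J * (L (cons a K) (cons c I) * R (cons c J) (cons b K)) := by
    intro K
    simp only [Matrix.mul_apply, sum_option, emb_cons, mul_ite, mul_zero, Finset.sum_mul, ite_mul,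
      zero_mul]
    calc _ = ∑ c, ∑ J, ∑ I, L (cons a K) (cons c I) * Q I J * R (cons c J) (cons b K) := by
          refine Finset.sum_congr rfl fun c _ => Finset.sum_congr rfl fun J _ => ?_
          rw [Finset.sum_comm]
          exact Finset.sum_congr rfl fun I _ => by simp
      _ = ∑ J, ∑ c, ∑ I, L (cons a K) (cons c I) * Q I J * R (cons c J) (cons b K) :=
          Finset.sum_comm
      _ = ∑ J, ∑ I, ∑ c, L (cons a K) (cons c I) * Q I J * R (cons c J) (cons b K) :=
          Finset.sum_congr rfl fun J _ => Finset.sum_comm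
      _ = ∑ I, ∑ J, ∑ c, L (cons a K) (cons c I) * Q I J * R (cons c J) (cons b K) :=
          Finset.sum_comm
      _ = _ := by
        refine Finset.sum_congr rfl fun I _ => Finset.sum_congr rfl fun J _ =>
          Finset.sum_congr rfl fun c _ => ?_
        rw [(hL _ _ (Q I J)).eq, mul_assoc]
  simp only [ptr, Matrix.of_apply, e]
  calc _ = ∑ I, ∑ J, Q I J * ∑ c, ∑ K, L (cons a K) (cons c I) * R (cons c J) (cons b K) := by
        rw [Finset.sum_comm]
        refine Finset.sum_congr rfl fun I _ => ?_
        rw [Finset.sum_comm]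
        refine Finset.sum_congr rfl fun J _ => ?_
        rw [Finset.sum_comm, Finset.mul_sum]
        exact Finset.sum_congr rfl fun c _ => (Finset.mul_sum _ _ _).symm
    _ = (Matrix.trace Q • (1 : Matrix (Fin N) (Fin N) D)) a b := by
        simp only [h, mul_ite, mul_one, mul_zero]
        by_cases hab : a = b
        · simp [hab, Matrix.trace]
        · simp [hab]

theorem ptr_absorb {E M : Matrix (κ → Fin N) (κ → Fin N) D}
    {L R : Matrix (Option κ → Fin N) (Option κ → Fin N) D}
    (hE : E ∈ centralM _ D) (hL : L ∈ centralM _ D) (hEE : E * E = E)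
    (hM : E * M * E = E * M) (hEL : emb E * L * emb E = emb E * L)
    (hER : emb E * R * emb E = emb E * R) (hLR : pT L * pT R = 1) :
    ptr (emb E * L * emb M * R) = Matrix.trace (E * M) • 1 := by
  have hM' : emb E * emb M * emb E = emb E * emb M := by rw [← map_mul, ← map_mul, hM]
  have h1 : emb E * L * emb M * R = emb E * (L * emb (E * M) * R * emb E) := by
    calc emb E * L * emb M * R = emb E * L * (emb E * emb M) * R := by
          rw [← mul_assoc (emb E * L), hEL]
      _ = emb E * L * emb E * emb M * (emb E * R) := by
          rw [← hM']; simp only [mul_assoc]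
      _ = emb E * L * (emb E * emb M * emb E) * R * emb E := by
          rw [← hER]; simp only [mul_assoc]
      _ = _ := by rw [hM', map_mul]; simp only [mul_assoc]
  have hEE' : emb (D := D) E * emb E = emb E := by rw [← map_mul, hEE]
  rw [h1, ptr_emb_mul hE, mul_assoc _ (emb E), hEE', ← ptr_mul_emb_mul hL hLR]
  congr 1
  calc L * emb (E * M) * R * emb E = L * (emb (E * M * E) * R * emb E) := by
        rw [hM]; simp only [mul_assoc]
    _ = L * (emb (E * M) * (emb E * R * emb E)) := by rw [map_mul emb (E * M) E]; simp only [mul_assoc]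
    _ = L * (emb (E * M * E) * R) := by rw [hER, map_mul emb (E * M) E]; simp only [mul_assoc]
    _ = _ := by rw [hM, mul_assoc]

theorem apply_update_of_commute {Z : Matrix (Option κ → Fin N) (Option κ → Fin N) D} {o : Option κ}
    (hZ : ∀ X, Commute Z (siteM o X)) (I J : Option κ → Fin N) (y : Fin N) :
    Z (Function.update I o y) J = if J o = y then Z I (Function.update J o (I o)) else 0 := by
  have h := congrFun (congrFun (hZ (Matrix.single (I o) y 1)).eq I) J
  simp only [Matrix.mul_apply] at h
  rw [Finset.sum_eq_single (Function.update J o (I o)),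
    Finset.sum_eq_single (Function.update I o y)] at h
  · simp only [siteM, Matrix.of_apply, Function.update_self, Matrix.single_apply] at h
    rw [if_pos fun k hk => Function.update_of_ne hk _ _,
      if_pos fun k hk => (Function.update_of_ne hk _ _).symm] at h
    simp only [true_and, eq_comm (a := y), mul_ite, mul_one, mul_zero, and_true, if_true,
      one_mul] at h
    exact h.symm
  · intro K _ hK
    simp only [siteM, Matrix.of_apply, Matrix.single_apply]
    by_cases h1 : ∀ k, k ≠ o → I k = K k
    · rw [if_pos h1, if_neg, zero_mul]
      rintro ⟨-, h2⟩
      refine hK (funext fun k => ?_)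
      by_cases hk : k = o
      · subst hk; simp [h2]
      · simp [hk, h1 k hk]
    · rw [if_neg h1, zero_mul]
  · simp
  · intro K _ hK
    simp only [siteM, Matrix.of_apply, Matrix.single_apply]
    by_cases h1 : ∀ k, k ≠ o → K k = J k
    · rw [if_pos h1, if_neg, mul_zero]
      rintro ⟨h2, -⟩
      refine hK (funext fun k => ?_)
      by_cases hk : k = o
      · subst hk; simp [h2]
      · simp [hk, h1 k hk]
    · rw [if_neg h1, mul_zero]
  · simp

theorem apply_update_cons {Z : Matrix (Option κ → Fin N) (Option κ → Fin N) D} {i : κ}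
    (hZ : ∀ X, Commute Z (siteM (some i) X)) (a b y : Fin N) (I J : κ → Fin N) :
    Z (cons a (Function.update I i y)) (cons b J) =
      if J i = y then Z (cons a I) (cons b (Function.update J i (I i))) else 0 := by
  rw [← update_cons_some, apply_update_of_commute hZ, update_cons_some]; rfl

theorem mul_Pm_cons (Z : Matrix (Option κ → Fin N) (Option κ → Fin N) D) (i : κ) (a b : Fin N)
    (K L : κ → Fin N) : (Z * Pm N D none (some i)) (cons a K) (cons b L) =
      Z (cons a K) (cons (L i) (Function.update L i b)) := by
  rw [Pm, mul_permM_apply, Equiv.swap_inv]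
  congr 1
  funext o
  cases o with
  | none => simp
  | some j =>
    by_cases h : j = i
    · subst h; simp
    · simp [Equiv.swap_apply_of_ne_of_ne, h]

theorem mul_Qm_cons (Z : Matrix (Option κ → Fin N) (Option κ → Fin N) D) (i : κ) (a b : Fin N)
    (K L : κ → Fin N) : (Z * Qm N D none (some i)) (cons a K) (cons b L) =
      if b = L i then ∑ x, Z (cons a K) (cons x (Function.update L i x)) else 0 := by
  rw [mul_Qm_apply (by simp)]
  simp only [update_cons_none, update_cons_some, cons_none, cons_some]

theorem pT_mul_Pm {Z : Matrix (Option κ → Fin N) (Option κ → Fin N) D} {i : κ}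
    (hZ : ∀ X, Commute Z (siteM (some i) X)) :
    pT (Z * Pm N D none (some i)) = pT Z * Qm N D none (some i) := by
  refine matrix_ext_cons fun a b I J => ?_
  rw [pT_cons, mul_Pm_cons, mul_Qm_cons]
  simp only [pT_cons]
  simp only [apply_update_cons hZ, Finset.sum_ite_eq, Finset.mem_univ, if_true]
  have h := apply_update_cons hZ a (I i) (J i) J (Function.update I i b)
  rw [Function.update_eq_self, Function.update_self, Function.update_idem] at h
  by_cases hb : b = J i
  · rw [if_pos hb, hb]
  · rw [if_neg hb, h, if_neg hb]

theorem pT_mul_Qm {Z : Matrix (Option κ → Fin N) (Option κ → Fin N) D} {i : κ}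
    (hZ : ∀ X, Commute Z (siteM (some i) X)) :
    pT (Z * Qm N D none (some i)) = pT Z * Pm N D none (some i) := by
  refine matrix_ext_cons fun a b I J => ?_
  rw [pT_cons, mul_Pm_cons, mul_Qm_cons, pT_cons, apply_update_cons hZ]
  simp only [eq_comm (a := b)]
  by_cases hb : I i = b
  · rw [if_pos hb, if_pos hb, Finset.sum_eq_single (J i)]
    · intro x _ hx
      have h := apply_update_cons hZ a x (J i) J (Function.update I i x)
      rw [Function.update_eq_self, Function.update_self, if_neg hx] at h
      exact h
    · simp
  · rw [if_neg hb, if_neg hb]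

theorem pT_one : pT (1 : Matrix (Option κ → Fin N) (Option κ → Fin N) D) = 1 := by
  refine matrix_ext_cons fun a b I J => ?_
  rw [pT_cons]
  simp only [Matrix.one_apply, cons_inj, eq_comm (a := J)]

theorem pT_add (Z Z' : Matrix (Option κ → Fin N) (Option κ → Fin N) D) :
    pT (Z + Z') = pT Z + pT Z' := rfl

theorem pT_smul {S : Type*} [CommRing S] [Algebra S D] (z : S)
    (Z : Matrix (Option κ → Fin N) (Option κ → Fin N) D) : pT (z • Z) = z • pT Z := rfl

variable {M : ℕ} {S : Type*} [CommRing S] [Algebra Kh S] [Algebra S D]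

theorem list_prod_commute_siteM {l : List κ} {F : κ → Matrix (Option κ → Fin N) (Option κ → Fin N) D}
    (hF : ∀ j k X, j ≠ k → Commute (F j) (siteM (some k) X)) {k : κ} (hk : k ∉ l)
    (X : Matrix (Fin N) (Fin N) D) : Commute (l.map F).prod (siteM (some k) X) :=
  (commute_map_prod fun j hj => (hF j k X fun h => hk (h ▸ hj)).symm).symm

theorem pT_prod_Rb (p : κ → S) {l : List κ} (hl : l.Nodup) :
    pT (l.map fun i => Rb N M D none (some i) (p i)).prod =
      (l.map fun i => Rbt N M D none (some i) (p i)).prod := by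
  induction l using List.reverseRecOn with
  | nil => exact pT_one
  | append_singleton l i ih =>
    rw [List.nodup_append] at hl
    simp only [List.map_append, List.map_cons, List.map_nil, List.prod_append, List.prod_singleton]
    rw [← ih hl.1, Rb, Rbt, mul_add, mul_add, mul_smul_comm, mul_smul_comm, mul_smul_comm,
      mul_smul_comm, mul_one, mul_one, pT_add, pT_smul, pT_smul, pT_mul_Pm]
    exact list_prod_commute_siteM (fun j k X hjk => Rb_siteM_comm (by simp) (by simpa using hjk.symm)
      _ _) fun h => hl.2.2 i h i (by simp) rfl

theorem pT_prod_Rbt (p : κ → S) {l : List κ} (hl : l.Nodup) :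
    pT (l.map fun i => Rbt N M D none (some i) (p i)).prod =
      (l.map fun i => Rb N M D none (some i) (p i)).prod := by
  induction l using List.reverseRecOn with
  | nil => exact pT_one
  | append_singleton l i ih =>
    rw [List.nodup_append] at hl
    simp only [List.map_append, List.map_cons, List.map_nil, List.prod_append, List.prod_singleton]
    rw [← ih hl.1, Rb, Rbt, mul_add, mul_add, mul_smul_comm, mul_smul_comm, mul_smul_comm,
      mul_smul_comm, mul_one, mul_one, pT_add, pT_smul, pT_smul, pT_mul_Qm]
    exact list_prod_commute_siteM (fun j k X hjk => Rbt_siteM_comm (by simp) (by simp)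
      (by simpa using hjk.symm) _ _) fun h => hl.2.2 i h i (by simp) rfl

end Aux

/-! ### The commutator of the trace with a generator matrix -/

section Core

variable {N M : ℕ} {S D : Type*} [CommRing S] [Algebra Kh S] [Ring D] [Algebra S D]

theorem absorb_of_intertwine {A : Type*} [Ring A] {E Z Y : A} (hE : E * E = E)
    (h : E * Z = Y * E) : E * Z * E = E * Z := by
  rw [h, mul_assoc, hE]

theorem absorb_inverse {A : Type*} [Ring A] {E Z Z' Y : A} (hE : E * E = E)
    (h : E * Z = Y * E) (hY : IsUnit Y) (hZ : Z * Z' = 1) : E * Z' * E = E * Z' := by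
  obtain ⟨y, rfl⟩ := hY
  refine absorb_of_intertwine hE (Y := ↑y⁻¹) ?_
  calc E * Z' = ↑y⁻¹ * (↑y * E) * Z' := by rw [← mul_assoc, Units.inv_mul, one_mul]
    _ = ↑y⁻¹ * E := by rw [← h, mul_assoc, mul_assoc, hZ, mul_one]

theorem emb_jmEigen {κ : Type*} [DecidableEq κ] [Fintype κ]
    {F : Matrix (κ → Fin N) (κ → Fin N) D} {c : κ → S} {l : List κ} (h : JMEigen F c l) :
    JMEigen (emb F) (fun o => o.elim 0 c) (l.map some) := by
  intro l' m hl
  obtain ⟨t, ht⟩ := hl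
  obtain ⟨a, b, rfl, hab, rfl⟩ := List.map_eq_append_iff.1 ht.symm
  obtain ⟨a₁, a₂, rfl, rfl, h2⟩ := List.map_eq_append_iff.1 hab
  obtain ⟨k, a₃, rfl, rfl, h3⟩ := List.map_eq_cons_iff.1 h2
  obtain rfl := List.map_eq_nil_iff.1 h3
  have := congrArg emb (h a₁ k ⟨b, rfl⟩)
  rw [map_mul, map_list_sum, List.map_map, emb_smul] at this
  rw [List.map_map]
  simp only [Function.comp_def, emb_permM_swap] at this ⊢
  exact this

theorem list_prod_mul_reverse_prod {A κ : Type*} [Monoid A] {f g : κ → A} {l : List κ}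
    (h : ∀ i ∈ l, f i * g i = 1) : (l.map f).prod * (l.map g).reverse.prod = 1 := by
  induction l with
  | nil => simp
  | cons i l ih =>
    simp only [List.map_cons, List.prod_cons, List.reverse_cons, List.prod_append, List.prod_nil,
      mul_one]
    calc f i * (l.map f).prod * ((l.map g).reverse.prod * g i)
        = f i * ((l.map f).prod * (l.map g).reverse.prod) * g i := by simp only [mul_assoc]
      _ = 1 := by rw [ih fun j hj => h j (by simp [hj]), mul_one, h i (by simp)]

theorem reverse_prod_mul_list_prod {A κ : Type*} [Monoid A] {f g : κ → A} {l : List κ}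
    (h : ∀ i ∈ l, f i * g i = 1) : (l.map f).reverse.prod * (l.map g).prod = 1 := by
  have := list_prod_mul_reverse_prod (f := f) (g := g) (l := l.reverse) fun i hi => h i (by simpa using hi)
  simpa using this

variable {ν : YoungDiagram} (U : StandardTableau ν)

theorem emb_youngE_commute {Z : Matrix (Option (Fin ν.card) → Fin N) (Option (Fin ν.card) → Fin N) D}
    (h : ∀ i j, i ≠ j → Commute Z (Pm N D (some i) (some j))) :
    Commute Z (emb (youngE N S D U)) := by
  rw [youngE_eq, map_list_prod, List.map_map]
  refine commute_map_prod fun k _ => ?_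
  rw [Function.comp_apply, map_list_prod, List.map_map]
  refine commute_map_prod fun a _ => ?_
  rw [Function.comp_apply, emb_smul, map_sub, emb_smul, map_one, jmM, map_sum]
  refine Commute.smul_right (Commute.sub_right (Commute.sum_right _ _ _ fun i hi => ?_)
    ((Commute.one_right Z).smul_right _)) _
  rw [emb_permM_swap]
  simp only [Finset.mem_filter, Finset.mem_univ, true_and] at hi
  exact h i k hi.ne

theorem emb_youngE_mul_self : emb (youngE N S D U) * emb (youngE N S D U) = emb (youngE N S D U) := by
  rw [← map_mul, youngE_mul_self]

theorem isUnit_smul_one_sub {A : Type*} [Ring A] [Algebra S A] {g p : S} (hg : IsUnit g)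
    (hp : p ^ M = 0) (x : A) : IsUnit (g • (1 - p • x)) := by
  have h1 : IsUnit (1 - p • x) := IsNilpotent.isUnit_one_sub ⟨M, by rw [smul_pow, hp, zero_smul]⟩
  rw [Algebra.smul_def]
  exact (hg.map _).mul h1

theorem isUnit_list_prod_gval (hN : N ≠ 0) {κ : Type*} {p : κ → S} (hp : ∀ i, p i ^ M = 0)
    (l : List κ) : IsUnit (l.map fun i => gval N M (p i)).prod := by
  induction l with
  | nil => exact isUnit_one
  | cons i l ih =>
    rw [List.map_cons, List.prod_cons]
    exact (isUnit_gval hN (hp i)).mul ih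

theorem intertwine_P (hN : N ≠ 0) {p : Fin ν.card → S} {p₀ : S} (hp : ∀ i, p i ^ M = 0)
    (hp₀ : p₀ ^ M = 0) (h : ∀ i, p i * (1 - cst S (U.content i : ℂ) * p₀) = p₀) :
    ∃ Y, IsUnit Y ∧ emb (youngE N S D U) *
      ((List.finRange ν.card).map fun i => Rb N M D none (some i) (p i)).reverse.prod =
        Y * emb (youngE N S D U) := by
  have hnd : ((List.finRange ν.card).map some).Nodup :=
    (List.nodup_finRange _).map (Option.some_injective _)
  have f := fusion_P (p := fun o : Option (Fin ν.card) => o.elim 0 p) (p₀ := p₀)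
    (emb_jmEigen (youngE_jmEigen (S := S) (D := D) (N := N) U)) hnd (by
      intro o ho
      obtain ⟨i, -, rfl⟩ := List.mem_map.1 ho
      exact h i) none (by simp)
  set P := (((List.finRange ν.card).map some).map fun i => Pm N D i none).sum with hP
  have hc : Commute P (emb (youngE N S D U)) := emb_youngE_commute U fun i j hij =>
    (commute_Pm_sum (fun k => by
      have h0 : Equiv.swap (some i) (some j) none = none :=
        Equiv.swap_apply_of_ne_of_ne (by simp) (by simp)
      rw [Pm, permM_mul_Pm, h0]) hnd (by simp) (by simp)).symm
  refine ⟨((List.finRange ν.card).map fun i => gval N M (p i)).prod • (1 - p₀ • P),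
    isUnit_smul_one_sub (isUnit_list_prod_gval hN hp _) hp₀ P, ?_⟩
  have e : ((List.finRange ν.card).map fun i => Rb N M D none (some i) (p i)).reverse.prod =
      ((List.finRange ν.card).map fun i => gval N M (p i)).prod •
        (((List.finRange ν.card).map some).map fun i =>
          1 - (fun o : Option (Fin ν.card) => o.elim 0 p) i • Pm N D i none).reverse.prod := by
    rw [List.map_map, ← List.map_reverse, ← List.map_reverse]
    simp only [Rb_eq, list_prod_smul]
    congr 1
    · rw [List.map_reverse, List.prod_reverse]
    · simp only [Function.comp_def, Option.elim, Pm_comm none]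
  rw [e, mul_smul_comm, f, smul_mul_assoc]
  congr 1
  rw [mul_sub, sub_mul, mul_one, one_mul, mul_smul_comm, smul_mul_assoc, hc.eq]

theorem intertwine_Q (hN : N ≠ 0) {p : Fin ν.card → S} {p₀ : S} (hp : ∀ i, p i ^ M = 0)
    (hp₀ : p₀ ^ M = 0) (h : ∀ i, p i * (1 - cst S (U.content i : ℂ) * p₀) = p₀) :
    ∃ Y, IsUnit Y ∧ emb (youngE N S D U) *
      ((List.finRange ν.card).map fun i => Rbt N M D none (some i) (p i)).prod =
        Y * emb (youngE N S D U) := by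
  have hnd : ((List.finRange ν.card).map some).Nodup :=
    (List.nodup_finRange _).map (Option.some_injective _)
  have f := fusion_Q (q := fun o : Option (Fin ν.card) => o.elim 0 p) (q₀ := p₀)
    (emb_jmEigen (youngE_jmEigen (S := S) (D := D) (N := N) U)) hnd (by
      intro o ho
      obtain ⟨i, -, rfl⟩ := List.mem_map.1 ho
      exact h i) none (by simp)
  set P := (((List.finRange ν.card).map some).map fun i => Qm N D i none).sum with hP
  have hc : Commute P (emb (youngE N S D U)) := emb_youngE_commute U fun i j hij =>
    (commute_Pm_sum (fun k => by
      have h0 : Equiv.swap (some i) (some j) none = none :=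
        Equiv.swap_apply_of_ne_of_ne (by simp) (by simp)
      rw [Pm, permM_mul_Qm, h0]) hnd (by simp) (by simp)).symm
  refine ⟨((List.finRange ν.card).map fun i => gval N M (p i)).prod • (1 - p₀ • P),
    isUnit_smul_one_sub (isUnit_list_prod_gval hN hp _) hp₀ P, ?_⟩
  have e : ((List.finRange ν.card).map fun i => Rbt N M D none (some i) (p i)).prod =
      ((List.finRange ν.card).map fun i => gval N M (p i)).prod •
        (((List.finRange ν.card).map some).map fun i =>
          1 - (fun o : Option (Fin ν.card) => o.elim 0 p) i • Qm N D i none).prod := by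
    rw [List.map_map]
    simp only [Rbt_eq, list_prod_smul]
    congr 1
    simp only [Function.comp_def, Option.elim, Qm_comm none]
  rw [e, mul_smul_comm, f, smul_mul_assoc]
  congr 1
  rw [mul_sub, sub_mul, mul_one, one_mul, mul_smul_comm, smul_mul_assoc, hc.eq]

theorem smul_mem_centralM {m : Type*} [Fintype m] [DecidableEq m] (z : S) {X : Matrix m m D}
    (hX : X ∈ centralM m D) : z • X ∈ centralM m D := by
  rw [mem_centralM] at hX ⊢
  intro i j d
  rw [Matrix.smul_apply, Algebra.smul_def]
  exact (Algebra.commute_algebraMap_left z d).mul_left (hX i j d)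

theorem Pm_mem_centralM {ι : Type*} [DecidableEq ι] [Fintype ι] (i j : ι) :
    Pm N D i j ∈ centralM _ D := by
  rw [mem_centralM]
  intro I J d
  simp only [Pm, permM, Matrix.of_apply]
  split_ifs <;> simp

theorem Qm_mem_centralM {ι : Type*} [DecidableEq ι] [Fintype ι] (i j : ι) :
    Qm N D i j ∈ centralM _ D := by
  rw [mem_centralM]
  intro I J d
  simp only [Qm, Matrix.of_apply]
  split_ifs <;> simp

theorem Rb_mem_centralM {ι : Type*} [DecidableEq ι] [Fintype ι] (i j : ι) (p : S) :
    Rb N M D i j p ∈ centralM _ D :=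
  Subring.add_mem _ (smul_mem_centralM _ (Subring.one_mem _))
    (smul_mem_centralM _ (Pm_mem_centralM i j))

theorem Rbt_mem_centralM {ι : Type*} [DecidableEq ι] [Fintype ι] (i j : ι) (p : S) :
    Rbt N M D i j p ∈ centralM _ D :=
  Subring.add_mem _ (smul_mem_centralM _ (Subring.one_mem _))
    (smul_mem_centralM _ (Qm_mem_centralM i j))

theorem list_prod_mem_centralM {κ m : Type*} [Fintype m] [DecidableEq m] {f : κ → Matrix m m D}
    (hf : ∀ i, f i ∈ centralM m D) (l : List κ) : (l.map f).prod ∈ centralM m D := by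
  refine Subring.list_prod_mem _ fun x hx => ?_
  obtain ⟨i, -, rfl⟩ := List.mem_map.1 hx
  exact hf i

theorem youngE_mem_centralM : youngE N S D U ∈ centralM _ D := by
  rw [mem_centralM]
  intro I J d
  exact Algebra.commute_algebraMap_left _ d

theorem emb_mem_centralM {κ : Type*} [DecidableEq κ] [Fintype κ]
    {X : Matrix (κ → Fin N) (κ → Fin N) D} (hX : X ∈ centralM _ D) : emb X ∈ centralM _ D := by
  rw [mem_centralM] at hX ⊢
  intro I J d
  rw [← cons_eta I, ← cons_eta J, emb_cons]
  split_ifs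
  · exact hX _ _ d
  · exact Commute.zero_left d

theorem commutator_key {A : Type*} [Ring A] {e t m X X' X'' Y Y' Y'' : A} (h1 : X' * X = 1)
    (h2 : Y' * Y'' = 1) (hc : Commute t e) :
    e * X' * (X * t * Y * m - m * X'' * t * Y') * Y'' =
      t * (e * Y * m * Y'') - e * X' * m * X'' * t := by
  rw [mul_sub, sub_mul]
  congr 1
  · calc e * X' * (X * t * Y * m) * Y'' = e * (X' * X) * t * Y * m * Y'' := by
          simp only [mul_assoc]
      _ = (e * t) * Y * m * Y'' := by rw [h1, mul_one]
      _ = _ := by rw [← hc.eq]; simp only [mul_assoc]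
  · calc e * X' * (m * X'' * t * Y') * Y'' = e * X' * m * X'' * t * (Y' * Y'') := by
          simp only [mul_assoc]
      _ = _ := by rw [h2, mul_one]

theorem trace_commutator (hN : N ≠ 0) {X₀ : Matrix (Fin ν.card → Fin N) (Fin ν.card → Fin N) D}
    (hX₀ : youngE N S D U * X₀ * youngE N S D U = youngE N S D U * X₀)
    {x x' y y' : Fin ν.card → S} {x₀ x₀' y₀ y₀' : S}
    (hx : ∀ i, x i ^ M = 0) (hx' : ∀ i, x' i ^ M = 0) (hy : ∀ i, y i ^ M = 0)
    (hy' : ∀ i, y' i ^ M = 0)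
    (hx₀ : x₀ ^ M = 0) (hx₀' : x₀' ^ M = 0) (hy₀ : y₀ ^ M = 0) (hy₀' : y₀' ^ M = 0)
    (fx : ∀ i, x i * (1 - cst S (U.content i : ℂ) * x₀) = x₀)
    (fx' : ∀ i, x' i * (1 - cst S (U.content i : ℂ) * x₀') = x₀')
    (fy : ∀ i, y i * (1 - cst S (U.content i : ℂ) * y₀) = y₀)
    (fy' : ∀ i, y' i * (1 - cst S (U.content i : ℂ) * y₀') = y₀')
    (hxx : ∀ i, x' i * (1 + N * x i) = x i) (hyy : ∀ i, y' i * (1 + N * y i) = y i)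
    (s : Matrix (Fin N) (Fin N) D) :
    ∃ L ∈ centralM (Option (Fin ν.card) → Fin N) D, ∃ R ∈ centralM (Option (Fin ν.card) → Fin N) D,
      ∀ a b, s a b * Matrix.trace (youngE N S D U * X₀) -
        Matrix.trace (youngE N S D U * X₀) * s a b =
      ptr (L * (((List.finRange ν.card).map fun i => Rb N M D none (some i) (x i)).reverse.prod *
          siteM none s * ((List.finRange ν.card).map fun i => Rbt N M D none (some i) (y i)).prod *
          emb X₀ -
        emb X₀ * ((List.finRange ν.card).map fun i => Rb N M D none (some i) (x' i)).reverse.prod *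
          siteM none s *
          ((List.finRange ν.card).map fun i => Rbt N M D none (some i) (y' i)).prod) * R) a b := by
  set l := List.finRange ν.card
  have hnd : l.Nodup := List.nodup_finRange _
  have hnd' : l.reverse.Nodup := List.nodup_reverse.2 hnd
  set E := youngE N S D U with hEdef
  have hEc : E ∈ centralM _ D := youngE_mem_centralM U
  have hEE : emb (D := D) E * emb E = emb E := emb_youngE_mul_self U
  set Xd := (l.map fun i => Rb N M D none (some i) (x i)).reverse.prod
  set Xi := (l.map fun i => Rb N M D none (some i) (-x i)).prod
  set X'd := (l.map fun i => Rb N M D none (some i) (x' i)).reverse.prod with hX'd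
  set Yp := (l.map fun i => Rbt N M D none (some i) (y i)).prod
  set Y'p := (l.map fun i => Rbt N M D none (some i) (y' i)).prod
  set Y'i := (l.map fun i => Rbt N M D none (some i) (-y i)).reverse.prod with hY'i
  have hXdXi : Xd * Xi = 1 := reverse_prod_mul_list_prod fun i _ => Rb_mul_neg hN (hx i) _ _
  have hXiXd : Xi * Xd = 1 := list_prod_mul_reverse_prod fun i _ => Rb_neg_mul hN (hx i) _ _
  have hYY : Y'p * Y'i = 1 :=
    list_prod_mul_reverse_prod fun i _ => (Rbt_crossing hN (hy i) (hyy i) (by simp)).2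
  obtain ⟨A₁, hA₁, e₁⟩ := intertwine_P (M := M) (D := D) U hN hx hx₀ fx
  obtain ⟨A₂, hA₂, e₂⟩ := intertwine_P (M := M) (D := D) U hN hx' hx₀' fx'
  obtain ⟨A₃, hA₃, e₃⟩ := intertwine_Q (M := M) (D := D) U hN hy hy₀ fy
  obtain ⟨A₄, hA₄, e₄⟩ := intertwine_Q (M := M) (D := D) U hN hy' hy₀' fy'
  have a₁ : emb E * Xi * emb E = emb E * Xi := absorb_inverse hEE e₁ hA₁ hXdXi
  have a₂ : emb E * X'd * emb E = emb E * X'd := absorb_of_intertwine hEE e₂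
  have a₃ : emb E * Yp * emb E = emb E * Yp := absorb_of_intertwine hEE e₃
  have a₄ : emb E * Y'i * emb E = emb E * Y'i := absorb_inverse hEE e₄ hA₄ hYY
  have hXic : Xi ∈ centralM _ D := list_prod_mem_centralM (fun i => Rb_mem_centralM _ _ _) l
  have hYpc : Yp ∈ centralM _ D := list_prod_mem_centralM (fun i => Rbt_mem_centralM _ _ _) l
  have hY'ic : Y'i ∈ centralM _ D := by
    rw [hY'i, ← List.map_reverse]
    exact list_prod_mem_centralM (fun i => Rbt_mem_centralM _ _ _) _
  have t₁ : pT Yp * pT Y'i = 1 := by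
    rw [pT_prod_Rbt y hnd, hY'i, ← List.map_reverse, pT_prod_Rbt _ hnd', List.map_reverse]
    exact list_prod_mul_reverse_prod fun i _ => Rb_mul_neg hN (hy i) _ _
  have t₂ : pT Xi * pT X'd = 1 := by
    rw [pT_prod_Rb _ hnd, hX'd, ← List.map_reverse, pT_prod_Rb _ hnd', List.map_reverse]
    exact list_prod_mul_reverse_prod fun i _ => (Rbt_crossing hN (hx i) (hxx i) (by simp)).1
  have r₁ := ptr_absorb hEc hYpc (youngE_mul_self U) hX₀ a₃ a₄ t₁
  have r₂ := ptr_absorb hEc hXic (youngE_mul_self U) hX₀ a₁ a₂ t₂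
  have hsE : Commute (siteM none s) (emb E) := emb_youngE_commute U fun i j hij =>
    (Pm_siteM_comm (by simp) (by simp) s).symm
  refine ⟨emb E * Xi, Subring.mul_mem _ (emb_mem_centralM hEc) hXic, Y'i, hY'ic, fun a b => ?_⟩
  rw [commutator_key hXiXd hYY hsE, ptr_sub, ptr_siteM_mul, ptr_mul_siteM, r₁, r₂,
    Matrix.sub_apply, smul_mul_assoc, one_mul, Matrix.smul_apply, smul_eq_mul]
  congr 1
  generalize Matrix.trace (E * X₀) = τ
  simp only [Matrix.mul_apply, Matrix.smul_apply, Matrix.one_apply, smul_eq_mul, mul_ite, mul_one,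
    mul_zero, Finset.sum_ite_eq', Finset.mem_univ, if_true]

end Core

/-! ### Laurent series and Laurent polynomials -/

section Ser

variable {A A' : Type*} [Ring A] [Ring A'] {σ : ℤˣ}

/-- Laurent series in `u` if `σ = 1`, in `u⁻¹` if `σ = -1`. -/
def Ser (_σ : ℤˣ) (A : Type*) [Ring A] : Type _ := HahnSeries ℤ A

instance : Ring (Ser σ A) := inferInstanceAs (Ring (HahnSeries ℤ A))

/-- The coefficient at the `n`-th power of the variable `u^σ`. -/
def Ser.coeff (n : ℤ) : Ser σ A →+ A where
  toFun f := HahnSeries.coeff f n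
  map_zero' := rfl
  map_add' _ _ := rfl

@[ext] theorem Ser.ext {f g : Ser σ A} (h : ∀ n, Ser.coeff n f = Ser.coeff n g) : f = g :=
  HahnSeries.ext (funext h)

/-- Constants. -/
def Ser.C : A →+* Ser σ A := (HahnSeries.C : A →+* HahnSeries ℤ A)

/-- The power `u^{σ n}`. -/
def Ser.mono (n : ℤ) (a : A) : Ser σ A := HahnSeries.single n a

variable (σ) in
/-- Power series as Laurent series. -/
def Ser.ofPS : PowerSeries A →+* Ser σ A := HahnSeries.ofPowerSeries ℤ A

theorem Ser.coeff_mono (n m : ℤ) (a : A) :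
    Ser.coeff m (Ser.mono n a : Ser σ A) = if m = n then a else 0 := by
  have : Ser.coeff m (Ser.mono n a : Ser σ A) = (HahnSeries.single n a).coeff m := rfl
  rw [this, HahnSeries.coeff_single]
  congr

theorem Ser.C_eq_mono (a : A) : (Ser.C a : Ser σ A) = Ser.mono 0 a := rfl

theorem Ser.coeff_C (m : ℤ) (a : A) : Ser.coeff m (Ser.C a : Ser σ A) = if m = 0 then a else 0 :=
  Ser.coeff_mono 0 m a

theorem Ser.mono_mul_mono (n m : ℤ) (a b : A) :
    (Ser.mono n a : Ser σ A) * Ser.mono m b = Ser.mono (n + m) (a * b) :=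
  HahnSeries.single_mul_single

theorem Ser.coeff_C_mul (a : A) (f : Ser σ A) (n : ℤ) :
    Ser.coeff n (Ser.C a * f) = a * Ser.coeff n f :=
  HahnSeries.coeff_single_zero_mul

theorem Ser.coeff_mul_C (a : A) (f : Ser σ A) (n : ℤ) :
    Ser.coeff n (f * Ser.C a) = Ser.coeff n f * a :=
  HahnSeries.coeff_mul_single_zero

theorem Ser.coeff_mono_mul (k : ℤ) (a : A) (f : Ser σ A) (n : ℤ) :
    Ser.coeff n (Ser.mono k a * f) = a * Ser.coeff (n - k) f :=
  HahnSeries.coeff_single_mul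

theorem Ser.coeff_mul_mono (k : ℤ) (a : A) (f : Ser σ A) (n : ℤ) :
    Ser.coeff n (f * Ser.mono k a) = Ser.coeff (n - k) f * a :=
  HahnSeries.coeff_mul_single

theorem Ser.exists_bound (f : Ser σ A) : ∃ a, ∀ n < a, Ser.coeff n f = 0 := by
  by_cases h : (f : HahnSeries ℤ A) = 0
  · exact ⟨0, fun n _ => by rw [show f = (0 : Ser σ A) from h, map_zero]⟩
  · exact ⟨HahnSeries.order (f : HahnSeries ℤ A), fun n hn =>
      HahnSeries.coeff_eq_zero_of_lt_order hn⟩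

theorem Ser.coeff_mul {f g : Ser σ A} {a b : ℤ} (hf : ∀ n < a, Ser.coeff n f = 0)
    (hg : ∀ n < b, Ser.coeff n g = 0) (n : ℤ) :
    Ser.coeff n (f * g) = ∑ i ∈ Finset.Icc a (n - b), Ser.coeff i f * Ser.coeff (n - i) g := by
  have h : Ser.coeff n (f * g) = _ := HahnSeries.coeff_mul (x := f) (y := g)
  rw [h]
  refine Finset.sum_of_injOn Prod.fst ?_ ?_ ?_ ?_
  · rintro ⟨i, j⟩ h ⟨i', j'⟩ h' e
    simp at h h' e
    ext <;> simp <;> omega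
  · rintro ⟨i, j⟩ h
    simp at h
    have h1 : ¬ i < a := fun hi => h.1 (hf i hi)
    have h2 : ¬ j < b := fun hj => h.2.1 (hg j hj)
    simp
    omega
  · intro i _ hi
    by_contra hne
    refine hi ⟨(i, n - i), ?_, rfl⟩
    simp
    exact ⟨left_ne_zero_of_mul hne, right_ne_zero_of_mul hne⟩
  · rintro ⟨i, j⟩ h
    simp at h
    rw [show n - i = j by omega]
    rfl

theorem Ser.coeff_ofPS_nat (f : PowerSeries A) (n : ℕ) :
    Ser.coeff n (Ser.ofPS σ f) = PowerSeries.coeff n f :=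
  HahnSeries.ofPowerSeries_apply_coeff f n

theorem Ser.coeff_ofPS_neg (f : PowerSeries A) {n : ℤ} (hn : n < 0) :
    Ser.coeff n (Ser.ofPS σ f) = 0 := by
  change HahnSeries.coeff (HahnSeries.ofPowerSeries ℤ A f) n = 0
  rw [HahnSeries.ofPowerSeries_apply]
  refine HahnSeries.embDomain_of_notMem_range ?_
  rintro ⟨m, rfl⟩
  simp at hn
  omega

theorem Ser.ofPS_C (a : A) : Ser.ofPS σ (PowerSeries.C a) = Ser.C a :=
  HahnSeries.ofPowerSeries_C a

theorem Ser.ofPS_X : Ser.ofPS σ (PowerSeries.X : PowerSeries A) = Ser.mono 1 1 :=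
  HahnSeries.ofPowerSeries_X

open LaurentPolynomial

variable (σ) in
/-- Laurent polynomials in `u` as Laurent series. -/
def toSer : A[T;T⁻¹] →+* Ser σ A :=
  AddMonoidAlgebra.liftNCRingHom Ser.C
    { toFun := fun k => Ser.mono (σ * k.toAdd) 1
      map_one' := by simp [← Ser.C_eq_mono]
      map_mul' := fun k l => by rw [Ser.mono_mul_mono, one_mul, toAdd_mul, mul_add] }
    fun a k => by
      change Ser.C a * Ser.mono _ 1 = Ser.mono _ 1 * Ser.C a
      rw [Ser.C_eq_mono, Ser.mono_mul_mono, Ser.mono_mul_mono, add_comm, one_mul, mul_one]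

theorem toSer_C_mul_T (a : A) (k : ℤ) :
    toSer σ (LaurentPolynomial.C a * LaurentPolynomial.T k) = Ser.mono (σ * k) a := by
  rw [← single_eq_C_mul_T, toSer, AddMonoidAlgebra.liftNCRingHom_single]
  change Ser.C a * Ser.mono (σ * k) 1 = _
  rw [Ser.C_eq_mono, Ser.mono_mul_mono, zero_add, mul_one]

theorem toSer_C (a : A) : toSer σ (LaurentPolynomial.C a) = Ser.C a := by
  simpa [Ser.C_eq_mono] using toSer_C_mul_T (σ := σ) a 0

theorem toSer_T (k : ℤ) : toSer σ (LaurentPolynomial.T k : A[T;T⁻¹]) =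
    Ser.mono (σ * k) 1 := by
  simpa using toSer_C_mul_T (σ := σ) (1 : A) k

theorem coeff_toSer (f : A[T;T⁻¹]) (n : ℤ) :
    Ser.coeff n (toSer σ f) = f.coeff (σ * n) := by
  induction f using LaurentPolynomial.induction_on' with
  | add f g hf hg => simp [hf, hg]
  | C_mul_T k a =>
    rw [toSer_C_mul_T, Ser.coeff_mono, ← single_eq_C_mul_T, AddMonoidAlgebra.coeff_single,
      Finsupp.single_apply]
    rcases Int.units_eq_one_or σ with rfl | rfl
    · simp [eq_comm]
    · congr 1
      simp only [Units.val_neg, Units.val_one, eq_iff_iff]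
      omega

/-- A ring homomorphism applied to the coefficients of a Laurent polynomial. -/
def mapLau (φ : A →+* A') : A[T;T⁻¹] →+* A'[T;T⁻¹] :=
  AddMonoidAlgebra.liftNCRingHom (LaurentPolynomial.C.comp φ)
    { toFun := fun k => T k.toAdd
      map_one' := by simp
      map_mul' := fun k l => by rw [toAdd_mul, T_add] }
    fun a k => (commute_T _ _).symm

theorem mapLau_C_mul_T (φ : A →+* A') (a : A) (k : ℤ) :
    mapLau φ (LaurentPolynomial.C a * T k) = LaurentPolynomial.C (φ a) * T k := by
  rw [← single_eq_C_mul_T, mapLau, AddMonoidAlgebra.liftNCRingHom_single]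
  rfl

theorem mapLau_C (φ : A →+* A') (a : A) :
    mapLau φ (LaurentPolynomial.C a) = LaurentPolynomial.C (φ a) := by
  simpa using mapLau_C_mul_T φ a 0

theorem mapLau_T (φ : A →+* A') (k : ℤ) : mapLau φ (T k) = T k := by
  simpa using mapLau_C_mul_T φ (1 : A) k

variable {K : Type*} [CommRing K] [Algebra K A]

theorem mapLau_algebraMap_commute (f : K[T;T⁻¹]) (g : A[T;T⁻¹]) :
    mapLau (algebraMap K A) f * g = g * mapLau (algebraMap K A) f := by
  induction f using LaurentPolynomial.induction_on' with
  | add f f' hf hf' => rw [map_add, add_mul, mul_add, hf, hf']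
  | C_mul_T k a =>
    rw [mapLau_C_mul_T]
    induction g using LaurentPolynomial.induction_on' with
    | add g g' hg hg' => rw [mul_add, add_mul, hg, hg']
    | C_mul_T l b =>
      rw [← single_eq_C_mul_T, ← single_eq_C_mul_T, AddMonoidAlgebra.single_mul_single,
        AddMonoidAlgebra.single_mul_single, Algebra.commutes, add_comm]

instance (priority := 50) algebraLau : Algebra K[T;T⁻¹] A[T;T⁻¹] :=
  (mapLau (algebraMap K A)).toAlgebra' mapLau_algebraMap_commute

theorem toSer_algebraMap_commute (f : K[T;T⁻¹]) (g : Ser σ A) :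
    toSer σ (mapLau (algebraMap K A) f) * g = g * toSer σ (mapLau (algebraMap K A) f) := by
  induction f using LaurentPolynomial.induction_on' with
  | add f f' hf hf' => rw [map_add, map_add, add_mul, mul_add, hf, hf']
  | C_mul_T k a =>
    rw [mapLau_C_mul_T, toSer_C_mul_T]
    ext n
    rw [Ser.coeff_mono_mul, Ser.coeff_mul_mono, Algebra.commutes]

instance algebraSer : Algebra K[T;T⁻¹] (Ser σ A) :=
  ((toSer σ).comp (mapLau (algebraMap K A))).toAlgebra' toSer_algebraMap_commute

theorem algebraMap_Ser (f : K[T;T⁻¹]) :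
    algebraMap K[T;T⁻¹] (Ser σ A) f = toSer σ (mapLau (algebraMap K A) f) := rfl

theorem algebraMap_Lau (f : K[T;T⁻¹]) :
    algebraMap K[T;T⁻¹] A[T;T⁻¹] f = mapLau (algebraMap K A) f := rfl

variable (σ K A) in
/-- Laurent polynomials as Laurent series, over the scalars. -/
def toSerAlg : A[T;T⁻¹] →ₐ[K[T;T⁻¹]] Ser σ A :=
  { toSer σ with commutes' := fun _ => rfl }

theorem algebraMap_Ser_C (a : K) : algebraMap K[T;T⁻¹] (Ser σ A)
    (LaurentPolynomial.C a) = Ser.C (algebraMap K A a) := by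
  rw [algebraMap_Ser, mapLau_C, toSer_C]

theorem algebraMap_Ser_T (k : ℤ) : algebraMap K[T;T⁻¹] (Ser σ A) (T k) =
    Ser.mono (σ * k) 1 := by
  rw [algebraMap_Ser, mapLau_T, toSer_T]

end Ser

/-! ### Power series in an outer variable -/

section Out

open PowerSeries

variable {S B B' : Type*} [CommRing S] [Ring B] [Algebra S B] [Ring B'] [Algebra S B']

theorem map_algebraMap_commute (f : PowerSeries S) (g : PowerSeries B) :
    PowerSeries.map (algebraMap S B) f * g = g * PowerSeries.map (algebraMap S B) f := by
  ext n
  rw [coeff_mul, coeff_mul, ← Finset.Nat.sum_antidiagonal_swap]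
  refine Finset.sum_congr rfl fun x _ => ?_
  simp only [coeff_map, Prod.fst_swap, Prod.snd_swap, Algebra.commutes]

instance (priority := 50) algebraOut : Algebra (PowerSeries S) (PowerSeries B) :=
  (PowerSeries.map (algebraMap S B)).toAlgebra' map_algebraMap_commute

theorem algebraMap_Out (f : PowerSeries S) :
    @algebraMap (PowerSeries S) (PowerSeries B) _ _ algebraOut f =
      PowerSeries.map (algebraMap S B) f := rfl

/-- A homomorphism of algebras applied to the coefficients in the outer variable. -/
def mapOut (φ : B →ₐ[S] B') : PowerSeries B →ₐ[PowerSeries S] PowerSeries B' :=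
  { PowerSeries.map (φ : B →+* B') with
    commutes' := fun f => by
      ext n
      exact φ.commutes _ }

end Out

/-! ### Series with matrix coefficients and double series -/

section DoubleSeries

open PowerSeries Finset

variable {A : Type*} [Ring A]

/-- A series with matrix coefficients as a matrix of series. -/
def psMat {n : Type*} [Fintype n] [DecidableEq n] :
    PowerSeries (Matrix n n A) →+* Matrix n n (PowerSeries A) where
  toFun F := Matrix.of fun i j => PowerSeries.mk fun r => coeff r F i j
  map_zero' := by ext; simp
  map_one' := by
    ext i j r
    simp only [Matrix.of_apply, coeff_mk, coeff_one, Matrix.one_apply]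
    by_cases h : r = 0 <;> by_cases h' : i = j <;> simp [h, h', coeff_one, Matrix.one_apply]
  map_add' F H := by ext; simp
  map_mul' F H := by
    ext i j r
    simp only [Matrix.of_apply, coeff_mk, coeff_mul, Matrix.mul_apply, Matrix.sum_apply, map_sum]
    exact sum_comm

theorem coeff_psMat {n : Type*} [Fintype n] [DecidableEq n] (F : PowerSeries (Matrix n n A))
    (i j : n) (r : ℕ) : coeff r (psMat F i j) = coeff r F i j := by
  simp [psMat]

/-- The exchange of the two variables of a double series. -/
def swapPS : PowerSeries (PowerSeries A) →+* PowerSeries (PowerSeries A) where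
  toFun F := PowerSeries.mk fun a => PowerSeries.mk fun b => coeff a (coeff b F)
  map_zero' := by ext; simp
  map_one' := by
    ext a b
    simp only [coeff_mk, coeff_one]
    by_cases h : a = 0 <;> by_cases h' : b = 0 <;> simp [h, h', coeff_one]
  map_add' F H := by ext; simp
  map_mul' F H := by
    ext a b
    rw [coeff_coeff_mul]
    simp only [coeff_mk]
    rw [coeff_coeff_mul, sum_comm]

theorem swapPS_C (f : PowerSeries A) : swapPS (C f) = PowerSeries.map C f := by
  ext a b
  simp only [swapPS, RingHom.coe_mk, MonoidHom.coe_mk, OneHom.coe_mk, coeff_mk, coeff_map, coeff_C]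
  split_ifs <;> simp

theorem swapPS_map_C (f : PowerSeries A) : swapPS (PowerSeries.map C f) = C f := by
  ext a b
  simp only [swapPS, RingHom.coe_mk, MonoidHom.coe_mk, OneHom.coe_mk, coeff_mk, coeff_map, coeff_C]
  split_ifs <;> simp

theorem sum_antidiagonal_interchange {X : Type*} [AddCommMonoid X] (n : ℕ)
    (f : ℕ → ℕ → ℕ → ℕ → X) :
    ∑ x ∈ antidiagonal n, ∑ y ∈ antidiagonal x.1, ∑ z ∈ antidiagonal x.2, f y.1 y.2 z.1 z.2 =
      ∑ x ∈ antidiagonal n, ∑ y ∈ antidiagonal x.1, ∑ z ∈ antidiagonal x.2, f y.1 z.1 y.2 z.2 := by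
  simp only [← sum_product', sum_sigma']
  have e : ∀ t : (_ : ℕ × ℕ) × ((ℕ × ℕ) × (ℕ × ℕ)), t ∈ (antidiagonal n).sigma
      (fun x => antidiagonal x.1 ×ˢ antidiagonal x.2) ↔ t.1.1 + t.1.2 = n ∧
        t.2.1.1 + t.2.1.2 = t.1.1 ∧ t.2.2.1 + t.2.2.2 = t.1.2 := by
    rintro ⟨⟨a, b⟩, ⟨⟨a1, a2⟩, ⟨b1, b2⟩⟩⟩
    simp
  let g : (_ : ℕ × ℕ) × ((ℕ × ℕ) × (ℕ × ℕ)) → (_ : ℕ × ℕ) × ((ℕ × ℕ) × (ℕ × ℕ)) := fun t =>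
    ⟨(t.2.1.1 + t.2.2.1, t.2.1.2 + t.2.2.2), ((t.2.1.1, t.2.2.1), (t.2.1.2, t.2.2.2))⟩
  have hg : ∀ t ∈ (antidiagonal n).sigma (fun x => antidiagonal x.1 ×ˢ antidiagonal x.2),
      g t ∈ (antidiagonal n).sigma (fun x => antidiagonal x.1 ×ˢ antidiagonal x.2) := by
    intro t ht
    rw [e] at ht ⊢
    refine ⟨?_, rfl, rfl⟩
    simp only [g]
    omega
  have hgg : ∀ t ∈ (antidiagonal n).sigma (fun x => antidiagonal x.1 ×ˢ antidiagonal x.2),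
      g (g t) = t := by
    rintro ⟨⟨a, b⟩, ⟨⟨a1, a2⟩, ⟨b1, b2⟩⟩⟩ ht
    rw [e] at ht
    obtain ⟨-, h1, h2⟩ := ht
    dsimp only at h1 h2
    subst h1 h2
    rfl
  exact sum_nbij' g g hg hg hgg hgg fun t _ => rfl

/-- The restriction of a double series to the diagonal. -/
def diagPS : PowerSeries (PowerSeries A) →+* PowerSeries A where
  toFun F := PowerSeries.mk fun n => ∑ x ∈ antidiagonal n, coeff x.2 (coeff x.1 F)
  map_zero' := by ext; simp
  map_one' := by
    ext n
    rw [coeff_mk, coeff_one]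
    split_ifs with h
    · subst h; simp
    · refine sum_eq_zero fun x hx => ?_
      rw [HasAntidiagonal.mem_antidiagonal] at hx
      by_cases h1 : x.1 = 0
      · have h2 : x.2 ≠ 0 := by omega
        simp [h1, coeff_one, h2]
      · simp [coeff_one, h1]
  map_add' F H := by ext; simp [sum_add_distrib]
  map_mul' F H := by
    ext n
    simp only [coeff_mk, coeff_coeff_mul]
    simp only [coeff_mul, coeff_mk, sum_mul_sum]
    exact sum_antidiagonal_interchange n fun a b c d =>
      coeff c (coeff a F) * coeff d (coeff b H)

theorem coeff_diagPS (F : PowerSeries (PowerSeries A)) (n : ℕ) :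
    coeff n (diagPS F) = ∑ x ∈ antidiagonal n, coeff x.2 (coeff x.1 F) := by
  simp [diagPS]

theorem diagPS_C (f : PowerSeries A) : diagPS (C f) = f := by
  ext n
  rw [coeff_diagPS, sum_eq_single (0, n)]
  · simp
  · rintro ⟨a, b⟩ h h'
    have : a ≠ 0 := by rintro rfl; simp_all
    simp [coeff_C, this]
  · simp

theorem diagPS_map_C (f : PowerSeries A) : diagPS (PowerSeries.map C f) = f := by
  ext n
  rw [coeff_diagPS, sum_eq_single (n, 0)]
  · simp
  · rintro ⟨a, b⟩ h h'
    have : b ≠ 0 := by rintro rfl; simp_all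
    simp [coeff_C, this]
  · simp

theorem exists_eq_mul_of_diagPS_eq_zero {F : PowerSeries (PowerSeries A)} (h : diagPS F = 0) :
    ∃ F', F = (X - C X) * F' := by
  refine ⟨PowerSeries.mk fun m => PowerSeries.mk fun n =>
    ∑ k ∈ range (n + 1), coeff (n - k) (coeff (m + 1 + k) F), ?_⟩
  have key : ∀ n, ∑ k ∈ range (n + 1), coeff (n - k) (coeff k F) = 0 := by
    intro n
    have := coeff_diagPS F n
    rw [h, map_zero, Nat.sum_antidiagonal_eq_sum_range_succ_mk] at this
    exact this.symm
  ext m n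
  rw [sub_mul, map_sub, map_sub, coeff_C_mul]
  rcases n with _ | n
  · rcases m with _ | m
    · simpa using key 0
    · simp [coeff_succ_X_mul]
  · rcases m with _ | m
    · have := key (n + 1)
      rw [sum_range_succ'] at this
      simp only [coeff_zero_X_mul, map_zero, zero_sub, coeff_succ_X_mul, coeff_mk]
      rw [eq_neg_iff_add_eq_zero, add_comm, ← this]
      simp only [Nat.sub_zero, add_left_inj]
      refine sum_congr rfl fun k _ => ?_
      rw [Nat.add_sub_add_right, zero_add, add_comm 1 k]
    · simp only [coeff_succ_X_mul, coeff_mk]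
      rw [sum_range_succ' _ (n + 1)]
      simp only [Nat.sub_zero, add_zero, Nat.add_sub_add_right]
      rw [eq_sub_iff_add_eq, add_comm]
      congr 1
      refine sum_congr rfl fun k _ => ?_
      rw [show m + 1 + 1 + k = m + 1 + (k + 1) by ring]

theorem eq_of_mul_eq_mul {F H : PowerSeries (PowerSeries A)}
    (h : (X - C X) * F = (X - C X) * H) : F = H := by
  rw [← sub_eq_zero, ← mul_sub] at h
  rw [← sub_eq_zero]
  set G := F - H
  have h0 : ∀ m n, coeff n (coeff m ((X - C X : PowerSeries (PowerSeries A)) * G)) = 0 := by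
    simp [h]
  have key : ∀ m n, coeff n (coeff m G) = 0 := by
    intro m
    induction m with
    | zero =>
      intro n
      have := h0 0 (n + 1)
      rw [sub_mul, map_sub, map_sub, coeff_C_mul, coeff_succ_X_mul] at this
      simpa using this
    | succ m ih =>
      intro n
      have := h0 (m + 1) (n + 1)
      rw [sub_mul, map_sub, map_sub, coeff_C_mul, coeff_succ_X_mul, coeff_succ_X_mul, ih] at this
      simpa using this
  ext m n
  simp [key]

variable {K : Type*} [CommRing K] [Algebra K A]

/-- Substitution in both variables of a double series. -/
def theta {M : ℕ} {q₁ q₂ : PowerSeries K} (h₁ : constantCoeff q₁ ^ M = 0)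
    (h₂ : constantCoeff q₂ ^ M = 0) : PowerSeries (PowerSeries A) →+* PowerSeries (PowerSeries A) :=
  (PowerSeries.map (subsHom A M q₂ h₂)).comp (subsHom (PowerSeries A) M q₁ h₁)

theorem theta_C {M : ℕ} {q₁ q₂ : PowerSeries K} (h₁ : constantCoeff q₁ ^ M = 0)
    (h₂ : constantCoeff q₂ ^ M = 0) (g : PowerSeries A) :
    theta h₁ h₂ (C g) = C (subsHom A M q₂ h₂ g) := by
  simp [theta, subsHom_C]

theorem theta_map_C {M : ℕ} {q₁ q₂ : PowerSeries K} (h₁ : constantCoeff q₁ ^ M = 0)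
    (h₂ : constantCoeff q₂ ^ M = 0) (f : PowerSeries A) :
    theta h₁ h₂ (PowerSeries.map C f) = PowerSeries.map C (subsHom A M q₁ h₁ f) := by
  let φ : A →ₐ[K] PowerSeries A := { (C : A →+* PowerSeries A) with
    commutes' := fun r => (PowerSeries.algebraMap_apply (r := r)).symm }
  have h := map_subsHom φ h₁ f
  have e : (φ : A →+* PowerSeries A) = C := rfl
  rw [e] at h
  rw [theta, RingHom.comp_apply, ← h, ← RingHom.comp_apply, ← PowerSeries.map_comp]
  congr 2
  ext a
  simp [subsHom_C]

end DoubleSeries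

/-! ### Evaluation of the defining relations of the double Yangian -/

section Rep

open PowerSeries

variable {N : ℕ} {A : Type*} [Ring A] [Algebra Kh A]

theorem mapSeries_Rplus {D D' : Type*} [Ring D] [Algebra Kh D] [Ring D'] [Algebra Kh D']
    (φ : D →ₐ[Kh] D') : mapSeries φ (Rplus N D) = Rplus N D' := by
  simp only [mapSeries, Rplus, map_sub, PowerSeries.map_C, PowerSeries.map_X, map_hbar_flip]

/-- Elements of an algebra which satisfy the defining relations of the double Yangian. -/
structure IsRep (c : ℂ) (x : Gen N → A) : Prop where
  rtt : Rminus N A * copy1 (Tcoeff x) * copy2 (Tcoeff x) =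
    copy2 (Tcoeff x) * copy1 (Tcoeff x) * Rminus N A
  rttPlus : Rplus N A * copy1 (Tpcoeff x) * copy2 (Tpcoeff x) =
    copy2 (Tpcoeff x) * copy1 (Tpcoeff x) * Rplus N A
  rttMixed : Rbar N A (c / 2) * copy1 (Tcoeff x) * copy2 (Tpcoeff x) =
    copy2 (Tpcoeff x) * copy1 (Tcoeff x) * Rbar N A (-(c / 2))

theorem DY.isRep {c : ℂ} (φ : DY N c →ₐ[Kh] A) : IsRep c fun g => φ (DY.gen N c g) := by
  refine ⟨?_, ?_, ?_⟩
  · have h := congrArg (mapSeries φ) (DY.rtt (N := N) (c := c))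
    simpa only [map_mul, mapSeries_Rminus, mapSeries_copy1, mapSeries_copy2, map_Tcoeff] using h
  · have h : Rplus N (DY N c) * copy1 (Tpcoeff (DY.gen N c)) * copy2 (Tpcoeff (DY.gen N c)) =
        copy2 (Tpcoeff (DY.gen N c)) * copy1 (Tpcoeff (DY.gen N c)) * Rplus N (DY N c) := by
      ext a b I J
      have := DY.mk_rel (Rel.rttPlus (N := N) (c := c) a b I J)
      rw [← entry_mapSeries, ← entry_mapSeries] at this
      simp only [map_mul, mapSeries_Rplus, mapSeries_copy1, mapSeries_copy2, map_Tpcoeff] at this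
      exact this
    have h := congrArg (mapSeries φ) h
    simpa only [map_mul, mapSeries_Rplus, mapSeries_copy1, mapSeries_copy2, map_Tpcoeff] using h
  · have h := congrArg (mapSeries φ) (DY.rttMixed (N := N) (c := c))
    simpa only [map_mul, mapSeries_Rbar, mapSeries_copy1, mapSeries_copy2, map_Tcoeff,
      map_Tpcoeff] using h

/-- A sequence of matrices as a matrix of series. -/
def serMat (X : ℕ → Matrix (Fin N) (Fin N) A) : Matrix (Fin N) (Fin N) (PowerSeries A) :=
  Matrix.of fun i j => PowerSeries.mk fun r => X r i j

variable {S D : Type*} [CommRing S] [Algebra Kh S] [Ring D] [Algebra S D]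

/-- Compatible evaluations of double series and of series in the outer and the inner variable. -/
structure DEval (S : Type*) [CommRing S] [Algebra Kh S] {D : Type*} [Ring D] [Algebra S D]
    (Ψ : PowerSeries (PowerSeries A) →+* D)
    (eO eI : PowerSeries A →+* D) : Prop where
  outer : ∀ f, Ψ (PowerSeries.map C f) = eO f
  inner : ∀ f, Ψ (C f) = eI f
  scalar : ∀ z : Kh, eI (C (algebraMap Kh A z)) = algebraMap S D (algebraMap Kh S z)

/-- A ring homomorphism applied to the entries of a double series of matrices. -/
def evMat (Ψ : PowerSeries (PowerSeries A) →+* D) :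
    PowerSeries (PowerSeries (Matrix (Fin N × Fin N) (Fin N × Fin N) A)) →+*
      Matrix (Fin N × Fin N) (Fin N × Fin N) D :=
  Ψ.mapMatrix.comp (psMat.comp (PowerSeries.map psMat))

theorem evMat_apply (Ψ : PowerSeries (PowerSeries A) →+* D)
    (F : PowerSeries (PowerSeries (Matrix (Fin N × Fin N) (Fin N × Fin N) A)))
    (I J : Fin N × Fin N) : evMat Ψ F I J =
      Ψ (PowerSeries.mk fun a => PowerSeries.mk fun b => coeff b (coeff a F) I J) := by
  change Ψ (psMat (PowerSeries.map psMat F) I J) = _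
  congr 1

variable {Ψ : PowerSeries (PowerSeries A) →+* D} {eO eI : PowerSeries A →+* D}

theorem DEval.outer_X (h : DEval S Ψ eO eI) : Ψ X = eO X := by
  rw [← h.outer, PowerSeries.map_X]

theorem DEval.scalar_smul (h : DEval S Ψ eO eI) (z : Kh) (F : PowerSeries (PowerSeries A)) :
    Ψ (C (C (algebraMap Kh A z)) * F) = algebraMap Kh S z • Ψ F := by
  rw [map_mul, h.inner, h.scalar, Algebra.smul_def]

theorem evMat_copy1 (h : DEval S Ψ eO eI) (Y : ℕ → Matrix (Fin N) (Fin N) A) :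
    evMat Ψ (copy1 Y) = kl ((serMat Y).map eO) := by
  ext ⟨i, k⟩ ⟨j, l⟩
  have hk : kl ((serMat Y).map eO) (i, k) (j, l) = eO (serMat Y i j) *
    (1 : Matrix (Fin N) (Fin N) D) k l := rfl
  rw [evMat_apply, hk, ← h.outer, Matrix.one_apply]
  have e : (PowerSeries.mk fun a => PowerSeries.mk fun b =>
      coeff b (coeff a (copy1 Y)) (i, k) (j, l)) =
      PowerSeries.map C (serMat Y i j) * (if k = l then 1 else 0) := by
    ext a b
    rw [coeff_mk, coeff_mk, copy1, coeff_mk, coeff_C]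
    by_cases hb : b = 0 <;> by_cases hk : k = l <;>
      simp [hb, hk, serMat, coeff_C, Matrix.kroneckerMap_apply]
  rw [e, map_mul]
  split_ifs <;> simp

theorem evMat_copy2 (h : DEval S Ψ eO eI) (Y : ℕ → Matrix (Fin N) (Fin N) A) :
    evMat Ψ (copy2 Y) = kr ((serMat Y).map eI) := by
  ext ⟨i, k⟩ ⟨j, l⟩
  have hk : kr ((serMat Y).map eI) (i, k) (j, l) = (1 : Matrix (Fin N) (Fin N) D) i j *
    eI (serMat Y k l) := rfl
  rw [evMat_apply, hk, ← h.inner, Matrix.one_apply]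
  have e : (PowerSeries.mk fun a => PowerSeries.mk fun b =>
      coeff b (coeff a (copy2 Y)) (i, k) (j, l)) =
      (if i = j then 1 else 0) * C (serMat Y k l) := by
    ext a b
    rw [coeff_mk, coeff_mk, copy2, coeff_C]
    by_cases hb : a = 0 <;> by_cases hk : i = j <;>
      simp [hb, hk, serMat, coeff_C, Matrix.kroneckerMap_apply]
  rw [e, map_mul]
  split_ifs <;> simp

theorem evMat_flip : evMat Ψ (C (C (flip N A))) = flip N D := by
  ext I J
  rw [evMat_apply]
  have e : (PowerSeries.mk fun a => PowerSeries.mk fun b =>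
      coeff b (coeff a (C (C (flip N A)))) I J) = if I.1 = J.2 ∧ I.2 = J.1 then 1 else 0 := by
    ext a b
    rw [coeff_mk, coeff_mk, coeff_C]
    by_cases ha : a = 0 <;> by_cases hb : b = 0 <;> by_cases hI : I.1 = J.2 ∧ I.2 = J.1 <;>
      simp [ha, hb, hI, flip, coeff_C, coeff_one]
  rw [e, flip, Matrix.of_apply]
  split_ifs <;> simp

theorem evMat_map_map {f : PowerSeries (PowerSeries Kh)} {s : S}
    (hf : Ψ (PowerSeries.map (PowerSeries.map (algebraMap Kh A)) f) = algebraMap S D s) :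
    evMat (N := N) Ψ (PowerSeries.map (PowerSeries.map (algebraMap Kh _)) f) = s • 1 := by
  ext I J
  rw [evMat_apply, Matrix.smul_apply, Matrix.one_apply]
  have e : (PowerSeries.mk fun a => PowerSeries.mk fun b => coeff b (coeff a
      (PowerSeries.map (PowerSeries.map (algebraMap Kh
        (Matrix (Fin N × Fin N) (Fin N × Fin N) A))) f)) I J) =
      PowerSeries.map (PowerSeries.map (algebraMap Kh A)) f * if I = J then 1 else 0 := by
    ext a b
    rw [coeff_mk, coeff_mk, coeff_map, coeff_map, Matrix.algebraMap_matrix_apply]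
    split_ifs <;> simp
  rw [e, map_mul, hf]
  split_ifs <;> simp [Algebra.smul_def]

theorem evMat_X {s : S} (hf : Ψ X = algebraMap S D s) :
    evMat (N := N) Ψ X = s • 1 := by
  have := evMat_map_map (N := N) (Ψ := Ψ) (f := X) (s := s) (by simpa using hf)
  simpa using this

theorem evMat_C_X {s : S} (hf : Ψ (C X) = algebraMap S D s) :
    evMat (N := N) Ψ (C X) = s • 1 := by
  have := evMat_map_map (N := N) (Ψ := Ψ) (f := C X) (s := s) (by simpa using hf)
  simpa using this

theorem evMat_hbar_flip (h : DEval S Ψ eO eI) :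
    evMat Ψ (C (C (hbar • flip N A))) = algebraMap Kh S hbar • flip N D := by
  have := evMat_map_map (N := N) (Ψ := Ψ) (f := C (C hbar)) (s := algebraMap Kh S hbar)
    (by simp [h.inner, h.scalar])
  rw [Algebra.smul_def, map_mul, map_mul, map_mul, evMat_flip]
  simp only [PowerSeries.map_C] at this
  rw [this, smul_mul_assoc, one_mul]

theorem rtt_of_evMat (h : DEval S Ψ eO eI) {Y Z : ℕ → Matrix (Fin N) (Fin N) A}
    {R R' : PowerSeries (PowerSeries (Matrix (Fin N × Fin N) (Fin N × Fin N) A))}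
    (hrel : R * copy1 Y * copy2 Z = copy2 Z * copy1 Y * R') {r r' : S × S}
    (hr : evMat Ψ R = lin N D r) (hr' : evMat Ψ R' = lin N D r') :
    RTT ((serMat Y).map eO) ((serMat Z).map eI) r r' := by
  have := congrArg (evMat Ψ) hrel
  rw [map_mul, map_mul, map_mul, map_mul, evMat_copy1 h, evMat_copy2 h, hr, hr'] at this
  exact this

variable {c : ℂ} {x : Gen N → A} {y z : S}

theorem IsRep.rtt_plus (hx : IsRep c x) (h : DEval S Ψ eO eI) (hy : eO X = algebraMap S D y)
    (hz : eI X = algebraMap S D z) :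
    RTT ((serMat (Tpcoeff x)).map eO) ((serMat (Tpcoeff x)).map eI)
      (y - z, -algebraMap Kh S hbar) (y - z, -algebraMap Kh S hbar) := by
  have e : evMat Ψ (Rplus N A) = lin N D (y - z, -algebraMap Kh S hbar) := by
    rw [Rplus, map_sub, map_sub, evMat_hbar_flip h, evMat_X (h.outer_X.trans hy),
      evMat_C_X ((h.inner X).trans hz), lin]
    module
  exact rtt_of_evMat h hx.rttPlus e e

theorem IsRep.rtt_minus (hx : IsRep c x) (h : DEval S Ψ eO eI) (hy : eO X = algebraMap S D y)
    (hz : eI X = algebraMap S D z) :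
    RTT ((serMat (Tcoeff x)).map eO) ((serMat (Tcoeff x)).map eI)
      (z - y, -(algebraMap Kh S hbar * y * z)) (z - y, -(algebraMap Kh S hbar * y * z)) := by
  have e : evMat Ψ (Rminus N A) = lin N D (z - y, -(algebraMap Kh S hbar * y * z)) := by
    rw [Rminus, map_sub, map_sub, map_mul, map_mul, evMat_hbar_flip h,
      evMat_X (h.outer_X.trans hy), evMat_C_X ((h.inner X).trans hz), lin]
    simp only [smul_mul_assoc, one_mul]
    module
  exact rtt_of_evMat h hx.rtt e e

theorem gh_eq_sum (N M : ℕ) : ∃ r : PowerSeries Kh, gh N =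
    ∑ k ∈ Finset.range M, C (C (gCoeff N k)) * (C hbar * X) ^ k + C (hbar ^ M) * r := by
  refine ⟨PowerSeries.mk fun k => if M ≤ k then hbar ^ (k - M) * C (gCoeff N k) else 0, ?_⟩
  ext1 k
  rw [map_add, map_sum, coeff_C_mul, coeff_mk, gh, coeff_mk]
  have e : ∀ l, coeff k (C (C (gCoeff N l)) * (C hbar * X) ^ l : PowerSeries Kh) =
      if k = l then hbar ^ k * C (gCoeff N k) else 0 := by
    intro l
    rw [mul_pow, ← map_pow, coeff_C_mul, coeff_C_mul, coeff_X_pow]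
    split_ifs with h
    · subst h; ring
    · simp
  simp only [e, Finset.sum_ite_eq, Finset.mem_range]
  by_cases h : k < M
  · rw [if_pos h, if_neg (by omega), mul_zero, add_zero]
  · rw [if_neg h, if_pos (by omega), zero_add, ← mul_assoc, ← pow_add]
    congr 2
    omega

/-- The values of the coefficients of the normalized R-matrix. -/
theorem eval_gh {B : Type*} [CommRing B] (ι : Kh →+* B) (Φ : PowerSeries B →+* D)
    (hι : ∀ z, Φ (C (ι z)) = algebraMap S D (algebraMap Kh S z)) {M : ℕ}
    (hM : algebraMap Kh S hbar ^ M = 0) {q : PowerSeries B} (hq : constantCoeff q ^ 1 = 0) {p : S}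
    (hp : Φ (C (ι hbar) * q) = algebraMap S D p) :
    Φ (subsHom B 1 q hq (PowerSeries.map ι (gh N))) = algebraMap S D (gval N M p) ∧
      Φ (subsHom B 1 q hq (PowerSeries.map ι (ghP N))) = algebraMap S D (-(gval N M p * p)) := by
  have hX : Φ (subsHom B 1 q hq (C (ι hbar) * X)) = algebraMap S D p := by
    rw [map_mul, subsHom_C, subsHom_X, ← hp]
    simp
  have h1 : Φ (subsHom B 1 q hq (PowerSeries.map ι (gh N))) = algebraMap S D (gval N M p) := by
    obtain ⟨r, hr⟩ := gh_eq_sum N M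
    rw [hr]
    simp only [map_add, map_sum, map_mul, map_pow, PowerSeries.map_C, PowerSeries.map_X,
      subsHom_C, hι]
    rw [← map_pow, hM, map_zero, zero_mul, add_zero, gval, map_sum]
    refine Finset.sum_congr rfl fun k _ => ?_
    rw [map_mul, map_pow, ← hX, map_mul, map_mul, subsHom_C, hι]
  refine ⟨h1, ?_⟩
  rw [ghP, map_mul, map_mul, map_mul, h1, map_neg, map_neg, map_neg, map_mul, PowerSeries.map_C,
    PowerSeries.map_X, hX, neg_mul, map_neg, mul_comm (gval N M p), map_mul]

theorem evMat_Rbar (h : DEval S Ψ eO eI) (hy : eO X = algebraMap S D y)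
    (hz : eI X = algebraMap S D z) {M : ℕ} (hM : algebraMap Kh S hbar ^ M = 0) {α : ℂ} {p : S}
    (hu : IsUnit (1 + (-z + algebraMap Kh S hbar * cst S α) * y))
    (hp : p * (1 + (-z + algebraMap Kh S hbar * cst S α) * y) = algebraMap Kh S hbar * y) :
    evMat Ψ (Rbar N A α) = lin N D (rr N M p) := by
  have hι : ∀ z, (Ψ.comp (PowerSeries.map (PowerSeries.map (algebraMap Kh A))))
      (C (C z : PowerSeries Kh)) = algebraMap S D (algebraMap Kh S z) := by
    intro z
    simp [h.inner, h.scalar]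
  have hq := congrArg (Ψ.comp (PowerSeries.map (PowerSeries.map (algebraMap Kh A))))
    (atInfQ_mul 1 (-X + C (hmul α) : PowerSeries Kh))
  have hp' : (Ψ.comp (PowerSeries.map (PowerSeries.map (algebraMap Kh A))))
      (C (C hbar) * atInfQ 1 (-X + C (hmul α) : PowerSeries Kh)) = algebraMap S D p := by
    have e1 : (Ψ.comp (PowerSeries.map (PowerSeries.map (algebraMap Kh A))))
        (1 + C (algebraMap ℂ (PowerSeries Kh) (1 : ℂ)⁻¹ * (-X + C (hmul α))) * X) =
        algebraMap S D (1 + (-z + algebraMap Kh S hbar * cst S α) * y) := by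
      simp only [inv_one, map_one, one_mul, map_add, map_mul, map_neg]
      rw [hι, hι]
      simp [h.outer_X, hy, h.inner, hz, cst]
    have e2 : (Ψ.comp (PowerSeries.map (PowerSeries.map (algebraMap Kh A))))
        (C (algebraMap ℂ (PowerSeries Kh) (1 : ℂ)⁻¹) * X) = algebraMap S D y := by
      simp [h.outer_X, hy]
    rw [map_mul, e1, e2] at hq
    have := hu.map (algebraMap S D)
    rw [← this.mul_left_inj, ← map_mul (algebraMap S D) p, hp, map_mul, mul_assoc, hq, hι, map_mul]
  obtain ⟨g1, g2⟩ := eval_gh (N := N) (C : Kh →+* PowerSeries Kh) _ hι hM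
    (constantCoeff_atInfQ 1 (-X + C (hmul α) : PowerSeries Kh)) hp'
  have t1 := evMat_map_map (N := N) (Ψ := Ψ) (s := (rr N M p).1) g1
  have t2 := evMat_map_map (N := N) (Ψ := Ψ) (s := (rr N M p).2) g2
  simp only [Rbar]
  rw [map_add (evMat Ψ), map_mul (evMat Ψ), atInf_eq, atInf_eq, t1, t2, evMat_flip, smul_mul_assoc, one_mul]

theorem IsRep.rtt_mixed (hx : IsRep c x) (h : DEval S Ψ eO eI) (hy : eO X = algebraMap S D y)
    (hz : eI X = algebraMap S D z) {M : ℕ} (hM : algebraMap Kh S hbar ^ M = 0) {p p' : S}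
    (hu : IsUnit (1 + (-z + algebraMap Kh S hbar * cst S (c / 2)) * y))
    (hu' : IsUnit (1 + (-z + algebraMap Kh S hbar * cst S (-(c / 2))) * y))
    (hp : p * (1 + (-z + algebraMap Kh S hbar * cst S (c / 2)) * y) = algebraMap Kh S hbar * y)
    (hp' : p' * (1 + (-z + algebraMap Kh S hbar * cst S (-(c / 2))) * y) =
      algebraMap Kh S hbar * y) :
    RTT ((serMat (Tcoeff x)).map eO) ((serMat (Tpcoeff x)).map eI) (rr N M p) (rr N M p') :=
  rtt_of_evMat h hx.rttMixed (evMat_Rbar h hy hz hM hu hp) (evMat_Rbar h hy hz hM hu' hp')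

end Rep

/-! ### Relations for arguments which differ by a multiple of `h` -/

section Close

open PowerSeries

variable {N : ℕ} {A : Type*} [Ring A] [Algebra Kh A]
  {S D : Type*} [CommRing S] [Algebra Kh S] [Ring D] [Algebra S D]
  {Ψ : PowerSeries (PowerSeries A) →+* D} {eO eI : PowerSeries A →+* D}
  {c : ℂ} {x : Gen N → A} {y z : S}

theorem RTT.swap {X Y : Matrix (Fin N) (Fin N) D} {r r' : S × S} (h : RTT Y X r r') :
    RTTr X Y r' r := by
  rw [RTT_iff] at h
  rw [RTTr_iff]
  intro i j k l
  have := h k l i j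
  rw [this]

instance algebraCenter {R B : Type*} [CommRing R] [Ring B] [Algebra R B] :
    Algebra (Subalgebra.center R B) B :=
  (Subalgebra.center R B).val.toRingHom.toAlgebra' fun z b =>
    (Subalgebra.mem_center_iff.1 z.2 b).symm

theorem algebraMap_double (z : Kh) : algebraMap Kh (PowerSeries (PowerSeries A)) z =
    C (C (algebraMap Kh A z)) := by
  rw [PowerSeries.algebraMap_apply, PowerSeries.algebraMap_apply]

theorem dEval_id : DEval (Subalgebra.center Kh (PowerSeries (PowerSeries A)))
    (RingHom.id (PowerSeries (PowerSeries A))) (PowerSeries.map C) C :=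
  ⟨fun _ => rfl, fun _ => rfl, fun z => (algebraMap_double z).symm⟩

theorem X_mem_center : (X : PowerSeries (PowerSeries A)) ∈
    Subalgebra.center Kh (PowerSeries (PowerSeries A)) :=
  Subalgebra.mem_center_iff.2 fun f => commute_X f

theorem C_X_mem_center : (C X : PowerSeries (PowerSeries A)) ∈
    Subalgebra.center Kh (PowerSeries (PowerSeries A)) :=
  Subalgebra.mem_center_iff.2 fun f => by
    ext1 n
    rw [coeff_mul_C, coeff_C_mul]
    exact commute_X _

theorem C_C_mem_center (z : Kh) : (C (C (algebraMap Kh A z)) : PowerSeries (PowerSeries A)) ∈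
    Subalgebra.center Kh (PowerSeries (PowerSeries A)) := by
  rw [← algebraMap_double]
  exact Subalgebra.algebraMap_mem _ z

theorem diagPS_commutator (a b a' b' : PowerSeries A) (h : a * b = a' * b') :
    diagPS (PowerSeries.map C a * C b - C a' * PowerSeries.map C b') = 0 := by
  rw [map_sub, map_mul, map_mul, diagPS_C, diagPS_C, diagPS_map_C, diagPS_map_C, h, sub_self]

theorem rtt_close {X' Y' : Matrix (Fin N) (Fin N) (PowerSeries A)} {d : S}
    (h : ∀ i j k l, d • (eO (X' i j) * eI (Y' k l) - eI (Y' k l) * eO (X' i j)) =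
      eO (X' k j) * eI (Y' i l) - eI (Y' k j) * eO (X' i l)) :
    RTT (X'.map eO) (Y'.map eI) (d, -1) (d, -1) := by
  rw [RTT_iff]
  intro i j k l
  have := h i j k l
  simp only [Matrix.map_apply, neg_smul, one_smul]
  rw [smul_sub, sub_eq_sub_iff_add_eq_add] at this
  rw [← sub_eq_add_neg, ← sub_eq_add_neg, sub_eq_sub_iff_add_eq_add, this, add_comm]

theorem IsRep.rtt_plus_entry (hx : IsRep c x) (h : DEval S Ψ eO eI)
    (hy : eO X = algebraMap S D y) (hz : eI X = algebraMap S D z) (i j k l : Fin N) :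
    (eO X - eI X) * (eO (serMat (Tpcoeff x) i j) * eI (serMat (Tpcoeff x) k l)) +
      -eI (C (algebraMap Kh A hbar)) *
        (eO (serMat (Tpcoeff x) k j) * eI (serMat (Tpcoeff x) i l)) =
    (eO X - eI X) * (eI (serMat (Tpcoeff x) k l) * eO (serMat (Tpcoeff x) i j)) +
      -eI (C (algebraMap Kh A hbar)) *
        (eI (serMat (Tpcoeff x) k j) * eO (serMat (Tpcoeff x) i l)) := by
  have hr := (RTT_iff _ _ _ _).1 (hx.rtt_plus h hy hz) i j k l
  simpa only [Matrix.map_apply, Algebra.smul_def, map_sub, map_neg, hy, hz, h.scalar] using hr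

theorem IsRep.rtt_minus_entry (hx : IsRep c x) (h : DEval S Ψ eO eI)
    (hy : eO X = algebraMap S D y) (hz : eI X = algebraMap S D z) (i j k l : Fin N) :
    (eI X - eO X) * (eO (serMat (Tcoeff x) i j) * eI (serMat (Tcoeff x) k l)) +
      -(eI (C (algebraMap Kh A hbar)) * eO X * eI X) *
        (eO (serMat (Tcoeff x) k j) * eI (serMat (Tcoeff x) i l)) =
    (eI X - eO X) * (eI (serMat (Tcoeff x) k l) * eO (serMat (Tcoeff x) i j)) +
      -(eI (C (algebraMap Kh A hbar)) * eO X * eI X) *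
        (eI (serMat (Tcoeff x) k j) * eO (serMat (Tcoeff x) i l)) := by
  have hr := (RTT_iff _ _ _ _).1 (hx.rtt_minus h hy hz) i j k l
  simpa only [Matrix.map_apply, Algebra.smul_def, map_sub, map_neg, map_mul, hy, hz, h.scalar]
    using hr

theorem IsRep.rtt_plus_close (hx : IsRep c x) (h : DEval S Ψ eO eI)
    (hy : eO X = algebraMap S D y) (hz : eI X = algebraMap S D z) {d : S}
    (hd : y - z = algebraMap Kh S hbar * d) :
    RTT ((serMat (Tpcoeff x)).map eO) ((serMat (Tpcoeff x)).map eI) (d, -1) (d, -1) := by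
  refine rtt_close fun i j k l => ?_
  have hr : (X - C X) * (PowerSeries.map C (serMat (Tpcoeff x) i j) * C (serMat (Tpcoeff x) k l)) +
      -C (C (algebraMap Kh A hbar)) *
        (PowerSeries.map C (serMat (Tpcoeff x) k j) * C (serMat (Tpcoeff x) i l)) =
      (X - C X) * (C (serMat (Tpcoeff x) k l) * PowerSeries.map C (serMat (Tpcoeff x) i j)) +
      -C (C (algebraMap Kh A hbar)) *
        (C (serMat (Tpcoeff x) k j) * PowerSeries.map C (serMat (Tpcoeff x) i l)) := by
    have e := hx.rtt_plus_entry (dEval_id (A := A)) (y := ⟨X, X_mem_center⟩)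
      (z := ⟨C X, C_X_mem_center⟩) (PowerSeries.map_X _) rfl i j k l
    rwa [PowerSeries.map_X] at e
  generalize serMat (Tpcoeff x) = T at hr ⊢
  obtain ⟨F, hF⟩ := exists_eq_mul_of_diagPS_eq_zero
    (diagPS_commutator (T k j) (T i l) (T k j) (T i l) rfl)
  have hB : PowerSeries.map C (T i j) * C (T k l) - C (T k l) * PowerSeries.map C (T i j) =
      C (C (algebraMap Kh A hbar)) * F := by
    apply eq_of_mul_eq_mul
    have hc : (X - C X) * (C (C (algebraMap Kh A hbar)) * F) =
        C (C (algebraMap Kh A hbar)) * ((X - C X) * F) := by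
      rw [← mul_assoc, ← mul_assoc, Subalgebra.mem_center_iff.1 (C_C_mem_center hbar)]
    rw [hc, ← hF, mul_sub, mul_sub, sub_eq_sub_iff_add_eq_add]
    rw [neg_mul, neg_mul, ← sub_eq_add_neg, ← sub_eq_add_neg, sub_eq_sub_iff_add_eq_add] at hr
    rw [← sub_eq_zero] at hr ⊢
    rw [← hr]
    abel
  have hB' := congrArg Ψ hB
  have hF' := congrArg Ψ hF
  rw [h.scalar_smul] at hB'
  rw [map_mul, map_sub Ψ X, h.outer_X, h.inner, hy, hz, ← map_sub, hd, ← Algebra.smul_def] at hF'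
  simp only [map_sub, map_mul, h.outer, h.inner] at hB' hF'
  rw [hB', hF', mul_comm, mul_smul]

theorem IsRep.rtt_minus_close (hx : IsRep c x) (h : DEval S Ψ eO eI)
    (hy : eO X = algebraMap S D y) (hz : eI X = algebraMap S D z) {d : S}
    (hd : z - y = algebraMap Kh S hbar * y * z * d) :
    RTT ((serMat (Tcoeff x)).map eO) ((serMat (Tcoeff x)).map eI) (d, -1) (d, -1) := by
  refine rtt_close fun i j k l => ?_
  have hr : (C X - X) * (PowerSeries.map C (serMat (Tcoeff x) i j) * C (serMat (Tcoeff x) k l)) +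
      -(C (C (algebraMap Kh A hbar)) * X * C X) *
        (PowerSeries.map C (serMat (Tcoeff x) k j) * C (serMat (Tcoeff x) i l)) =
      (C X - X) * (C (serMat (Tcoeff x) k l) * PowerSeries.map C (serMat (Tcoeff x) i j)) +
      -(C (C (algebraMap Kh A hbar)) * X * C X) *
        (C (serMat (Tcoeff x) k j) * PowerSeries.map C (serMat (Tcoeff x) i l)) := by
    have e := hx.rtt_minus_entry (dEval_id (A := A)) (y := ⟨X, X_mem_center⟩)
      (z := ⟨C X, C_X_mem_center⟩) (PowerSeries.map_X _) rfl i j k l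
    rwa [PowerSeries.map_X] at e
  generalize serMat (Tcoeff x) = T at hr ⊢
  obtain ⟨F, hF⟩ := exists_eq_mul_of_diagPS_eq_zero
    (diagPS_commutator (T k j) (T i l) (T k j) (T i l) rfl)
  have hB : PowerSeries.map C (T i j) * C (T k l) - C (T k l) * PowerSeries.map C (T i j) =
      C (C (algebraMap Kh A hbar)) * (-(X * C X * F)) := by
    apply eq_of_mul_eq_mul
    have hc : (X - C X) * (C (C (algebraMap Kh A hbar)) * (-(X * C X * F))) =
        -(C (C (algebraMap Kh A hbar)) * X * C X * ((X - C X) * F)) := by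
      have h1 := fun f => (Subalgebra.mem_center_iff.1 (C_C_mem_center (A := A) hbar) f)
      have h2 : ∀ f : PowerSeries (PowerSeries A), f * X = X * f :=
        Subalgebra.mem_center_iff.1 (X_mem_center (A := A))
      have h3 : ∀ f : PowerSeries (PowerSeries A), f * C X = C X * f :=
        Subalgebra.mem_center_iff.1 (C_X_mem_center (A := A))
      rw [mul_neg, mul_neg, ← mul_assoc, h1, mul_assoc _ (X - C X), ← mul_assoc (X - C X),
        ← mul_assoc (X - C X), h2 (X - C X), mul_assoc X (X - C X), h3 (X - C X)]
      simp only [mul_assoc]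
    rw [hc, ← hF, ← neg_inj, neg_neg, ← neg_mul, neg_sub, mul_sub, mul_sub,
      sub_eq_sub_iff_add_eq_add]
    rw [neg_mul, neg_mul, ← sub_eq_add_neg, ← sub_eq_add_neg, sub_eq_sub_iff_add_eq_add] at hr
    rw [← sub_eq_zero] at hr ⊢
    rw [← hr]
    abel
  have hB' := congrArg Ψ hB
  have hF' := congrArg Ψ hF
  rw [h.scalar_smul, map_neg, map_mul, map_mul, h.outer_X, h.inner, hy, hz, ← map_mul,
    ← Algebra.smul_def] at hB'
  rw [map_mul, map_sub Ψ X, h.outer_X, h.inner, hy, hz, ← map_sub, ← neg_sub z y, hd,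
    ← Algebra.smul_def] at hF'
  simp only [map_sub, map_mul, h.outer, h.inner] at hB' hF'
  rw [hB', hF']
  module

end Close

/-! ### Evaluation points -/

section Points

open PowerSeries

variable (K : Type*) {A : Type*} [CommRing K] [Algebra Kh K] [Ring A] [Algebra K A] [Algebra Kh A]
  [IsScalarTower Kh K A] {M : ℕ} {σ : ℤˣ}

/-- The series `ε X + h a`. -/
def qP (ε : ℤˣ) (a : ℂ) : PowerSeries K := ((ε : ℤ) : PowerSeries K) * X +
  C (algebraMap Kh K (hmul a))

/-- The series `(ε x + h a)⁻¹` in `x⁻¹`. -/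
def qT (ε : ℤˣ) (a : ℂ) : PowerSeries K :=
  PowerSeries.map (algebraMap Kh K) (atInfQ ((ε : ℤ) : ℂ) (hmul a))

theorem qT_mul (ε : ℤˣ) (a : ℂ) :
    qT K ε a * (((ε : ℤ) : PowerSeries K) + C (algebraMap Kh K (hmul a)) * X) = X := by
  have h := congrArg (PowerSeries.map (algebraMap Kh K)) (atInfQ_mul ((ε : ℤ) : ℂ) (hmul a))
  rw [map_mul] at h
  rw [qT]
  generalize PowerSeries.map (algebraMap Kh K) (atInfQ ((ε : ℤ) : ℂ) (hmul a)) = q at h ⊢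
  generalize hmul a = b at h ⊢
  rcases Int.units_eq_one_or ε with rfl | rfl
  · simpa using h
  · simp only [Units.val_neg, Units.val_one, Int.cast_neg, Int.cast_one, inv_neg, inv_one,
      map_neg, map_one, neg_mul, one_mul, map_add, map_mul, PowerSeries.map_C,
      PowerSeries.map_X] at h ⊢
    rw [← neg_inj, ← h]
    ring

/-- The Laurent polynomial `ε u + h a`. -/
def arg (ε : ℤˣ) (a : ℂ) : K[T;T⁻¹] :=
  ((ε : ℤ) : K[T;T⁻¹]) * LaurentPolynomial.T 1 +
    LaurentPolynomial.C (algebraMap Kh K (hmul a))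

variable {K}

theorem hmul_pow (hM : algebraMap Kh K hbar ^ M = 0) (a : ℂ) :
    algebraMap Kh K (hmul a) ^ M = 0 := by
  rw [map_mul, mul_pow, hM, zero_mul]

theorem constantCoeff_qP (hM : algebraMap Kh K hbar ^ M = 0) (ε : ℤˣ) (a : ℂ) :
    constantCoeff (qP K ε a) ^ M = 0 := by
  rw [qP, map_add, map_mul, constantCoeff_X, mul_zero, zero_add, constantCoeff_C, hmul_pow hM]

theorem constantCoeff_qT (hM0 : M ≠ 0) (ε : ℤˣ) (a : ℂ) :
    constantCoeff (qT K ε a) ^ M = 0 := by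
  have h := constantCoeff_atInfQ ((ε : ℤ) : ℂ) (hmul a)
  rw [pow_one] at h
  rw [qT, ← coeff_zero_eq_constantCoeff_apply, coeff_map, coeff_zero_eq_constantCoeff_apply, h,
    map_zero, zero_pow hM0]

theorem isUnit_intUnit (R : Type*) [Ring R] (ε : ℤˣ) : IsUnit ((ε : ℤ) : R) :=
  ε.isUnit.map (Int.castRingHom R)

theorem isUnit_arg (hM : algebraMap Kh K hbar ^ M = 0) (ε : ℤˣ) (a : ℂ) : IsUnit (arg K ε a) := by
  refine IsNilpotent.isUnit_add_left_of_commute ⟨M, ?_⟩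
    ((isUnit_intUnit _ ε).mul (LaurentPolynomial.isUnit_T 1)) (Commute.all _ _)
  rw [← map_pow, hmul_pow hM, map_zero]

variable (A)

/-- The substitution of `ε X + h a`. -/
def evP (hM : algebraMap Kh K hbar ^ M = 0) (ε : ℤˣ) (a : ℂ) : PowerSeries A →+* PowerSeries A :=
  subsHom A M (qP K ε a) (constantCoeff_qP hM ε a)

variable (K)

/-- The substitution of `ε x + h a`, for series in `x⁻¹`. -/
def evT (hM0 : M ≠ 0) (ε : ℤˣ) (a : ℂ) : PowerSeries A →+* PowerSeries A :=
  subsHom A M (qT K ε a) (constantCoeff_qT hM0 ε a)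

variable {K A}

theorem ofPS_evP_X (hM : algebraMap Kh K hbar ^ M = 0) (ε : ℤˣ) (a : ℂ) :
    Ser.ofPS 1 (evP A hM ε a X) = algebraMap K[T;T⁻¹] (Ser 1 A) (arg K ε a) := by
  rw [evP, subsHom_X, qP, arg]
  simp only [map_add, map_mul, PowerSeries.map_C, PowerSeries.map_X, map_intCast, Ser.ofPS_C,
    Ser.ofPS_X, algebraMap_Ser_C, algebraMap_Ser_T, Units.val_one, mul_one]

theorem ofPS_evT_X (hM : algebraMap Kh K hbar ^ M = 0) (hM0 : M ≠ 0) (ε : ℤˣ) (a : ℂ) :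
    Ser.ofPS (-1) (evT K A hM0 ε a X) =
      algebraMap K[T;T⁻¹] (Ser (-1) A) (Ring.inverse (arg K ε a)) := by
  have hu := (isUnit_arg hM ε a).map (algebraMap K[T;T⁻¹] (Ser (-1) A))
  rw [← hu.mul_left_inj, ← map_mul, Ring.inverse_mul_cancel _ (isUnit_arg hM ε a), map_one]
  rw [evT, subsHom_X, arg]
  have h := congrArg (fun f => Ser.ofPS (-1) (PowerSeries.map (algebraMap K A) f)) (qT_mul K ε a)
  generalize qT K ε a = q at h ⊢
  generalize hmul a = b at h ⊢
  simp only [map_add, map_mul, PowerSeries.map_C, PowerSeries.map_X, map_intCast, Ser.ofPS_C,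
    Ser.ofPS_X] at h
  have h' := congrArg (fun f => f * (Ser.mono (-1) 1 : Ser (-1) A)) h
  simp only [Ser.mono_mul_mono, add_neg_cancel, mul_one] at h'
  rw [map_add, map_mul, map_intCast, algebraMap_Ser_C, algebraMap_Ser_T]
  simp only [Units.val_neg, Units.val_one, mul_one]
  rw [← Ser.C_eq_mono, map_one] at h'
  rw [← h', mul_assoc, add_mul, mul_assoc (Ser.C _), Ser.mono_mul_mono, add_neg_cancel, mul_one,
    ← Ser.C_eq_mono, map_one, mul_one]

theorem algebraMap_Lau_Kh (z : Kh) : algebraMap Kh K[T;T⁻¹] z =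
    LaurentPolynomial.C (algebraMap Kh K z) := by
  rw [LaurentPolynomial.algebraMap_apply]

theorem algebraMap_Ser_Kh (z : Kh) : algebraMap K[T;T⁻¹] (Ser σ A)
    (algebraMap Kh K[T;T⁻¹] z) = Ser.C (algebraMap Kh A z) := by
  rw [algebraMap_Lau_Kh, algebraMap_Ser_C, ← IsScalarTower.algebraMap_apply]

/-- Evaluation of double series on the diagonal. -/
theorem dEval_diag {q₁ q₂ : PowerSeries K} (h₁ : constantCoeff q₁ ^ M = 0)
    (h₂ : constantCoeff q₂ ^ M = 0) :
    DEval K[T;T⁻¹] (((Ser.ofPS σ).comp diagPS).comp (theta h₁ h₂))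
      ((Ser.ofPS σ).comp (subsHom A M q₁ h₁)) ((Ser.ofPS σ).comp (subsHom A M q₂ h₂)) where
  outer f := by
    rw [RingHom.comp_apply, RingHom.comp_apply, RingHom.comp_apply, theta_map_C, diagPS_map_C]
  inner f := by
    rw [RingHom.comp_apply, RingHom.comp_apply, RingHom.comp_apply, theta_C, diagPS_C]
  scalar z := by
    rw [RingHom.comp_apply, subsHom_C, Ser.ofPS_C, algebraMap_Ser_Kh]

/-- A series in the outer variable. -/
def outS (σ : ℤˣ) (A : Type*) [Ring A] : PowerSeries A →+* PowerSeries (Ser σ A) := PowerSeries.map Ser.C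

/-- A series in the inner variable. -/
def inS (σ : ℤˣ) (A : Type*) [Ring A] : PowerSeries A →+* PowerSeries (Ser σ A) := C.comp (Ser.ofPS σ)

theorem algebraMap_Out_Kh (z : Kh) :
    algebraMap (PowerSeries K[T;T⁻¹]) (PowerSeries (Ser σ A))
      (algebraMap Kh (PowerSeries K[T;T⁻¹]) z) = C (Ser.C (algebraMap Kh A z)) := by
  rw [algebraMap_Out, PowerSeries.algebraMap_apply, PowerSeries.map_C, algebraMap_Ser_Kh]

theorem map_ofPS_map_C (f : PowerSeries A) :
    PowerSeries.map (Ser.ofPS σ) (PowerSeries.map C f) = outS σ A f := by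
  rw [outS, ← RingHom.comp_apply, ← PowerSeries.map_comp]
  congr 2
  ext1 a
  exact Ser.ofPS_C a

/-- Evaluation of double series, the outer variable being `ω`. -/
theorem dEval_double {q₁ q₂ : PowerSeries K} (h₁ : constantCoeff q₁ ^ M = 0)
    (h₂ : constantCoeff q₂ ^ M = 0) :
    DEval (PowerSeries K[T;T⁻¹]) ((PowerSeries.map (Ser.ofPS σ)).comp (theta h₁ h₂))
      ((outS σ A).comp (subsHom A M q₁ h₁)) ((inS σ A).comp (subsHom A M q₂ h₂)) where
  outer f := by
    rw [RingHom.comp_apply, RingHom.comp_apply, theta_map_C, map_ofPS_map_C]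
  inner f := by
    rw [RingHom.comp_apply, RingHom.comp_apply, theta_C, PowerSeries.map_C]
    rfl
  scalar z := by
    rw [RingHom.comp_apply, subsHom_C, inS, RingHom.comp_apply, Ser.ofPS_C, algebraMap_Out_Kh]

/-- Evaluation of double series, the inner variable being `ω`. -/
theorem dEval_swap {q₁ q₂ : PowerSeries K} (h₁ : constantCoeff q₁ ^ M = 0)
    (h₂ : constantCoeff q₂ ^ M = 0) :
    DEval (PowerSeries K[T;T⁻¹])
      (((PowerSeries.map (Ser.ofPS σ)).comp swapPS).comp (theta h₁ h₂))
      ((inS σ A).comp (subsHom A M q₁ h₁)) ((outS σ A).comp (subsHom A M q₂ h₂)) where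
  outer f := by
    rw [RingHom.comp_apply, RingHom.comp_apply, RingHom.comp_apply, theta_map_C, swapPS_map_C,
      PowerSeries.map_C]
    rfl
  inner f := by
    rw [RingHom.comp_apply, RingHom.comp_apply, RingHom.comp_apply, theta_C, swapPS_C,
      map_ofPS_map_C]
  scalar z := by
    rw [RingHom.comp_apply, subsHom_C, outS, PowerSeries.map_C, algebraMap_Out_Kh]

variable (K) in
/-- Constants of the inner scalars. -/
def cS : K[T;T⁻¹] →+* PowerSeries K[T;T⁻¹] := C

theorem algebraMap_C_Out (s : K[T;T⁻¹]) :
    algebraMap (PowerSeries K[T;T⁻¹]) (PowerSeries (Ser σ A)) (cS K s) =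
      C (algebraMap K[T;T⁻¹] (Ser σ A) s) := by
  rw [algebraMap_Out, cS, PowerSeries.map_C]

theorem inS_evP_X (hM : algebraMap Kh K hbar ^ M = 0) (ε : ℤˣ) (a : ℂ) :
    inS 1 A (evP A hM ε a X) = algebraMap (PowerSeries K[T;T⁻¹]) _
      (cS K (arg K ε a)) := by
  rw [algebraMap_C_Out, ← ofPS_evP_X hM]
  rfl

theorem inS_evT_X (hM : algebraMap Kh K hbar ^ M = 0) (hM0 : M ≠ 0) (ε : ℤˣ) (a : ℂ) :
    inS (-1) A (evT K A hM0 ε a X) = algebraMap (PowerSeries K[T;T⁻¹]) _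
      (cS K (Ring.inverse (arg K ε a))) := by
  rw [algebraMap_C_Out, ← ofPS_evT_X hM hM0]
  rfl

theorem outS_map_algebraMap (q : PowerSeries K) :
    outS σ A (PowerSeries.map (algebraMap K A) q) =
      algebraMap (PowerSeries K[T;T⁻¹]) (PowerSeries (Ser σ A))
        (PowerSeries.map LaurentPolynomial.C q) := by
  rw [outS, algebraMap_Out, ← RingHom.comp_apply, ← RingHom.comp_apply, ← PowerSeries.map_comp,
    ← PowerSeries.map_comp]
  congr 2
  ext1 a
  simp only [RingHom.comp_apply, algebraMap_Ser_C]

theorem outS_evP_X (hM : algebraMap Kh K hbar ^ M = 0) (ε : ℤˣ) (a : ℂ) :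
    outS σ A (evP A hM ε a X) = algebraMap (PowerSeries K[T;T⁻¹]) _
      (PowerSeries.map LaurentPolynomial.C (qP K ε a)) := by
  rw [evP, subsHom_X, outS_map_algebraMap]

theorem outS_evT_X (hM0 : M ≠ 0) (ε : ℤˣ) (a : ℂ) :
    outS σ A (evT K A hM0 ε a X) = algebraMap (PowerSeries K[T;T⁻¹]) _
      (PowerSeries.map LaurentPolynomial.C (qT K ε a)) := by
  rw [evT, subsHom_X, outS_map_algebraMap]

end Points

/-! ### The arguments of the R-matrices -/

section Args

open PowerSeries

variable (K : Type*) [CommRing K] [Algebra Kh K] {M N : ℕ}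

/-- The ring of scalars: power series in `ω` over the Laurent polynomials in `u`. -/
abbrev OS (K : Type*) [CommRing K] : Type _ := PowerSeries K[T;T⁻¹]

/-- `h` as a scalar. -/
abbrev hs (S : Type*) [CommRing S] [Algebra Kh S] : S := algebraMap Kh S hbar

/-- The denominator of `w = e₁ / e₀`, where `w = ω⁻¹` if `b` and `w = ω` otherwise. -/
def e₀ (b : Bool) : OS K := if b then X else 1

/-- The numerator of `w = e₁ / e₀`. -/
def e₁ (b : Bool) : OS K := if b then 1 else X

/-- The product of `e₀` and of `ε w + δ u + h α`. -/
def nn (b : Bool) (ε δ : ℤˣ) (α : ℂ) : OS K :=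
  ((ε : ℤ) : OS K) * e₁ K b + (((δ : ℤ) : OS K) * cS K (LaurentPolynomial.T 1) +
    hs (OS K) * cst (OS K) α) * e₀ K b

/-- `h / (ε w + δ u + h α)`. -/
def pv (b : Bool) (ε δ : ℤˣ) (α : ℂ) : OS K :=
  hs (OS K) * e₀ K b * Ring.inverse (nn K b ε δ α)

/-- `-2 u + h γ`. -/
def arg₂ (γ : ℂ) : K[T;T⁻¹] :=
  -2 * LaurentPolynomial.T 1 + hs K[T;T⁻¹] * cst K[T;T⁻¹] γ

/-- `h / (-2 u + h γ)`. -/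
def qv (γ : ℂ) : K[T;T⁻¹] := hs K[T;T⁻¹] * Ring.inverse (arg₂ K γ)

variable {K}

theorem cS_hs : cS K (hs K[T;T⁻¹]) = hs (OS K) := by
  rw [cS, hs, hs, PowerSeries.algebraMap_apply]

theorem cS_cst (a : ℂ) : cS K (cst K[T;T⁻¹] a) = cst (OS K) a := by
  rw [cS, cst, cst, RingHom.comp_apply, RingHom.comp_apply, PowerSeries.algebraMap_apply]

theorem arg_eq (ε : ℤˣ) (a : ℂ) : arg K ε a =
    ((ε : ℤ) : K[T;T⁻¹]) * LaurentPolynomial.T 1 +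
      hs K[T;T⁻¹] * cst K[T;T⁻¹] a := by
  rw [arg, ← algebraMap_Lau_Kh, map_mul]
  rfl

theorem cS_arg (ε : ℤˣ) (a : ℂ) : cS K (arg K ε a) =
    ((ε : ℤ) : OS K) * cS K (LaurentPolynomial.T 1) + hs (OS K) * cst (OS K) a := by
  rw [arg_eq, map_add, map_mul, map_mul, cS_hs, cS_cst, map_intCast]

theorem map_C_hmul (a : ℂ) : PowerSeries.map LaurentPolynomial.C
    (C (algebraMap Kh K (hmul a))) = hs (OS K) * cst (OS K) a := by
  rw [PowerSeries.map_C, ← algebraMap_Lau_Kh, map_mul, map_mul]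
  exact congrArg₂ (· * ·) cS_hs (cS_cst a)

theorem map_C_qP (ε : ℤˣ) (a : ℂ) : PowerSeries.map LaurentPolynomial.C (qP K ε a) =
    ((ε : ℤ) : OS K) * X + hs (OS K) * cst (OS K) a := by
  rw [qP, map_add, map_C_hmul, map_mul, PowerSeries.map_X, map_intCast]

theorem map_C_qT_mul (ε : ℤˣ) (a : ℂ) : PowerSeries.map LaurentPolynomial.C (qT K ε a) *
    (((ε : ℤ) : OS K) + hs (OS K) * cst (OS K) a * X) = X := by
  have h := congrArg (PowerSeries.map (LaurentPolynomial.C : K →+* K[T;T⁻¹]))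
    (qT_mul K ε a)
  rwa [map_mul, map_add, map_mul _ (C _), map_C_hmul, PowerSeries.map_X, map_intCast] at h

variable (hM : algebraMap Kh K hbar ^ M = 0)
include hM

theorem hs_Lau_pow : hs K[T;T⁻¹] ^ M = 0 := by
  rw [hs, algebraMap_Lau_Kh, ← map_pow, hM, map_zero]

theorem hs_pow : hs (OS K) ^ M = 0 := by
  rw [← cS_hs, ← map_pow, hs_Lau_pow hM, map_zero]

theorem isUnit_outT (ε : ℤˣ) (a : ℂ) :
    IsUnit (((ε : ℤ) : OS K) + hs (OS K) * cst (OS K) a * X) := by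
  refine IsNilpotent.isUnit_add_left_of_commute ⟨M, ?_⟩ (isUnit_intUnit _ ε) (Commute.all _ _)
  rw [mul_pow, mul_pow, hs_pow hM, zero_mul, zero_mul]

theorem isUnit_nn (b : Bool) (ε δ : ℤˣ) (α : ℂ) : IsUnit (nn K b ε δ α) := by
  rw [PowerSeries.isUnit_iff_constantCoeff, nn, ← cS_arg]
  cases b
  · simpa [e₀, e₁, cS] using isUnit_arg hM δ α
  · simpa [e₀, e₁, cS] using isUnit_intUnit _ ε

theorem isUnit_arg₂ (γ : ℂ) : IsUnit (arg₂ K γ) := by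
  refine IsNilpotent.isUnit_add_left_of_commute ⟨M, ?_⟩ ?_ (Commute.all _ _)
  · rw [mul_pow, hs_Lau_pow hM, zero_mul]
  · refine IsUnit.mul ?_ (LaurentPolynomial.isUnit_T 1)
    have h : (-2 : K[T;T⁻¹]) = cst K[T;T⁻¹] (-2) := by rw [map_neg, map_ofNat]
    rw [h]
    exact (isUnit_iff_ne_zero.2 (by norm_num)).map _

theorem pv_mul (b : Bool) (ε δ : ℤˣ) (α : ℂ) :
    pv K b ε δ α * nn K b ε δ α = hs (OS K) * e₀ K b := by
  rw [pv, mul_assoc, Ring.inverse_mul_cancel _ (isUnit_nn hM b ε δ α), mul_one]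

theorem eq_pv {b : Bool} {ε δ : ℤˣ} {α : ℂ} {p : OS K} (h : p * nn K b ε δ α = hs (OS K) * e₀ K b) :
    p = pv K b ε δ α := by
  rwa [← pv_mul hM, (isUnit_nn hM b ε δ α).mul_left_inj] at h

theorem qv_mul (γ : ℂ) : qv K γ * arg₂ K γ = hs K[T;T⁻¹] := by
  rw [qv, mul_assoc, Ring.inverse_mul_cancel _ (isUnit_arg₂ hM γ), mul_one]

theorem pv_pow (b : Bool) (ε δ : ℤˣ) (α : ℂ) : pv K b ε δ α ^ M = 0 := by
  rw [pv, mul_pow, mul_pow, hs_pow hM, zero_mul, zero_mul]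

theorem qv_pow (γ : ℂ) : qv K γ ^ M = 0 := by
  rw [qv, mul_pow, hs_Lau_pow hM, zero_mul]

theorem neg_pv (b : Bool) (ε δ : ℤˣ) (α : ℂ) : -pv K b ε δ α = pv K b (-ε) (-δ) (-α) := by
  apply eq_pv hM
  rw [← pv_mul hM b ε δ α, nn, nn, map_neg]
  push_cast
  ring

theorem pv_fusion (b : Bool) (ε δ : ℤˣ) (α c : ℂ) :
    pv K b ε δ (α - c) * (1 - cst (OS K) c * pv K b ε δ α) = pv K b ε δ α := by
  have h1 := pv_mul hM b ε δ α
  have h2 := pv_mul hM b ε δ (α - c)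
  have h3 : nn K b ε δ (α - c) = nn K b ε δ α - hs (OS K) * cst (OS K) c * e₀ K b := by
    rw [nn, nn, map_sub]
    ring
  apply ((isUnit_nn hM b ε δ α).mul (isUnit_nn hM b ε δ (α - c))).mul_left_injective
  simp only
  rw [h3] at h2 ⊢
  linear_combination (nn K b ε δ α - cst (OS K) c * pv K b ε δ α * nn K b ε δ α) * h2 -
    (hs (OS K) * cst (OS K) c * e₀ K b + nn K b ε δ α -
      hs (OS K) * cst (OS K) c * e₀ K b) * h1

theorem pv_crossing (b : Bool) (ε δ : ℤˣ) (α : ℂ) :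
    pv K b ε δ (α + N) * (1 + N * pv K b ε δ α) = pv K b ε δ α := by
  have := pv_fusion hM b ε δ α (-(N : ℂ))
  simpa using this

theorem qv_fusion (γ c : ℂ) :
    qv K (γ - c) * (1 - cst K[T;T⁻¹] c * qv K γ) = qv K γ := by
  have h1 := qv_mul hM γ
  have h2 := qv_mul hM (γ - c)
  have h3 : arg₂ K (γ - c) = arg₂ K γ -
      hs K[T;T⁻¹] * cst K[T;T⁻¹] c := by
    rw [arg₂, arg₂, map_sub]
    ring
  apply ((isUnit_arg₂ hM γ).mul (isUnit_arg₂ hM (γ - c))).mul_left_injective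
  simp only
  rw [h3] at h2 ⊢
  linear_combination (arg₂ K γ - cst K[T;T⁻¹] c * qv K γ * arg₂ K γ) * h2 -
    arg₂ K γ * h1

theorem pv_ybe (b : Bool) (α β : ℂ) :
    pv K b 1 (-1) α * pv K b (-1) (-1) β = pv K b 1 (-1) α * cS K (qv K (α + β)) +
      pv K b (-1) (-1) β * cS K (qv K (α + β)) := by
  have h1 := pv_mul hM b 1 (-1) α
  have h2 := pv_mul hM b (-1) (-1) β
  have h3 := congrArg (cS K) (qv_mul hM (α + β))
  have h4 : nn K b 1 (-1) α + nn K b (-1) (-1) β = cS K (arg₂ K (α + β)) * e₀ K b := by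
    rw [nn, nn, arg₂, map_add, map_mul, map_mul, map_add, cS_hs, map_add, cS_cst, cS_cst]
    simp only [Units.val_neg, Units.val_one, Int.cast_neg, Int.cast_one, map_neg, map_ofNat]
    ring
  rw [map_mul, cS_hs] at h3
  apply ((isUnit_nn hM b 1 (-1) α).mul (isUnit_nn hM b (-1) (-1) β)).mul_left_injective
  simp only
  linear_combination (pv K b (-1) (-1) β * nn K b (-1) (-1) β - cS K (qv K (α + β)) *
    nn K b (-1) (-1) β) * h1 + (hs (OS K) * e₀ K b - cS K (qv K (α + β)) * nn K b 1 (-1) α) * h2 -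
    cS K (qv K (α + β)) * hs (OS K) * e₀ K b * h4 - hs (OS K) * e₀ K b ^ 2 * h3

end Args

/-! ### RTT relations and reflection equations at the evaluation points -/

section Normal

variable {N M : ℕ} {S D : Type*} [CommRing S] [Algebra Kh S] [Ring D] [Algebra S D]
  {ι : Type*} [DecidableEq ι] [Fintype ι]

theorem RTT.normalize {X Y : Matrix (Fin N) (Fin N) D} {n g p : S} (h : RTT X Y (n, -g) (n, -g))
    (hn : IsUnit n) (hp : p * n = g) : RTT X Y (rr N M p) (rr N M p) := by
  have e : (gval N M p * Ring.inverse n) • (n, -g) = rr N M p := by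
    have h1 : Ring.inverse n * n = 1 := Ring.inverse_mul_cancel n hn
    rw [rr, Prod.smul_mk, smul_eq_mul, smul_eq_mul, ← hp]
    refine Prod.ext ?_ ?_
    · linear_combination (gval N M p) * h1
    · linear_combination -(gval N M p * p) * h1
  rw [← e]
  exact h.smul _

theorem RTT.normalize_smul {X Y : Matrix (Fin N) (Fin N) D} {n g p n' g' : S}
    (h : RTT X Y (n, -g) (n, -g)) (s : S) (hn' : n' = s * n) (hg' : g' = s * g) (hn : IsUnit n')
    (hp : p * n' = g') : RTT X Y (rr N M p) (rr N M p) := by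
  have h' := h.smul s
  rw [Prod.smul_mk, smul_eq_mul, smul_eq_mul, mul_neg, ← hn', ← hg'] at h'
  exact h'.normalize hn hp

/-- The reflection equation with normalized R-matrices. -/
theorem reflection_Rb (hN : N ≠ 0) {G X X' Y Y' : Matrix (Fin N) (Fin N) D}
    (hc : ∀ i j (d : D), Commute (G i j) d) (hG : Gᵀ = G ∨ Gᵀ = -G)
    {p₁ p₁' p₂ p₂' p₃ p₃' p₄ p₄' : S} (n₂ : p₂ ^ M = 0) (n₂' : p₂' ^ M = 0) (n₄ : p₄ ^ M = 0)
    (n₄' : p₄' ^ M = 0) (h1 : RTT X Y (rr N M p₁) (rr N M p₁'))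
    (h3 : RTT X' Y (rr N M p₃) (rr N M p₃')) (h2 : RTT X Y' (rr N M p₂) (rr N M p₂'))
    (h4 : RTT X' Y' (rr N M p₄) (rr N M p₄')) (h23 : -p₂' = p₃') (h14 : -p₄' = p₁')
    {i j : ι} (hij : i ≠ j) :
    Rb N M D i j p₁ * siteM i (X * G * X'ᵀ) * Rbt N M D i j p₃ * siteM j (Y * G * Y'ᵀ) =
      siteM j (Y * G * Y'ᵀ) * Rbt N M D i j (-p₂) * siteM i (X * G * X'ᵀ) *
        Rb N M D i j (-p₄) := by
  have h2' := h2.toRTTr hN n₂ n₂'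
  have h4' := h4.toRTTr hN n₄ n₄'
  rw [h23] at h2'
  rw [h14] at h4'
  exact reflection hc hG h1 h3 h2' h4' hij

end Normal

section AtPoints

open PowerSeries

variable {K A : Type*} [CommRing K] [Algebra Kh K] [Ring A] [Algebra K A] [Algebra Kh A]
  [IsScalarTower Kh K A] {M N : ℕ} {σ : ℤˣ}

/-- The matrix `T` at an evaluation point. -/
abbrev matT {D : Type*} [Ring D] (x : Gen N → A) (e : PowerSeries A →+* D) :
    Matrix (Fin N) (Fin N) D := (serMat (Tcoeff x)).map e

/-- The matrix `T⁺` at an evaluation point. -/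
abbrev matP {D : Type*} [Ring D] (x : Gen N → A) (e : PowerSeries A →+* D) :
    Matrix (Fin N) (Fin N) D := (serMat (Tpcoeff x)).map e

theorem pv_eq {b : Bool} {ε δ : ℤˣ} {α β : ℂ} (h : α = β) : pv K b ε δ α = pv K b ε δ β := by
  rw [h]

variable (hM : algebraMap Kh K hbar ^ M = 0) (hM0 : M ≠ 0) {c : ℂ} {x : Gen N → A}

theorem isUnit_and_eq_of_mul {S : Type*} [CommRing S] {n f e p g y : S} (hn : IsUnit n)
    (he : IsUnit e) (hf : f * e = n) (hg : g = y * e) (hp : p * n = g) :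
    IsUnit f ∧ p * f = y := by
  refine ⟨isUnit_of_mul_isUnit_left (hf ▸ hn), he.mul_left_injective ?_⟩
  simp only
  rw [← hg, ← hp, ← hf]
  ring

include hM in
theorem mixed_outT (ε δ : ℤˣ) (a b α : ℂ) :
    IsUnit (1 + (-cS K (arg K δ b) + hs (OS K) * cst (OS K) α) *
      PowerSeries.map LaurentPolynomial.C (qT K ε a)) ∧
    pv K true ε (-δ) (a - b + α) * (1 + (-cS K (arg K δ b) + hs (OS K) * cst (OS K) α) *
      PowerSeries.map LaurentPolynomial.C (qT K ε a)) =
        hs (OS K) * PowerSeries.map LaurentPolynomial.C (qT K ε a) := by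
  refine isUnit_and_eq_of_mul (isUnit_nn hM true ε (-δ) (a - b + α)) (isUnit_outT hM ε a) ?_ ?_
    (pv_mul hM _ _ _ _)
  · have h := map_C_qT_mul (K := K) ε a
    rw [nn, cS_arg]
    simp only [e₀, e₁, if_true, map_add, map_sub, Units.val_neg, Int.cast_neg]
    linear_combination (-(((δ : ℤ) : OS K) * cS K (LaurentPolynomial.T 1) +
      hs (OS K) * cst (OS K) b) + hs (OS K) * cst (OS K) α) * h
  · rw [mul_assoc, map_C_qT_mul]
    simp [e₀]

include hM in
theorem mixed_inT (ε δ : ℤˣ) (a b α : ℂ) :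
    IsUnit (1 + (-PowerSeries.map LaurentPolynomial.C (qP K ε a) + hs (OS K) * cst (OS K) α) *
      cS K (Ring.inverse (arg K δ b))) ∧
    pv K false (-ε) δ (b - a + α) *
      (1 + (-PowerSeries.map LaurentPolynomial.C (qP K ε a) + hs (OS K) * cst (OS K) α) *
        cS K (Ring.inverse (arg K δ b))) =
        hs (OS K) * cS K (Ring.inverse (arg K δ b)) := by
  have h : cS K (Ring.inverse (arg K δ b)) * cS K (arg K δ b) = 1 := by
    rw [← map_mul, Ring.inverse_mul_cancel _ (isUnit_arg hM δ b), map_one]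
  refine isUnit_and_eq_of_mul (isUnit_nn hM false (-ε) δ (b - a + α))
    ((isUnit_arg hM δ b).map (cS K)) ?_ ?_ (pv_mul hM _ _ _ _)
  · rw [nn, map_C_qP]
    rw [cS_arg] at h ⊢
    simp only [e₀, e₁, map_add, map_sub, Units.val_neg, Int.cast_neg]
    simp only [Bool.false_eq_true, if_false]
    linear_combination (-(((ε : ℤ) : OS K) * X + hs (OS K) * cst (OS K) a) +
      hs (OS K) * cst (OS K) α) * h
  · rw [mul_assoc, h]
    simp [e₀]

variable (hx : IsRep c x)

include hx in
theorem rtt_TP (ε δ : ℤˣ) (a b : ℂ) :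
    RTT (matT x ((outS 1 A).comp (evT K A hM0 ε a))) (matP x ((inS 1 A).comp (evP A hM δ b)))
      (rr N M (pv K true ε (-δ) (a - b + c / 2))) (rr N M (pv K true ε (-δ) (a - b + -(c / 2)))) := by
  obtain ⟨u1, e1⟩ := mixed_outT hM ε δ a b (c / 2)
  obtain ⟨u2, e2⟩ := mixed_outT hM ε δ a b (-(c / 2))
  exact hx.rtt_mixed (dEval_double (constantCoeff_qT hM0 ε a) (constantCoeff_qP hM δ b))
    (outS_evT_X hM0 ε a) (inS_evP_X hM δ b) (hs_pow hM) u1 u2 e1 e2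

include hx in
theorem rtt_TP_swap (ε δ : ℤˣ) (a b : ℂ) :
    RTT (matT x ((inS (-1) A).comp (evT K A hM0 δ b)))
      (matP x ((outS (-1) A).comp (evP A hM ε a)))
      (rr N M (pv K false (-ε) δ (b - a + c / 2)))
      (rr N M (pv K false (-ε) δ (b - a + -(c / 2)))) := by
  obtain ⟨u1, e1⟩ := mixed_inT hM ε δ a b (c / 2)
  obtain ⟨u2, e2⟩ := mixed_inT hM ε δ a b (-(c / 2))
  exact hx.rtt_mixed (dEval_swap (constantCoeff_qT hM0 δ b) (constantCoeff_qP hM ε a))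
    (inS_evT_X hM hM0 δ b) (outS_evP_X hM ε a) (hs_pow hM) u1 u2 e1 e2

include hx in
theorem rtt_PP (ε δ : ℤˣ) (a b : ℂ) :
    RTT (matP x ((outS 1 A).comp (evP A hM ε a))) (matP x ((inS 1 A).comp (evP A hM δ b)))
      (rr N M (pv K false ε (-δ) (a - b))) (rr N M (pv K false ε (-δ) (a - b))) := by
  have h := hx.rtt_plus (dEval_double (constantCoeff_qP hM ε a) (constantCoeff_qP hM δ b))
    (outS_evP_X hM ε a) (inS_evP_X hM δ b)
  have e : PowerSeries.map LaurentPolynomial.C (qP K ε a) - cS K (arg K δ b) =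
      nn K false ε (-δ) (a - b) := by
    rw [nn, map_C_qP, cS_arg]
    simp only [e₀, e₁, map_sub, Units.val_neg, Int.cast_neg]
    simp only [Bool.false_eq_true, if_false]
    ring
  rw [e] at h
  refine h.normalize (isUnit_nn hM _ _ _ _) ?_
  rw [pv_mul hM]
  simp [e₀]

include hM in
theorem isUnit_arg_mul (δ : ℤˣ) (b : ℂ) :
    cS K (Ring.inverse (arg K δ b)) * cS K (arg K δ b) = 1 := by
  rw [← map_mul, Ring.inverse_mul_cancel _ (isUnit_arg hM δ b), map_one]

include hM hx in
theorem rtt_TT (ε δ : ℤˣ) (a b : ℂ) :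
    RTT (matT x ((outS (-1) A).comp (evT K A hM0 ε a)))
      (matT x ((inS (-1) A).comp (evT K A hM0 δ b)))
      (rr N M (pv K true ε (-δ) (a - b))) (rr N M (pv K true ε (-δ) (a - b))) := by
  have h := hx.rtt_minus (dEval_double (constantCoeff_qT hM0 ε a) (constantCoeff_qT hM0 δ b))
    (outS_evT_X hM0 ε a) (inS_evT_X hM hM0 δ b)
  have e1 := map_C_qT_mul (K := K) ε a
  have e2 := isUnit_arg_mul hM δ b
  refine RTT.normalize_smul (n' := nn K true ε (-δ) (a - b)) (g' := hs (OS K) * e₀ K true) h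
    ((((ε : ℤ) : OS K) + hs (OS K) * cst (OS K) a * X) * cS K (arg K δ b)) ?_ ?_
    (isUnit_nn hM _ _ _ _) (pv_mul hM _ _ _ _)
  all_goals
    rw [cS_arg] at e2
    simp only [nn, cS_arg, e₀, e₁, map_sub, Units.val_neg, Int.cast_neg, if_true]
    generalize PowerSeries.map LaurentPolynomial.C (qT K ε a) = y at e1 ⊢
    generalize cS K (Ring.inverse (arg K δ b)) = z at e2 ⊢
  · linear_combination (-((ε : ℤ) : OS K) - hs (OS K) * cst (OS K) a * X) * e2 +
      (((δ : ℤ) : OS K) * cS K (LaurentPolynomial.T 1) + hs (OS K) * cst (OS K) b) * e1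
  · linear_combination -hs (OS K) * e1 * (z * (((δ : ℤ) : OS K) * cS K (LaurentPolynomial.T 1) +
      hs (OS K) * cst (OS K) b)) - hs (OS K) * X * e2

/-! Points on the diagonal. -/

theorem arg_sub_opposite (a b : ℂ) : arg K (-1) a - arg K 1 b = arg₂ K (a - b) := by
  rw [arg_eq, arg_eq, arg₂]
  simp only [map_sub, Units.val_neg, Units.val_one, Int.cast_neg, Int.cast_one]
  ring

theorem arg_sub_same (ε : ℤˣ) (a b : ℂ) : arg K ε a - arg K ε b =
    hs K[T;T⁻¹] * cst K[T;T⁻¹] (a - b) := by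
  rw [arg_eq, arg_eq, map_sub]
  ring

include hM hx in
theorem rtt_PP_opposite (a b : ℂ) :
    RTT (matP x ((Ser.ofPS 1).comp (evP A hM (-1) a))) (matP x ((Ser.ofPS 1).comp (evP A hM 1 b)))
      (rr N M (qv K (a - b))) (rr N M (qv K (a - b))) := by
  have h := hx.rtt_plus (S := K[T;T⁻¹]) (dEval_diag (σ := 1) (constantCoeff_qP hM (-1) a)
    (constantCoeff_qP hM 1 b)) (ofPS_evP_X hM (-1) a) (ofPS_evP_X hM 1 b)
  rw [arg_sub_opposite] at h
  exact h.normalize (isUnit_arg₂ hM _) (qv_mul hM _)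

include hM hx in
theorem rtt_PP_same (ε : ℤˣ) (a b : ℂ) :
    RTT (matP x ((Ser.ofPS 1).comp (evP A hM ε a))) (matP x ((Ser.ofPS 1).comp (evP A hM ε b)))
      (cst K[T;T⁻¹] (a - b), -1) (cst K[T;T⁻¹] (a - b), -1) :=
  hx.rtt_plus_close (S := K[T;T⁻¹]) (dEval_diag (σ := 1) (constantCoeff_qP hM ε a)
    (constantCoeff_qP hM ε b)) (ofPS_evP_X hM ε a) (ofPS_evP_X hM ε b) (arg_sub_same ε a b)

include hM hx in
theorem rtt_TT_opposite (a b : ℂ) :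
    RTT (matT x ((Ser.ofPS (-1)).comp (evT K A hM0 (-1) a)))
      (matT x ((Ser.ofPS (-1)).comp (evT K A hM0 1 b)))
      (rr N M (qv K (a - b))) (rr N M (qv K (a - b))) := by
  have h := hx.rtt_minus (S := K[T;T⁻¹]) (dEval_diag (σ := -1)
    (constantCoeff_qT hM0 (-1) a) (constantCoeff_qT hM0 1 b)) (ofPS_evT_X hM hM0 (-1) a)
    (ofPS_evT_X hM hM0 1 b)
  have e1 := Ring.inverse_mul_cancel _ (isUnit_arg hM (-1) a)
  have e2 := Ring.inverse_mul_cancel _ (isUnit_arg hM 1 b)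
  have e3 := arg_sub_opposite (K := K) a b
  refine RTT.normalize_smul (n' := arg₂ K (a - b)) (g' := hs _) h (arg K (-1) a * arg K 1 b) ?_ ?_
    (isUnit_arg₂ hM _) (qv_mul hM _)
  all_goals
    generalize Ring.inverse (arg K (-1) a) = y at *
    generalize Ring.inverse (arg K 1 b) = z at *
  · linear_combination -e3 + arg K 1 b * e1 - arg K (-1) a * e2
  · linear_combination -hs K[T;T⁻¹] * e1 -
      hs K[T;T⁻¹] * y * arg K (-1) a * e2

include hM hx in
theorem rtt_TT_same (ε : ℤˣ) (a b : ℂ) :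
    RTT (matT x ((Ser.ofPS (-1)).comp (evT K A hM0 ε a)))
      (matT x ((Ser.ofPS (-1)).comp (evT K A hM0 ε b)))
      (cst K[T;T⁻¹] (a - b), -1) (cst K[T;T⁻¹] (a - b), -1) := by
  refine hx.rtt_minus_close (S := K[T;T⁻¹]) (dEval_diag (σ := -1)
    (constantCoeff_qT hM0 ε a) (constantCoeff_qT hM0 ε b)) (ofPS_evT_X hM hM0 ε a)
    (ofPS_evT_X hM hM0 ε b) ?_
  have e1 := Ring.inverse_mul_cancel _ (isUnit_arg hM ε a)
  have e2 := Ring.inverse_mul_cancel _ (isUnit_arg hM ε b)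
  have e3 := arg_sub_same (K := K) ε a b
  generalize Ring.inverse (arg K ε a) = y at *
  generalize Ring.inverse (arg K ε b) = z at *
  linear_combination y * z * e3 - z * e1 + y * e2

end AtPoints

/-! ### Change of the coefficient ring -/

section BaseChange

variable {N M : ℕ} {S D S' D' : Type*} [CommRing S] [Algebra Kh S] [Ring D] [Algebra S D]
  [CommRing S'] [Algebra Kh S'] [Ring D'] [Algebra S' D'] {ι : Type*} [DecidableEq ι] [Fintype ι]

/-- A homomorphism of rings over a homomorphism of the scalars. -/
structure ScalarHom (φ : D →+* D') (ψ : S →+* S') : Prop where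
  kh : ∀ z : Kh, ψ (algebraMap Kh S z) = algebraMap Kh S' z
  alg : ∀ s, φ (algebraMap S D s) = algebraMap S' D' (ψ s)

theorem mapMatrix_siteM (φ : D →+* D') (i : ι) (X : Matrix (Fin N) (Fin N) D) :
    φ.mapMatrix (siteM i X) = siteM i (φ.mapMatrix X) := by
  ext I J
  simp only [RingHom.mapMatrix_apply, Matrix.map_apply, siteM, Matrix.of_apply]
  split_ifs <;> simp

theorem mapMatrix_Qm (φ : D →+* D') (i j : ι) : φ.mapMatrix (Qm N D i j) = Qm N D' i j := by
  ext I J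
  simp only [RingHom.mapMatrix_apply, Matrix.map_apply, Qm, Matrix.of_apply]
  split_ifs <;> simp

theorem mapMatrix_emb (φ : D →+* D') (X : Matrix (ι → Fin N) (ι → Fin N) D) :
    φ.mapMatrix (emb X) = emb (φ.mapMatrix X) := by
  refine matrix_ext_cons fun a b K L => ?_
  rw [RingHom.mapMatrix_apply, Matrix.map_apply, emb_cons, emb_cons]
  split_ifs <;> simp

variable {φ : D →+* D'} {ψ : S →+* S'}

theorem ScalarHom.cst (h : ScalarHom φ ψ) (z : ℂ) : ψ (cst S z) = TwistedYangian.cst S' z :=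
  h.kh _

theorem ScalarHom.gval (h : ScalarHom φ ψ) (p : S) :
    ψ (gval N M p) = TwistedYangian.gval N M (ψ p) := by
  simp only [TwistedYangian.gval, map_sum, map_mul, map_pow, h.kh]

theorem ScalarHom.smul (h : ScalarHom φ ψ) {m : Type*} [Fintype m] [DecidableEq m] (s : S)
    (X : Matrix m m D) : φ.mapMatrix (s • X) = ψ s • φ.mapMatrix X := by
  ext i j
  change φ (s • X i j) = ψ s • φ (X i j)
  rw [Algebra.smul_def, Algebra.smul_def, map_mul, h.alg]

theorem ScalarHom.Rb (h : ScalarHom φ ψ) (i j : ι) (p : S) :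
    φ.mapMatrix (Rb N M D i j p) = TwistedYangian.Rb N M D' i j (ψ p) := by
  rw [Rb_eq, Rb_eq, h.smul, h.gval, map_sub, map_one, h.smul, mapMatrix_Pm]

theorem ScalarHom.Rbt (h : ScalarHom φ ψ) (i j : ι) (p : S) :
    φ.mapMatrix (Rbt N M D i j p) = TwistedYangian.Rbt N M D' i j (ψ p) := by
  rw [Rbt_eq, Rbt_eq, h.smul, h.gval, map_sub, map_one, h.smul, mapMatrix_Qm]

variable (S D) in
/-- A complex matrix over the ring `D`. -/
def gM (G : Matrix (Fin N) (Fin N) ℂ) : Matrix (Fin N) (Fin N) D :=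
  ((algebraMap S D).comp (cst S)).mapMatrix G

theorem gM_commute (G : Matrix (Fin N) (Fin N) ℂ) (i j : Fin N) (d : D) :
    Commute (gM S D G i j) d := Algebra.commutes _ _

theorem gM_transpose {G : Matrix (Fin N) (Fin N) ℂ} (hG : Gᵀ = G ∨ Gᵀ = -G) :
    (gM S D G)ᵀ = gM S D G ∨ (gM S D G)ᵀ = -gM S D G := by
  have h : (gM S D G)ᵀ = gM S D Gᵀ := rfl
  rcases hG with hG | hG
  · exact Or.inl (by rw [h, hG])
  · exact Or.inr (by rw [h, hG, gM, gM, map_neg])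

theorem ScalarHom.gM (h : ScalarHom φ ψ) (G : Matrix (Fin N) (Fin N) ℂ) :
    φ.mapMatrix (gM S D G) = TwistedYangian.gM S' D' G := by
  ext i j
  exact (h.alg _).trans (congrArg _ (h.cst _))

theorem ScalarHom.youngE (h : ScalarHom φ ψ) {ν : YoungDiagram} (U : StandardTableau ν) :
    φ.mapMatrix (youngE N S D U) = TwistedYangian.youngE N S' D' U := by
  ext i j
  exact (h.alg _).trans (congrArg _ (h.cst _))

variable {A : Type*} [Ring A] [Algebra Kh A]

variable (S) in
/-- The matrix `T G Tᵗ`. -/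
def sT (G : Matrix (Fin N) (Fin N) ℂ) (x : Gen N → A) (e e' : PowerSeries A →+* D) :
    Matrix (Fin N) (Fin N) D := matT x e * gM S D G * (matT x e')ᵀ

variable (S) in
/-- The matrix `T⁺ G T⁺ᵗ`. -/
def sP (G : Matrix (Fin N) (Fin N) ℂ) (x : Gen N → A) (e e' : PowerSeries A →+* D) :
    Matrix (Fin N) (Fin N) D := matP x e * gM S D G * (matP x e')ᵀ

theorem ScalarHom.sT (h : ScalarHom φ ψ) (G : Matrix (Fin N) (Fin N) ℂ) (x : Gen N → A)
    (e e' : PowerSeries A →+* D) : φ.mapMatrix (sT S G x e e') =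
      TwistedYangian.sT S' G x (φ.comp e) (φ.comp e') := by
  rw [TwistedYangian.sT, TwistedYangian.sT, map_mul, map_mul, h.gM]
  rfl

theorem ScalarHom.sP (h : ScalarHom φ ψ) (G : Matrix (Fin N) (Fin N) ℂ) (x : Gen N → A)
    (e e' : PowerSeries A →+* D) : φ.mapMatrix (sP S G x e e') =
      TwistedYangian.sP S' G x (φ.comp e) (φ.comp e') := by
  rw [TwistedYangian.sP, TwistedYangian.sP, map_mul, map_mul, h.gM]
  rfl

end BaseChange

/-! ### Exchange of the multiple products with a generator matrix -/

section Exchange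

variable {N M : ℕ} {S D : Type*} [CommRing S] [Algebra Kh S] [Ring D] [Algebra S D]
  {κ : Type*} [DecidableEq κ] [Fintype κ]

theorem exchange_R {S₀ : Matrix (Fin N) (Fin N) D} {s : κ → Matrix (Fin N) (Fin N) D}
    {x y z w : κ → S} {r : κ → κ → S}
    (hrefl : ∀ i, Rb N M D none (some i) (x i) * siteM none S₀ * Rbt N M D none (some i) (y i) *
        siteM (some i) (s i) =
      siteM (some i) (s i) * Rbt N M D none (some i) (z i) * siteM none S₀ *
        Rb N M D none (some i) (w i))
    (hwy : ∀ i j, w i * y j = w i * r i j + y j * r i j)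
    (hxz : ∀ i j, x j * z i = x j * r i j + z i * r i j) {l : List κ} (hl : l.Nodup) :
    (l.map fun i => Rb N M D none (some i) (x i)).reverse.prod * siteM none S₀ *
        (l.map fun i => Rbt N M D none (some i) (y i)).prod *
        emb (prodS (fun i j => Rbt N M D i j (r i j)) (fun i => siteM i (s i)) l) =
      emb (prodS (fun i j => Rbt N M D i j (r i j)) (fun i => siteM i (s i)) l) *
        (l.map fun i => Rbt N M D none (some i) (z i)).prod * siteM none S₀ *
        (l.map fun i => Rb N M D none (some i) (w i)).reverse.prod := by
  have eR : ∀ i j, emb (Rbt N M D i j (r i j)) = Rbt N M D (some i) (some j) (r i j) := by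
    intro i j
    rw [Rbt_eq, Rbt_eq, emb_smul, map_sub, map_one, emb_smul, emb_Qm]
  rw [map_prodS]
  simp only [eR, emb_siteM]
  have ne : ∀ i : κ, none ≠ some i := fun i h => by cases h
  have ne' : ∀ {i j : κ}, i ≠ j → some i ≠ some j := fun h h' => h (Option.some.inj h')
  refine multisite hl (fun i _ => hrefl i) (fun i _ j _ hij => ?_) (fun i _ j _ hij => ?_)
    (fun i _ j _ hij => ⟨?_, ?_, ?_, ?_, ?_⟩) (fun i _ j _ k _ hij hik hjk => ⟨?_, ?_, ?_, ?_⟩)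
  · exact Rb_Rbt_Rbt (hwy i j) (ne i) (ne j) (ne' hij)
  · rw [Rbt_comm (some i)]
    exact Rb_Rbt_Rbt (hxz i j) (ne j) (ne i) (ne' hij.symm)
  · exact Rb_siteM_comm (ne j).symm (ne' hij.symm) _ _
  · exact Rbt_siteM_comm (ne i) (ne j).symm (ne' hij.symm) _ _
  · exact Rbt_siteM_comm (ne i) (ne j).symm (ne' hij.symm) _ _
  · exact Rb_siteM_comm (ne j).symm (ne' hij.symm) _ _
  · exact (Rbt_siteM_comm (ne' hij) (ne i) (ne j) _ _).symm
  · exact Rb_Rbt_comm (ne j).symm (ne' hij.symm) (ne k).symm (ne' hik.symm) _ _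
  · exact Rbt_Rbt_comm (ne i) (ne' hjk) (ne j) (ne k) (ne' hij) (ne' hik) _ _
  · exact Rbt_Rbt_comm (ne i) (ne' hjk) (ne j) (ne k) (ne' hij) (ne' hik) _ _
  · exact Rb_Rbt_comm (ne j).symm (ne' hij.symm) (ne k).symm (ne' hik.symm) _ _

end Exchange

section Products

open PowerSeries

variable {K A : Type*} [CommRing K] [Algebra Kh K] [Ring A] [Algebra K A] [Algebra Kh A]
  [IsScalarTower Kh K A] {M N : ℕ} {σ : ℤˣ}
  (hM : algebraMap Kh K hbar ^ M = 0) (hM0 : M ≠ 0) {c : ℂ} {x : Gen N → A}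

theorem scalarHom_C : ScalarHom (C : Ser σ A →+* PowerSeries (Ser σ A)) (cS K) where
  kh z := by
    rw [cS, PowerSeries.algebraMap_apply]
  alg s := (algebraMap_C_Out s).symm

/-- The matrix `S⁺(u + h a)`. -/
def sPin (G : Matrix (Fin N) (Fin N) ℂ) (x : Gen N → A) (a : ℂ) : Matrix (Fin N) (Fin N) (Ser 1 A) :=
  sP K[T;T⁻¹] G x ((Ser.ofPS 1).comp (evP A hM 1 a))
    ((Ser.ofPS 1).comp (evP A hM (-1) (-a)))

variable (K) in
/-- The matrix `S(u + h (a + c / 2))`. -/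
def sTin (G : Matrix (Fin N) (Fin N) ℂ) (c : ℂ) (x : Gen N → A) (a : ℂ) :
    Matrix (Fin N) (Fin N) (Ser (-1) A) :=
  sT K[T;T⁻¹] G x ((Ser.ofPS (-1)).comp (evT K A hM0 1 (a + 3 * c / 2)))
    ((Ser.ofPS (-1)).comp (evT K A hM0 (-1) (-a - c / 2)))

variable (σ) in
/-- The matrix `S⁺(w)`. -/
def sPout (G : Matrix (Fin N) (Fin N) ℂ) (x : Gen N → A) :
    Matrix (Fin N) (Fin N) (PowerSeries (Ser σ A)) :=
  sP (OS K) G x ((outS σ A).comp (evP A hM 1 0)) ((outS σ A).comp (evP A hM (-1) 0))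

variable (K σ) in
/-- The matrix `S(w)`. -/
def sTout (G : Matrix (Fin N) (Fin N) ℂ) (c : ℂ) (x : Gen N → A) :
    Matrix (Fin N) (Fin N) (PowerSeries (Ser σ A)) :=
  sT (OS K) G x ((outS σ A).comp (evT K A hM0 1 c)) ((outS σ A).comp (evT K A hM0 (-1) 0))

variable {ι : Type*} [DecidableEq ι] [Fintype ι]

/-- The product `S⁺_{[n]}` at `u + h a_i`. -/
def bracketP (G : Matrix (Fin N) (Fin N) ℂ) (x : Gen N → A) (a : ι → ℂ) (l : List ι) :
    Matrix (ι → Fin N) (ι → Fin N) (Ser 1 A) :=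
  prodS (fun i j => Rbt N M (Ser 1 A) i j (qv K (-(a i + a j))))
    (fun i => siteM i (sPin hM G x (a i))) l

variable (K) in
/-- The product `S_{[n]}` at `u + h (a_i + c / 2)`. -/
def bracketT (G : Matrix (Fin N) (Fin N) ℂ) (c : ℂ) (x : Gen N → A) (a : ι → ℂ) (l : List ι) :
    Matrix (ι → Fin N) (ι → Fin N) (Ser (-1) A) :=
  prodS (fun i j => Rbt N M (Ser (-1) A) i j (qv K (-(a i + a j) - 2 * c)))
    (fun i => siteM i (sTin K hM0 G c x (a i))) l

theorem map_sPin (G : Matrix (Fin N) (Fin N) ℂ) (a : ℂ) :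
    C.mapMatrix (sPin hM G x a) = sP (OS K) G x ((inS 1 A).comp (evP A hM 1 a))
      ((inS 1 A).comp (evP A hM (-1) (-a))) :=
  scalarHom_C.sP G x _ _

theorem map_sTin (G : Matrix (Fin N) (Fin N) ℂ) (a : ℂ) :
    C.mapMatrix (sTin K hM0 G c x a) =
      sT (OS K) G x ((inS (-1) A).comp (evT K A hM0 1 (a + 3 * c / 2)))
        ((inS (-1) A).comp (evT K A hM0 (-1) (-a - c / 2))) :=
  scalarHom_C.sT G x _ _

theorem map_bracketP (G : Matrix (Fin N) (Fin N) ℂ) (a : ι → ℂ) (l : List ι) :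
    C.mapMatrix (bracketP hM G x a l) =
      prodS (fun i j => Rbt N M _ i j (cS K (qv K (-(a i + a j)))))
        (fun i => siteM i (C.mapMatrix (sPin hM G x (a i)))) l := by
  rw [bracketP, map_prodS]
  simp only [scalarHom_C.Rbt, mapMatrix_siteM]

theorem map_bracketT (G : Matrix (Fin N) (Fin N) ℂ) (a : ι → ℂ) (l : List ι) :
    C.mapMatrix (bracketT K hM0 G c x a l) =
      prodS (fun i j => Rbt N M _ i j (cS K (qv K (-(a i + a j) - 2 * c))))
        (fun i => siteM i (C.mapMatrix (sTin K hM0 G c x (a i)))) l := by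
  rw [bracketT, map_prodS]
  simp only [scalarHom_C.Rbt, mapMatrix_siteM]

variable (hN : N ≠ 0) (hx : IsRep c x) {G : Matrix (Fin N) (Fin N) ℂ} (hG : Gᵀ = G ∨ Gᵀ = -G)

include hM in
theorem neg_pv_eq {b : Bool} {ε δ ε' δ' : ℤˣ} {α β : ℂ} (hε : -ε = ε') (hδ : -δ = δ')
    (h : -α = β) : -pv K b ε δ α = pv K b ε' δ' β := by
  rw [neg_pv hM, hε, hδ, h]

include hM in
theorem pv_ybe_eq {b : Bool} {α β γ : ℂ} (h : α + β = γ) :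
    pv K b 1 (-1) α * pv K b (-1) (-1) β = pv K b 1 (-1) α * cS K (qv K γ) +
      pv K b (-1) (-1) β * cS K (qv K γ) := by
  rw [← h]
  exact pv_ybe hM b α β

include hx hG hN in
theorem reflection_TP (a : ℂ) {i j : ι} (hij : i ≠ j) :
    Rb N M _ i j (pv K true 1 (-1) (3 * c / 2 - a)) * siteM i (sTout K 1 hM0 G c x) *
        Rbt N M _ i j (pv K true (-1) (-1) (c / 2 - a)) * siteM j (C.mapMatrix (sPin hM G x a)) =
      siteM j (C.mapMatrix (sPin hM G x a)) * Rbt N M _ i j (pv K true (-1) (-1) (-3 * c / 2 - a)) *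
        siteM i (sTout K 1 hM0 G c x) * Rb N M _ i j (pv K true 1 (-1) (-c / 2 - a)) := by
  rw [map_sPin, sTout, sT, sP]
  have h := reflection_Rb (ι := ι) hN (gM_commute (S := OS K) G) (gM_transpose hG) (pv_pow hM _ _ _ _)
    (pv_pow hM _ _ _ _) (pv_pow hM _ _ _ _) (pv_pow hM _ _ _ _)
    (rtt_TP hM hM0 hx 1 1 c a) (rtt_TP hM hM0 hx (-1) 1 0 a) (rtt_TP hM hM0 hx 1 (-1) c (-a))
    (rtt_TP hM hM0 hx (-1) (-1) 0 (-a))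
    (neg_pv_eq hM (by simp) (by simp) (by ring)) (neg_pv_eq hM (by simp) (by simp) (by ring)) hij
  rw [neg_pv_eq hM (ε' := -1) (δ' := -1) (β := -3 * c / 2 - a) (by simp) (by simp) (by ring),
    neg_pv_eq hM (ε' := 1) (δ' := -1) (β := -c / 2 - a) (by simp) (by simp) (by ring),
    pv_eq (α := c - a + c / 2) (β := 3 * c / 2 - a) (by ring),
    pv_eq (α := 0 - a + c / 2) (β := c / 2 - a) (by ring)] at h
  exact h

include hx hG hN in
theorem reflection_PP (a : ℂ) {i j : ι} (hij : i ≠ j) :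
    Rb N M _ i j (pv K false 1 (-1) (-a)) * siteM i (sPout 1 hM G x) *
        Rbt N M _ i j (pv K false (-1) (-1) (-a)) * siteM j (C.mapMatrix (sPin hM G x a)) =
      siteM j (C.mapMatrix (sPin hM G x a)) * Rbt N M _ i j (pv K false (-1) (-1) (-a)) *
        siteM i (sPout 1 hM G x) * Rb N M _ i j (pv K false 1 (-1) (-a)) := by
  rw [map_sPin, sPout, sP, sP]
  have h := reflection_Rb (ι := ι) hN (gM_commute (S := OS K) G) (gM_transpose hG) (pv_pow hM _ _ _ _)
    (pv_pow hM _ _ _ _) (pv_pow hM _ _ _ _) (pv_pow hM _ _ _ _)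
    (rtt_PP hM hx 1 1 0 a) (rtt_PP hM hx (-1) 1 0 a) (rtt_PP hM hx 1 (-1) 0 (-a))
    (rtt_PP hM hx (-1) (-1) 0 (-a))
    (neg_pv_eq hM (by simp) (by simp) (by ring)) (neg_pv_eq hM (by simp) (by simp) (by ring)) hij
  rw [neg_pv_eq hM (ε' := -1) (δ' := -1) (β := - a) (by simp) (by simp) (by ring),
    neg_pv_eq hM (ε' := 1) (δ' := -1) (β := - a) (by simp) (by simp) (by ring),
    zero_sub] at h
  exact h

include hM hx hG hN in
theorem reflection_TT (a : ℂ) {i j : ι} (hij : i ≠ j) :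
    Rb N M _ i j (pv K true 1 (-1) (-c / 2 - a)) * siteM i (sTout K (-1) hM0 G c x) *
        Rbt N M _ i j (pv K true (-1) (-1) (-3 * c / 2 - a)) *
        siteM j (C.mapMatrix (sTin K hM0 G c x a)) =
      siteM j (C.mapMatrix (sTin K hM0 G c x a)) *
        Rbt N M _ i j (pv K true (-1) (-1) (-3 * c / 2 - a)) *
        siteM i (sTout K (-1) hM0 G c x) * Rb N M _ i j (pv K true 1 (-1) (-c / 2 - a)) := by
  rw [map_sTin, sTout, sT, sT]
  have h := reflection_Rb (ι := ι) hN (gM_commute (S := OS K) G) (gM_transpose hG) (pv_pow hM _ _ _ _)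
    (pv_pow hM _ _ _ _) (pv_pow hM _ _ _ _) (pv_pow hM _ _ _ _)
    (rtt_TT hM hM0 hx 1 1 c (a + 3 * c / 2)) (rtt_TT hM hM0 hx (-1) 1 0 (a + 3 * c / 2))
    (rtt_TT hM hM0 hx 1 (-1) c (-a - c / 2)) (rtt_TT hM hM0 hx (-1) (-1) 0 (-a - c / 2))
    (neg_pv_eq hM (by simp) (by simp) (by ring)) (neg_pv_eq hM (by simp) (by simp) (by ring)) hij
  rw [neg_pv_eq hM (ε' := -1) (δ' := -1) (β := -3 * c / 2 - a) (by simp) (by simp) (by ring),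
    neg_pv_eq hM (ε' := 1) (δ' := -1) (β := -c / 2 - a) (by simp) (by simp) (by ring),
    pv_eq (α := c - (a + 3 * c / 2)) (β := -c / 2 - a) (by ring),
    pv_eq (α := 0 - (a + 3 * c / 2)) (β := -3 * c / 2 - a) (by ring)] at h
  exact h

include hx hG hN in
theorem reflection_PT (a : ℂ) {i j : ι} (hij : i ≠ j) :
    Rb N M _ i j (pv K false 1 (-1) (-2 * c - a)) * siteM i (sPout (-1) hM G x) *
        Rbt N M _ i j (pv K false (-1) (-1) (-2 * c - a)) *
        siteM j (C.mapMatrix (sTin K hM0 G c x a)) =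
      siteM j (C.mapMatrix (sTin K hM0 G c x a)) *
        Rbt N M _ i j (pv K false (-1) (-1) (-a)) *
        siteM i (sPout (-1) hM G x) * Rb N M _ i j (pv K false 1 (-1) (-a)) := by
  have h : Rb N M _ j i (-pv K false 1 (-1) (-2 * c - a)) * siteM j (C.mapMatrix (sTin K hM0 G c x a)) *
      Rbt N M _ j i (pv K false (-1) (-1) (-a)) * siteM i (sPout (-1) hM G x) =
      siteM i (sPout (-1) hM G x) * Rbt N M _ j i (pv K false (-1) (-1) (-2 * c - a)) *
        siteM j (C.mapMatrix (sTin K hM0 G c x a)) * Rb N M _ j i (-pv K false 1 (-1) (-a)) := by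
    rw [map_sTin, sPout, sT, sP]
    have h := reflection_Rb (ι := ι) hN (gM_commute (S := OS K) G) (gM_transpose hG) (pv_pow hM _ _ _ _)
      (pv_pow hM _ _ _ _) (pv_pow hM _ _ _ _) (pv_pow hM _ _ _ _)
      (rtt_TP_swap hM hM0 hx 1 1 0 (a + 3 * c / 2)) (rtt_TP_swap hM hM0 hx 1 (-1) 0 (-a - c / 2))
      (rtt_TP_swap hM hM0 hx (-1) 1 0 (a + 3 * c / 2))
      (rtt_TP_swap hM hM0 hx (-1) (-1) 0 (-a - c / 2))
      (neg_pv_eq hM (by simp) (by simp) (by ring)) (neg_pv_eq hM (by simp) (by simp) (by ring))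
      hij.symm
    rw [neg_pv_eq hM (ε := - -1) (ε' := -1) (δ' := -1) (β := -2 * c - a) (by simp) (by simp) (by ring),
      pv_eq (b := false) (ε := -1) (δ := 1) (β := -(-2 * c - a)) (by ring),
      pv_eq (b := false) (ε := -1) (δ := -1) (α := -a - c / 2 - 0 + c / 2) (β := -a) (by ring),
      pv_eq (b := false) (ε := - -1) (δ := -1) (α := -a - c / 2 - 0 + c / 2) (β := -a) (by ring),
      neg_neg] at h
    rw [neg_pv hM false 1 (-1) (-2 * c - a), neg_neg]
    exact h
  rw [Rb_comm j i, Rb_comm j i, Rbt_comm j i, Rbt_comm j i] at h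
  have u1 := Rb_mul_neg (D := PowerSeries (Ser (-1) A)) hN (pv_pow hM false 1 (-1) (-2 * c - a)) i j
  have u2 := Rb_neg_mul (D := PowerSeries (Ser (-1) A)) hN (pv_pow hM false 1 (-1) (-a)) i j
  generalize Rb N M (PowerSeries (Ser (-1) A)) i j (-pv K false 1 (-1) (-2 * c - a)) = R₁ at *
  generalize Rb N M (PowerSeries (Ser (-1) A)) i j (-pv K false 1 (-1) (-a)) = R₂ at *
  generalize Rb N M (PowerSeries (Ser (-1) A)) i j (pv K false 1 (-1) (-2 * c - a)) = R₃ at *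
  generalize Rb N M (PowerSeries (Ser (-1) A)) i j (pv K false 1 (-1) (-a)) = R₄ at *
  calc _ = R₃ * (siteM i (sPout (-1) hM G x) * Rbt N M _ i j (pv K false (-1) (-1) (-2 * c - a)) *
        siteM j (C.mapMatrix (sTin K hM0 G c x a)) * R₂) * R₄ := by
          simp only [mul_assoc, u2, mul_one]
    _ = _ := by
      rw [← h]
      simp only [← mul_assoc, u1, one_mul]

include hx hG hN in
theorem exchange_TP (a : ι → ℂ) {l : List ι} (hl : l.Nodup) :
    (l.map fun i => Rb N M _ none (some i) (pv K true 1 (-1) (3 * c / 2 - a i))).reverse.prod *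
        siteM none (sTout K 1 hM0 G c x) *
        (l.map fun i => Rbt N M _ none (some i) (pv K true (-1) (-1) (c / 2 - a i))).prod *
        emb (C.mapMatrix (bracketP hM G x a l)) =
      emb (C.mapMatrix (bracketP hM G x a l)) *
        (l.map fun i => Rbt N M _ none (some i) (pv K true (-1) (-1) (-3 * c / 2 - a i))).prod *
        siteM none (sTout K 1 hM0 G c x) *
        (l.map fun i => Rb N M _ none (some i) (pv K true 1 (-1) (-c / 2 - a i))).reverse.prod := by
  rw [map_bracketP]
  exact exchange_R (fun i => reflection_TP hM hM0 hN hx hG (a i) (by simp))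
    (fun i j => pv_ybe_eq hM (by ring)) (fun i j => pv_ybe_eq hM (by ring)) hl

include hx hG hN in
theorem exchange_PP (a : ι → ℂ) {l : List ι} (hl : l.Nodup) :
    (l.map fun i => Rb N M _ none (some i) (pv K false 1 (-1) (-a i))).reverse.prod *
        siteM none (sPout 1 hM G x) *
        (l.map fun i => Rbt N M _ none (some i) (pv K false (-1) (-1) (-a i))).prod *
        emb (C.mapMatrix (bracketP hM G x a l)) =
      emb (C.mapMatrix (bracketP hM G x a l)) *
        (l.map fun i => Rbt N M _ none (some i) (pv K false (-1) (-1) (-a i))).prod *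
        siteM none (sPout 1 hM G x) *
        (l.map fun i => Rb N M _ none (some i) (pv K false 1 (-1) (-a i))).reverse.prod := by
  rw [map_bracketP]
  exact exchange_R (fun i => reflection_PP hM hN hx hG (a i) (by simp))
    (fun i j => pv_ybe_eq hM (by ring)) (fun i j => pv_ybe_eq hM (by ring)) hl

include hM hx hG hN in
theorem exchange_TT (a : ι → ℂ) {l : List ι} (hl : l.Nodup) :
    (l.map fun i => Rb N M _ none (some i) (pv K true 1 (-1) (-c / 2 - a i))).reverse.prod *
        siteM none (sTout K (-1) hM0 G c x) *
        (l.map fun i => Rbt N M _ none (some i) (pv K true (-1) (-1) (-3 * c / 2 - a i))).prod *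
        emb (C.mapMatrix (bracketT K hM0 G c x a l)) =
      emb (C.mapMatrix (bracketT K hM0 G c x a l)) *
        (l.map fun i => Rbt N M _ none (some i) (pv K true (-1) (-1) (-3 * c / 2 - a i))).prod *
        siteM none (sTout K (-1) hM0 G c x) *
        (l.map fun i => Rb N M _ none (some i) (pv K true 1 (-1) (-c / 2 - a i))).reverse.prod := by
  rw [map_bracketT]
  exact exchange_R (fun i => reflection_TT hM hM0 hN hx hG (a i) (by simp))
    (fun i j => pv_ybe_eq hM (by ring)) (fun i j => pv_ybe_eq hM (by ring)) hl

include hx hG hN in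
theorem exchange_PT (a : ι → ℂ) {l : List ι} (hl : l.Nodup) :
    (l.map fun i => Rb N M _ none (some i) (pv K false 1 (-1) (-2 * c - a i))).reverse.prod *
        siteM none (sPout (-1) hM G x) *
        (l.map fun i => Rbt N M _ none (some i) (pv K false (-1) (-1) (-2 * c - a i))).prod *
        emb (C.mapMatrix (bracketT K hM0 G c x a l)) =
      emb (C.mapMatrix (bracketT K hM0 G c x a l)) *
        (l.map fun i => Rbt N M _ none (some i) (pv K false (-1) (-1) (-a i))).prod *
        siteM none (sPout (-1) hM G x) *
        (l.map fun i => Rb N M _ none (some i) (pv K false 1 (-1) (-a i))).reverse.prod := by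
  rw [map_bracketT]
  exact exchange_R (fun i => reflection_PT hM hM0 hN hx hG (a i) (by simp))
    (fun i j => pv_ybe_eq hM (by ring)) (fun i j => pv_ybe_eq hM (by ring)) hl

end Products

/-! ### Polynomial dependence on the evaluation points -/

section PolyEval

open PowerSeries

theorem matrix_mem_polyFun {S D m : Type*} [CommRing S] [Algebra Kh S] [Ring D] [Algebra S D]
    [Fintype m] [DecidableEq m] {F : ℂ → Matrix m m D}
    (h : ∀ i j, (fun a => F a i j) ∈ polyFun S D) : F ∈ polyFun S (Matrix m m D) := by
  have e : F = ∑ i, ∑ j, fun a => Matrix.singleLinearMap S i j (F a i j) := by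
    funext a
    rw [Finset.sum_apply]
    simp only [Finset.sum_apply]
    exact Matrix.matrix_eq_sum_single (F a)
  rw [e]
  exact Subring.sum_mem _ fun i _ => Subring.sum_mem _ fun j _ => polyFun_map _ (h i j)

theorem polyFun_affine {S R : Type*} [CommRing S] [Algebra Kh S] [Ring R] [Algebra S R]
    {f : ℂ → R} (hf : f ∈ polyFun S R) (ε d : ℂ) : (fun a => f (ε * a + d)) ∈ polyFun S R := by
  obtain ⟨p, hp⟩ := mem_polyFun_iff.1 hf
  have e : (fun a => f (ε * a + d)) = ∑ k ∈ p.support, ((fun _ => algebraMap S R (cst S ε)) *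
      (fun a => algebraMap S R (cst S a)) + fun _ => algebraMap S R (cst S d)) ^ k *
        fun _ => p.coeff k := by
    funext a
    rw [hp, Polynomial.sum, Finset.sum_apply]
    refine Finset.sum_congr rfl fun k _ => ?_
    simp only [Pi.mul_apply, Pi.pow_apply, Pi.add_apply]
    rw [Algebra.smul_def, map_pow, map_add, map_mul, map_add, map_mul]
  rw [e]
  exact Subring.sum_mem _ fun k _ => Subring.mul_mem _ (Subring.pow_mem _ (Subring.add_mem _
    (Subring.mul_mem _ (const_mem_polyFun _) cst_mem_polyFun) (const_mem_polyFun _)) k)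
    (const_mem_polyFun _)

variable {K A : Type*} [CommRing K] [Algebra Kh K] [Ring A] [Algebra K A] [Algebra Kh A]
  [IsScalarTower Kh K A] {M N : ℕ} {σ : ℤˣ}

theorem algebraMap_cst_Ser (a : ℂ) : algebraMap K[T;T⁻¹] (Ser σ A)
    (cst K[T;T⁻¹] a) = Ser.C (algebraMap K A (cst K a)) := by
  rw [cst, RingHom.comp_apply, algebraMap_Ser_Kh, cst, RingHom.comp_apply,
    ← IsScalarTower.algebraMap_apply]

theorem ofPS_mem_polyFun {F : ℂ → PowerSeries A} (γ : ℕ → ℕ → A)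
    (h : ∀ a m, coeff m (F a) = ∑ l ∈ Finset.range M, cst K a ^ l • γ m l) :
    (fun a => Ser.ofPS σ (F a)) ∈ polyFun K[T;T⁻¹] (Ser σ A) := by
  have e : (fun a => Ser.ofPS σ (F a)) = ∑ l ∈ Finset.range M,
      (fun a => algebraMap K[T;T⁻¹] (Ser σ A) (cst K[T;T⁻¹] a)) ^ l *
        fun _ => Ser.ofPS σ (PowerSeries.mk fun m => γ m l) := by
    funext a
    have e' : F a = ∑ l ∈ Finset.range M, C (algebraMap K A (cst K a)) ^ l *
        PowerSeries.mk fun m => γ m l := by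
      ext m
      rw [h, map_sum]
      refine Finset.sum_congr rfl fun l _ => ?_
      rw [← map_pow C, coeff_C_mul, coeff_mk, ← map_pow (algebraMap K A), Algebra.smul_def]
    rw [e', map_sum, Finset.sum_apply]
    refine Finset.sum_congr rfl fun l _ => ?_
    rw [Pi.mul_apply, Pi.pow_apply, map_mul, map_pow, Ser.ofPS_C, algebraMap_cst_Ser]
  rw [e]
  exact Subring.sum_mem _ fun l _ => Subring.mul_mem _ (Subring.pow_mem _ cst_mem_polyFun l)
    (const_mem_polyFun _)

theorem coeff_linear_pow (e b : K) (m k : ℕ) : coeff m ((C e * X + C b) ^ k) =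
    if m ≤ k then e ^ m * b ^ (k - m) * (k.choose m : K) else 0 := by
  rw [add_pow, map_sum]
  have h : ∀ i, coeff m ((C e * X) ^ i * C b ^ (k - i) * ((k.choose i : ℕ) : PowerSeries K)) =
      if m = i then e ^ i * b ^ (k - i) * (k.choose i : K) else 0 := by
    intro i
    have : (C e * X) ^ i * C b ^ (k - i) * ((k.choose i : ℕ) : PowerSeries K) =
        C (e ^ i * b ^ (k - i) * (k.choose i : K)) * X ^ i := by
      rw [map_mul, map_mul, map_pow, map_pow, map_natCast, mul_pow]
      ring
    rw [this, coeff_C_mul, coeff_X_pow]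
    split_ifs <;> simp
  simp only [h]
  rw [Finset.sum_ite_eq]
  simp

theorem hmul_eq (a : ℂ) : algebraMap Kh K (hmul a) = hs K * cst K a := map_mul _ _ _

theorem coeff_evP (hM : algebraMap Kh K hbar ^ M = 0) (ε : ℤˣ) (a : ℂ) (f : PowerSeries A) (m : ℕ) :
    coeff m (evP A hM ε a f) = ∑ l ∈ Finset.range M, cst K a ^ l •
      ((((ε : ℤ) : K) ^ m * hs K ^ l * ((m + l).choose m : K)) • coeff (m + l) f) := by
  rw [evP, coeff_subsHom _ _ le_rfl, Finset.sum_range_add, Finset.sum_eq_zero, zero_add]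
  · refine Finset.sum_congr rfl fun l _ => ?_
    have : qP K ε a = C ((ε : ℤ) : K) * X + C (hs K * cst K a) := by
      rw [qP, hmul_eq, map_intCast]
    rw [this, coeff_linear_pow, if_pos (by omega), smul_smul, Nat.add_sub_cancel_left]
    congr 1
    ring
  · intro k hk
    rw [Finset.mem_range] at hk
    have : qP K ε a = C ((ε : ℤ) : K) * X + C (hs K * cst K a) := by
      rw [qP, hmul_eq, map_intCast]
    rw [this, coeff_linear_pow, if_neg (by omega), zero_smul]

theorem coeff_qT_pow (ε : ℤˣ) (a : ℂ) (m k : ℕ) : coeff m (qT K ε a ^ k) = if k ≤ m then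
    cst K a ^ (m - k) * (algebraMap Kh K (algebraMap ℂ Kh (((ε : ℤ) : ℂ)⁻¹ ^ k *
      ((Ring.choose (-(k : ℤ)) (m - k) : ℤ) : ℂ)) * algebraMap ℂ Kh (((ε : ℤ) : ℂ)⁻¹) ^ (m - k)) *
        hs K ^ (m - k)) else 0 := by
  rw [qT, ← map_pow, atInfQ_pow, coeff_map, atInfPow, coeff_mk]
  split_ifs with h
  · have e : ∀ z w v : Kh, algebraMap Kh K (z * (w * v) ^ (m - k)) =
        algebraMap Kh K (z * w ^ (m - k)) * algebraMap Kh K v ^ (m - k) := fun z w v => by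
      rw [mul_pow, ← mul_assoc, map_mul, map_pow]
    rw [e, hmul_eq, mul_pow]
    ring
  · simp

theorem coeff_evT (hM : algebraMap Kh K hbar ^ M = 0) (hM0 : M ≠ 0) (ε : ℤˣ) (f : PowerSeries A) :
    ∃ z : ℕ → ℕ → K, ∀ a m, coeff m (evT K A hM0 ε a f) = ∑ l ∈ Finset.range M, cst K a ^ l •
      (if l ≤ m then z m l • coeff (m - l) f else 0) := by
  refine ⟨fun m l => algebraMap Kh K (algebraMap ℂ Kh (((ε : ℤ) : ℂ)⁻¹ ^ (m - l) *
      ((Ring.choose (-((m - l : ℕ) : ℤ)) l : ℤ) : ℂ)) * algebraMap ℂ Kh (((ε : ℤ) : ℂ)⁻¹) ^ l) *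
        hs K ^ l, fun a m => ?_⟩
  rw [evT, coeff_subsHom _ _ le_rfl]
  have e1 : ∑ k ∈ Finset.range (m + M), coeff m (qT K ε a ^ k) • coeff k f =
      ∑ k ∈ Finset.range (m + 1), coeff m (qT K ε a ^ k) • coeff k f := by
    refine (Finset.sum_subset (by intro k; simp only [Finset.mem_range]; omega)
      fun k _ hk => ?_).symm
    rw [Finset.mem_range] at hk
    rw [coeff_qT_pow, if_neg (by omega), zero_smul]
  rw [e1, ← Finset.sum_range_reflect]
  have e2 : ∀ n, m + 1 ≤ n → M ≤ n → ∀ t : ℕ → A, (∀ l, m < l → t l = 0) → (∀ l, M ≤ l → t l = 0) →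
      ∑ l ∈ Finset.range (m + 1), t l = ∑ l ∈ Finset.range M, t l := by
    intro n h1 h2 t h3 h4
    rw [Finset.sum_subset (s₁ := Finset.range (m + 1)) (s₂ := Finset.range n)
        (by intro k; simp only [Finset.mem_range]; omega)
        fun k _ hk => h3 k (by simp only [Finset.mem_range] at hk; omega),
      Finset.sum_subset (s₁ := Finset.range M) (s₂ := Finset.range n)
        (by intro k; simp only [Finset.mem_range]; omega)
        fun k _ hk => h4 k (by simp only [Finset.mem_range] at hk; omega)]
  rw [← e2 (m + 1 + M) (by omega) (by omega)]
  · refine Finset.sum_congr rfl fun l hl => ?_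
    rw [Finset.mem_range] at hl
    have e3 : m + 1 - 1 - l = m - l := by omega
    have e4 : m - (m - l) = l := by omega
    rw [e3, coeff_qT_pow, if_pos (by omega), if_pos (by omega), e4, smul_smul]
  · intro l hl
    rw [if_neg (by omega), smul_zero]
  · intro l hl
    have : hs K ^ l = 0 := pow_eq_zero_of_le hl hM
    simp [this]

theorem ofPS_evP_mem_polyFun (hM : algebraMap Kh K hbar ^ M = 0) (ε : ℤˣ) (f : PowerSeries A) :
    (fun a => Ser.ofPS σ (evP A hM ε a f)) ∈ polyFun K[T;T⁻¹] (Ser σ A) :=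
  ofPS_mem_polyFun _ fun a m => coeff_evP hM ε a f m

theorem ofPS_evT_mem_polyFun (hM : algebraMap Kh K hbar ^ M = 0) (hM0 : M ≠ 0) (ε : ℤˣ)
    (f : PowerSeries A) :
    (fun a => Ser.ofPS σ (evT K A hM0 ε a f)) ∈ polyFun K[T;T⁻¹] (Ser σ A) := by
  obtain ⟨z, hz⟩ := coeff_evT (A := A) hM hM0 ε f
  exact ofPS_mem_polyFun _ hz

end PolyEval

/-! ### Absorption of the Young idempotents by the products -/

section AbsorbProducts

open PowerSeries

theorem siteM_mem_polyFun {S D ι : Type*} [CommRing S] [Algebra Kh S] [Ring D] [Algebra S D]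
    [Fintype ι] [DecidableEq ι] {N : ℕ} {X X' : ℂ → Matrix (Fin N) (Fin N) D}
    (Y : Matrix (Fin N) (Fin N) D) (hX : ∀ i j, (fun a => X a i j) ∈ polyFun S D)
    (hX' : ∀ i j, (fun a => X' a i j) ∈ polyFun S D) (m : ι) :
    (fun a => siteM m (X a * Y * (X' a)ᵀ)) ∈ polyFun S (Matrix (ι → Fin N) (ι → Fin N) D) := by
  have h : (fun a => X a * Y * (X' a)ᵀ) ∈ polyFun S (Matrix (Fin N) (Fin N) D) :=
    Subring.mul_mem _ (Subring.mul_mem _ (matrix_mem_polyFun hX) (const_mem_polyFun Y))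
      (matrix_mem_polyFun fun i j => hX' j i)
  have e : ∀ i j, (fun a => (X a * Y * (X' a)ᵀ) i j) ∈ polyFun S D := fun i j =>
    polyFun_map (Matrix.entryLinearMap S D i j) h
  refine matrix_mem_polyFun fun I J => ?_
  by_cases hIJ : ∀ k, k ≠ m → I k = J k
  · have : (fun a => siteM m (X a * Y * (X' a)ᵀ) I J) =
        fun a => (X a * Y * (X' a)ᵀ) (I m) (J m) := funext fun a => if_pos hIJ
    rw [this]
    exact e _ _
  · have : (fun a => siteM m (X a * Y * (X' a)ᵀ) I J) = fun a => 0 :=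
      funext fun a => if_neg hIJ
    rw [this]
    exact const_mem_polyFun 0

theorem reflection_close {N M : ℕ} {S D : Type*} [CommRing S] [Algebra Kh S] [Ring D] [Algebra S D]
    {ι : Type*} [DecidableEq ι] [Fintype ι] {G X X' Y Y' : Matrix (Fin N) (Fin N) D}
    (hc : ∀ i j (d : D), Commute (G i j) d) (hG : Gᵀ = G ∨ Gᵀ = -G) {a b : ℂ} (hab : a ≠ b) {q : S}
    (h1 : RTT X Y (cst S (a - b), -1) (cst S (a - b), -1))
    (h3 : RTT X' Y (rr N M q) (rr N M q)) (h2 : RTT Y' X (rr N M q) (rr N M q))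
    (h4 : RTT Y' X' (cst S (a - b), -1) (cst S (a - b), -1)) {i j : ι} (hij : i ≠ j) :
    (1 - cst S (a - b)⁻¹ • Pm N D i j) * siteM i (X * G * X'ᵀ) * Rbt N M D i j q *
        siteM j (Y * G * Y'ᵀ) =
      siteM j (Y * G * Y'ᵀ) * Rbt N M D i j q * siteM i (X * G * X'ᵀ) *
        (1 - cst S (a - b)⁻¹ • Pm N D i j) := by
  have e : cst S (a - b)⁻¹ • (cst S (a - b), (-1 : S)) = (1, -cst S (a - b)⁻¹) := by
    rw [Prod.smul_mk, smul_eq_mul, smul_eq_mul, ← map_mul, inv_mul_cancel₀ (sub_ne_zero.2 hab),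
      map_one, mul_neg, mul_one]
  have h1' := h1.smul (cst S (a - b)⁻¹)
  have h4' := h4.smul (cst S (a - b)⁻¹)
  rw [e] at h1' h4'
  have := reflection hc hG h1' h3 h2.swap h4'.swap hij
  simp only [one_smul, neg_smul, ← sub_eq_add_neg] at this
  exact this

variable {K A : Type*} [CommRing K] [Algebra Kh K] [Ring A] [Algebra K A] [Algebra Kh A]
  [IsScalarTower Kh K A] {M N : ℕ} (hM : algebraMap Kh K hbar ^ M = 0) (hM0 : M ≠ 0) {c : ℂ}
  {x : Gen N → A} (hx : IsRep c x) {G : Matrix (Fin N) (Fin N) ℂ} (hG : Gᵀ = G ∨ Gᵀ = -G)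
  {ν : YoungDiagram} (U : StandardTableau ν)

include hx hG in
theorem bracketP_absorb :
    youngE N K[T;T⁻¹] (Ser 1 A) U *
        bracketP hM G x (fun i => (U.content i : ℂ)) (List.finRange ν.card) *
        youngE N K[T;T⁻¹] (Ser 1 A) U =
      youngE N K[T;T⁻¹] (Ser 1 A) U *
        bracketP hM G x (fun i => (U.content i : ℂ)) (List.finRange ν.card) := by
  refine JMEigen.mul_youngE (S := K[T;T⁻¹]) U (jmEigen_prodS (fun b => qv K (-b))
    (fun a => sPin hM G x a) (fun a b => ?_) (fun a => qv_pow hM _) (fun m => ?_)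
    (fun i j a b hij hab => ?_) (List.nodup_finRange _) (youngE_jmEigen U))
  · have := qv_fusion hM (-a) b
    rwa [← neg_add'] at this
  · refine siteM_mem_polyFun _ (fun i j => ofPS_evP_mem_polyFun hM 1 _) (fun i j => ?_) m
    have := polyFun_affine (ofPS_evP_mem_polyFun (σ := 1) hM (-1) (serMat (Tpcoeff x) i j)) (-1) 0
    simp only [neg_mul, one_mul, add_zero] at this
    exact this
  · refine reflection_close (gM_commute G) (gM_transpose hG) hab (rtt_PP_same hM hx 1 a b) ?_ ?_ ?_ hij
    · have := rtt_PP_opposite hM hx (-a) b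
      rwa [← neg_add'] at this
    · have := rtt_PP_opposite hM hx (-b) a
      rwa [← neg_add', add_comm b a] at this
    · have := rtt_PP_same hM hx (-1) (-b) (-a)
      rwa [show -b - -a = a - b by ring] at this

include hM hx hG in
theorem bracketT_absorb :
    youngE N K[T;T⁻¹] (Ser (-1) A) U *
        bracketT K hM0 G c x (fun i => (U.content i : ℂ)) (List.finRange ν.card) *
        youngE N K[T;T⁻¹] (Ser (-1) A) U =
      youngE N K[T;T⁻¹] (Ser (-1) A) U *
        bracketT K hM0 G c x (fun i => (U.content i : ℂ)) (List.finRange ν.card) := by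
  refine JMEigen.mul_youngE (S := K[T;T⁻¹]) U (jmEigen_prodS (fun b => qv K (-b - 2 * c))
    (fun a => sTin K hM0 G c x a) (fun a b => ?_) (fun a => qv_pow hM _) (fun m => ?_)
    (fun i j a b hij hab => ?_) (List.nodup_finRange _) (youngE_jmEigen U))
  · have := qv_fusion hM (-a - 2 * c) b
    rwa [show -a - 2 * c - b = -(a + b) - 2 * c by ring] at this
  · refine siteM_mem_polyFun _ (fun i j => ?_) (fun i j => ?_) m
    · have := polyFun_affine (ofPS_evT_mem_polyFun (σ := -1) hM hM0 1 (serMat (Tcoeff x) i j))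
        1 (3 * c / 2)
      simp only [one_mul] at this
      exact this
    · have := polyFun_affine (ofPS_evT_mem_polyFun (σ := -1) hM hM0 (-1) (serMat (Tcoeff x) i j))
        (-1) (-(c / 2))
      simp only [neg_mul, one_mul, ← sub_eq_add_neg] at this
      exact this
  · refine reflection_close (gM_commute G) (gM_transpose hG) hab ?_ ?_ ?_ ?_ hij
    · have := rtt_TT_same hM hM0 hx 1 (a + 3 * c / 2) (b + 3 * c / 2)
      rwa [show a + 3 * c / 2 - (b + 3 * c / 2) = a - b by ring] at this
    · have := rtt_TT_opposite hM hM0 hx (-a - c / 2) (b + 3 * c / 2)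
      rwa [show -a - c / 2 - (b + 3 * c / 2) = -(a + b) - 2 * c by ring] at this
    · have := rtt_TT_opposite hM hM0 hx (-b - c / 2) (a + 3 * c / 2)
      rwa [show -b - c / 2 - (a + 3 * c / 2) = -(a + b) - 2 * c by ring] at this
    · have := rtt_TT_same hM hM0 hx (-1) (-b - c / 2) (-a - c / 2)
      rwa [show -b - c / 2 - (-a - c / 2) = a - b by ring] at this

end AbsorbProducts

/-! ### Series with locally finite coefficients -/

section LocallyFinite

open PowerSeries

variable {A : Type*} [Ring A] (J : Ideal A)

theorem exists_uniform_bound {α : Type*} (s : Finset α) {p : α → ℤ → Prop}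
    (h : ∀ i ∈ s, ∃ k, ∀ n ≥ k, p i n) : ∃ k, ∀ i ∈ s, ∀ n ≥ k, p i n := by
  classical
  induction s using Finset.induction_on with
  | empty => exact ⟨0, by simp⟩
  | insert a s ha ih =>
    obtain ⟨k, hk⟩ := ih fun i hi => h i (by simp [hi])
    obtain ⟨k', hk'⟩ := h a (by simp)
    refine ⟨max k k', fun i hi n hn => ?_⟩
    rcases Finset.mem_insert.1 hi with rfl | hi
    · exact hk' n (le_trans (le_max_right _ _) hn)
    · exact hk i hi n (le_trans (le_max_left _ _) hn)

/-- The Laurent series in `u⁻¹` whose coefficients, multiplied by any element from the right, are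
eventually in the left ideal `J`. -/
def locFin : Subring (Ser (-1) A) where
  carrier := {f | ∀ y, ∃ k, ∀ n ≥ k, Ser.coeff n f * y ∈ J}
  zero_mem' y := ⟨0, fun n _ => by simp⟩
  one_mem' y := ⟨1, fun n hn => by
    rw [← map_one Ser.C, Ser.coeff_C, if_neg (by omega), zero_mul]
    exact J.zero_mem⟩
  add_mem' {f g} hf hg y := by
    obtain ⟨k, hk⟩ := hf y
    obtain ⟨l, hl⟩ := hg y
    refine ⟨max k l, fun n hn => ?_⟩
    rw [map_add, add_mul]
    exact J.add_mem (hk n (le_trans (le_max_left _ _) hn)) (hl n (le_trans (le_max_right _ _) hn))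
  neg_mem' {f} hf y := by
    obtain ⟨k, hk⟩ := hf y
    refine ⟨k, fun n hn => ?_⟩
    rw [map_neg, neg_mul]
    exact J.neg_mem (hk n hn)
  mul_mem' {f g} hf hg y := by
    obtain ⟨a, ha⟩ := f.exists_bound
    obtain ⟨b, hb⟩ := g.exists_bound
    obtain ⟨l, hl⟩ := hg y
    obtain ⟨k, hk⟩ := exists_uniform_bound (Finset.Icc b l)
      (p := fun j n => Ser.coeff n f * (Ser.coeff j g * y) ∈ J) fun j _ => hf _
    refine ⟨k + l, fun n hn => ?_⟩
    rw [Ser.coeff_mul ha hb, Finset.sum_mul]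
    refine J.sum_mem fun i hi => ?_
    rw [Finset.mem_Icc] at hi
    rw [mul_assoc]
    by_cases h : n - i ≤ l
    · exact hk (n - i) (Finset.mem_Icc.2 ⟨by omega, h⟩) i (by omega)
    · exact J.mul_mem_left _ (hl _ (by omega))

theorem toSer_mem_locFin (f : A[T;T⁻¹]) : toSer (-1) f ∈ locFin J := by
  induction f using LaurentPolynomial.induction_on' with
  | add f g hf hg =>
    rw [map_add]
    exact Subring.add_mem _ hf hg
  | C_mul_T k a =>
    rw [toSer_C_mul_T]
    intro y
    refine ⟨-k + 1, fun n hn => ?_⟩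
    rw [Ser.coeff_mono, if_neg (by push_cast; omega), zero_mul]
    exact J.zero_mem

variable {K : Type*} [CommRing K] [Algebra K A] [Algebra Kh K] [Algebra Kh A] [IsScalarTower Kh K A]
  {M : ℕ}

theorem algebraMap_mem_locFin (s : K[T;T⁻¹]) :
    algebraMap K[T;T⁻¹] (Ser (-1) A) s ∈ locFin J := toSer_mem_locFin J _

theorem smul_mem_left_ideal {z : K} {y : A} (hy : y ∈ J) : z • y ∈ J := by
  rw [Algebra.smul_def]
  exact J.mul_mem_left _ hy

theorem ofPS_evT_mem_locFin (hM : algebraMap Kh K hbar ^ M = 0) (hM0 : M ≠ 0) (ε : ℤˣ) (a : ℂ)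
    {f : PowerSeries A} (hf : ∀ y, ∃ k : ℕ, ∀ n ≥ k, coeff n f * y ∈ J) :
    Ser.ofPS (-1) (evT K A hM0 ε a f) ∈ locFin J := by
  obtain ⟨z, hz⟩ := coeff_evT (A := A) hM hM0 ε f
  intro y
  obtain ⟨k, hk⟩ := hf y
  refine ⟨k + M, fun n hn => ?_⟩
  obtain ⟨n, rfl⟩ := Int.eq_ofNat_of_zero_le (a := n) (by omega)
  rw [Ser.coeff_ofPS_nat, hz, Finset.sum_mul]
  refine J.sum_mem fun l hl => ?_
  rw [Finset.mem_range] at hl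
  rw [if_pos (by omega), smul_mul_assoc, smul_mul_assoc]
  exact smul_mem_left_ideal J (smul_mem_left_ideal J (hk _ (by omega)))

end LocallyFinite

/-! ### Congruences modulo `h` and inverses -/

section ModH

variable {S R : Type*} [CommRing S] [Algebra Kh S] [Ring R] [Algebra S R] {M : ℕ}

variable (S) in
/-- Congruence modulo `h`. -/
def HCong (x y : R) : Prop := ∃ z : R, x = y + hs S • z

theorem HCong.refl (x : R) : HCong S x x := ⟨0, by simp⟩

theorem HCong.mul {x y x' y' : R} (h : HCong S x y) (h' : HCong S x' y') :
    HCong S (x * x') (y * y') := by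
  obtain ⟨z, rfl⟩ := h
  obtain ⟨z', rfl⟩ := h'
  refine ⟨z * y' + y * z' + hs S • (z * z'), ?_⟩
  simp only [add_mul, mul_add, smul_mul_assoc, mul_smul_comm, smul_add]
  abel

theorem HCong.list_prod {κ : Type*} {f g : κ → R} {l : List κ} (h : ∀ i ∈ l, HCong S (f i) (g i)) :
    HCong S (l.map f).prod (l.map g).prod := by
  induction l with
  | nil => exact HCong.refl _
  | cons a l ih =>
    rw [List.map_cons, List.map_cons, List.prod_cons, List.prod_cons]
    exact (h a (by simp)).mul (ih fun i hi => h i (by simp [hi]))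

theorem HCong.prodS {κ : Type*} {r : κ → κ → R} {s g : κ → R} (hs : ∀ i, HCong S (s i) (g i))
    (hr : ∀ i j, HCong S (r i j) 1) : ∀ l : List κ, HCong S (prodS r s l) (l.map g).prod
  | [] => HCong.refl _
  | i :: l => by
    rw [TwistedYangian.prodS, List.map_cons, List.prod_cons]
    refine HCong.mul ?_ (HCong.prodS hs hr l)
    have := (hs i).mul (HCong.list_prod (l := l) fun j _ => hr i j)
    simpa using this

theorem exists_inverse_of_hCong (hM : hs S ^ M = 0) {E X Y Y' : R} (hXY : HCong S X Y)
    (h1 : Y * Y' = 1) (h2 : Y' * Y = 1) (hE : Commute E Y) (hEE : E * E = E) (hX : E * X * E = E * X) :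
    ∃ X', X * X' = 1 ∧ X' * X = 1 ∧ E * X' * E = E * X' ∧
      ∀ Λ : Subring R, X ∈ Λ → Y' ∈ Λ → X' ∈ Λ := by
  obtain ⟨z, hz⟩ := hXY
  have hE' : Commute E Y' := by
    have : Y' * (E * Y) * Y' = Y' * (Y * E) * Y' := by rw [hE.eq]
    calc E * Y' = Y' * (Y * E) * Y' := by rw [← mul_assoc Y', h2, one_mul]
      _ = Y' * E * (Y * Y') := by rw [← this]; simp only [mul_assoc]
      _ = Y' * E := by rw [h1, mul_one]
  set n : R := 1 - Y' * X with hn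
  have hYn : Y * (1 - n) = X := by rw [hn, sub_sub_cancel, ← mul_assoc, h1, one_mul]
  have hnM : n ^ M = 0 := by
    have : n = hs S • (-(Y' * z)) := by
      rw [hn, hz, mul_add, h2, mul_smul_comm, smul_neg]
      abel
    rw [this, smul_pow, hM, zero_smul]
  have hEn : E * n * E = E * n := by
    rw [hn, mul_sub, sub_mul, mul_one, ← mul_assoc, hE'.eq, mul_assoc Y', mul_assoc Y', hX]
    rw [hEE]
  have hEk : ∀ k, E * n ^ k * E = E * n ^ k := by
    intro k
    induction k with
    | zero => simp [hEE]
    | succ k ih =>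
      calc E * n ^ (k + 1) * E = E * n ^ k * n * E := by rw [pow_succ, ← mul_assoc]
        _ = E * n ^ k * (E * n * E) := by
          nth_rewrite 1 [← ih]
          simp only [mul_assoc]
        _ = E * n ^ k * E * n := by rw [hEn]; simp only [mul_assoc]
        _ = E * n ^ (k + 1) := by rw [ih, pow_succ, mul_assoc]
  set g : R := ∑ k ∈ Finset.range M, n ^ k with hg
  have g1 : (1 - n) * g = 1 := by rw [hg, mul_neg_geom_sum, hnM, sub_zero]
  have g2 : g * (1 - n) = 1 := by rw [hg, geom_sum_mul_neg, hnM, sub_zero]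
  refine ⟨g * Y', ?_, ?_, ?_, fun Λ hX hY => ?_⟩
  · rw [← hYn, mul_assoc, ← mul_assoc _ g, g1, one_mul, h1]
  · rw [← hYn, mul_assoc, ← mul_assoc Y', h2, one_mul, g2]
  · have : E * g * E = E * g := by
      rw [hg, Finset.mul_sum, Finset.sum_mul]
      exact Finset.sum_congr rfl fun k _ => hEk k
    calc E * (g * Y') * E = E * g * (Y' * E) := by simp only [mul_assoc]
      _ = E * g * E * Y' := by rw [← hE'.eq, mul_assoc (E * g)]
      _ = E * (g * Y') := by rw [this, mul_assoc]
  · exact Subring.mul_mem _ (Subring.sum_mem _ fun k _ => Subring.pow_mem _ (Subring.sub_mem _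
      (Subring.one_mem _) (Subring.mul_mem _ hY hX)) k) hY

end ModH

/-! ### The inverse of the product `S_{[n]}` -/

section InverseBracket

open PowerSeries

theorem gval_eq_one_add {S : Type*} [CommRing S] [Algebra Kh S] {N M : ℕ} (hM0 : M ≠ 0) (p : S) :
    ∃ y, gval N M p = 1 + p * y := by
  obtain ⟨m, rfl⟩ := Nat.exists_eq_succ_of_ne_zero hM0
  refine ⟨∑ k ∈ Finset.range m, algebraMap Kh S (C (gCoeff N (k + 1))) * p ^ k, ?_⟩
  rw [gval, Finset.sum_range_succ', Finset.mul_sum, add_comm]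
  congr 1
  · simp [gCoeff]
  · exact Finset.sum_congr rfl fun k _ => by ring

theorem Rbt_hCong {S D ι : Type*} [CommRing S] [Algebra Kh S] [Ring D] [Algebra S D] [Fintype ι]
    [DecidableEq ι] {N M : ℕ} (hM0 : M ≠ 0) (i j : ι) (p : S) :
    HCong S (Rbt N M D i j (hs S * p)) 1 := by
  obtain ⟨y, hy⟩ := gval_eq_one_add (N := N) hM0 (hs S * p)
  refine ⟨(p * y) • 1 - (p + hs S * p * y * p) • Qm N D i j, ?_⟩
  rw [Rbt_eq, hy]
  module

theorem matT_hCong {S D A : Type*} [CommRing S] [Algebra Kh S] [Ring D] [Algebra S D] [Ring A]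
    [Algebra Kh A] {N : ℕ} (x : Gen N → A) (e : PowerSeries A →+* D)
    (he : e (C (algebraMap Kh A hbar)) = algebraMap S D (hs S)) : HCong S (matT x e) 1 := by
  refine ⟨Matrix.of fun i j => e (X * PowerSeries.mk fun r => x (.pos i j r)), ?_⟩
  ext i j
  change e (serMat (Tcoeff x) i j) = (1 : Matrix (Fin N) (Fin N) D) i j +
    hs S • e (X * PowerSeries.mk fun r => x (.pos i j r))
  rw [Algebra.smul_def, ← he, ← map_mul]
  have h : (1 : Matrix (Fin N) (Fin N) D) i j = e (C ((1 : Matrix (Fin N) (Fin N) A) i j)) := by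
    rw [Matrix.one_apply, Matrix.one_apply]
    split_ifs <;> simp
  rw [h, ← map_add]
  congr 1
  ext r
  rw [serMat, Matrix.of_apply, coeff_mk, map_add, coeff_C_mul]
  cases r with
  | zero => simp [Tcoeff]
  | succ r => simp [Tcoeff, coeff_succ_X_mul, Algebra.smul_def]

theorem HCong.transpose {S D m : Type*} [CommRing S] [Algebra Kh S] [Ring D] [Algebra S D]
    [Fintype m] [DecidableEq m] {X Y : Matrix m m D} (h : HCong S X Y) : HCong S Xᵀ Yᵀ := by
  obtain ⟨Z, rfl⟩ := h
  exact ⟨Zᵀ, rfl⟩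

theorem HCong.siteM {S D ι : Type*} [CommRing S] [Algebra Kh S] [Ring D] [Algebra S D]
    [Fintype ι] [DecidableEq ι] {N : ℕ} {X Y : Matrix (Fin N) (Fin N) D} (h : HCong S X Y) (i : ι) :
    HCong S (siteM i X) (siteM i Y) := by
  obtain ⟨Z, rfl⟩ := h
  refine ⟨TwistedYangian.siteM i Z, ?_⟩
  ext I J
  simp only [TwistedYangian.siteM, Matrix.of_apply, Matrix.add_apply, Matrix.smul_apply]
  split_ifs <;> simp

theorem siteM_commute {D ι : Type*} [Ring D] [Fintype ι] [DecidableEq ι] {N : ℕ}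
    {X Y : Matrix (Fin N) (Fin N) D} (h : ∀ i j k l, Commute (X i j) (Y k l)) {i j : ι}
    (hij : i ≠ j) : Commute (siteM i X) (siteM j Y) := by
  rw [← pairM_left hij, ← pairM_right hij]
  have := kl_kr_commute h
  rw [Commute, SemiconjBy, ← pairM_mul hij, ← pairM_mul hij, this.eq]

theorem Pm_commute_prod_siteM {D ι : Type*} [Ring D] [Fintype ι] [DecidableEq ι] {N : ℕ}
    {X : Matrix (Fin N) (Fin N) D} (h : ∀ i j d, Commute (X i j) d) {l : List ι} (hl : l.Nodup)
    (hl' : ∀ i, i ∈ l) (i j : ι) : Commute (Pm N D i j) (l.map fun k => siteM k X).prod := by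
  have e : ∀ l : List ι, Pm N D i j * (l.map fun k => siteM k X).prod =
      ((l.map (Equiv.swap i j)).map fun k => siteM k X).prod * Pm N D i j := by
    intro l
    induction l with
    | nil => simp
    | cons a l ih =>
      rw [List.map_cons, List.prod_cons, ← mul_assoc, Pm, permM_mul_siteM, mul_assoc, ← Pm, ih,
        List.map_cons, List.map_cons, List.prod_cons, mul_assoc]
  rw [Commute, SemiconjBy, e]
  congr 1
  have hp : List.Perm (l.map (Equiv.swap i j)) l := by
    refine (List.perm_ext_iff_of_nodup (hl.map (Equiv.injective _)) hl).2 fun k => ?_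
    simp only [hl', iff_true, List.mem_map]
    exact ⟨Equiv.swap i j k, trivial, by simp⟩
  refine (hp.map _).prod_eq' ?_
  refine List.Pairwise.map _ (R := fun a b => a ≠ b) (fun a b hab =>
    siteM_commute (fun i j k l => h i j _) hab) (hl.map (Equiv.injective _))

theorem gM_mul {S D : Type*} [CommRing S] [Algebra Kh S] [Ring D] [Algebra S D] {N : ℕ}
    (G G' : Matrix (Fin N) (Fin N) ℂ) : gM S D G * gM S D G' = gM S D (G * G') := (map_mul _ _ _).symm

theorem gM_one {S D : Type*} [CommRing S] [Algebra Kh S] [Ring D] [Algebra S D] {N : ℕ} :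
    gM S D (1 : Matrix (Fin N) (Fin N) ℂ) = 1 := map_one _

variable {K A : Type*} [CommRing K] [Algebra Kh K] [Ring A] [Algebra K A] [Algebra Kh A]
  [IsScalarTower Kh K A] {M N : ℕ} (hM : algebraMap Kh K hbar ^ M = 0) (hM0 : M ≠ 0) {c : ℂ}
  {x : Gen N → A} (hx : IsRep c x) {G : Matrix (Fin N) (Fin N) ℂ} (hG : Gᵀ = G ∨ Gᵀ = -G)
  (hGdet : IsUnit G.det) {ν : YoungDiagram} (U : StandardTableau ν) {J : Ideal A}
  (hJ : ∀ i j y, ∃ k : ℕ, ∀ n ≥ k, hbar • x (.pos i j n) * y ∈ J)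

theorem ofPS_evT_h (ε : ℤˣ) (a : ℂ) :
    ((Ser.ofPS (-1)).comp (evT K A hM0 ε a)) (C (algebraMap Kh A hbar)) =
      algebraMap K[T;T⁻¹] (Ser (-1) A) (hs K[T;T⁻¹]) := by
  rw [RingHom.comp_apply, evT, subsHom_C, Ser.ofPS_C, hs, algebraMap_Ser_Kh]

theorem bracketT_hCong {ι : Type*} [DecidableEq ι] [Fintype ι] (a : ι → ℂ) (l : List ι) :
    HCong K[T;T⁻¹] (bracketT K hM0 G c x a l)
      (l.map fun i => siteM i (gM K[T;T⁻¹] (Ser (-1) A) G)).prod := by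
  refine HCong.prodS (fun i => ?_) (fun i j => Rbt_hCong hM0 i j _) l
  have := ((matT_hCong x _ (ofPS_evT_h (K := K) hM0 1 (a i + 3 * c / 2))).mul (HCong.refl
    (gM K[T;T⁻¹] _ G))).mul
    (matT_hCong x _ (ofPS_evT_h (K := K) hM0 (-1) (-a i - c / 2))).transpose
  rw [one_mul, Matrix.transpose_one, mul_one] at this
  exact this.siteM i

theorem siteM_mem_matrix {D ι : Type*} [Ring D] [Fintype ι] [DecidableEq ι] (Λ : Subring D)
    {X : Matrix (Fin N) (Fin N) D} (hX : X ∈ Λ.matrix) (i : ι) : siteM i X ∈ Λ.matrix := by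
  intro I J
  rw [siteM, Matrix.of_apply]
  split_ifs
  · exact hX _ _
  · exact Λ.zero_mem

theorem prodS_mem {R κ : Type*} [Ring R] (Λ : Subring R) {r : κ → κ → R} {s : κ → R}
    (hs : ∀ i, s i ∈ Λ) (hr : ∀ i j, r i j ∈ Λ) : ∀ l : List κ, prodS r s l ∈ Λ
  | [] => Λ.one_mem
  | i :: l => by
    rw [prodS]
    refine Λ.mul_mem (Λ.mul_mem (hs i) (Λ.list_prod_mem ?_)) (prodS_mem Λ hs hr l)
    intro y hy
    obtain ⟨j, -, rfl⟩ := List.mem_map.1 hy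
    exact hr i j

theorem smul_mem_matrix {S D m : Type*} [CommRing S] [Ring D] [Algebra S D] [Fintype m]
    [DecidableEq m] {Λ : Subring D} (hΛ : ∀ s, algebraMap S D s ∈ Λ) (s : S) {X : Matrix m m D}
    (hX : X ∈ Λ.matrix) : s • X ∈ Λ.matrix := by
  intro i j
  rw [Matrix.smul_apply, Algebra.smul_def]
  exact Λ.mul_mem (hΛ s) (hX i j)

theorem Rbt_mem_matrix {S D ι : Type*} [CommRing S] [Algebra Kh S] [Ring D] [Algebra S D]
    [Fintype ι] [DecidableEq ι] {Λ : Subring D} (hΛ : ∀ s, algebraMap S D s ∈ Λ) (i j : ι) (p : S) :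
    Rbt N M D i j p ∈ Λ.matrix := by
  have hQ : Qm N D i j ∈ Λ.matrix := fun I J => by
    rw [Qm, Matrix.of_apply]
    split_ifs
    · exact Λ.one_mem
    · exact Λ.zero_mem
  exact Subring.add_mem _ (smul_mem_matrix hΛ _ (Subring.one_mem _)) (smul_mem_matrix hΛ _ hQ)

include hM hJ in
theorem matT_mem_locFin (ε : ℤˣ) (a : ℂ) :
    matT x ((Ser.ofPS (-1)).comp (evT K A hM0 ε a)) ∈ (locFin J).matrix := by
  intro i j
  refine ofPS_evT_mem_locFin J hM hM0 ε a fun y => ?_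
  obtain ⟨k, hk⟩ := hJ i j y
  refine ⟨k + 1, fun n hn => ?_⟩
  obtain ⟨n, rfl⟩ : ∃ m, n = m + 1 := ⟨n - 1, by omega⟩
  rw [serMat, Matrix.of_apply, coeff_mk]
  exact hk n (by omega)

include hM hJ in
theorem sTin_mem_locFin (a : ℂ) : sTin K hM0 G c x a ∈ (locFin J).matrix := by
  have h1 := matT_mem_locFin hM hM0 hJ 1 (a + 3 * c / 2)
  have h2 := matT_mem_locFin hM hM0 hJ (-1) (-a - c / 2)
  have h3 : (matT x ((Ser.ofPS (-1)).comp (evT K A hM0 (-1) (-a - c / 2))))ᵀ ∈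
      (locFin J).matrix := fun i j => h2 j i
  have h4 : gM K[T;T⁻¹] (Ser (-1) A) G ∈ (locFin J).matrix := fun i j =>
    algebraMap_mem_locFin J _
  exact Subring.mul_mem _ (Subring.mul_mem _ h1 h4) h3

include hM hJ in
theorem bracketT_mem_locFin {ι : Type*} [DecidableEq ι] [Fintype ι] (a : ι → ℂ) (l : List ι) :
    bracketT K hM0 G c x a l ∈ (locFin J).matrix :=
  prodS_mem _ (fun i => siteM_mem_matrix _ (sTin_mem_locFin hM hM0 hJ (a i)) i)
    (fun i j => Rbt_mem_matrix (algebraMap_mem_locFin J) i j _) l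

include hM hx hG hGdet in
/-- The inverse of `S_{[n]}`. -/
theorem exists_bracketT_inverse :
    ∃ X', bracketT K hM0 G c x (fun i => (U.content i : ℂ)) (List.finRange ν.card) * X' = 1 ∧
      X' * bracketT K hM0 G c x (fun i => (U.content i : ℂ)) (List.finRange ν.card) = 1 ∧
      youngE N K[T;T⁻¹] (Ser (-1) A) U * X' *
        youngE N K[T;T⁻¹] (Ser (-1) A) U =
          youngE N K[T;T⁻¹] (Ser (-1) A) U * X' ∧
      ∀ J : Ideal A, (∀ i j y, ∃ k : ℕ, ∀ n ≥ k, hbar • x (.pos i j n) * y ∈ J) →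
        X' ∈ (locFin J).matrix := by
  have hgg : ∀ G G' : Matrix (Fin N) (Fin N) ℂ, G * G' = 1 → ∀ i : Fin ν.card,
      siteM i (gM K[T;T⁻¹] (Ser (-1) A) G) *
        siteM i (gM K[T;T⁻¹] (Ser (-1) A) G') = 1 := fun G G' h i => by
    rw [← siteM_mul, gM_mul, h, gM_one, siteM_one]
  have i1 : ((List.finRange ν.card).map fun i =>
      siteM i (gM K[T;T⁻¹] (Ser (-1) A) G)).prod * ((List.finRange ν.card).map fun i =>
      siteM i (gM K[T;T⁻¹] (Ser (-1) A) G⁻¹)).reverse.prod = 1 :=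
    list_prod_mul_reverse_prod fun i _ => hgg G G⁻¹ (Matrix.mul_nonsing_inv _ hGdet) i
  have i2 : ((List.finRange ν.card).map fun i =>
      siteM i (gM K[T;T⁻¹] (Ser (-1) A) G⁻¹)).reverse.prod *
      ((List.finRange ν.card).map fun i =>
        siteM i (gM K[T;T⁻¹] (Ser (-1) A) G)).prod = 1 :=
    reverse_prod_mul_list_prod fun i _ => hgg G⁻¹ G (Matrix.nonsing_inv_mul _ hGdet) i
  have i3 := youngE_commute (S := K[T;T⁻¹]) U fun i j => (Pm_commute_prod_siteM
    (gM_commute (S := K[T;T⁻¹]) (D := Ser (-1) A) G)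
    (List.nodup_finRange _) (List.mem_finRange) i j).symm
  obtain ⟨X', h1, h2, h3, h4⟩ := exists_inverse_of_hCong (hs_Lau_pow hM)
    (bracketT_hCong (x := x) (G := G) (c := c) hM0 (fun i => (U.content i : ℂ)) (List.finRange ν.card))
    i1 i2 i3.symm (youngE_mul_self U) (bracketT_absorb hM hM0 hx hG U)
  refine ⟨X', h1, h2, h3, fun J hJ => h4 _ (bracketT_mem_locFin hM hM0 hJ _ _) ?_⟩
  refine Subring.list_prod_mem _ fun y hy => ?_
  obtain ⟨i, -, rfl⟩ := List.mem_map.1 (List.mem_reverse.1 hy)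
  exact siteM_mem_matrix _ (fun i j => algebraMap_mem_locFin J _) i

end InverseBracket

/-! ### Truncation of Laurent series -/

section Trunc

open PowerSeries

variable {A : Type*} [Ring A]

/-- The part of a Laurent series in `u⁻¹` with the exponents from `a` to `k`. -/
def trunc (a k : ℤ) : Ser (-1) A →+ A[T;T⁻¹] where
  toFun f := ∑ n ∈ Finset.Icc a k, LaurentPolynomial.C (Ser.coeff n f) * LaurentPolynomial.T (-n)
  map_zero' := by simp
  map_add' f g := by simp [add_mul, Finset.sum_add_distrib]

theorem trunc_apply (a k : ℤ) (f : Ser (-1) A) : trunc a k f =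
    ∑ n ∈ Finset.Icc a k, LaurentPolynomial.C (Ser.coeff n f) * LaurentPolynomial.T (-n) := rfl

theorem trunc_C_mul (a k : ℤ) (b : A) (f : Ser (-1) A) :
    trunc a k (Ser.C b * f) = LaurentPolynomial.C b * trunc a k f := by
  simp only [trunc_apply, Ser.coeff_C_mul, map_mul, Finset.mul_sum, mul_assoc]

theorem trunc_mul_C (a k : ℤ) (b : A) (f : Ser (-1) A) :
    trunc a k (f * Ser.C b) = trunc a k f * LaurentPolynomial.C b := by
  simp only [trunc_apply, Ser.coeff_mul_C, map_mul, Finset.sum_mul, mul_assoc]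
  refine Finset.sum_congr rfl fun n _ => ?_
  rw [(LaurentPolynomial.commute_T (-n) _).eq]

theorem coeff_toSer_trunc {a : ℤ} (k : ℤ) {f : Ser (-1) A} (hf : ∀ n < a, Ser.coeff n f = 0) (n : ℤ) :
    Ser.coeff n (toSer (-1) (trunc a k f)) = if n ≤ k then Ser.coeff n f else 0 := by
  simp only [trunc_apply, map_sum, toSer_C_mul_T, Ser.coeff_mono]
  have e : ∀ m : ℤ, (((-1 : ℤˣ) : ℤ) * -m) = m := fun m => by simp
  simp only [e]
  rw [Finset.sum_ite_eq]
  by_cases h1 : a ≤ n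
  · simp [h1]
  · rw [hf n (by omega)]
    simp

variable (J : Ideal A)

/-- The left ideal of Laurent series with the coefficients in a left ideal. -/
def serIdeal (σ : ℤˣ) : Ideal (Ser σ A) where
  carrier := {f | ∀ n, Ser.coeff n f ∈ J}
  zero_mem' n := by rw [map_zero]; exact J.zero_mem
  add_mem' {f g} hf hg n := by rw [map_add]; exact J.add_mem (hf n) (hg n)
  smul_mem' f g hg n := by
    obtain ⟨a, ha⟩ := f.exists_bound
    obtain ⟨b, hb⟩ := g.exists_bound
    rw [smul_eq_mul, Ser.coeff_mul ha hb]
    exact J.sum_mem fun i _ => J.mul_mem_left _ (hg _)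

theorem toSer_mem_serIdeal {f : A[T;T⁻¹]} (σ σ' : ℤˣ) (h : toSer σ f ∈ serIdeal J σ) :
    toSer σ' f ∈ serIdeal J σ' := by
  intro n
  have := h (σ * σ' * n)
  rw [coeff_toSer, ← mul_assoc, ← mul_assoc] at this
  have e : ((σ : ℤ) * σ) = 1 := by
    rw [← Units.val_mul, Int.units_mul_self]; rfl
  rw [e, one_mul] at this
  rwa [coeff_toSer]

theorem trunc_remainder {a : ℤ} {f : Ser (-1) A} (hf : f ∈ locFin J)
    (ha : ∀ n < a, Ser.coeff n f = 0) (w : A[T;T⁻¹]) :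
    ∃ k₀, ∀ k ≥ k₀, (f - toSer (-1) (trunc a k f)) * toSer (-1) w ∈ serIdeal J (-1) := by
  induction w using LaurentPolynomial.induction_on' with
  | add w w' hw hw' =>
    obtain ⟨k, hk⟩ := hw
    obtain ⟨l, hl⟩ := hw'
    refine ⟨max k l, fun n hn => ?_⟩
    rw [map_add, mul_add]
    exact Ideal.add_mem _ (hk n (le_trans (le_max_left _ _) hn))
      (hl n (le_trans (le_max_right _ _) hn))
  | C_mul_T m y =>
    obtain ⟨k, hk⟩ := hf y
    refine ⟨k, fun l hl n => ?_⟩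
    rw [toSer_C_mul_T, Ser.coeff_mul_mono, map_sub, coeff_toSer_trunc l ha]
    split_ifs with h
    · simp
    · rw [sub_zero]
      exact hk _ (by omega)

variable {m : Type*} [Fintype m] [DecidableEq m]

theorem exists_matrix_bound {σ : ℤˣ} (X : Matrix m m (Ser σ A)) :
    ∃ a, ∀ i j, ∀ n < a, Ser.coeff n (X i j) = 0 := by
  have h : ∀ p ∈ (Finset.univ : Finset (m × m)), ∃ k, ∀ n ≥ k, ∀ n' < -n,
      Ser.coeff n' (X p.1 p.2) = 0 := fun p _ => by
    obtain ⟨a, ha⟩ := (X p.1 p.2).exists_bound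
    exact ⟨-a, fun n hn n' hn' => ha n' (by omega)⟩
  obtain ⟨k, hk⟩ := exists_uniform_bound Finset.univ h
  exact ⟨-k, fun i j n hn => hk (i, j) (by simp) k le_rfl n hn⟩

theorem trunc_commutator {X : Matrix m m (Ser (-1) A)} (hX : X ∈ (locFin J).matrix) {a : ℤ}
    (ha : ∀ i j, ∀ n < a, Ser.coeff n (X i j) = 0) {z z' : Matrix m m A[T;T⁻¹]}
    (h : (toSer (-1)).mapMatrix z * X = X * (toSer (-1)).mapMatrix z') :
    ∃ k₀, ∀ k ≥ k₀, ∀ i j, toSer (-1) ((z * X.map (trunc a k) - X.map (trunc a k) * z') i j) ∈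
      serIdeal J (-1) := by
  have b1 : ∀ p ∈ (Finset.univ : Finset (m × m)), ∃ k₀, ∀ k ≥ k₀,
      (X p.1 p.2 - toSer (-1) (trunc a k (X p.1 p.2))) * toSer (-1) 1 ∈ serIdeal J (-1) :=
    fun p _ => trunc_remainder J (hX _ _) (ha _ _) 1
  have b2 : ∀ p ∈ (Finset.univ : Finset (m × m × m)), ∃ k₀, ∀ k ≥ k₀,
      (X p.1 p.2.1 - toSer (-1) (trunc a k (X p.1 p.2.1))) * toSer (-1) (z' p.2.1 p.2.2) ∈
        serIdeal J (-1) :=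
    fun p _ => trunc_remainder J (hX _ _) (ha _ _) _
  obtain ⟨k1, h1⟩ := exists_uniform_bound _ b1
  obtain ⟨k2, h2⟩ := exists_uniform_bound _ b2
  refine ⟨max k1 k2, fun k hk i j => ?_⟩
  have e : (toSer (-1)).mapMatrix (z * X.map (trunc a k) - X.map (trunc a k) * z') =
      (X - (toSer (-1)).mapMatrix (X.map (trunc a k))) * (toSer (-1)).mapMatrix z' -
        (toSer (-1)).mapMatrix z * (X - (toSer (-1)).mapMatrix (X.map (trunc a k))) := by
    rw [map_sub, map_mul, map_mul, sub_mul, mul_sub, h]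
    abel
  have e' := congrFun (congrFun e i) j
  change toSer (-1) _ = _ at e'
  rw [e', Matrix.sub_apply, Matrix.mul_apply, Matrix.mul_apply]
  refine Ideal.sub_mem _ (Ideal.sum_mem _ fun l _ => ?_) (Ideal.sum_mem _ fun l _ => ?_)
  · exact h2 (i, l, j) (by simp) k (le_trans (le_max_right _ _) hk)
  · have := h1 (l, j) (by simp) k (le_trans (le_max_left _ _) hk)
    rw [map_one, mul_one] at this
    exact Ideal.mul_mem_left _ _ this

end Trunc

/-! ### Commutators modulo a left ideal -/

section CommutatorIdeal

open PowerSeries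

variable {A : Type*} [Ring A] (J : Ideal A)

/-- The left ideal of the series whose first coefficients are in a left ideal. -/
def outIdeal {B : Type*} [Ring B] (I : Ideal B) (r₀ : ℕ) : Ideal (PowerSeries B) where
  carrier := {F | ∀ r ≤ r₀, coeff r F ∈ I}
  zero_mem' r _ := by rw [map_zero]; exact I.zero_mem
  add_mem' {f g} hf hg r hr := by rw [map_add]; exact I.add_mem (hf r hr) (hg r hr)
  smul_mem' f g hg r hr := by
    rw [smul_eq_mul, coeff_mul]
    refine I.sum_mem fun p hp => I.mul_mem_left _ (hg _ ?_)
    rw [Finset.HasAntidiagonal.mem_antidiagonal] at hp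
    omega

/-- All entries of a matrix are in a left ideal. -/
def EntriesMem {D m : Type*} [Ring D] (I : Ideal D) (Z : Matrix m m D) : Prop := ∀ i j, Z i j ∈ I

theorem ideal_mul_matrix {D m : Type*} [Ring D] [Fintype m] [DecidableEq m] {I : Ideal D}
    {L Z R : Matrix m m D} (hZ : ∀ i j, Z i j ∈ I) (hR : R ∈ centralM m D) (i j : m) :
    (L * Z * R) i j ∈ I := by
  rw [Matrix.mul_apply]
  refine I.sum_mem fun k _ => ?_
  rw [((mem_centralM.1 hR k j) ((L * Z) i k)).symm.eq, Matrix.mul_apply]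
  exact I.mul_mem_left _ (I.sum_mem fun l _ => I.mul_mem_left _ (hZ _ _))

theorem coeff_mul_mapC {B m : Type*} [Ring B] [Fintype m] [DecidableEq m]
    (F : Matrix m m (PowerSeries B)) (Y : Matrix m m B) (r : ℕ) :
    (F * C.mapMatrix Y).map (coeff r) = F.map (coeff r) * Y := by
  ext i j
  simp [Matrix.mul_apply, coeff_mul_C]

theorem coeff_mapC_mul {B m : Type*} [Ring B] [Fintype m] [DecidableEq m]
    (F : Matrix m m (PowerSeries B)) (Y : Matrix m m B) (r : ℕ) :
    (C.mapMatrix Y * F).map (coeff r) = Y * F.map (coeff r) := by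
  ext i j
  simp [Matrix.mul_apply, coeff_C_mul]

theorem emb_map {D D' κ : Type*} [Ring D] [Ring D'] [DecidableEq κ] [Fintype κ] {N : ℕ}
    (f : D →+ D') (X : Matrix (κ → Fin N) (κ → Fin N) D) : emb (X.map f) = (emb X).map f := by
  refine matrix_ext_cons fun a b K L => ?_
  rw [Matrix.map_apply, emb_cons, emb_cons]
  split_ifs <;> simp

variable {K : Type*} [CommRing K] [Algebra Kh K] [Algebra K A] [Algebra Kh A]
  [IsScalarTower Kh K A] {M N : ℕ} {σ : ℤˣ}

/-- The map from series over Laurent polynomials to series over Laurent series. -/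
abbrev toSerOut (σ : ℤˣ) (A : Type*) [Ring A] : PowerSeries A[T;T⁻¹] →+* PowerSeries (Ser σ A) :=
  PowerSeries.map (toSer σ)

theorem scalarHom_toSerOut : ScalarHom (S := OS K) (S' := OS K) (toSerOut σ A) (RingHom.id _) where
  kh _ := rfl
  alg s := (mapOut (toSerAlg A σ K)).commutes s

theorem scalarHom_toSer : ScalarHom (S := K[T;T⁻¹]) (S' := K[T;T⁻¹])
    (toSer σ : A[T;T⁻¹] →+* Ser σ A) (RingHom.id _) where
  kh _ := rfl
  alg _ := rfl

theorem toSerOut_map_C (f : PowerSeries A) :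
    toSerOut σ A (PowerSeries.map LaurentPolynomial.C f) = outS σ A f := by
  ext r
  simp [outS, toSer_C]

theorem siteEmb_mem {D κ : Type*} [Ring D] [DecidableEq κ] [Fintype κ] (Λ : Subring D)
    {X : Matrix (κ → Fin N) (κ → Fin N) D} (hX : X ∈ Λ.matrix) : emb X ∈ Λ.matrix := by
  intro I J
  change (if _ then _ else _) ∈ _
  split_ifs
  · exact hX _ _
  · exact Λ.zero_mem

theorem emb_coeff_eq_zero {κ : Type*} [DecidableEq κ] [Fintype κ] {n : ℤ}
    {X : Matrix (κ → Fin N) (κ → Fin N) (Ser σ A)} (hX : ∀ I J, Ser.coeff n (X I J) = 0)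
    (I J : Option κ → Fin N) : Ser.coeff n (emb X I J) = 0 := by
  change Ser.coeff n (if I none = J none then X _ _ else 0) = 0
  split_ifs
  · exact hX _ _
  · exact map_zero _

theorem exchange_transfer {m : Type*} [Fintype m] [DecidableEq m] {X : Matrix m m (Ser (-1) A)}
    (hX : X ∈ (locFin J).matrix) {a : ℤ} (ha : ∀ i j, ∀ n < a, Ser.coeff n (X i j) = 0)
    {z z' : Matrix m m (PowerSeries A[T;T⁻¹])}
    (h : (toSerOut (-1) A).mapMatrix z * C.mapMatrix X =
      C.mapMatrix X * (toSerOut (-1) A).mapMatrix z') (r₀ : ℕ) :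
    ∃ k₀, ∀ k ≥ k₀, ∀ i j, (toSerOut 1 A).mapMatrix (z * C.mapMatrix (X.map (trunc a k)) -
      C.mapMatrix (X.map (trunc a k)) * z') i j ∈ outIdeal (serIdeal J 1) r₀ := by
  have hcoef : ∀ r ∈ Finset.range (r₀ + 1), ∃ k₀, ∀ k ≥ k₀, ∀ i j, toSer (-1)
      ((z.map (coeff r) * X.map (trunc a k) - X.map (trunc a k) * z'.map (coeff r)) i j) ∈
        serIdeal J (-1) := by
    intro r _
    refine trunc_commutator J hX ha ?_
    have := congrArg (fun Z => Z.map (coeff r)) h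
    simp only [coeff_mul_mapC, coeff_mapC_mul] at this
    have e : ∀ F : Matrix m m (PowerSeries A[T;T⁻¹]),
        ((toSerOut (-1) A).mapMatrix F).map (coeff r) =
          (toSer (-1)).mapMatrix (F.map (coeff r)) := fun F => by
      ext I J' : 1
      exact PowerSeries.coeff_map (toSer (-1)) r (F I J')
    rw [e, e] at this
    exact this
  obtain ⟨k₀, hk₀⟩ := exists_uniform_bound _ hcoef
  refine ⟨k₀, fun k hk i j r hr => ?_⟩
  rw [RingHom.mapMatrix_apply, Matrix.map_apply, coeff_map]
  refine toSer_mem_serIdeal J (-1) 1 ?_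
  have := hk₀ r (Finset.mem_range.2 (by omega)) k hk i j
  rw [← coeff_mul_mapC, ← coeff_mapC_mul] at this
  rw [Matrix.sub_apply, map_sub]
  exact this

variable {ν : YoungDiagram} (U : StandardTableau ν)

theorem youngE_toSer_trunc {X : Matrix (Fin ν.card → Fin N) (Fin ν.card → Fin N) (Ser (-1) A)}
    (h : youngE N K[T;T⁻¹] (Ser (-1) A) U * X *
      youngE N K[T;T⁻¹] (Ser (-1) A) U =
        youngE N K[T;T⁻¹] (Ser (-1) A) U * X) (a k : ℤ) :
    youngE N K[T;T⁻¹] (Ser σ A) U * (toSer σ).mapMatrix (X.map (trunc a k)) *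
      youngE N K[T;T⁻¹] (Ser σ A) U =
        youngE N K[T;T⁻¹] (Ser σ A) U * (toSer σ).mapMatrix (X.map (trunc a k)) := by
  have e : ∀ I J, ∃ b : A, youngE N K[T;T⁻¹] (Ser (-1) A) U I J = Ser.C b ∧
      youngE N K[T;T⁻¹] A[T;T⁻¹] U I J = LaurentPolynomial.C b := by
    intro I J
    refine ⟨algebraMap Kh A (C (permAction N U.idempotent I J)), algebraMap_Ser_Kh _, ?_⟩
    change algebraMap K[T;T⁻¹] A[T;T⁻¹]
      (algebraMap Kh K[T;T⁻¹] _) = _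
    rw [algebraMap_Lau_Kh, algebraMap_Lau, mapLau_C, ← IsScalarTower.algebraMap_apply]
  choose b hb hb' using e
  have e1 : ∀ Z : Matrix (Fin ν.card → Fin N) (Fin ν.card → Fin N) (Ser (-1) A),
      (youngE N K[T;T⁻¹] (Ser (-1) A) U * Z).map (trunc a k) =
        youngE N K[T;T⁻¹] A[T;T⁻¹] U * Z.map (trunc a k) := by
    intro Z
    ext I J : 1
    simp only [Matrix.map_apply, Matrix.mul_apply, map_sum, hb, hb', trunc_C_mul]
  have e2 : ∀ Z : Matrix (Fin ν.card → Fin N) (Fin ν.card → Fin N) (Ser (-1) A),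
      (Z * youngE N K[T;T⁻¹] (Ser (-1) A) U).map (trunc a k) =
        Z.map (trunc a k) * youngE N K[T;T⁻¹] A[T;T⁻¹] U := by
    intro Z
    ext I J : 1
    simp only [Matrix.map_apply, Matrix.mul_apply, map_sum, hb, hb', trunc_mul_C]
  have h' := congrArg (fun Z => (toSer σ).mapMatrix (Z.map (trunc a k))) h
  simp only [e1, e2, map_mul] at h'
  rw [scalarHom_toSer.youngE] at h'
  exact h'

theorem absorb_mul {R : Type*} [Semigroup R] {e p t : R} (hp : e * p * e = e * p)
    (ht : e * t * e = e * t) : e * (p * t) * e = e * (p * t) := by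
  calc e * (p * t) * e = e * p * t * e := by rw [← mul_assoc]
    _ = e * p * e * t * e := by rw [hp]
    _ = e * p * (e * t * e) := by simp only [mul_assoc]
    _ = e * p * e * t := by rw [ht, mul_assoc (e * p)]
    _ = e * (p * t) := by rw [hp, mul_assoc]

theorem commutator_mem_of_exchange (hN : N ≠ 0)
    {P t : Matrix (Fin ν.card → Fin N) (Fin ν.card → Fin N) (Ser 1 A)}
    (hP : youngE N K[T;T⁻¹] (Ser 1 A) U * P *
      youngE N K[T;T⁻¹] (Ser 1 A) U = youngE N K[T;T⁻¹] (Ser 1 A) U * P)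
    (ht : youngE N K[T;T⁻¹] (Ser 1 A) U * t *
      youngE N K[T;T⁻¹] (Ser 1 A) U = youngE N K[T;T⁻¹] (Ser 1 A) U * t)
    {S₀ : Matrix (Fin N) (Fin N) (PowerSeries A)} {x x' y y' : Fin ν.card → OS K}
    {x₀ x₀' y₀ y₀' : OS K}
    (hx : ∀ i, x i ^ M = 0) (hx' : ∀ i, x' i ^ M = 0) (hy : ∀ i, y i ^ M = 0)
    (hy' : ∀ i, y' i ^ M = 0)
    (hx₀ : x₀ ^ M = 0) (hx₀' : x₀' ^ M = 0) (hy₀ : y₀ ^ M = 0) (hy₀' : y₀' ^ M = 0)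
    (fx : ∀ i, x i * (1 - cst (OS K) (U.content i : ℂ) * x₀) = x₀)
    (fx' : ∀ i, x' i * (1 - cst (OS K) (U.content i : ℂ) * x₀') = x₀')
    (fy : ∀ i, y i * (1 - cst (OS K) (U.content i : ℂ) * y₀) = y₀)
    (fy' : ∀ i, y' i * (1 - cst (OS K) (U.content i : ℂ) * y₀') = y₀')
    (hxx : ∀ i, x' i * (1 + N * x i) = x i) (hyy : ∀ i, y' i * (1 + N * y i) = y i) {r₀ : ℕ}
    (hmem : EntriesMem (outIdeal (serIdeal J 1) r₀) (((List.finRange ν.card).map fun i => Rb N M (PowerSeries (Ser 1 A)) none (some i) (x i)).reverse.prod *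
        siteM none (S₀.map (outS 1 A)) *
        ((List.finRange ν.card).map fun i => Rbt N M (PowerSeries (Ser 1 A)) none (some i) (y i)).prod *
        emb (C.mapMatrix (P * t)) -
      emb (C.mapMatrix (P * t)) *
        ((List.finRange ν.card).map fun i => Rb N M (PowerSeries (Ser 1 A)) none (some i) (x' i)).reverse.prod *
        siteM none (S₀.map (outS 1 A)) *
        ((List.finRange ν.card).map fun i => Rbt N M (PowerSeries (Ser 1 A)) none (some i) (y' i)).prod)) {r : ℕ} (hr : r ≤ r₀) (i j : Fin N) (n : ℤ) :
    coeff r (S₀ i j) *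
        Ser.coeff n (Matrix.trace (youngE N K[T;T⁻¹] (Ser 1 A) U * (P * t))) -
      Ser.coeff n (Matrix.trace (youngE N K[T;T⁻¹] (Ser 1 A) U * (P * t))) *
        coeff r (S₀ i j) ∈ J := by
  have hX₀ : youngE N (OS K) (PowerSeries (Ser 1 A)) U * C.mapMatrix (P * t) *
      youngE N (OS K) (PowerSeries (Ser 1 A)) U =
      youngE N (OS K) (PowerSeries (Ser 1 A)) U * C.mapMatrix (P * t) := by
    rw [← scalarHom_C.youngE, ← map_mul, ← map_mul, absorb_mul hP ht]
  obtain ⟨L, -, R, hRc, h⟩ := trace_commutator U hN hX₀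
    hx hx' hy hy' hx₀ hx₀' hy₀ hy₀' fx fx' fy fy' hxx hyy (S₀.map (outS 1 A))
  have hfin : (S₀.map (outS 1 A)) i j * Matrix.trace (youngE N (OS K) (PowerSeries (Ser 1 A)) U *
      C.mapMatrix (P * t)) - Matrix.trace (youngE N (OS K) (PowerSeries (Ser 1 A)) U *
      C.mapMatrix (P * t)) * (S₀.map (outS 1 A)) i j ∈ outIdeal (serIdeal J 1) r₀ := by
    rw [h i j]
    exact Ideal.sum_mem _ fun I _ => ideal_mul_matrix hmem hRc _ _
  have etr : Matrix.trace (youngE N (OS K) (PowerSeries (Ser 1 A)) U * C.mapMatrix (P * t)) =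
      C (Matrix.trace (youngE N K[T;T⁻¹] (Ser 1 A) U * (P * t))) := by
    rw [← scalarHom_C.youngE, ← map_mul]
    exact (map_sum C _ _).symm
  have := hfin r hr n
  rw [etr, map_sub, coeff_mul_C, coeff_C_mul, Matrix.map_apply, outS, coeff_map, map_sub,
    Ser.coeff_C_mul, Ser.coeff_mul_C] at this
  exact this

theorem conj_of_inverse {R : Type*} [Monoid R] {q x z z' : R} (h1 : q * x = 1) (h2 : x * q = 1)
    (h : z' * q = q * z) : z * x = x * z' := by
  calc z * x = x * (q * z) * x := by rw [← mul_assoc x, h2, one_mul]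
    _ = x * z' := by rw [← h, mul_assoc, mul_assoc, h1, mul_one]

theorem exists_exchange_mem {P : Matrix (Fin ν.card → Fin N) (Fin ν.card → Fin N) (Ser 1 A)}
    {Q X : Matrix (Fin ν.card → Fin N) (Fin ν.card → Fin N) (Ser (-1) A)}
    (hQX : Q * X = 1) (hXQ : X * Q = 1)
    (hXJ : X ∈ (locFin J).matrix) {a : ℤ} (ha : ∀ i j, ∀ n < a, Ser.coeff n (X i j) = 0)
    {S₀ : Matrix (Fin N) (Fin N) (PowerSeries A)} {x x' y y' z w : Fin ν.card → OS K}
    (hL : ((List.finRange ν.card).map fun i => Rb N M (PowerSeries (Ser 1 A)) none (some i) (x i)).reverse.prod *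
        siteM none (S₀.map (outS 1 A)) *
        ((List.finRange ν.card).map fun i => Rbt N M (PowerSeries (Ser 1 A)) none (some i) (y i)).prod *
        emb (C.mapMatrix P) =
      emb (C.mapMatrix P) *
        ((List.finRange ν.card).map fun i => Rbt N M (PowerSeries (Ser 1 A)) none (some i) (z i)).prod *
        siteM none (S₀.map (outS 1 A)) *
        ((List.finRange ν.card).map fun i => Rb N M (PowerSeries (Ser 1 A)) none (some i) (w i)).reverse.prod)
    (hR : ((List.finRange ν.card).map fun i => Rb N M (PowerSeries (Ser (-1) A)) none (some i) (x' i)).reverse.prod *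
        siteM none (S₀.map (outS (-1) A)) *
        ((List.finRange ν.card).map fun i => Rbt N M (PowerSeries (Ser (-1) A)) none (some i) (y' i)).prod *
        emb (C.mapMatrix Q) =
      emb (C.mapMatrix Q) *
        ((List.finRange ν.card).map fun i => Rbt N M (PowerSeries (Ser (-1) A)) none (some i) (z i)).prod *
        siteM none (S₀.map (outS (-1) A)) *
        ((List.finRange ν.card).map fun i => Rb N M (PowerSeries (Ser (-1) A)) none (some i) (w i)).reverse.prod)
    (r₀ : ℕ) : ∃ k₀, ∀ k ≥ k₀, EntriesMem (outIdeal (serIdeal J 1) r₀)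
      (((List.finRange ν.card).map fun i => Rb N M (PowerSeries (Ser 1 A)) none (some i) (x i)).reverse.prod *
        siteM none (S₀.map (outS 1 A)) *
        ((List.finRange ν.card).map fun i => Rbt N M (PowerSeries (Ser 1 A)) none (some i) (y i)).prod *
        emb (C.mapMatrix (P * (toSer 1).mapMatrix (X.map (trunc a k)))) -
      emb (C.mapMatrix (P * (toSer 1).mapMatrix (X.map (trunc a k)))) *
        ((List.finRange ν.card).map fun i => Rb N M (PowerSeries (Ser 1 A)) none (some i) (x' i)).reverse.prod *
        siteM none (S₀.map (outS 1 A)) *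
        ((List.finRange ν.card).map fun i => Rbt N M (PowerSeries (Ser 1 A)) none (some i) (y' i)).prod) := by
  obtain ⟨zC, hzC⟩ : ∃ zC, zC = ((List.finRange ν.card).map fun i =>
      Rbt N M (PowerSeries A[T;T⁻¹]) none (some i) (z i)).prod *
      siteM none (S₀.map (PowerSeries.map LaurentPolynomial.C)) *
      ((List.finRange ν.card).map fun i => Rb N M (PowerSeries A[T;T⁻¹]) none (some i) (w i)).reverse.prod := ⟨_, rfl⟩
  obtain ⟨zC', hzC'⟩ : ∃ zC', zC' = ((List.finRange ν.card).map fun i =>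
      Rb N M (PowerSeries A[T;T⁻¹]) none (some i) (x' i)).reverse.prod *
      siteM none (S₀.map (PowerSeries.map LaurentPolynomial.C)) *
      ((List.finRange ν.card).map fun i => Rbt N M (PowerSeries A[T;T⁻¹]) none (some i) (y' i)).prod := ⟨_, rfl⟩
  have eS : ∀ σ : ℤˣ, (toSerOut σ A).mapMatrix (S₀.map (PowerSeries.map LaurentPolynomial.C)) =
      S₀.map (outS σ A) := by
    intro σ
    ext i j : 1
    exact toSerOut_map_C _
  have ez : ∀ σ : ℤˣ, (toSerOut σ A).mapMatrix zC =
      ((List.finRange ν.card).map fun i => Rbt N M (PowerSeries (Ser σ A)) none (some i) (z i)).prod *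
      siteM none (S₀.map (outS σ A)) *
      ((List.finRange ν.card).map fun i => Rb N M (PowerSeries (Ser σ A)) none (some i) (w i)).reverse.prod := by
    intro σ
    rw [hzC, map_mul, map_mul, map_list_prod, map_list_prod, mapMatrix_siteM, eS, List.map_reverse,
      List.map_map, List.map_map]
    simp only [Function.comp_def, scalarHom_toSerOut.Rbt, scalarHom_toSerOut.Rb, RingHom.id_apply]
  have ez' : ∀ σ : ℤˣ, (toSerOut σ A).mapMatrix zC' =
      ((List.finRange ν.card).map fun i => Rb N M (PowerSeries (Ser σ A)) none (some i) (x' i)).reverse.prod *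
      siteM none (S₀.map (outS σ A)) *
      ((List.finRange ν.card).map fun i => Rbt N M (PowerSeries (Ser σ A)) none (some i) (y' i)).prod := by
    intro σ
    rw [hzC', map_mul, map_mul, map_list_prod, map_list_prod, mapMatrix_siteM, eS, List.map_reverse,
      List.map_map, List.map_map]
    simp only [Function.comp_def, scalarHom_toSerOut.Rbt, scalarHom_toSerOut.Rb, RingHom.id_apply]
  clear hzC hzC'
  rw [← ez', mul_assoc (emb _), mul_assoc (emb _), ← ez] at hR
  rw [mul_assoc (emb _), mul_assoc (emb _), ← ez] at hL
  have hR' : (toSerOut (-1) A).mapMatrix zC * C.mapMatrix (emb X) =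
      C.mapMatrix (emb X) * (toSerOut (-1) A).mapMatrix zC' := by
    rw [mapMatrix_emb]
    refine conj_of_inverse (q := emb (C.mapMatrix Q)) ?_ ?_ hR
    · rw [← map_mul, ← map_mul, hQX, map_one, map_one]
    · rw [← map_mul, ← map_mul, hXQ, map_one, map_one]
  obtain ⟨k₀, hk₀⟩ := exchange_transfer J (X := emb X) (siteEmb_mem _ hXJ) (a := a)
    (fun I J' n hn => emb_coeff_eq_zero (fun I J => ha I J n hn) I J') hR' r₀
  refine ⟨k₀, fun k hk => ?_⟩
  obtain ⟨t, ht⟩ : ∃ t, t = X.map (trunc a k) := ⟨_, rfl⟩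
  have hk := hk₀ k hk
  rw [← emb_map] at hk
  rw [← ht] at hk ⊢
  have et : (toSerOut 1 A).mapMatrix (C.mapMatrix (emb t)) =
      emb (C.mapMatrix ((toSer 1).mapMatrix t)) := by
    rw [← mapMatrix_emb, ← mapMatrix_emb (toSer 1)]
    ext I J' : 1
    exact PowerSeries.map_C (toSer 1) _
  rw [map_mul, map_mul, ← mul_assoc, hL, mul_assoc (emb _ * emb _), mul_assoc (emb _ * emb _), ← ez', ← et]
  intro I J'
  have := ideal_mul_matrix (L := emb (C.mapMatrix P)) hk (Subring.one_mem (centralM _ _)) I J'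
  rw [mul_one, map_sub, map_mul, map_mul, mul_sub, ← mul_assoc, ← mul_assoc] at this
  exact this

end CommutatorIdeal

/-! ### Commutators at the critical level -/

section Critical

open PowerSeries

variable {K A : Type*} [CommRing K] [Algebra Kh K] [Ring A] [Algebra K A] [Algebra Kh A]
  [IsScalarTower Kh K A] {M N : ℕ} {σ : ℤˣ}
  (hM : algebraMap Kh K hbar ^ M = 0) (hM0 : M ≠ 0) {c : ℂ}
  {G : Matrix (Fin N) (Fin N) ℂ} {ν : YoungDiagram} (U : StandardTableau ν) {J : Ideal A}

theorem scalarHom_outS : ScalarHom (outS σ A) ((cS K).comp LaurentPolynomial.C) where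
  kh z := by
    rw [RingHom.comp_apply, ← algebraMap_Lau_Kh, cS, PowerSeries.algebraMap_apply]
  alg s := by
    have := outS_map_algebraMap (σ := σ) (A := A) (C s)
    rw [PowerSeries.map_C, PowerSeries.map_C] at this
    rw [PowerSeries.algebraMap_apply]
    exact this

/-- The matrix `S⁺`, as a matrix of power series. -/
def sPser (G : Matrix (Fin N) (Fin N) ℂ) (x : Gen N → A) : Matrix (Fin N) (Fin N) (PowerSeries A) :=
  sP K G x (evP A hM 1 0) (evP A hM (-1) 0)

variable (K) in
/-- The matrix `S`, as a matrix of power series. -/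
def sTser (G : Matrix (Fin N) (Fin N) ℂ) (c : ℂ) (x : Gen N → A) :
    Matrix (Fin N) (Fin N) (PowerSeries A) :=
  sT K G x (evT K A hM0 1 c) (evT K A hM0 (-1) 0)

theorem sPser_map (x : Gen N → A) : (sPser hM G x).map (outS σ A) = sPout σ hM G x :=
  scalarHom_outS.sP G x _ _

theorem sTser_map (x : Gen N → A) : (sTser K hM0 G c x).map (outS σ A) = sTout K σ hM0 G c x :=
  scalarHom_outS.sT G x _ _

variable {x : Gen N → A}

include hM in
theorem commutator_mem_of_points (hN : N ≠ 0) {b : Bool} {α β : ℂ}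
    {P : Matrix (Fin ν.card → Fin N) (Fin ν.card → Fin N) (Ser 1 A)}
    {Q X : Matrix (Fin ν.card → Fin N) (Fin ν.card → Fin N) (Ser (-1) A)}
    (hP : youngE N K[T;T⁻¹] (Ser 1 A) U * P *
      youngE N K[T;T⁻¹] (Ser 1 A) U = youngE N K[T;T⁻¹] (Ser 1 A) U * P)
    (hX : youngE N K[T;T⁻¹] (Ser (-1) A) U * X *
      youngE N K[T;T⁻¹] (Ser (-1) A) U =
        youngE N K[T;T⁻¹] (Ser (-1) A) U * X)
    (hQX : Q * X = 1) (hXQ : X * Q = 1)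
    (hXJ : X ∈ (locFin J).matrix) {a : ℤ} (ha : ∀ i j, ∀ n < a, Ser.coeff n (X i j) = 0)
    {S₀ : Matrix (Fin N) (Fin N) (PowerSeries A)} {x x' y y' z w : Fin ν.card → OS K}
    (ex : ∀ i, x i = pv K b 1 (-1) (α - U.content i))
    (ex' : ∀ i, x' i = pv K b 1 (-1) (α + N - U.content i))
    (ey : ∀ i, y i = pv K b (-1) (-1) (β - U.content i))
    (ey' : ∀ i, y' i = pv K b (-1) (-1) (β + N - U.content i))
    (hL : ((List.finRange ν.card).map fun i => Rb N M (PowerSeries (Ser 1 A)) none (some i) (x i)).reverse.prod *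
        siteM none (S₀.map (outS 1 A)) *
        ((List.finRange ν.card).map fun i => Rbt N M (PowerSeries (Ser 1 A)) none (some i) (y i)).prod *
        emb (C.mapMatrix P) =
      emb (C.mapMatrix P) *
        ((List.finRange ν.card).map fun i => Rbt N M (PowerSeries (Ser 1 A)) none (some i) (z i)).prod *
        siteM none (S₀.map (outS 1 A)) *
        ((List.finRange ν.card).map fun i => Rb N M (PowerSeries (Ser 1 A)) none (some i) (w i)).reverse.prod)
    (hR : ((List.finRange ν.card).map fun i => Rb N M (PowerSeries (Ser (-1) A)) none (some i) (x' i)).reverse.prod *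
        siteM none (S₀.map (outS (-1) A)) *
        ((List.finRange ν.card).map fun i => Rbt N M (PowerSeries (Ser (-1) A)) none (some i) (y' i)).prod *
        emb (C.mapMatrix Q) =
      emb (C.mapMatrix Q) *
        ((List.finRange ν.card).map fun i => Rbt N M (PowerSeries (Ser (-1) A)) none (some i) (z i)).prod *
        siteM none (S₀.map (outS (-1) A)) *
        ((List.finRange ν.card).map fun i => Rb N M (PowerSeries (Ser (-1) A)) none (some i) (w i)).reverse.prod)
    (r₀ : ℕ) : ∃ k₀ : ℤ, ∀ k ≥ k₀, ∀ τ, τ = Matrix.trace (youngE N K[T;T⁻¹] (Ser 1 A) U *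
        (P * (toSer 1).mapMatrix (X.map (trunc a k)))) →
      ∀ r ≤ r₀, ∀ i j n, coeff r (S₀ i j) * Ser.coeff n τ - Ser.coeff n τ * coeff r (S₀ i j) ∈ J := by
  obtain ⟨k₀, hk₀⟩ := exists_exchange_mem J hQX hXQ hXJ ha hL hR r₀
  refine ⟨k₀, fun k hk τ hτ r hr i j n => ?_⟩
  rw [hτ]
  have e : ∀ γ δ : ℂ, γ + N - δ = γ - δ + N := fun γ δ => by ring
  exact commutator_mem_of_exchange J U hN hP (youngE_toSer_trunc U hX a k)
    (x₀ := pv K b 1 (-1) α) (x₀' := pv K b 1 (-1) (α + N)) (y₀ := pv K b (-1) (-1) β)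
    (y₀' := pv K b (-1) (-1) (β + N))
    (fun i => by rw [ex, pv_pow hM]) (fun i => by rw [ex', pv_pow hM])
    (fun i => by rw [ey, pv_pow hM]) (fun i => by rw [ey', pv_pow hM])
    (pv_pow hM _ _ _ _) (pv_pow hM _ _ _ _) (pv_pow hM _ _ _ _) (pv_pow hM _ _ _ _)
    (fun i => by rw [ex, pv_fusion hM]) (fun i => by rw [ex', pv_fusion hM])
    (fun i => by rw [ey, pv_fusion hM]) (fun i => by rw [ey', pv_fusion hM])
    (fun i => by rw [ex, ex', e, pv_crossing hM]) (fun i => by rw [ey, ey', e, pv_crossing hM])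
    (hk₀ k hk) hr i j n

/-- The trace of the product of `S⁺_{[n]}` and of a truncation of the inverse of `S_{[n]}` commutes
with the coefficients of `S` and `S⁺` modulo a left ideal. -/
theorem exists_trunc_commutator (hN : N ≠ 0) (hx : IsRep (crit N) x) (hG : Gᵀ = G ∨ Gᵀ = -G)
    {X : Matrix (Fin ν.card → Fin N) (Fin ν.card → Fin N) (Ser (-1) A)}
    (hQX : bracketT K hM0 G (crit N) x (fun i => (U.content i : ℂ)) (List.finRange ν.card) * X = 1)
    (hXQ : X * bracketT K hM0 G (crit N) x (fun i => (U.content i : ℂ)) (List.finRange ν.card) = 1)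
    (hX : youngE N K[T;T⁻¹] (Ser (-1) A) U * X *
      youngE N K[T;T⁻¹] (Ser (-1) A) U =
        youngE N K[T;T⁻¹] (Ser (-1) A) U * X)
    (hXJ : X ∈ (locFin J).matrix) (r₀ : ℕ) :
    ∃ t : Matrix (Fin ν.card → Fin N) (Fin ν.card → Fin N) A[T;T⁻¹],
      (∀ i j, X i j - toSer (-1) (t i j) ∈ serIdeal J (-1)) ∧
      ∀ τ, τ = Matrix.trace (youngE N K[T;T⁻¹] (Ser 1 A) U *
          (bracketP hM G x (fun i => (U.content i : ℂ)) (List.finRange ν.card) *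
            (toSer 1).mapMatrix t)) →
        ∀ r ≤ r₀, ∀ i j n,
          coeff r (sPser hM G x i j) * Ser.coeff n τ -
            Ser.coeff n τ * coeff r (sPser hM G x i j) ∈ J ∧
          coeff r (sTser K hM0 G (crit N) x i j) * Ser.coeff n τ -
            Ser.coeff n τ * coeff r (sTser K hM0 G (crit N) x i j) ∈ J := by
  obtain ⟨a, ha⟩ := exists_matrix_bound X
  have hP := bracketP_absorb hM hx hG U
  have hnd := List.nodup_finRange ν.card
  have L1 := exchange_TP hM hM0 hN hx hG (fun i => (U.content i : ℂ)) hnd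
  have R1 := exchange_TT hM hM0 hN hx hG (fun i => (U.content i : ℂ)) hnd
  have L2 := exchange_PP hM hN hx hG (fun i => (U.content i : ℂ)) hnd
  have R2 := exchange_PT hM hM0 hN hx hG (fun i => (U.content i : ℂ)) hnd
  rw [← sTser_map] at L1 R1
  rw [← sPser_map] at L2 R2
  obtain ⟨k1, h1⟩ := commutator_mem_of_points hM U hN (b := true) (α := 3 * crit N / 2)
    (β := crit N / 2) hP hX hQX hXQ hXJ ha (fun _ => rfl)
    (fun i => pv_eq (by rw [crit]; ring)) (fun _ => rfl) (fun i => pv_eq (by rw [crit]; ring)) L1 R1 r₀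
  obtain ⟨k2, h2⟩ := commutator_mem_of_points hM U hN (b := false) (α := 0)
    (β := 0) hP hX hQX hXQ hXJ ha (fun _ => pv_eq (by ring))
    (fun i => pv_eq (by rw [crit]; ring)) (fun _ => pv_eq (by ring))
    (fun i => pv_eq (by rw [crit]; ring)) L2 R2 r₀
  obtain ⟨k3, h3⟩ := exists_uniform_bound (Finset.univ : Finset (_ × _)) (p := fun q k =>
    (X q.1 q.2 - toSer (-1) (trunc a k (X q.1 q.2))) * toSer (-1) 1 ∈ serIdeal J (-1))
    fun q _ => trunc_remainder J (hXJ q.1 q.2) (ha _ _) 1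
  refine ⟨X.map (trunc a (max k1 (max k2 k3))), fun i j => ?_, fun τ hτ r hr i j n => ⟨?_, ?_⟩⟩
  · have := h3 (i, j) (by simp) (max k1 (max k2 k3)) (by simp)
    rw [map_one, mul_one] at this
    exact this
  · exact h2 _ (by simp) τ hτ r hr i j n
  · exact h1 _ (by simp) τ hτ r hr i j n

end Critical

/-! ### Compositions of substitutions -/

section Comp

open PowerSeries

variable {K A : Type*} [CommRing K] [Algebra Kh K] [Ring A] [Algebra K A] [Algebra Kh A]
  [IsScalarTower Kh K A] {M : ℕ}

theorem constantCoeff_qT_one (ε : ℤˣ) (a : ℂ) : constantCoeff (qT K ε a) ^ 1 = 0 :=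
  constantCoeff_qT one_ne_zero ε a

theorem evT_eq (hM0 : M ≠ 0) (ε : ℤˣ) (a : ℂ) :
    evT K A hM0 ε a = subsHom A 1 (qT K ε a) (constantCoeff_qT_one ε a) := by
  ext f m
  rw [evT, coeff_subsHom _ _ le_rfl, coeff_subsHom _ _ (n := m + M) (by omega)]

theorem subsHom_qT (a b d : ℂ) (ε : ℤˣ) (hd : d = b + ((ε : ℤ) : ℂ) * a) :
    subsHom K 1 (qT K 1 a) (constantCoeff_qT_one 1 a) (qT K ε b) = qT K ε d := by
  have hu : IsUnit (((ε : ℤ) : PowerSeries K) + C (algebraMap Kh K (hmul d)) * X) := by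
    rw [isUnit_iff_constantCoeff]
    simpa using isUnit_intUnit K ε
  rw [← hu.mul_left_inj, qT_mul]
  have h1 := qT_mul K 1 a
  have h2 := congrArg (subsHom K 1 (qT K 1 a) (constantCoeff_qT_one 1 a)) (qT_mul K ε b)
  rw [map_mul (subsHom K 1 _ _), map_add, map_intCast, map_mul (subsHom K 1 _ _), subsHom_C,
    subsHom_X, Algebra.algebraMap_self, PowerSeries.map_id, id_eq] at h2
  have h3 : C (algebraMap Kh K (hmul d)) = C (algebraMap Kh K (hmul b)) +
      ((ε : ℤ) : PowerSeries K) * C (algebraMap Kh K (hmul a)) := by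
    rw [hd, hmul_eq, hmul_eq, hmul_eq, map_add, map_mul (cst K), map_intCast]
    simp only [map_mul, map_add, map_intCast]
    ring
  rw [h3]
  generalize subsHom K 1 (qT K 1 a) (constantCoeff_qT_one 1 a) (qT K ε b) = y at h2 ⊢
  generalize qT K 1 a = q at h1 h2
  simp only [Units.val_one, Int.cast_one] at h1
  linear_combination h1 + (1 + C (algebraMap Kh K (hmul a)) * X) * h2 -
    y * C (algebraMap Kh K (hmul b)) * h1

theorem evT_comp_evT (hM0 : M ≠ 0) (ε : ℤˣ) {a b d : ℂ} (hd : d = b + ((ε : ℤ) : ℂ) * a) :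
    (evT K A hM0 1 a).comp (evT K A hM0 ε b) = evT K A hM0 ε d := by
  ext f : 1
  have h := subsHom_qT (K := K) a b d ε hd
  rw [RingHom.comp_apply, evT_eq, evT_eq, evT_eq, subsHom_subsHom _ _
    (by rw [h]; exact constantCoeff_qT_one ε d)]
  congr 2

theorem evP_zero (hM : algebraMap Kh K hbar ^ M = 0) (ε : ℤˣ) (f : PowerSeries A) :
    evP A hM ε 0 f = PowerSeries.mk fun m => (((ε : ℤ) : K) ^ m) • coeff m f := by
  ext m
  rw [coeff_evP, coeff_mk]
  rcases M with _ | M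
  · have : (1 : K) = 0 := by simpa using hM
    have h1 : ∀ y : A, y = 0 := fun y => by rw [← one_smul K y, this, zero_smul]
    rw [h1 (_ • _), Finset.range_zero, Finset.sum_empty]
  · rw [Finset.sum_eq_single 0]
    · simp
    · intro l _ hl
      rw [map_zero, zero_pow hl, zero_smul]
    · simp

theorem evP_comp_evP_zero (hM : algebraMap Kh K hbar ^ M = 0) (ε : ℤˣ) {a b : ℂ}
    (hb : b = ((ε : ℤ) : ℂ) * a) :
    (evP A hM 1 a).comp (evP A hM ε 0) = evP A hM ε b := by
  ext f m
  rw [RingHom.comp_apply, evP_zero, coeff_evP, coeff_evP]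
  refine Finset.sum_congr rfl fun l _ => ?_
  rw [coeff_mk, hb, map_mul, map_intCast]
  simp only [smul_smul]
  congr 1
  simp only [Units.val_one, Int.cast_one, one_pow, one_mul, mul_pow, pow_add]
  ring

end Comp

/-! ### Reduction of series with matrix coefficients -/

section Reduction

open PowerSeries

variable {D A m : Type*} [Ring D] [Algebra Kh D] [Ring A] [Algebra Kh A] [Fintype m] [DecidableEq m]
  {σ : ℤˣ}

/-- A homomorphism applied to a series with matrix coefficients. -/
def psHom (φ : D →ₐ[Kh] A) : PowerSeries (Matrix m m D) →+* Matrix m m (PowerSeries A) :=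
  (PowerSeries.map (φ : D →+* A)).mapMatrix.comp psMat

theorem coeff_psHom (φ : D →ₐ[Kh] A) (F : PowerSeries (Matrix m m D)) (i j : m) (r : ℕ) :
    coeff r (psHom φ F i j) = φ (coeff r F i j) := by
  rw [psHom, RingHom.comp_apply, RingHom.mapMatrix_apply, Matrix.map_apply, coeff_map, coeff_psMat]
  rfl

/-- A Laurent series with matrix coefficients as a matrix of Laurent series, as a map. -/
def serHomFun (φ : D →ₐ[Kh] A) (F : Ser σ (Matrix m m D)) : Matrix m m (Ser σ A) :=
  Matrix.of fun i j => HahnSeries.map (Γ := ℤ) F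
    ((φ : D →+* A).toAddMonoidHom.comp (Matrix.entryAddMonoidHom D i j))

theorem coeff_serHomFun (φ : D →ₐ[Kh] A) (F : Ser σ (Matrix m m D)) (i j : m) (n : ℤ) :
    Ser.coeff n (serHomFun φ F i j) = φ (Ser.coeff n F i j) := rfl

/-- A homomorphism applied to a Laurent series with matrix coefficients. -/
def serHom (φ : D →ₐ[Kh] A) : Ser σ (Matrix m m D) →+* Matrix m m (Ser σ A) where
  toFun := serHomFun φ
  map_zero' := by
    ext i j n
    rw [coeff_serHomFun]
    simp
  map_one' := by
    ext i j n
    rw [coeff_serHomFun, ← map_one Ser.C, Ser.coeff_C, Matrix.one_apply]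
    by_cases h : i = j
    · rw [if_pos h, ← map_one Ser.C, Ser.coeff_C]
      split_ifs
      · exact (congrArg φ (by rw [h, Matrix.one_apply_eq])).trans (map_one φ)
      · exact map_zero φ
    · rw [if_neg h, map_zero]
      split_ifs
      · exact (congrArg φ (Matrix.one_apply_ne h)).trans (map_zero φ)
      · exact map_zero φ
  map_add' F H := by
    ext i j n
    rw [Matrix.add_apply, map_add, coeff_serHomFun, coeff_serHomFun, coeff_serHomFun, map_add,
      Matrix.add_apply, map_add]
  map_mul' F H := by
    ext i j n
    obtain ⟨a, ha⟩ := F.exists_bound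
    obtain ⟨b, hb⟩ := H.exists_bound
    rw [Matrix.mul_apply, coeff_serHomFun, Ser.coeff_mul ha hb, map_sum, Matrix.sum_apply, map_sum]
    have e : ∀ l, Ser.coeff n (serHomFun φ F i l * serHomFun φ H l j) =
        ∑ s ∈ Finset.Icc a (n - b), φ (Ser.coeff s F i l) * φ (Ser.coeff (n - s) H l j) := fun l => by
      rw [Ser.coeff_mul (a := a) (b := b)
        (fun s hs => by rw [coeff_serHomFun, ha s hs]; simp)
        (fun s hs => by rw [coeff_serHomFun, hb s hs]; simp)]
      rfl
    simp only [e, Matrix.mul_apply, map_sum, map_mul]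
    exact Finset.sum_comm

theorem coeff_serHom (φ : D →ₐ[Kh] A) (F : Ser σ (Matrix m m D)) (i j : m) (n : ℤ) :
    Ser.coeff n (serHom φ F i j) = φ (Ser.coeff n F i j) := rfl

theorem serHom_ofPS (φ : D →ₐ[Kh] A) (F : PowerSeries (Matrix m m D)) :
    serHom φ (Ser.ofPS σ F) = (Ser.ofPS σ).mapMatrix (psHom φ F) := by
  ext i j n
  rw [coeff_serHom, RingHom.mapMatrix_apply, Matrix.map_apply]
  rcases lt_or_ge n 0 with hn | hn
  · rw [Ser.coeff_ofPS_neg _ hn, Ser.coeff_ofPS_neg _ hn]; simp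
  · lift n to ℕ using hn
    rw [Ser.coeff_ofPS_nat, Ser.coeff_ofPS_nat, coeff_psHom]

theorem serHom_C (φ : D →ₐ[Kh] A) (X : Matrix m m D) :
    serHom φ (Ser.C X : Ser σ (Matrix m m D)) = X.map fun y => Ser.C (φ y) := by
  ext i j n
  rw [coeff_serHom, Matrix.map_apply, Ser.coeff_C, Ser.coeff_C]
  split_ifs <;> simp

theorem serHom_mono_one (φ : D →ₐ[Kh] A) (k : ℤ) :
    serHom φ (Ser.mono k 1 : Ser σ (Matrix m m D)) = Matrix.diagonal fun _ => Ser.mono k 1 := by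
  ext i j n
  rw [coeff_serHom, Ser.coeff_mono, Matrix.diagonal_apply]
  by_cases h : i = j
  · rw [if_pos h, Ser.coeff_mono]
    split_ifs
    · exact (congrArg φ (by rw [h, Matrix.one_apply_eq])).trans (map_one φ)
    · exact map_zero φ
  · rw [if_neg h, map_zero]
    split_ifs
    · exact (congrArg φ (Matrix.one_apply_ne h)).trans (map_zero φ)
    · exact map_zero φ

variable {K : Type*} [CommRing K] [Algebra Kh K] [Algebra K A] [IsScalarTower Kh K A] {M : ℕ}

theorem psHom_atInf (hM0 : M ≠ 0) (φ : D →ₐ[Kh] A) (ε : ℤˣ) (a : ℂ)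
    (F : PowerSeries (Matrix m m D)) :
    psHom φ (atInf ((ε : ℤ) : ℂ) (hmul a) F) = (evT K A hM0 ε a).mapMatrix (psHom φ F) := by
  ext i j r
  rw [coeff_psHom, RingHom.mapMatrix_apply, Matrix.map_apply, evT_eq, coeff_subsHom _ _ le_rfl,
    atInf_eq, coeff_subsHom _ _ le_rfl, Matrix.sum_apply, map_sum]
  refine Finset.sum_congr rfl fun k _ => ?_
  rw [Matrix.smul_apply, map_smul, coeff_psHom, qT, ← map_pow, coeff_map, algebraMap_smul]

theorem psHom_map_algebraMap (φ : D →ₐ[Kh] A) (f : PowerSeries Kh) :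
    psHom φ (PowerSeries.map (algebraMap Kh (Matrix m m D)) f) =
      Matrix.diagonal fun _ => PowerSeries.map (algebraMap Kh A) f := by
  ext i j r
  rw [coeff_psHom, coeff_map, Matrix.diagonal_apply, Matrix.algebraMap_matrix_apply]
  by_cases h : i = j
  · rw [if_pos h, if_pos h, coeff_map, AlgHom.commutes]
  · rw [if_neg h, if_neg h]; simp

theorem psHom_C (φ : D →ₐ[Kh] A) (X : Matrix m m D) :
    psHom φ (C X) = X.map fun y => C (φ y) := by
  ext i j r
  rw [coeff_psHom, Matrix.map_apply, coeff_C, coeff_C]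
  split_ifs <;> simp

end Reduction

/-! ### Reduction of the series `S`, `S⁺` and of the R-matrices -/

section Objects

open PowerSeries

variable {N : ℕ} {c : ℂ} {K A : Type*} [CommRing K] [Algebra Kh K] [Ring A] [Algebra K A]
  [Algebra Kh A] [IsScalarTower Kh K A] {M : ℕ} (φ : DY N c →ₐ[Kh] A)
  (hM : algebraMap Kh K hbar ^ M = 0) (hM0 : M ≠ 0) (G : Matrix (Fin N) (Fin N) ℂ)

/-- The images of the generators. -/
abbrev genImg (g : Gen N) : A := φ (DY.gen N c g)

theorem psHom_T : psHom φ (PowerSeries.mk (Tcoeff (DY.gen N c))) = serMat (Tcoeff (genImg φ)) := by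
  ext i j r
  rw [coeff_psHom, coeff_mk, serMat, Matrix.of_apply, coeff_mk, ← map_Tcoeff φ]
  rfl

theorem psHom_Tt : psHom φ (PowerSeries.mk fun r => (Tcoeff (DY.gen N c) r)ᵀ) =
    (serMat (Tcoeff (genImg φ)))ᵀ := by
  rw [← psHom_T]
  ext i j r
  rw [coeff_psHom, Matrix.transpose_apply, coeff_psHom, coeff_mk, coeff_mk, Matrix.transpose_apply]

theorem psHom_P : psHom φ (PowerSeries.mk (Tpcoeff (DY.gen N c))) = serMat (Tpcoeff (genImg φ)) := by
  ext i j r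
  rw [coeff_psHom, coeff_mk, serMat, Matrix.of_apply, coeff_mk, ← map_Tpcoeff φ]
  rfl

theorem psHom_scalarMat {m : Type*} [Fintype m] [DecidableEq m] (E : Matrix m m ℂ) :
    psHom φ (C (scalarMat N c E)) =
      ((algebraMap K (PowerSeries A)).comp (cst K)).mapMatrix E := by
  rw [psHom_C]
  ext i j : 1
  rw [Matrix.map_apply, scalarMat, Matrix.map_apply, AlgHom.commutes, RingHom.mapMatrix_apply,
    Matrix.map_apply, RingHom.comp_apply, PowerSeries.algebraMap_apply, cst, RingHom.comp_apply,
    ← IsScalarTower.algebraMap_apply]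

theorem psHom_Sminus : psHom φ (Sminus N c G) = sTser K hM0 G c (genImg φ) := by
  have e1 : (1 : ℂ) = (((1 : ℤˣ) : ℤ) : ℂ) := by simp
  have e2 : (-1 : ℂ) = (((-1 : ℤˣ) : ℤ) : ℂ) := by simp
  have e3 : (0 : Kh) = hmul 0 := by rw [hmul, map_zero, mul_zero]
  rw [Sminus, e2, e1, e3, map_mul, map_mul, psHom_atInf (K := K) hM0, psHom_atInf (K := K) hM0,
    psHom_T, psHom_Tt, psHom_scalarMat (K := K) φ]
  rfl

theorem psHom_Splus : psHom φ (Splus N c G) = sPser hM G (genImg φ) := by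
  rw [Splus, map_mul, map_mul, psHom_P, psHom_scalarMat (K := K) φ, sPser, sP, gM]
  congr 1
  · congr 1
    ext i j r
    rw [show matP (genImg φ) (evP A hM 1 0) i j = evP A hM 1 0 (serMat (Tpcoeff (genImg φ)) i j)
      from rfl, evP_zero, coeff_mk]
    simp
  · ext i j r
    rw [coeff_psHom, coeff_mk, Matrix.transpose_apply, show matP (genImg φ) (evP A hM (-1) 0) j i =
      evP A hM (-1) 0 (serMat (Tpcoeff (genImg φ)) j i) from rfl, evP_zero, coeff_mk, Matrix.smul_apply, map_smul, Matrix.transpose_apply, ← psHom_P, coeff_psHom, coeff_mk]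
    rw [show (((-1 : ℤˣ) : ℤ) : K) ^ r = algebraMap Kh K ((-1) ^ r) by simp, algebraMap_smul]

theorem psHom_site {n : ℕ} (i : Fin n) (F : PowerSeries (Matrix (Fin N) (Fin N) (DY N c))) :
    psHom φ (PowerSeries.mk fun m => site i (coeff m F)) = siteM i (psHom φ F) := by
  ext I J r
  rw [coeff_psHom, coeff_mk, site, siteM, Matrix.of_apply, Matrix.of_apply]
  split_ifs
  · rw [coeff_psHom]
  · simp

theorem map_flipT {n : ℕ} (i j : Fin n) {D : Type*} [Ring D] (f : DY N c → D) (h0 : f 0 = 0)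
    (h1 : f 1 = 1) : (flipT N c i j).map f = Qm N D i j := by
  ext I J
  rw [Matrix.map_apply, flipT, Qm, Matrix.of_apply, Matrix.of_apply]
  split_ifs <;> simp [h0, h1]

include hM in
theorem ofPS_atInfQ_two (γ : ℂ) : Ser.ofPS (-1) (PowerSeries.map (algebraMap Kh A)
    (C hbar * atInfQ (-2) (hmul γ))) =
      algebraMap K[T;T⁻¹] (Ser (-1) A) (qv K γ) := by
  have hu := (isUnit_arg₂ hM γ).map (algebraMap K[T;T⁻¹] (Ser (-1) A))
  rw [← hu.mul_left_inj, ← map_mul (algebraMap _ (Ser (-1) A)), qv_mul hM, hs, algebraMap_Ser_Kh]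
  have h : atInfQ (-2) (hmul γ) * (C (algebraMap ℂ Kh (-2)) + C (hmul γ) * X) = X := by
    have h := congrArg (C (algebraMap ℂ Kh (-2)) * ·) (atInfQ_mul (-2) (hmul γ))
    have e : C (algebraMap ℂ Kh (-2)) * C (algebraMap ℂ Kh (-2)⁻¹) = 1 := by
      rw [← map_mul, ← map_mul]
      norm_num
    generalize atInfQ (-2) (hmul γ) = q at h ⊢
    generalize hmul γ = b at h ⊢
    simp only [map_mul C] at h
    generalize C (algebraMap ℂ Kh (-2)) = w at *
    generalize C (algebraMap ℂ Kh (-2)⁻¹) = w' at *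
    linear_combination h + (X - q * C b * X) * e
  have h' := congrArg (fun f => Ser.ofPS (-1) (PowerSeries.map (algebraMap Kh A) f) *
    (Ser.mono (-1) 1 : Ser (-1) A)) h
  simp only [map_mul (PowerSeries.map (algebraMap Kh A)), map_add, PowerSeries.map_C,
    PowerSeries.map_X, map_mul (Ser.ofPS (-1)), Ser.ofPS_C, Ser.ofPS_X, Ser.mono_mul_mono,
    add_neg_cancel, mul_one, ← Ser.C_eq_mono, map_one, add_mul, mul_assoc] at h' ⊢
  have e : algebraMap K[T;T⁻¹] (Ser (-1) A) (arg₂ K γ) =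
      Ser.C (algebraMap Kh A (algebraMap ℂ Kh (-2))) * Ser.mono (-1) 1 +
        Ser.C (algebraMap Kh A (hmul γ)) := by
    rw [arg₂, map_add, map_mul (algebraMap _ (Ser (-1) A)), algebraMap_Ser_T,
      map_mul (algebraMap _ (Ser (-1) A)), hs, algebraMap_Ser_Kh, algebraMap_cst_Ser, hmul,
      map_mul (algebraMap Kh A), map_mul Ser.C, cst, RingHom.comp_apply,
      ← IsScalarTower.algebraMap_apply]
    simp only [Units.val_neg, Units.val_one, mul_one, map_neg]
    rw [map_ofNat, map_ofNat, map_ofNat, map_ofNat]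
  rw [e, h', mul_one]

include hM in
theorem ofPS_RbarT {n : ℕ} (i j : Fin n) (γ : ℂ) :
    (Ser.ofPS (-1)).mapMatrix (psHom φ (RbarT N c i j (hmul γ))) =
      Rbt N M (Ser (-1) A) i j (qv K γ) := by
  have hp : ((Ser.ofPS (-1)).comp (PowerSeries.map (algebraMap Kh A)))
      (C (RingHom.id Kh hbar) * atInfQ (-2) (hmul γ)) =
        algebraMap K[T;T⁻¹] (Ser (-1) A) (qv K γ) := by
    rw [RingHom.comp_apply, RingHom.id_apply, ofPS_atInfQ_two hM]
  obtain ⟨h1, h2⟩ := eval_gh (N := N) (S := K[T;T⁻¹]) (D := Ser (-1) A) (RingHom.id Kh)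
    ((Ser.ofPS (-1)).comp (PowerSeries.map (algebraMap Kh A)))
    (fun z => by
      rw [RingHom.comp_apply, RingHom.id_apply, PowerSeries.map_C, Ser.ofPS_C, algebraMap_Ser_Kh])
    (hs_Lau_pow hM) (constantCoeff_atInfQ (-2) (hmul γ)) hp
  rw [PowerSeries.map_id, id_eq, ← atInf_eq, RingHom.comp_apply] at h1
  rw [PowerSeries.map_id, id_eq, ← atInf_eq, RingHom.comp_apply] at h2
  rw [RbarT, map_add, map_mul (psHom φ), psHom_map_algebraMap, psHom_map_algebraMap, psHom_C,
    map_add, map_mul (Ser.ofPS (-1)).mapMatrix, map_flipT i j (fun y => C (φ y)) (by simp) (by simp),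
    mapMatrix_Qm]
  have e : ∀ f : PowerSeries A, (Ser.ofPS (-1)).mapMatrix (Matrix.diagonal fun _ => f) =
      (Matrix.diagonal fun _ => Ser.ofPS (-1) f : Matrix (Fin n → Fin N) (Fin n → Fin N) _) :=
    fun f => by
      rw [RingHom.mapMatrix_apply, Matrix.diagonal_map (map_zero _)]
  rw [e, e, h1, h2, Rbt, rr]
  congr 1
  · ext I J : 1
    rw [Matrix.diagonal_apply, Matrix.smul_apply, Matrix.one_apply, Algebra.smul_def]
    split_ifs <;> simp
  · ext I J : 1
    rw [Matrix.diagonal_mul, Matrix.smul_apply, Algebra.smul_def]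

end Objects

/-! ### Reduction of the products `S_{[n]}` and `S⁺_{[n]}` -/

section Brackets

open PowerSeries

theorem map_filter_prod_eq_prodS {R ι : Type*} [Monoid R] [LinearOrder ι] (r : ι → ι → R)
    (s : ι → R) : ∀ {l : List ι}, l.Pairwise (· < ·) →
      (l.map fun i => s i * ((l.filter fun j => i < j).map (r i)).prod).prod = prodS r s l
  | [], _ => rfl
  | i :: l, h => by
    rw [List.pairwise_cons] at h
    rw [List.map_cons, List.prod_cons, prodS, ← map_filter_prod_eq_prodS r s h.2,
      List.filter_cons_of_neg (by simp), List.filter_eq_self.2 fun j hj => by simpa using h.1 j hj]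
    congr 2
    refine List.map_congr_left fun k hk => ?_
    rw [List.filter_cons_of_neg (by simpa using (h.1 k hk).le)]

theorem ofFn_prod_eq_prodS {R : Type*} [Monoid R] {n : ℕ} (r : Fin n → Fin n → R) (s : Fin n → R) :
    (List.ofFn fun i => s i * (((List.finRange n).filter fun j => i < j).map (r i)).prod).prod =
      prodS r s (List.finRange n) := by
  rw [List.ofFn_eq_map, map_filter_prod_eq_prodS r s (List.pairwise_lt_finRange n)]

variable {N : ℕ} {c : ℂ} {K A : Type*} [CommRing K] [Algebra Kh K] [Ring A] [Algebra K A]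
  [Algebra Kh A] [IsScalarTower Kh K A] {M n : ℕ} (φ : DY N c →ₐ[Kh] A)
  (hM : algebraMap Kh K hbar ^ M = 0) (hM0 : M ≠ 0) (G : Matrix (Fin N) (Fin N) ℂ)

theorem scalarHom_ofPS {σ : ℤˣ} {e : PowerSeries A →+* PowerSeries A} (he : ∀ z, e (C z) = C z) :
    ScalarHom (S := K) ((Ser.ofPS σ).comp e) (LaurentPolynomial.C : K →+* K[T;T⁻¹]) where
  kh z := (algebraMap_Lau_Kh z).symm
  alg s := by
    rw [PowerSeries.algebraMap_apply, RingHom.comp_apply, he, Ser.ofPS_C, algebraMap_Ser_C]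

theorem sTin_eq (x : Gen N → A) {a a' : ℂ} (ha : a = a' + c / 2) :
    ((Ser.ofPS (-1)).comp (evT K A hM0 1 a)).mapMatrix (sTser K hM0 G c x) =
      sTin K hM0 G c x a' := by
  rw [sTser, (scalarHom_ofPS (K := K) (e := evT K A hM0 1 a) fun z => subsHom_C _ z).sT, RingHom.comp_assoc,
    RingHom.comp_assoc, evT_comp_evT hM0 1 (d := a' + 3 * c / 2) (by rw [ha]; push_cast; ring),
    evT_comp_evT hM0 (-1) (d := -a' - c / 2) (by rw [ha]; push_cast; ring)]
  rfl

theorem sPin_eq (x : Gen N → A) (a : ℂ) :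
    ((Ser.ofPS 1).comp (evP A hM 1 a)).mapMatrix (sPser hM G x) = sPin hM G x a := by
  rw [sPser, (scalarHom_ofPS (K := K) (e := evP A hM 1 a) fun z => subsHom_C _ z).sP, RingHom.comp_assoc,
    RingHom.comp_assoc, evP_comp_evP_zero hM 1 (b := a) (by simp),
    evP_comp_evP_zero hM (-1) (b := -a) (by simp)]
  rfl

include hM in
theorem ofPS_RbarTprod {γ : ℂ} {a a' : Fin n → ℂ} {δ : ℂ}
    (h : ∀ i j, -a i - a j - γ = -(a' i + a' j) - δ) (i : Fin n) :
    (Ser.ofPS (-1)).mapMatrix (psHom φ (RbarTprod N c γ a i)) =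
      (((List.finRange n).filter fun j => i < j).map fun j =>
        Rbt N M (Ser (-1) A) i j (qv K (-(a' i + a' j) - δ))).prod := by
  rw [RbarTprod, map_list_prod, map_list_prod, List.map_map, List.map_map]
  congr 1
  refine List.map_congr_left fun j _ => ?_
  rw [Function.comp_apply, Function.comp_apply, ofPS_RbarT φ hM, h]

include hM in
theorem ofPS_Sbracket {a a' : Fin n → ℂ} (ha : ∀ i, a i = a' i + c / 2) :
    (Ser.ofPS (-1)).mapMatrix (psHom φ (Sbracket N c G a)) =
      bracketT K hM0 G c (genImg φ) a' (List.finRange n) := by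
  rw [Sbracket, bracketT, ← ofFn_prod_eq_prodS, map_list_prod, map_list_prod, List.map_map,
    List.map_ofFn]
  congr 2
  funext i
  have e1 : (1 : ℂ) = (((1 : ℤˣ) : ℤ) : ℂ) := by simp
  rw [Function.comp_apply, Function.comp_apply, map_mul, map_mul, psHom_site, e1,
    psHom_atInf (K := K) hM0, psHom_Sminus (K := K) φ hM0, mapMatrix_siteM,
    ofPS_RbarTprod φ hM (a' := a') (δ := 2 * c) (fun i j => by rw [ha, ha]; ring),
    ← sTin_eq hM0 G (genImg φ) (ha i)]
  rfl

variable (K M) in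
/-- The term of the product `S⁺_{[n]}` of the given multidegree, for a series with the
coefficients `s r`. -/
def bracketTerm (s : ℕ → Matrix (Fin N) (Fin N) A) (a : Fin n → ℂ) (r : Fin n → ℕ) :
    Matrix (Fin n → Fin N) (Fin n → Fin N) A[T;T⁻¹] :=
  (List.ofFn fun i => arg K 1 (a i) ^ r i • siteM i ((s (r i)).map LaurentPolynomial.C) *
    (((List.finRange n).filter fun j => i < j).map fun j =>
      Rbt N M A[T;T⁻¹] i j (qv K (-(a i + a j)))).prod).prod

theorem toSer_bracketTerm {σ : ℤˣ} (s : ℕ → Matrix (Fin N) (Fin N) A) (a : Fin n → ℂ)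
    (r : Fin n → ℕ) : (toSer σ).mapMatrix (bracketTerm K M s a r) =
      (List.ofFn fun i => arg K 1 (a i) ^ r i • siteM i ((s (r i)).map Ser.C) *
        (((List.finRange n).filter fun j => i < j).map fun j =>
          Rbt N M (Ser σ A) i j (qv K (-(a i + a j)))).prod).prod := by
  rw [bracketTerm, map_list_prod, List.map_ofFn]
  congr 2
  funext i
  rw [Function.comp_apply, map_mul, scalarHom_toSer.smul, RingHom.id_apply, map_list_prod,
    List.map_map, mapMatrix_siteM]
  congr 1
  · congr 2
    ext i j : 1
    exact toSer_C _
  · congr 1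
    refine List.map_congr_left fun j _ => ?_
    rw [Function.comp_apply, scalarHom_toSer.Rbt, RingHom.id_apply]

include hM in
theorem serHom_SplusBracketTerm (a : Fin n → ℂ) (r : Fin n → ℕ) :
    serHom φ (SplusBracketTerm N c G a r : Ser (-1) (TMat N c n)) =
      (toSer (-1)).mapMatrix
        (bracketTerm K M (fun r => (sPser hM G (genImg φ)).map (coeff r)) a r) := by
  have hS : ∀ r i, serHom φ (Ser.C (site i (coeff r (Splus N c G))) : Ser (-1) (TMat N c n)) =
      siteM i (((sPser hM G (genImg φ)).map (coeff r)).map Ser.C) := by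
    intro r i
    rw [serHom_C, ← psHom_Splus]
    ext I J : 1
    rw [Matrix.map_apply, site, siteM, Matrix.of_apply, Matrix.of_apply]
    split_ifs
    · rw [Matrix.map_apply, Matrix.map_apply, coeff_psHom]
    · simp
  have hu : ∀ i, serHom φ (Ser.mono (-1) 1 + Ser.C (algebraMap Kh (TMat N c n) (hmul (a i))) :
      Ser (-1) (TMat N c n)) = Matrix.scalar _ (algebraMap K[T;T⁻¹] (Ser (-1) A)
        (arg K 1 (a i))) := by
    intro i
    rw [map_add, serHom_mono_one, serHom_C, arg, map_add, map_mul (algebraMap K[T;T⁻¹] (Ser (-1) A)),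
      map_intCast, algebraMap_Ser_C,
      algebraMap_Ser_T, ← IsScalarTower.algebraMap_apply, map_add (Matrix.scalar _)]
    congr 1
    · simp
    · ext I J : 1
      rw [Matrix.map_apply, Matrix.algebraMap_matrix_apply, Matrix.scalar_apply,
        Matrix.diagonal_apply]
      split_ifs <;> simp
  rw [toSer_bracketTerm]
  have e : (SplusBracketTerm N c G a r : Ser (-1) (TMat N c n)) =
      (List.ofFn fun i => (Ser.C (site i (coeff (r i) (Splus N c G))) : Ser (-1) (TMat N c n)) *
        ((Ser.mono (-1) 1 : Ser (-1) (TMat N c n)) +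
          (Ser.C (algebraMap Kh (TMat N c n) (hmul (a i))) : Ser (-1) (TMat N c n))) ^ r i *
        (Ser.ofPS (-1) (RbarTprod N c 0 a i) : Ser (-1) (TMat N c n))).prod := rfl
  rw [e]
  rw [map_list_prod, List.map_ofFn]
  congr 2
  funext i
  rw [Function.comp_apply, map_mul, map_mul, map_pow, hS, hu, serHom_ofPS,
    ofPS_RbarTprod φ hM (a' := a) (δ := 0) (fun i j => by ring), ← map_pow, ← map_pow]
  simp only [sub_zero]
  congr 1
  ext I J : 1
  rw [Matrix.scalar_apply, Matrix.mul_diagonal, Matrix.smul_apply, Algebra.smul_def,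
    Algebra.commutes]

end Brackets

/-! ### Orders of Laurent series with matrix coefficients -/

section Order

variable {A m : Type*} [Ring A] [Fintype m] [DecidableEq m] {σ : ℤˣ}

/-- All the coefficients before the `b`-th one vanish. -/
def OrderGE (b : ℤ) (X : Matrix m m (Ser σ A)) : Prop := ∀ i j, ∀ n < b, Ser.coeff n (X i j) = 0

theorem OrderGE.mono {a b : ℤ} {X : Matrix m m (Ser σ A)} (h : OrderGE b X) (hab : a ≤ b) :
    OrderGE a X := fun i j n hn => h i j n (by omega)

theorem OrderGE.add {b : ℤ} {X Y : Matrix m m (Ser σ A)} (hX : OrderGE b X) (hY : OrderGE b Y) :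
    OrderGE b (X + Y) := fun i j n hn => by
  rw [Matrix.add_apply, map_add, hX i j n hn, hY i j n hn, add_zero]

theorem OrderGE.mul {a b : ℤ} {X Y : Matrix m m (Ser σ A)} (hX : OrderGE a X) (hY : OrderGE b Y) :
    OrderGE (a + b) (X * Y) := fun i j n hn => by
  rw [Matrix.mul_apply, map_sum]
  refine Finset.sum_eq_zero fun l _ => ?_
  rw [Ser.coeff_mul (hX i l) (hY l j), Finset.Icc_eq_empty (by omega), Finset.sum_empty]

theorem OrderGE.one : OrderGE 0 (1 : Matrix m m (Ser σ A)) := fun i j n hn => by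
  rw [Matrix.one_apply]
  split_ifs
  · rw [← map_one Ser.C, Ser.coeff_C, if_neg (by omega)]
  · exact map_zero _

theorem OrderGE.sum {ι : Type*} {s : Finset ι} {b : ℤ} {X : ι → Matrix m m (Ser σ A)}
    (h : ∀ i ∈ s, OrderGE b (X i)) : OrderGE b (∑ i ∈ s, X i) := fun i j n hn => by
  rw [Matrix.sum_apply, map_sum]
  exact Finset.sum_eq_zero fun k hk => h k hk i j n hn

theorem OrderGE.list_prod {ι : Type*} {X : ι → Matrix m m (Ser σ A)} {b : ι → ℤ}
    (h : ∀ i, OrderGE (b i) (X i)) : ∀ l : List ι, OrderGE (l.map b).sum (l.map X).prod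
  | [] => OrderGE.one
  | i :: l => by
    rw [List.map_cons, List.map_cons, List.sum_cons, List.prod_cons]
    exact (h i).mul (OrderGE.list_prod h l)

theorem OrderGE.list_prod_sub {ι : Type*} {X Y : ι → Matrix m m (Ser σ A)} {d b : ℤ} (hd : 0 ≤ d)
    (hX : ∀ i, OrderGE (-d) (X i)) (hY : ∀ i, OrderGE (-d) (Y i))
    (h : ∀ i, OrderGE b (X i - Y i)) : ∀ l : List ι,
      OrderGE (b - l.length * d) ((l.map X).prod - (l.map Y).prod)
  | [] => by
    rw [List.map_nil, List.map_nil, sub_self]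
    exact fun i j n _ => map_zero _
  | i :: l => by
    have e : (List.map X (i :: l)).prod - (List.map Y (i :: l)).prod =
        X i * ((l.map X).prod - (l.map Y).prod) + (X i - Y i) * (l.map Y).prod := by
      rw [List.map_cons, List.map_cons, List.prod_cons, List.prod_cons]
      noncomm_ring
    rw [e, List.length_cons]
    refine OrderGE.add (((hX i).mul (OrderGE.list_prod_sub hd hX hY h l)).mono (le_of_eq ?_))
      (((h i).mul (OrderGE.list_prod hY l)).mono ?_)
    · push_cast; ring
    · rw [List.map_const', List.sum_replicate, nsmul_eq_mul]
      push_cast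
      linarith

theorem exists_orderGE (X : Matrix m m (Ser σ A)) : ∃ b, OrderGE b X := exists_matrix_bound X

theorem sum_prod_ofFn {R : Type*} [Ring R] {n : ℕ} (F : Fin n → ℕ → R) (s : Finset ℕ) :
    ∑ r ∈ Fintype.piFinset fun _ : Fin n => s, (List.ofFn fun i => F i (r i)).prod =
      (List.ofFn fun i => ∑ k ∈ s, F i k).prod := by
  have h := (MultilinearMap.mkPiAlgebraFin ℤ n R).map_sum_finset F (fun _ => s)
  simp only [MultilinearMap.mkPiAlgebraFin_apply] at h
  exact h.symm

end Order

/-! ### The expansion of `S⁺_{[n]}` -/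

section Expansion

open PowerSeries

variable {N : ℕ} {K A : Type*} [CommRing K] [Algebra Kh K] [Ring A] [Algebra K A]
  [Algebra Kh A] [IsScalarTower Kh K A] {M n : ℕ}
  (hM : algebraMap Kh K hbar ^ M = 0) (G : Matrix (Fin N) (Fin N) ℂ) (x : Gen N → A)

theorem orderGE_siteM {σ : ℤˣ} {b : ℤ} {X : Matrix (Fin N) (Fin N) (Ser σ A)} (h : OrderGE b X)
    (i : Fin n) : OrderGE b (siteM i X) := fun I J k hk => by
  rw [siteM, Matrix.of_apply]
  split_ifs
  · exact h _ _ k hk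
  · exact map_zero _

theorem coeff_ofPS_evP {f : PowerSeries A} {B : ℕ} (hf : ∀ k < B, coeff k f = 0) (a : ℂ) {k : ℤ}
    (hk : k < (B : ℤ) - M) : Ser.coeff k (Ser.ofPS 1 (evP A hM 1 a f)) = 0 := by
  rcases lt_or_ge k 0 with h | h
  · exact Ser.coeff_ofPS_neg _ h
  · lift k to ℕ using h
    rw [Ser.coeff_ofPS_nat, coeff_evP]
    refine Finset.sum_eq_zero fun l hl => ?_
    rw [Finset.mem_range] at hl
    rw [hf _ (by omega), smul_zero, smul_zero]

theorem ofPS_evP_C_mul_X_pow (a : ℂ) (y : A) (r : ℕ) : Ser.ofPS 1 (evP A hM 1 a (C y * X ^ r)) =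
    arg K 1 a ^ r • (Ser.C y : Ser 1 A) := by
  rw [map_mul (evP A hM 1 a), map_mul (Ser.ofPS 1), map_pow, map_pow, ofPS_evP_X, evP, subsHom_C,
    Ser.ofPS_C, Algebra.smul_def, map_pow, ← map_pow, Algebra.commutes, map_pow]

theorem smul_siteM_eq (a : ℂ) (S₀ : Matrix (Fin N) (Fin N) (PowerSeries A)) (i : Fin n) (r : ℕ) :
    arg K 1 a ^ r • siteM i ((S₀.map (coeff r)).map Ser.C) =
      siteM i (((Ser.ofPS 1).comp (evP A hM 1 a)).mapMatrix
        (S₀.map fun f => C (coeff r f) * X ^ r)) := by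
  ext I J : 1
  rw [Matrix.smul_apply, siteM, siteM, Matrix.of_apply, Matrix.of_apply]
  split_ifs
  · exact (ofPS_evP_C_mul_X_pow hM a _ r).symm
  · exact smul_zero _

theorem siteM_sub_sum (a : ℂ) (S₀ : Matrix (Fin N) (Fin N) (PowerSeries A)) (i : Fin n) (B : ℕ) :
    siteM i (((Ser.ofPS 1).comp (evP A hM 1 a)).mapMatrix S₀) -
      ∑ r ∈ Finset.range B, arg K 1 a ^ r • siteM i ((S₀.map (coeff r)).map Ser.C) =
      siteM i (((Ser.ofPS 1).comp (evP A hM 1 a)).mapMatrix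
        (S₀.map fun f => f - ∑ r ∈ Finset.range B, C (coeff r f) * X ^ r)) := by
  ext I J : 1
  simp only [smul_siteM_eq hM]
  rw [Matrix.sub_apply, Matrix.sum_apply]
  simp only [siteM, Matrix.of_apply]
  split_ifs
  · simp only [RingHom.mapMatrix_apply, Matrix.map_apply]
    rw [← map_sum, ← map_sub]
  · simp

theorem coeff_sub_sum (f : PowerSeries A) {B k : ℕ} (hk : k < B) :
    coeff k (f - ∑ r ∈ Finset.range B, C (coeff r f) * X ^ r) = 0 := by
  rw [map_sub, map_sum]
  simp only [coeff_C_mul, coeff_X_pow, mul_ite, mul_one, mul_zero]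
  rw [Finset.sum_ite_eq, if_pos (Finset.mem_range.2 hk), sub_self]

/-- The terms of the product `S⁺_{[n]}` are of large order for large degrees, and their sum is
`S⁺_{[n]}`. -/
theorem bracketTerm_expansion (a : Fin n → ℂ) :
    (∃ b : ℤ, ∀ r : Fin n → ℕ, OrderGE (∑ i, (r i : ℤ) - b) ((toSer 1).mapMatrix
      (bracketTerm K M (fun r => (sPser hM G x).map (coeff r)) a r))) ∧
    ∀ e : ℤ, ∃ B₀ : ℕ, ∀ B ≥ B₀, OrderGE e (bracketP hM G x a (List.finRange n) -
      (toSer 1).mapMatrix (∑ r ∈ Fintype.piFinset fun _ : Fin n => Finset.range B,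
        bracketTerm K M (fun r => (sPser hM G x).map (coeff r)) a r)) := by
  obtain ⟨W, hW⟩ : ∃ W : Fin n → Matrix (Fin n → Fin N) (Fin n → Fin N) (Ser 1 A), ∀ i, W i =
    (((List.finRange n).filter fun j => i < j).map fun j =>
      Rbt N M (Ser 1 A) i j (qv K (-(a i + a j)))).prod := ⟨_, fun _ => rfl⟩
  have hord : ∀ (i : Fin n) (r : ℕ), OrderGE ((r : ℤ) - M) (arg K 1 (a i) ^ r •
      siteM (ι := Fin n) i (((sPser hM G x).map (coeff r)).map (Ser.C (σ := 1)))) := fun i r => by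
    rw [smul_siteM_eq hM]
    refine orderGE_siteM (fun k l s hs => coeff_ofPS_evP hM (fun q hq => ?_) _ hs) i
    rw [Matrix.map_apply, coeff_C_mul, coeff_X_pow, if_neg (by omega), mul_zero]
  have hS : ∀ i, siteM i (sPin hM G x (a i)) = siteM i (((Ser.ofPS 1).comp
      (evP A hM 1 (a i))).mapMatrix (sPser hM G x)) := fun i => by rw [sPin_eq]
  obtain ⟨d, hd⟩ : ∃ d : ℤ, 0 ≤ d ∧ ∀ i, OrderGE (-d) (W i) := by
    choose b hb using fun i => exists_orderGE (W i)
    refine ⟨∑ i, |b i|, Finset.sum_nonneg fun i _ => abs_nonneg _, fun i => (hb i).mono ?_⟩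
    have := Finset.single_le_sum (fun i _ => abs_nonneg (b i)) (Finset.mem_univ i)
    have := neg_abs_le (b i)
    linarith
  have ht : ∀ r, (toSer 1).mapMatrix (bracketTerm K M (fun r => (sPser hM G x).map (coeff r)) a r) =
      (List.ofFn fun i => (arg K 1 (a i) ^ r i •
        siteM i (((sPser hM G x).map (coeff (r i))).map Ser.C)) * W i).prod := fun r => by
    rw [toSer_bracketTerm]
    simp only [hW]
  refine ⟨⟨n * (M + d), fun r => ?_⟩, fun e => ⟨(e + (n + 1) * (M + d)).toNat, fun B hB => ?_⟩⟩
  · rw [ht, List.ofFn_eq_map]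
    refine (OrderGE.list_prod (fun i => (hord i (r i)).mul (hd.2 i)) (List.finRange n)).mono
      (le_of_eq ?_)
    rw [← List.ofFn_eq_map, List.sum_ofFn, Finset.sum_add_distrib, Finset.sum_sub_distrib]
    simp
    ring
  · rw [map_sum]
    simp only [ht]
    rw [sum_prod_ofFn (fun i k => (arg K 1 (a i) ^ k •
      siteM i (((sPser hM G x).map (coeff k)).map Ser.C)) * W i), bracketP, ← ofFn_prod_eq_prodS]
    simp only [← hW, ← Finset.sum_mul]
    rw [List.ofFn_eq_map, List.ofFn_eq_map]
    refine (OrderGE.list_prod_sub (d := M + d) (b := B - M - d) (by have := hd.1; positivity)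
      (fun i => ?_) (fun i => ?_) (fun i => ?_) _).mono ?_
    · refine (OrderGE.mul (a := -M) ?_ (hd.2 i)).mono (le_of_eq (by ring))
      rw [hS]
      exact orderGE_siteM (fun k l s hs =>
        coeff_ofPS_evP hM (B := 0) (fun q hq => absurd hq (by omega)) _ (by simpa using hs)) i
    · refine (OrderGE.mul (a := -M) (OrderGE.sum fun k _ => (hord i k).mono ?_) (hd.2 i)).mono
        (le_of_eq (by ring))
      omega
    · rw [← sub_mul, hS, siteM_sub_sum]
      refine (OrderGE.mul (a := B - M) ?_ (hd.2 i)).mono (le_of_eq (by ring))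
      exact orderGE_siteM (fun k l s hs => coeff_ofPS_evP hM (fun q hq => by
        rw [Matrix.map_apply]; exact coeff_sub_sum _ hq) _ hs) i
    · rw [List.length_finRange]
      have h1 := Int.toNat_le.1 hB
      linarith

end Expansion

/-! ### Reduction modulo a power of `h` -/

section ModPower

variable {D : Type*} [Ring D] [Algebra Kh D]

instance isTwoSided_span_hbar (M : ℕ) : (Ideal.span {algebraMap Kh D (hbar ^ M)}).IsTwoSided where
  mul_mem_of_left b ha := by
    rw [Ideal.mem_span_singleton'] at ha ⊢
    obtain ⟨z, rfl⟩ := ha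
    exact ⟨z * b, by rw [mul_assoc, mul_assoc, Algebra.commutes]⟩

variable (D) in
/-- The quotient by a power of `h`. -/
def ModPow (M : ℕ) : Type _ := D ⧸ Ideal.span {algebraMap Kh D (hbar ^ M)}

instance (M : ℕ) : Ring (ModPow D M) :=
  inferInstanceAs (Ring (D ⧸ Ideal.span {algebraMap Kh D (hbar ^ M)}))

instance (M : ℕ) : Algebra Kh (ModPow D M) :=
  inferInstanceAs (Algebra Kh (D ⧸ Ideal.span {algebraMap Kh D (hbar ^ M)}))

variable (D) in
/-- The projection to the quotient by a power of `h`. -/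
def toModPow (M : ℕ) : D →ₐ[Kh] ModPow D M :=
  Ideal.Quotient.mkₐ Kh (Ideal.span {algebraMap Kh D (hbar ^ M)})

theorem toModPow_surjective (M : ℕ) : Function.Surjective (toModPow D M) :=
  Ideal.Quotient.mk_surjective

theorem toModPow_eq_zero {M : ℕ} {y : D} (h : toModPow D M y = 0) : ∃ z, y = hbar ^ M • z := by
  obtain ⟨z, rfl⟩ := Ideal.mem_span_singleton'.1 (Ideal.Quotient.eq_zero_iff_mem.1 h)
  exact ⟨z, by rw [← Algebra.commutes, Algebra.smul_def]⟩

theorem center_hbar_pow (M : ℕ) :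
    algebraMap Kh (Subalgebra.center Kh (ModPow D M)) hbar ^ M = 0 := by
  rw [← map_pow]
  refine Subtype.ext ?_
  change algebraMap Kh (ModPow D M) (hbar ^ M) = 0
  rw [← AlgHom.commutes (toModPow D M)]
  exact Ideal.Quotient.eq_zero_iff_mem.2 (Ideal.subset_span rfl)

/-- The left ideal of the images of the multiples of `h` of the elements of a left ideal. -/
def hIdeal (M : ℕ) (I : Ideal D) : Ideal (ModPow D M) where
  carrier := {y | ∃ z ∈ I, toModPow D M (hbar • z) = y}
  zero_mem' := ⟨0, I.zero_mem, by rw [smul_zero, map_zero]⟩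
  add_mem' := by
    rintro _ _ ⟨z, hz, rfl⟩ ⟨z', hz', rfl⟩
    exact ⟨z + z', I.add_mem hz hz', by rw [smul_add, map_add]⟩
  smul_mem' := by
    rintro w _ ⟨z, hz, rfl⟩
    obtain ⟨w, rfl⟩ := toModPow_surjective M w
    exact ⟨w * z, I.mul_mem_left _ hz, by rw [smul_eq_mul, ← map_mul, mul_smul_comm]⟩

variable {N : ℕ} {c : ℂ}

theorem exists_smul_of_mem_hIdeal {q m : ℕ} {w : DY N c}
    (h : toModPow (DY N c) (m + 1) w ∈ hIdeal (m + 1) (nbhd N c q m)) :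
    ∃ z ∈ nbhd N c q m, w = hbar • z := by
  obtain ⟨z, hz, e⟩ := h
  obtain ⟨z', hz'⟩ := toModPow_eq_zero (y := w - hbar • z) (M := m + 1) (by rw [map_sub, e, sub_self])
  refine ⟨z + hbar ^ m • z', Ideal.add_mem _ hz (hbar_pow_smul_mem _ _ _), ?_⟩
  rw [smul_add, smul_smul, ← pow_succ', ← hz']
  abel

theorem mem_nbhd_of_mem_hIdeal {q m : ℕ} {w : DY N c}
    (h : toModPow (DY N c) (m + 1) w ∈ hIdeal (m + 1) (nbhd N c q m)) : w ∈ nbhd N c q m := by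
  obtain ⟨z, hz, rfl⟩ := exists_smul_of_mem_hIdeal h
  exact smul_mem_ideal _ _ hz

theorem smul_pos_mul_mem_hIdeal (M q m : ℕ) (i j : Fin N) (y : ModPow (DY N c) M) :
    ∃ k : ℕ, ∀ n ≥ k, hbar • genImg (toModPow (DY N c) M) (.pos i j n) * y ∈
      hIdeal M (nbhd N c q m) := by
  obtain ⟨w, rfl⟩ := toModPow_surjective M y
  obtain ⟨q', hq'⟩ := nbhd_mul_right w q m
  refine ⟨q', fun n hn => ⟨DY.gen N c (.pos i j n) * w, hq' _ ?_, ?_⟩⟩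
  · exact Ideal.mem_sup_left (Ip_gen i j (by omega))
  · rw [map_smul, map_mul, smul_mul_assoc]

end ModPower

/-! ### Coefficients of `𝔸_ν(u)` modulo a left ideal -/

section Pairing

variable {N : ℕ} {K A : Type*} [CommRing K] [Algebra Kh K] [Ring A] [Algebra K A]
  [Algebra Kh A] [IsScalarTower Kh K A] {M : ℕ} {ν : YoungDiagram} (U : StandardTableau ν)
  {J : Ideal A} {X : Matrix (Fin ν.card → Fin N) (Fin ν.card → Fin N) (Ser (-1) A)}

/-- The coefficients of the trace of the product of a Laurent polynomial and a Laurent series, which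
is replaced by a Laurent polynomial modulo a left ideal. -/
theorem coeff_trace_sub_mem {t : Matrix (Fin ν.card → Fin N) (Fin ν.card → Fin N) A[T;T⁻¹]}
    (ht : ∀ i j, X i j - toSer (-1) (t i j) ∈ serIdeal J (-1))
    (z : Matrix (Fin ν.card → Fin N) (Fin ν.card → Fin N) A[T;T⁻¹]) (k : ℤ) :
    Ser.coeff (-k) (Matrix.trace (youngE N K[T;T⁻¹] (Ser (-1) A) U *
        ((toSer (-1)).mapMatrix z * X))) -
      Ser.coeff k (Matrix.trace (youngE N K[T;T⁻¹] (Ser 1 A) U *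
        ((toSer 1).mapMatrix z * (toSer 1).mapMatrix t))) ∈ J := by
  have e : ∀ σ : ℤˣ, Matrix.trace (youngE N K[T;T⁻¹] (Ser σ A) U *
      ((toSer σ).mapMatrix z * (toSer σ).mapMatrix t)) =
        toSer σ (Matrix.trace (youngE N K[T;T⁻¹] A[T;T⁻¹] U * (z * t))) := by
    intro σ
    rw [← scalarHom_toSer.youngE, ← map_mul, ← map_mul]
    exact (map_sum (toSer σ) _ _).symm
  have e' : Ser.coeff k (toSer 1 (Matrix.trace (youngE N K[T;T⁻¹]
      A[T;T⁻¹] U * (z * t)))) = Ser.coeff (-k) (toSer (-1) (Matrix.trace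
        (youngE N K[T;T⁻¹] A[T;T⁻¹] U * (z * t)))) := by
    rw [coeff_toSer, coeff_toSer]
    simp
  rw [e, e', ← e, ← map_sub, ← Matrix.trace_sub, ← mul_sub, ← mul_sub, ← mul_assoc]
  refine (serIdeal J (-1)).sum_mem (fun I _ => ?_) (-k)
  exact (serIdeal J (-1)).sum_mem fun l _ => Ideal.mul_mem_left _ _ (ht l I)

variable (φ : DY N (crit N) →ₐ[Kh] A) (hM : algebraMap Kh K hbar ^ M = 0) (hM0 : M ≠ 0)
  {G : Matrix (Fin N) (Fin N) ℂ} (hGdet : IsUnit G.det)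

include hGdet in
theorem map_AnuTerm
    (hXQ : X * bracketT K hM0 G (crit N) (genImg φ) (fun i => (U.content i : ℂ))
      (List.finRange ν.card) = 1) (k : ℤ) (r : Fin ν.card → ℕ) :
    φ (AnuTerm G U k r) = Ser.coeff (-k) (Matrix.trace (youngE N K[T;T⁻¹] (Ser (-1) A) U *
      ((toSer (-1)).mapMatrix (bracketTerm K M
        (fun r => (sPser hM G (genImg φ)).map (PowerSeries.coeff r))
          (fun i => (U.content i : ℂ)) r) * X))) := by
  have hX : X = serHom φ (Ser.ofPS (-1) (Ring.inverse
      (Sbracket N (crit N) G fun p => (U.content p : ℂ) - (N : ℂ) / 4))) := by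
    have h1 := Ring.mul_inverse_cancel _ (isUnit_Sbracket (N := N) (c := crit N) hGdet
      fun p : Fin ν.card => (U.content p : ℂ) - (N : ℂ) / 4)
    have h2 := congrArg (fun F => (Ser.ofPS (-1)).mapMatrix (psHom φ F)) h1
    simp only [map_mul, map_one] at h2
    rw [ofPS_Sbracket φ hM hM0 G (a' := fun p => (U.content p : ℂ)) fun i => by rw [crit]; ring] at h2
    rw [serHom_ofPS]
    exact left_inv_eq_right_inv hXQ h2
  obtain ⟨F, hF⟩ : ∃ F : Ser (-1) (TMat N (crit N) ν.card), F =
    SplusBracketTerm N (crit N) G (fun p => (U.content p : ℂ)) r := ⟨_, rfl⟩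
  have hF' := serHom_SplusBracketTerm φ hM G (fun p => (U.content p : ℂ)) r
  rw [← hF] at hF'
  rw [hX, ← hF', ← map_mul (serHom φ), AnuTerm, ← hF, Matrix.trace, Matrix.trace, map_sum,
    map_sum]
  refine Finset.sum_congr rfl fun I _ => ?_
  rw [Matrix.diag_apply, Matrix.diag_apply, Matrix.mul_apply, Matrix.mul_apply, map_sum, map_sum]
  refine Finset.sum_congr rfl fun L _ => ?_
  have e : youngE N K[T;T⁻¹] (Ser (-1) A) U I L =
      Ser.C (φ (scalarMat N (crit N) (permAction N U.idempotent) I L)) := by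
    rw [scalarMat, Matrix.map_apply, AlgHom.commutes]
    exact algebraMap_Ser_Kh _
  rw [e, Ser.coeff_C_mul, coeff_serHom, ← map_mul]
  rfl

end Pairing

/-! ### Commutators with the coefficients of `𝔸_ν(u)` -/

section Commutators

open PowerSeries

theorem coeff_trace_mul_eq_zero {A m : Type*} [Ring A] [Fintype m] [DecidableEq m]
    {E Y T : Matrix m m (Ser 1 A)} {a b d k : ℤ} (hE : OrderGE a E) (hY : OrderGE b Y)
    (hT : OrderGE d T) (hk : k < a + (b + d)) : Ser.coeff k (Matrix.trace (E * (Y * T))) = 0 := by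
  rw [Matrix.trace, map_sum]
  exact Finset.sum_eq_zero fun I _ => hE.mul (hY.mul hT) I I k hk

variable {N : ℕ} {G : Matrix (Fin N) (Fin N) ℂ} {ν : YoungDiagram} (U : StandardTableau ν)

theorem commutator_coeff_of_sub_C {A : Type*} [Ring A] [Algebra Kh A] {z : Kh} {s : A} (w : A)
    {r : ℕ} {f : PowerSeries A} (h : coeff r f - coeff r (C (algebraMap Kh A z)) = s) :
    coeff r f * w - w * coeff r f = s * w - w * s := by
  rw [← h, coeff_C]
  split_ifs
  · rw [sub_mul, mul_sub, Algebra.commutes]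
    abel
  · rw [sub_zero]

theorem AnuTerm_approximation_mod {K A : Type*} [CommRing K] [Algebra Kh K] [Ring A] [Algebra K A]
    [Algebra Kh A] [hKA : IsScalarTower Kh K A] {M : ℕ} (hM : algebraMap Kh K hbar ^ M = 0) (hM0 : M ≠ 0)
    {φ : DY N (crit N) →ₐ[Kh] A} (hφ : Function.Surjective φ) {J : Ideal A}
    (hJ : ∀ i j y, ∃ k : ℕ, ∀ n ≥ k, hbar • genImg φ (.pos i j n) * y ∈ J)
    (hN : N ≠ 0) (hGdet : IsUnit G.det) (hG : Gᵀ = G ∨ Gᵀ = -G) (k : ℤ) (r₀ : ℕ) :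
    ∃ y : DY N (crit N), ∃ R B₀ : ℕ,
      (∀ r : Fin ν.card → ℕ, R ≤ ∑ i, r i → φ (AnuTerm G U k r) ∈ J) ∧
      (∀ B ≥ B₀, φ (∑ r ∈ Fintype.piFinset fun _ : Fin ν.card => Finset.range B,
        AnuTerm G U k r - y) ∈ J) ∧
      ∀ r ≤ r₀, ∀ i j,
        coeff r (psHom φ (Splus N (crit N) G) i j) * φ y -
          φ y * coeff r (psHom φ (Splus N (crit N) G) i j) ∈ J ∧
        coeff r (psHom φ (Sminus N (crit N) G) i j) * φ y -
          φ y * coeff r (psHom φ (Sminus N (crit N) G) i j) ∈ J := by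
  have hx : IsRep (crit N) (genImg φ) := DY.isRep φ
  obtain ⟨X, hQX, hXQ, hXE, hXJ⟩ := exists_bracketT_inverse hM hM0 hx hG hGdet U
  obtain ⟨t, ht, hcomm⟩ := exists_trunc_commutator hM hM0 U hN hx hG hQX hXQ hXE (hXJ J hJ) r₀
  obtain ⟨⟨b, hb⟩, hsum⟩ := bracketTerm_expansion hM G (genImg φ) fun i => (U.content i : ℂ)
  obtain ⟨P, hP⟩ : ∃ P, P = bracketTerm K M (fun r => (sPser hM G (genImg φ)).map (coeff r))
    fun i => (U.content i : ℂ) := ⟨_, rfl⟩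
  rw [← hP] at hb
  simp only [← hP] at hsum
  obtain ⟨bt, hbt⟩ := exists_orderGE ((toSer 1).mapMatrix t)
  obtain ⟨bE, hbE⟩ := exists_orderGE (youngE N K[T;T⁻¹] (Ser 1 A) U)
  obtain ⟨τ, hτ⟩ : ∃ τ, τ = Matrix.trace (youngE N K[T;T⁻¹] (Ser 1 A) U *
    (bracketP hM G (genImg φ) (fun i => (U.content i : ℂ)) (List.finRange ν.card) *
      (toSer 1).mapMatrix t)) := ⟨_, rfl⟩
  obtain ⟨y, hy⟩ := hφ (Ser.coeff k τ)
  have hterm := map_AnuTerm U φ hM hM0 hGdet hXQ k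
  rw [← hP] at hterm
  obtain ⟨B₀, hB₀⟩ := hsum (k + 1 - bE - bt)
  refine ⟨y, (k + 1 + b - bE - bt).toNat, B₀, fun r hr => ?_, fun B hB => ?_, fun r hr i j => ?_⟩
  · have h := coeff_trace_sub_mem (K := K) U ht (P r) k
    rw [coeff_trace_mul_eq_zero hbE (hb r) hbt, sub_zero, ← hterm] at h
    · exact h
    · have h1 := Int.toNat_le.1 hr
      push_cast at h1
      linarith
  · have h := coeff_trace_sub_mem (K := K) U ht
      (∑ r ∈ Fintype.piFinset fun _ : Fin ν.card => Finset.range B, P r) k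
    have e0 := coeff_trace_mul_eq_zero hbE (hB₀ B hB) hbt (k := k) (by linarith)
    rw [sub_mul, mul_sub, Matrix.trace_sub, map_sub, ← hτ, ← hy, sub_eq_zero] at e0
    rw [← e0, map_sum (toSer (-1)).mapMatrix, Finset.sum_mul, Finset.mul_sum, Matrix.trace_sum,
      map_sum, Finset.sum_congr rfl fun r _ => (hterm r).symm, ← map_sum, ← map_sub] at h
    exact h
  · rw [hy, psHom_Splus φ hM, psHom_Sminus (K := K) φ hM0]
    exact hcomm τ hτ r hr i j k

/-- An element of the double Yangian which approximates a coefficient of `𝔸_ν(u)` and which almost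
commutes with the first generators of `A_c(g_N)`. -/
theorem AnuTerm_approximation (hN : N ≠ 0) (hGdet : IsUnit G.det) (hG : Gᵀ = G ∨ Gᵀ = -G) (k : ℤ)
    (q m r₀ : ℕ) : ∃ y : DY N (crit N), ∃ R B₀ : ℕ,
      (∀ r : Fin ν.card → ℕ, R ≤ ∑ i, r i → AnuTerm G U k r ∈ nbhd N (crit N) q m) ∧
      (∀ B ≥ B₀, ∑ r ∈ Fintype.piFinset fun _ : Fin ν.card => Finset.range B, AnuTerm G U k r - y ∈
        nbhd N (crit N) q m) ∧
      ∀ r ≤ r₀, ∀ i j s,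
        (coeff r (Splus N (crit N) G - C (scalarMat N (crit N) G)) i j = -(hbar • s) ∨
          coeff r (Sminus N (crit N) G) i j = hbar • s) →
        s * y - y * s ∈ nbhd N (crit N) q m := by
  obtain ⟨y, R, B₀, h1, h2, h3⟩ := AnuTerm_approximation_mod
    (K := Subalgebra.center Kh (ModPow (DY N (crit N)) (m + 1)))
    (hKA := IsScalarTower.of_algebraMap_eq fun _ => rfl) (φ := toModPow (DY N (crit N)) (m + 1))
    U (center_hbar_pow (m + 1)) m.succ_ne_zero (toModPow_surjective (m + 1))
    (smul_pos_mul_mem_hIdeal (m + 1) q m) hN hGdet hG k r₀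
  refine ⟨y, R, B₀, fun r hr => mem_nbhd_of_mem_hIdeal (h1 r hr),
    fun B hB => mem_nbhd_of_mem_hIdeal (h2 B hB), fun r hr i j s hs => ?_⟩
  have key : toModPow (DY N (crit N)) (m + 1) (hbar • (s * y - y * s)) ∈
      hIdeal (m + 1) (nbhd N (crit N) q m) := by
    rcases hs with hs | hs
    · have h := (h3 r hr i j).1
      have e := congrArg (toModPow (DY N (crit N)) (m + 1)) hs
      rw [map_sub, Matrix.sub_apply, map_sub] at e
      have e' : toModPow (DY N (crit N)) (m + 1) (coeff r (C (scalarMat N (crit N) G)) i j) =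
          coeff r (C (algebraMap Kh (ModPow (DY N (crit N)) (m + 1)) (C (G i j)))) := by
        rw [coeff_C, coeff_C]
        split_ifs
        · rw [scalarMat, Matrix.map_apply, AlgHom.commutes]
        · exact map_zero _
      rw [e', ← coeff_psHom] at e
      rw [commutator_coeff_of_sub_C _ e, ← map_mul, ← map_mul, ← map_sub] at h
      rw [← neg_mem_iff, ← map_neg]
      convert h using 2
      rw [smul_sub, neg_mul, mul_neg, smul_mul_assoc, mul_smul_comm]
      abel
    · have h := (h3 r hr i j).2
      rw [coeff_psHom, hs, ← map_mul, ← map_mul, ← map_sub] at h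
      rwa [smul_sub, ← smul_mul_assoc, ← mul_smul_comm]
  obtain ⟨z, hz, e⟩ := exists_smul_of_mem_hIdeal key
  rwa [DY.smul_cancel 1 (by rwa [pow_one] : hbar ^ 1 • (s * y - y * s) = hbar ^ 1 • z)]

end Commutators

/-! ### The coefficients of `𝔸_ν(u)` are limits of elements of `A_c(g_N)` -/

section Integrality

open PowerSeries

theorem atInf_one_add_smul {M : Type*} [Ring M] [Algebra Kh M] (α : ℂ) (β : Kh)
    (F : PowerSeries M) : atInf α β (1 + hbar • F) = 1 + hbar • atInf α β F := by
  ext m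
  rw [map_add, coeff_smul]
  simp only [atInf, coeff_mk, map_add, coeff_smul, smul_add, Finset.sum_add_distrib,
    Finset.smul_sum, smul_comm _ hbar]
  congr 1
  rw [Finset.sum_eq_single 0]
  · cases m with
    | zero => simp
    | succ m => simp [coeff_one, Ring.choose_zero_pos ℤ m.succ_pos]
  · intro k _ hk
    rw [coeff_one, if_neg hk, smul_zero]
  · simp

theorem exists_add_smul {M : Type*} [Ring M] [Algebra Kh M] (F H Z : M) :
    ∃ Y, (1 + hbar • F) * Z * (1 + hbar • H) = Z + hbar • Y :=
  ⟨F * Z + (Z * H + hbar • (F * Z * H)), by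
    simp only [add_mul, mul_add, one_mul, mul_one, smul_mul_assoc, mul_smul_comm, smul_add]
    abel⟩

variable {N : ℕ} {c : ℂ} (G : Matrix (Fin N) (Fin N) ℂ)

theorem exists_Splus_eq : ∃ Y, Splus N c G = C (scalarMat N c G) + hbar • Y := by
  have e1 : PowerSeries.mk (Tpcoeff (DY.gen N c)) = 1 + hbar • PowerSeries.mk fun r =>
      -Matrix.of fun i j => DY.gen N c (.neg i j r) := by
    ext1 r
    rw [coeff_mk, map_add, coeff_smul, coeff_mk, coeff_one, smul_neg, ← sub_eq_add_neg]
    rfl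
  have e2 : (PowerSeries.mk fun r => (-1 : Kh) ^ r • (Tpcoeff (DY.gen N c) r)ᵀ) =
      1 + hbar • PowerSeries.mk fun r => (-1 : Kh) ^ r • -Matrix.of fun i j =>
        DY.gen N c (.neg j i r) := by
    ext1 r
    rw [coeff_mk, map_add, coeff_smul, coeff_mk, coeff_one, smul_neg, smul_neg, ← sub_eq_add_neg,
      Tpcoeff, Matrix.transpose_sub, smul_sub, smul_comm hbar]
    congr 1
    split_ifs with h
    · rw [h, pow_zero, one_smul, Matrix.transpose_one]
    · rw [Matrix.transpose_zero, smul_zero]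
  rw [Splus, e1, e2]
  exact exists_add_smul _ _ _

theorem exists_Sminus_eq : ∃ Y, Sminus N c G = C (scalarMat N c G) + hbar • Y := by
  have e1 : PowerSeries.mk (Tcoeff (DY.gen N c)) = 1 + hbar • PowerSeries.mk fun r =>
      if r = 0 then 0 else Matrix.of fun i j => DY.gen N c (.pos i j (r - 1)) := by
    ext1 r
    cases r <;> simp [Tcoeff, coeff_one]
  have e2 : (PowerSeries.mk fun r => (Tcoeff (DY.gen N c) r)ᵀ) = 1 + hbar • PowerSeries.mk fun r =>
      if r = 0 then 0 else (Matrix.of fun i j => DY.gen N c (.pos i j (r - 1)))ᵀ := by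
    ext1 r
    cases r
    · simp [Tcoeff]
    · simp only [Tcoeff, coeff_mk, map_add, coeff_smul, coeff_one, Nat.succ_ne_zero, if_false, zero_add]
      rfl
  rw [Sminus, e1, e2, atInf_one_add_smul, atInf_one_add_smul]
  exact exists_add_smul _ _ _

end Integrality

section Membership

open PowerSeries

variable {M : Type*} [Ring M] [Algebra Kh M] (S : Subalgebra Kh M)

/-- The power series with coefficients in a subalgebra. -/
def psSub : Subring (PowerSeries M) where
  carrier := {F | ∀ k, coeff k F ∈ S}
  zero_mem' k := S.zero_mem
  one_mem' k := by
    rw [coeff_one]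
    split_ifs
    exacts [S.one_mem, S.zero_mem]
  add_mem' hF hH k := S.add_mem (hF k) (hH k)
  neg_mem' hF k := S.neg_mem (hF k)
  mul_mem' hF hH k := by
    rw [coeff_mul]
    exact S.sum_mem fun x _ => S.mul_mem (hF _) (hH _)

/-- The Laurent series with coefficients in a subalgebra. -/
def lauSub : Subring (LaurentSeries M) where
  carrier := {F | ∀ k, F.coeff k ∈ S}
  zero_mem' k := S.zero_mem
  one_mem' k := by
    rw [HahnSeries.coeff_one]
    split_ifs
    exacts [S.one_mem, S.zero_mem]
  add_mem' hF hH k := S.add_mem (hF k) (hH k)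
  neg_mem' hF k := S.neg_mem (hF k)
  mul_mem' hF hH k := by
    rw [HahnSeries.coeff_mul]
    exact S.sum_mem fun x _ => S.mul_mem (hF _) (hH _)

variable {S}

theorem single_mem_lauSub {x : M} (hx : x ∈ S) (k : ℤ) : HahnSeries.single k x ∈ lauSub S := by
  intro l
  rw [HahnSeries.coeff_single]
  split_ifs
  exacts [hx, S.zero_mem]

theorem ofPowerSeries_mem_lauSub {F : PowerSeries M} (hF : F ∈ psSub S) :
    HahnSeries.ofPowerSeries ℤ M F ∈ lauSub S := by
  intro l
  rcases lt_or_ge l 0 with h | h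
  · rw [HahnSeries.ofPowerSeries_apply, HahnSeries.embDomain_of_notMem_range]
    · exact S.zero_mem
    · rintro ⟨n, rfl⟩
      exact absurd h (by simp)
  · obtain ⟨n, rfl⟩ := Int.eq_ofNat_of_zero_le h
    rw [HahnSeries.ofPowerSeries_apply_coeff]
    exact hF n

theorem C_mem_psSub {x : M} (hx : x ∈ S) : C x ∈ psSub S := by
  intro k
  rw [coeff_C]
  split_ifs
  exacts [hx, S.zero_mem]

theorem map_algebraMap_mem_psSub (f : PowerSeries Kh) :
    PowerSeries.map (algebraMap Kh M) f ∈ psSub S := fun k => by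
  rw [coeff_map]
  exact S.algebraMap_mem _

theorem atInf_mem_psSub (α : ℂ) (β : Kh) {F : PowerSeries M} (hF : F ∈ psSub S) :
    atInf α β F ∈ psSub S := fun k => by
  rw [atInf, coeff_mk]
  exact S.sum_mem fun l _ => S.smul_mem (hF l) _

/-- The inverse of a series with coefficients in a subalgebra, whose constant term has an inverse
in the subalgebra. -/
theorem mem_psSub_of_mul_eq_one {F X : PowerSeries M} (hF : F ∈ psSub S) (h : F * X = 1) {d : M}
    (hd : d ∈ S) (hd' : d * coeff 0 F = 1) : X ∈ psSub S := by
  intro k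
  induction k using Nat.strong_induction_on with
  | _ k ih =>
    have hk := congrArg (fun H => d * coeff k H) h
    simp only [coeff_mul] at hk
    rw [Finset.Nat.sum_antidiagonal_eq_sum_range_succ fun i j => coeff i F * coeff j X,
      Finset.sum_range_succ', mul_add, ← mul_assoc, hd', one_mul, Nat.sub_zero,
      ← eq_sub_iff_add_eq'] at hk
    rw [hk]
    exact S.sub_mem (S.mul_mem hd ((psSub S).one_mem k)) (S.mul_mem hd (S.sum_mem fun i hi =>
      S.mul_mem (hF _) (ih _ (by have := Finset.mem_range.1 hi; omega))))

variable (S) in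
/-- The elements with a left inverse in a subalgebra. -/
def leftInv : Submonoid M where
  carrier := {x | ∃ d ∈ S, d * x = 1}
  one_mem' := ⟨1, S.one_mem, mul_one 1⟩
  mul_mem' := by
    rintro x y ⟨d, hd, hx⟩ ⟨e, he, hy⟩
    exact ⟨e * d, S.mul_mem he hd, by rw [mul_assoc, ← mul_assoc d, hx, one_mul, hy]⟩

end Membership

section AnuMembership

open PowerSeries

variable {N : ℕ} {c : ℂ} {G : Matrix (Fin N) (Fin N) ℂ} {n : ℕ}

theorem scalarMat_mem {ι : Type*} [Fintype ι] [DecidableEq ι] (E : Matrix ι ι ℂ) :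
    scalarMat N c E ∈ (Alg N c G).matrix := fun _ _ => (Alg N c G).algebraMap_mem _

theorem coeff_Splus_mem (r : ℕ) : coeff r (Splus N c G) ∈ (Alg N c G).matrix := by
  obtain ⟨Y, hY⟩ := exists_Splus_eq (c := c) G
  have h : coeff r (hbar • Y) ∈ (Alg N c G).matrix := fun i j => by
    have h1 : -(coeff r Y i j) ∈ Alg N c G := Algebra.subset_adjoin (Or.inl ⟨i, j, r, by
      rw [hY, add_sub_cancel_left, smul_neg, neg_neg, coeff_smul, Matrix.smul_apply]⟩)
    have h2 := (Alg N c G).smul_mem (neg_mem h1) hbar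
    rwa [neg_neg] at h2
  rw [hY, map_add]
  exact add_mem (C_mem_psSub (scalarMat_mem G) r) h

theorem coeff_zero_Sminus : coeff 0 (Sminus N c G) = scalarMat N c G := by
  rw [Sminus, coeff_zero_eq_constantCoeff_apply, map_mul, map_mul]
  simp only [← coeff_zero_eq_constantCoeff_apply, constantCoeff_atInf, coeff_mk]
  simp [Tcoeff]

theorem Sminus_mem : Sminus N c G ∈ psSub (Alg N c G).matrix := by
  intro r
  cases r with
  | zero =>
    rw [coeff_zero_Sminus]
    exact scalarMat_mem G
  | succ r =>
    obtain ⟨Y, hY⟩ := exists_Sminus_eq (c := c) G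
    intro i j
    have h : coeff (r + 1) (Sminus N c G) i j = hbar • coeff (r + 1) Y i j := by
      rw [hY, map_add, coeff_C, if_neg r.succ_ne_zero, zero_add, coeff_smul, Matrix.smul_apply]
    rw [h]
    exact (Alg N c G).smul_mem (Algebra.subset_adjoin (Or.inr ⟨i, j, r, h⟩)) _

theorem site_mem (i : Fin n) {X : Matrix (Fin N) (Fin N) (DY N c)} (hX : X ∈ (Alg N c G).matrix) :
    site i X ∈ (Alg N c G).matrix (n := Fin n → Fin N) := by
  intro I J
  rw [site, Matrix.of_apply]
  split_ifs
  exacts [hX _ _, (Alg N c G).zero_mem]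

theorem RbarTprod_mem (γ : ℂ) (a : Fin n → ℂ) (i : Fin n) :
    RbarTprod N c γ a i ∈ psSub (Alg N c G).matrix := by
  refine list_prod_mem fun F hF => ?_
  obtain ⟨j, -, rfl⟩ := List.mem_map.1 hF
  refine add_mem (map_algebraMap_mem_psSub _) (mul_mem (map_algebraMap_mem_psSub _)
    (C_mem_psSub fun I J => ?_))
  rw [flipT, Matrix.of_apply]
  split_ifs
  exacts [(Alg N c G).one_mem, (Alg N c G).zero_mem]

theorem Sbracket_mem (a : Fin n → ℂ) : Sbracket N c G a ∈ psSub (Alg N c G).matrix := by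
  refine list_prod_mem fun F hF => ?_
  obtain ⟨i, rfl⟩ := List.mem_ofFn.1 hF
  refine mul_mem (fun k => ?_) (RbarTprod_mem _ _ _)
  rw [coeff_mk]
  exact site_mem i (atInf_mem_psSub _ _ Sminus_mem k)

theorem constantCoeff_Sbracket_mem (hG : IsUnit G.det) (a : Fin n → ℂ) :
    coeff 0 (Sbracket N c G a) ∈ leftInv (Alg N c G).matrix := by
  rw [coeff_zero_eq_constantCoeff_apply, Sbracket, map_list_prod]
  refine list_prod_mem fun x hx => ?_
  simp only [List.map_ofFn, List.mem_ofFn, Function.comp_apply] at hx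
  obtain ⟨i, rfl⟩ := hx
  have e1 : constantCoeff (RbarTprod N c c a i) = 1 := by
    rw [RbarTprod, map_list_prod]
    refine List.prod_eq_one fun x hx => ?_
    simp only [List.map_map, List.mem_map, Function.comp_apply] at hx
    obtain ⟨j, -, rfl⟩ := hx
    rw [← coeff_zero_eq_constantCoeff_apply, constantCoeff_RbarT]
  refine ⟨site i (scalarMat N c G⁻¹), site_mem i (scalarMat_mem _), ?_⟩
  rw [map_mul, e1, mul_one, ← coeff_zero_eq_constantCoeff_apply, coeff_mk, constantCoeff_atInf,
    coeff_zero_Sminus, ← site_mul]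
  have e2 : ∀ E : Matrix (Fin N) (Fin N) ℂ, scalarMat N c E =
      ((algebraMap Kh (DY N c)).comp C).mapMatrix E := fun _ => rfl
  rw [e2, e2, ← map_mul, Matrix.nonsing_inv_mul _ hG, map_one, site_one]

theorem SplusBracketTerm_mem (a : Fin n → ℂ) (r : Fin n → ℕ) :
    SplusBracketTerm N c G a r ∈ lauSub (Alg N c G).matrix := by
  refine list_prod_mem fun F hF => ?_
  obtain ⟨i, rfl⟩ := List.mem_ofFn.1 hF
  refine mul_mem (mul_mem (single_mem_lauSub (site_mem i (coeff_Splus_mem _)) 0)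
    (pow_mem (add_mem (single_mem_lauSub (one_mem _) _)
      (single_mem_lauSub (Subalgebra.algebraMap_mem _ _) 0)) _))
    (ofPowerSeries_mem_lauSub (RbarTprod_mem _ _ _))

theorem AnuTerm_mem (hG : IsUnit G.det) {ν : YoungDiagram} (U : StandardTableau ν) (k : ℤ)
    (r : Fin ν.card → ℕ) : AnuTerm G U k r ∈ Alg N (crit N) G := by
  obtain ⟨d, hd, hd'⟩ := constantCoeff_Sbracket_mem (c := crit N) hG
    fun p => (U.content p : ℂ) - (N : ℂ) / 4
  have h := mem_psSub_of_mul_eq_one (Sbracket_mem _)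
    (Ring.mul_inverse_cancel _ (isUnit_Sbracket hG _)) hd hd'
  exact Subalgebra.sum_mem _ fun I _ => mul_mem (scalarMat_mem _)
    (mul_mem (SplusBracketTerm_mem _ r) (ofPowerSeries_mem_lauSub h) (-k)) I I

end AnuMembership

/-! ### Convergence and centrality -/

section Convergence

open Filter Topology UniformSpace PowerSeries

variable {N : ℕ} {c : ℂ}

theorem hasBasis_nhds_zero_DY : (𝓝 (0 : DY N c)).HasBasis (fun _ : ℕ × ℕ => True)
    fun i => (nbhd N c i.1 i.2 : Set (DY N c)) :=
  (nbhd_basis N c).hasBasis_nhds_zero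

instance : NonarchimedeanRing (DY N c) := (nbhd_basis N c).nonarchimedean

theorem tendsto_zero_of_eventually_nbhd {α : Type*} {l : Filter α} {f : α → DY N c}
    (h : ∀ p m, ∀ᶠ r in l, f r ∈ nbhd N c p m) :
    Tendsto (fun r => (f r : DYtilde N c)) l (𝓝 0) := by
  have h0 : Tendsto f l (𝓝 0) := hasBasis_nhds_zero_DY.tendsto_right_iff.2 fun i _ => h i.1 i.2
  have h1 := ((Completion.continuous_coe (DY N c)).tendsto 0).comp h0
  rwa [Completion.coe_zero] at h1

theorem tendsto_box_atTop (n : ℕ) :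
    Tendsto (fun B => Fintype.piFinset fun _ : Fin n => Finset.range B) atTop atTop := by
  refine tendsto_atTop_finset_of_monotone (fun B B' h => Fintype.piFinset_subset _ _ fun _ =>
    Finset.range_mono h) fun r => ⟨∑ i, r i + 1, Fintype.mem_piFinset.2 fun i =>
    Finset.mem_range.2 (Nat.lt_succ_of_le (Finset.single_le_sum (fun _ _ => Nat.zero_le _)
      (Finset.mem_univ i)))⟩

variable {G : Matrix (Fin N) (Fin N) ℂ} {ν : YoungDiagram} (U : StandardTableau ν)

theorem summable_AnuTerm (hN : N ≠ 0) (hGdet : IsUnit G.det) (hG : Gᵀ = G ∨ Gᵀ = -G) (k : ℤ) :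
    Summable fun r => (AnuTerm G U k r : DYtilde N (crit N)) := by
  refine NonarchimedeanAddGroup.summable_of_tendsto_cofinite_zero
    (tendsto_zero_of_eventually_nbhd fun p m => ?_)
  obtain ⟨-, R, -, h, -⟩ := AnuTerm_approximation U hN hGdet hG k p m 0
  refine (Fintype.piFinset fun _ : Fin ν.card => Finset.range R).finite_toSet.subset fun r hr => ?_
  refine Fintype.mem_piFinset.2 fun i => Finset.mem_range.2 ?_
  by_contra hi
  exact hr (h r ((not_lt.1 hi).trans (Finset.single_le_sum (fun _ _ => Nat.zero_le _)
    (Finset.mem_univ i))))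

/-- The generators of `A_c(g_N)` commute with the coefficients of `𝔸_ν(u)`. -/
theorem commute_of_hasSum_AnuTerm (hN : N ≠ 0) (hGdet : IsUnit G.det) (hG : Gᵀ = G ∨ Gᵀ = -G)
    {k : ℤ} {a : DYtilde N (crit N)}
    (ha : HasSum (fun r => (AnuTerm G U k r : DYtilde N (crit N))) a) {s : DY N (crit N)} {r : ℕ}
    {i j : Fin N} (hs : coeff r (Splus N (crit N) G - C (scalarMat N (crit N) G)) i j =
      -(hbar • s) ∨ coeff r (Sminus N (crit N) G) i j = hbar • s) :
    (s : DYtilde N (crit N)) * a = a * s := by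
  have hB : Tendsto (fun B => ((∑ r ∈ Fintype.piFinset fun _ : Fin ν.card => Finset.range B,
      AnuTerm G U k r : DY N (crit N)) : DYtilde N (crit N))) atTop (𝓝 a) := by
    refine (Tendsto.comp ha (tendsto_box_atTop ν.card)).congr fun B => ?_
    exact (map_sum (Completion.coeRingHom : DY N (crit N) →+* DYtilde N (crit N)) _ _).symm
  rw [← sub_eq_zero]
  refine tendsto_nhds_unique (((hB.const_mul (s : DYtilde N (crit N))).sub
    (hB.mul_const (s : DYtilde N (crit N)))).congr fun B => ?_)
    (tendsto_zero_of_eventually_nbhd (f := fun B =>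
      s * (∑ r ∈ Fintype.piFinset fun _ : Fin ν.card => Finset.range B, AnuTerm G U k r) -
        (∑ r ∈ Fintype.piFinset fun _ : Fin ν.card => Finset.range B, AnuTerm G U k r) * s)
      fun p m => ?_)
  · rw [Completion.coe_sub, Completion.coe_mul, Completion.coe_mul]
  · obtain ⟨q, hq⟩ := nbhd_mul_right s p m
    obtain ⟨y, -, B₀, -, h1, h2⟩ := AnuTerm_approximation U hN hGdet hG k (max p q) m r
    have hp := nbhd_anti (N := N) (c := crit N) (le_max_left p q) (le_refl m)
    have hq' := nbhd_anti (N := N) (c := crit N) (le_max_right p q) (le_refl m)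
    filter_upwards [eventually_ge_atTop B₀] with B hB
    have h3 := h1 B hB
    generalize (∑ r ∈ Fintype.piFinset fun _ : Fin ν.card => Finset.range B, AnuTerm G U k r) = z
      at h3 ⊢
    have e : s * z - z * s = (s * y - y * s) + s * (z - y) - (z - y) * s := by
      noncomm_ring
    rw [e]
    exact Ideal.sub_mem _ (Ideal.add_mem _ (hp (h2 r le_rfl i j s hs))
      (Ideal.mul_mem_left _ _ (hp h3))) (hq _ (hq' h3))

theorem mem_centralizer_of_commute_gen {a : DYtilde N c}
    (h : ∀ s : DY N c, ∀ r i j, (coeff r (Splus N c G - C (scalarMat N c G)) i j = -(hbar • s) ∨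
      coeff r (Sminus N c G) i j = hbar • s) → (s : DYtilde N c) * a = a * s) {z : DYtilde N c}
    (hz : z ∈ AlgTilde N c G) : z * a = a * z := by
  have hcl : IsClosed {z : DYtilde N c | z * a = a * z} :=
    isClosed_eq (continuous_mul_const a) (continuous_const_mul a)
  refine closure_minimal ?_ hcl hz
  rintro _ ⟨x, hx, rfl⟩
  change (x : DYtilde N c) * a = a * x
  induction hx using Algebra.adjoin_induction with
  | mem x hx =>
    rcases hx with ⟨i, j, r, hr⟩ | ⟨i, j, r, hr⟩
    exacts [h x r i j (Or.inl hr), h x (r + 1) i j (Or.inr hr)]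
  | algebraMap w =>
    clear h hcl
    induction a using Completion.induction_on with
    | hp =>
      exact isClosed_eq (continuous_const_mul (algebraMap Kh (DY N c) w : DYtilde N c))
        (continuous_mul_const (algebraMap Kh (DY N c) w : DYtilde N c))
    | ih a => rw [← Completion.coe_mul, ← Completion.coe_mul, Algebra.commutes]
  | add x y _ _ hx hy => rw [Completion.coe_add, add_mul, mul_add, hx, hy]
  | mul x y _ _ hx hy => rw [Completion.coe_mul, mul_assoc, hy, ← mul_assoc, hx, mul_assoc]

theorem mem_AlgTilde_of_hasSum {α : Type*} {f : α → DY N c} (hf : ∀ r, f r ∈ Alg N c G)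
    {a : DYtilde N c} (ha : HasSum (fun r => (f r : DYtilde N c)) a) : a ∈ AlgTilde N c G :=
  (Subring.isClosed_topologicalClosure _).mem_of_tendsto ha (Eventually.of_forall fun _ =>
    Subring.sum_mem _ fun r _ => Subring.le_topologicalClosure _ ⟨f r, hf r, rfl⟩)

end Convergence

end

end TwistedYangian

theorem theorem4p2 (N : ℕ) (hN : 2 ≤ N) (G : Matrix (Fin N) (Fin N) ℂ) (hGdet : IsUnit G.det)
    (hG : Gᵀ = G ∨ Gᵀ = -G) (ν : YoungDiagram) (hν : ν.colLen 0 ≤ N)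
    (U : TwistedYangian.StandardTableau ν) (k : ℤ) :
    ∃ a : TwistedYangian.AlgTilde N (TwistedYangian.crit N) G,
      HasSum (fun r : Fin ν.card → ℕ =>
        (TwistedYangian.AnuTerm G U k r : TwistedYangian.DYtilde N (TwistedYangian.crit N)))
        (a : TwistedYangian.DYtilde N (TwistedYangian.crit N)) ∧
      a ∈ Subring.center (TwistedYangian.AlgTilde N (TwistedYangian.crit N) G) := by
  have hN0 : N ≠ 0 := by omega
  have ha := (TwistedYangian.summable_AnuTerm U hN0 hGdet hG k).hasSum
  refine ⟨⟨_, TwistedYangian.mem_AlgTilde_of_hasSum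
    (TwistedYangian.AnuTerm_mem hGdet U k) ha⟩, ha, Subring.mem_center_iff.2 fun z => Subtype.ext ?_⟩
  exact TwistedYangian.mem_centralizer_of_commute_gen (fun s r i j hs =>
    TwistedYangian.commute_of_hasSum_AnuTerm U hN0 hGdet hG ha hs) z.2
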